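/- **Notation.** Let $n,m\ge 0$ be integers, $a\in\mathbb Z_{\ge0}^n$ and $b\in\mathbb Z_{\ge0}^m$ with $\sum_j b_j=\sum_i a_i$, let $\lambda^{(n)}\in\mathbb C^n$, and put $z_i=\lambda^{(n)}_i+a_i-i$ for $i=1,\dots,n$. Let $e_{ij}$ be the standard generators of $\mathfrak{gl}_m$, let $S^{(m)}(a)=S^{a_1}\mathbb C^m\otimes\cdots\otimes S^{a_n}\mathbb C^m$, and let $S^{(m)}(a)[b]$ be its subspace of weight $b$. For $j\ge0$ write $x^{\underline j}=x(x-1)\cdots(x-j+1)$. *Difference operators.* For an associative algebra $\mathcal A$, difference operators are finite sums $\sum_k f_k(u)\tau^k$ with $f_k\in\mathcal A((u^{-1}))$, where $\tau f(u)=f(u+1)\tau$; put $d=\tau-1$. Rational functions of $u$ are expanded at $u=\infty$. Suppose the generating series $t_{ij}(u)$, $1\le i,j\le m$, of the Yangian $Y(\mathfrak{gl}_m)$ act on a vector space over a field $F$. For $C=(c_1,\dots,c_m)\in F^m$ put $$D_m(C)=\sum_{\sigma\in S_m}\operatorname{sgn}(\sigma)\,\mathcal D_{\sigma(1)1}\mathcal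 D_{\sigma(2)2}\cdots\mathcal D_{\sigma(m)m},\qquad \mathcal D_{ij}=c_i\delta_{ij}\tau-t_{ij}(u-j+1).$$ For a $\mathfrak{gl}_m$-module $V$ and a scalar $c$, let $V(c)$ be $V$ with $t_{ij}(u)$ acting by $\delta_{ij}+e_{ij}/(u-c)$. On tensor products, $t_{ij}(u)$ acts by $\sum_k t_{ik}(u)\otimes t_{kj}(u)$ (iterated). *The operator $D_m(a,z;b,\lambda^{(m)})$.* Let $\lambda^{(m)}=(\lambda_{n+1},\dots,\lambda_{n+m})$ be independent variables, $K=\mathbb C(\lambda^{(m)})$, and let $M$ be the Verma module of $\mathfrak{gl}_m$ over $K$ with highest weight vector $v_0$: $e_{ij}v_0=0$ for $i<j$ and $e_{ii}v_0=\lambda_{n+i}v_0$. Let $\mathrm{Sing}$ be the space of vectors of weight $\lambda^{(m)}+b$ in $S^{(m)}(a)\otimes M$ that are annihilated by all $e_{ij}$ with $i<j$. Let $\theta:\mathrm{Sing}\to K\otimes S^{(m)}(a)[b]$ be the $K$-linear map such that, for every $v\in\mathrm{Sing}$, $v-\theta(v)\otimes v_0$ lies in the span of all $w\otimes x$ with $w\in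 S^{(m)}(a)$ and $x\in M$ a weight vector of weight different from $\lambda^{(m)}$. The difference operator $D_m(a,z;b,\lambda^{(m)})$, with coefficients in $K\otimes\operatorname{End}(S^{(m)}(a)[b])$, is $\theta\, D_m(1,\dots,1)\,\theta^{-1}$, where $D_m(1,\dots,1)$ is restricted to $\mathrm{Sing}$ inside $$S^{a_1}\mathbb C^m(z_1)\otimes\cdots\otimes S^{a_n}\mathbb C^m(z_n)\otimes M(0).$$ Let $\overline{\mathcal B}_m$ be the $\mathbb C$-subalgebra of $K\otimes\operatorname{End}(S^{(m)}(a)[b])$ generated by the coefficients of all $u^{-l}\tau^k$ in this operator. *The XXX operator.* Let $\xi=(\xi_1,\dots,\xi_m)$ be independent variables. Then $D_m^{XXX}(a,\lambda^{(n)};b,\xi)$ is the restriction to $\mathbb C(\xi)\otimes S^{(m)}(a)[b]$ of $\xi_1\cdots\xi_m\,D_m(\xi_1^{-1},\dots,\xi_m^{-1})$, acting on $S^{a_1}\mathbb C^m(z_1)\otimes\cdots\otimes S^{a_n}\mathbb C^m(z_n)$ over $\mathbb C(\xi)$. *Degree and leading terms.* Let $\pi:\mathbb C(\lambda^{(m)})\to\mathbb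 C(\xi)((r^{-1}))$ be the $\mathbb C$-algebra homomorphism $\lambda_{n+i}\mapsto r\xi_i$; write $\deg p\le k$ if $\pi(p)$ contains no power $r^l$ with $l>k$, and let $gr_k(p)\in\mathbb C(\xi)$ be the coefficient of $r^k$ in $\pi(p)$. For a complex vector space $V$, an element of $\mathbb C(\lambda^{(m)})\otimes V$ has degree $\le k$ if it is a sum of elements $p\otimes v$ with $\deg p\le k$; and $gr_k(\sum_s p_s\otimes v_s)=\sum_s gr_k(p_s)\otimes v_s\in\mathbb C(\xi)\otimes V$. **Proposition.** The map $\theta$ exists, is unique and is an isomorphism; $D_m(1,\dots,1)$ preserves $\mathrm{Sing}$, and the coefficients of $\xi_1\cdots\xi_m D_m(\xi_1^{-1},\dots,\xi_m^{-1})$ preserve $\mathbb C(\xi)\otimes S^{(m)}(a)[b]$, so that both operators above are well defined. There are unique elements $D_{ij}\in K\otimes\operatorname{End}(S^{(m)}(a)[b])$, $0\le i\le m$, $0\le j\le n$, with $$u^{\underline m}\prod_{i=1}^n(u-z_i)\,D_m(a,z;b,\lambda^{(m)})=\sum_{i=0}^m\sum_{j=0}^n D_{ij}\,(u+n)^{\underline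 j}\,\bigl((u-m+1)d\bigr)^i,$$ and they lie in $\overline{\mathcal B}_m$. For all $i,j$ one has $\deg D_{ij}\le m-i$, and $$\sum_{i=0}^m\sum_{j=0}^n gr_{m-i}(D_{ij})\,(u+n)^{\underline j}\,\tau^i=\prod_{i=1}^n(u-z_i)\;D_m^{XXX}(a,\lambda^{(n)};b,\xi).$$ -/

import Mathlib

open scoped TensorProduct

namespace BetheDuality

noncomputable section

/-! ## Difference operators

`A((u⁻¹))` is `LaurentSeries A` in the variable `u⁻¹`: the coefficient at `l` is the one of
`u^(-l)`.  The ring `A` need not be commutative; `u` is central. -/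

theorem shiftSeries_bddBelow {A : Type*} [Ring A] (c : ℤ) (f : LaurentSeries A) :
    BddBelow (Function.support fun N : ℤ =>
      ∑ᶠ p : ℕ, (c ^ p * Ring.choose ((p : ℤ) - N) p) • f.coeff (N - p)) := by
  refine ⟨f.order, fun N hN => ?_⟩
  by_contra h
  apply hN
  have : ∀ p : ℕ, (c ^ p * Ring.choose ((p : ℤ) - N) p) • f.coeff (N - p) = 0 := fun p => by
    rw [HahnSeries.coeff_eq_zero_of_lt_order (by lia), smul_zero]
  simp [this]

/-- The series `f(u + c)`, expanded at infinity: `(u + c)^(-l) = ∑ₚ c^p (-l choose p) u^(-l-p)`,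
so the coefficient of `u^(-N)` in `f(u + c)` is `∑ₚ c^p (p-N choose p) f_{N-p}` (a finite sum). -/
def shiftSeries {A : Type*} [Ring A] (c : ℤ) (f : LaurentSeries A) : LaurentSeries A :=
  HahnSeries.ofSuppBddBelow
    (fun N : ℤ => ∑ᶠ p : ℕ, (c ^ p * Ring.choose ((p : ℤ) - N) p) • f.coeff (N - p))
    (shiftSeries_bddBelow c f)

theorem shiftSeries_coeff_add {A : Type*} [Ring A] (c : ℤ) (f : LaurentSeries A) (B : ℤ)
    (hB : ∀ l < B, f.coeff l = 0) (s : ℕ) :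
    (shiftSeries c f).coeff (B + s) = ∑ x ∈ Finset.HasAntidiagonal.antidiagonal s,
      (c ^ x.1 * Ring.choose (-(B + x.2)) x.1) • f.coeff (B + x.2) := by
  change ∑ᶠ p : ℕ, (c ^ p * Ring.choose ((p : ℤ) - (B + s)) p) • f.coeff (B + s - p) = _
  rw [Finset.Nat.sum_antidiagonal_eq_sum_range_succ
    (fun p q => (c ^ p * Ring.choose (-(B + (q : ℤ))) p) • f.coeff (B + q))]
  rw [finsum_eq_sum_of_support_subset (s := Finset.range (s + 1))]
  · refine Finset.sum_congr rfl fun p hp => ?_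
    have hp' : p ≤ s := by simpa [Nat.lt_succ_iff] using hp
    rw [Nat.cast_sub hp']
    congr 3 <;> ring_nf
  · intro p hp
    by_contra h
    apply hp
    have : (s : ℤ) < p := by simpa using h
    simp only
    rw [hB _ (by lia), smul_zero]

theorem shiftSeries_coeff_lt {A : Type*} [Ring A] (c : ℤ) (f : LaurentSeries A) (B : ℤ)
    (hB : ∀ l < B, f.coeff l = 0) (N : ℤ) (hN : N < B) : (shiftSeries c f).coeff N = 0 := by
  change ∑ᶠ p : ℕ, (c ^ p * Ring.choose ((p : ℤ) - N) p) • f.coeff (N - p) = 0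
  have : ∀ p : ℕ, (c ^ p * Ring.choose ((p : ℤ) - N) p) • f.coeff (N - p) = 0 := fun p => by
    rw [hB _ (by lia), smul_zero]
  simp [this]

theorem coeff_mul_add {A : Type*} [Ring A] (f g : LaurentSeries A) (B B' : ℤ)
    (hB : ∀ l < B, f.coeff l = 0) (hB' : ∀ l < B', g.coeff l = 0) (s : ℕ) :
    (f * g).coeff (B + B' + s) =
      ∑ x ∈ Finset.HasAntidiagonal.antidiagonal s, f.coeff (B + x.1) * g.coeff (B' + x.2) := by
  rw [HahnSeries.coeff_mul]
  refine Finset.sum_of_injOn (fun x => ((x.1 - B).toNat, (x.2 - B').toNat)) ?_ ?_ ?_ ?_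
  · intro x hx y hy h
    simp only [Finset.mem_coe, Finset.mem_antidiagonal, HahnSeries.mem_support] at hx hy
    have h1 : B ≤ x.1 := by by_contra h'; exact hx.1 (hB _ (by lia))
    have h2 : B' ≤ x.2 := by by_contra h'; exact hx.2.1 (hB' _ (by lia))
    have h3 : B ≤ y.1 := by by_contra h'; exact hy.1 (hB _ (by lia))
    have h4 : B' ≤ y.2 := by by_contra h'; exact hy.2.1 (hB' _ (by lia))
    simp only [Prod.mk.injEq] at h
    ext <;> lia
  · intro x hx
    simp only [Finset.mem_coe, Finset.mem_antidiagonal, HahnSeries.mem_support] at hx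
    have h1 : B ≤ x.1 := by by_contra h'; exact hx.1 (hB _ (by lia))
    have h2 : B' ≤ x.2 := by by_contra h'; exact hx.2.1 (hB' _ (by lia))
    simp only [Finset.mem_coe, Finset.HasAntidiagonal.mem_antidiagonal]
    lia
  · intro y hy hy'
    by_contra h
    apply hy'
    simp only [Finset.HasAntidiagonal.mem_antidiagonal] at hy
    refine ⟨(B + y.1, B' + y.2), ?_, by simp⟩
    simp only [Finset.mem_coe, Finset.mem_antidiagonal, HahnSeries.mem_support]
    exact ⟨left_ne_zero_of_mul h, right_ne_zero_of_mul h, by lia⟩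
  · intro x hx
    simp only [Finset.mem_antidiagonal, HahnSeries.mem_support] at hx
    have h1 : B ≤ x.1 := by by_contra h'; exact hx.1 (hB _ (by lia))
    have h2 : B' ≤ x.2 := by by_contra h'; exact hx.2.1 (hB' _ (by lia))
    simp only
    congr 2 <;> lia

theorem shiftSeries_mul {A : Type*} [Ring A] (c : ℤ) (f g : LaurentSeries A) :
    shiftSeries c (f * g) = shiftSeries c f * shiftSeries c g := by
  obtain ⟨B, hB⟩ : ∃ B : ℤ, ∀ l < B, f.coeff l = 0 :=
    ⟨f.order, fun l hl => HahnSeries.coeff_eq_zero_of_lt_order hl⟩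
  obtain ⟨B', hB'⟩ : ∃ B : ℤ, ∀ l < B, g.coeff l = 0 :=
    ⟨g.order, fun l hl => HahnSeries.coeff_eq_zero_of_lt_order hl⟩
  have hfg : ∀ l < B + B', (f * g).coeff l = 0 := fun l hl => by
    rw [HahnSeries.coeff_mul]
    refine Finset.sum_eq_zero fun x hx => ?_
    simp only [Finset.mem_antidiagonal, HahnSeries.mem_support] at hx
    have h1 : B ≤ x.1 := by by_contra h'; exact hx.1 (hB _ (by lia))
    have h2 : B' ≤ x.2 := by by_contra h'; exact hx.2.1 (hB' _ (by lia))
    lia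
  have key : ∀ l l' : ℤ, ∀ p : ℕ, c ^ p * Ring.choose (-(l + l')) p =
      ∑ x ∈ Finset.HasAntidiagonal.antidiagonal p, (c ^ x.1 * Ring.choose (-l) x.1) *
        (c ^ x.2 * Ring.choose (-l') x.2) := fun l l' p => by
    rw [neg_add, Ring.add_choose_eq p (Commute.all _ _), Finset.mul_sum]
    refine Finset.sum_congr rfl fun x hx => ?_
    rw [← Finset.HasAntidiagonal.mem_antidiagonal.mp hx, pow_add]
    ring
  ext N
  by_cases hN : N < B + B'
  · rw [shiftSeries_coeff_lt c _ _ hfg N hN, HahnSeries.coeff_mul]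
    symm
    refine Finset.sum_eq_zero fun x hx => ?_
    simp only [Finset.mem_antidiagonal, HahnSeries.mem_support] at hx
    have h1 : B ≤ x.1 := by
      by_contra h'; exact hx.1 (shiftSeries_coeff_lt c f B hB _ (by lia))
    have h2 : B' ≤ x.2 := by
      by_contra h'; exact hx.2.1 (shiftSeries_coeff_lt c g B' hB' _ (by lia))
    lia
  · obtain ⟨s, rfl⟩ : ∃ s : ℕ, N = B + B' + s := ⟨(N - (B + B')).toNat, by lia⟩
    rw [shiftSeries_coeff_add c _ _ hfg, coeff_mul_add _ _ B B'
      (shiftSeries_coeff_lt c f B hB) (shiftSeries_coeff_lt c g B' hB')]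
    simp_rw [shiftSeries_coeff_add c f B hB, shiftSeries_coeff_add c g B' hB',
      coeff_mul_add f g B B' hB hB', Finset.sum_mul_sum, Finset.smul_sum, smul_mul_smul_comm]
    have h1 : ∀ x ∈ Finset.HasAntidiagonal.antidiagonal s, ∀ y ∈ Finset.HasAntidiagonal.antidiagonal x.2,
        (c ^ x.1 * Ring.choose (-(B + B' + (x.2 : ℤ))) x.1) •
          (f.coeff (B + y.1) * g.coeff (B' + y.2)) =
        ∑ w ∈ Finset.HasAntidiagonal.antidiagonal x.1,
          ((c ^ w.1 * Ring.choose (-(B + (y.1 : ℤ))) w.1) *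
            (c ^ w.2 * Ring.choose (-(B' + (y.2 : ℤ))) w.2)) •
          (f.coeff (B + y.1) * g.coeff (B' + y.2)) := fun x _ y hy => by
      rw [← Finset.sum_smul, ← key]
      congr 4
      rw [← Finset.HasAntidiagonal.mem_antidiagonal.mp hy]
      push_cast
      ring
    rw [Finset.sum_congr rfl fun x hx => Finset.sum_congr rfl (h1 x hx)]
    simp_rw [Finset.sum_sigma']
    refine Finset.sum_nbij'
      (fun i => ⟨(i.2.2.1 + i.2.1.1, i.2.2.2 + i.2.1.2), (i.2.2.1, i.2.1.1), (i.2.2.2, i.2.1.2)⟩)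
      (fun i => ⟨(i.2.1.1 + i.2.2.1, i.2.1.2 + i.2.2.2), (i.2.1.2, i.2.2.2), (i.2.1.1, i.2.2.1)⟩)
      ?_ ?_ ?_ ?_ ?_
    · rintro ⟨⟨x, x'⟩, ⟨y, y'⟩, ⟨w, w'⟩⟩ h
      simp only [Finset.mem_sigma, Finset.HasAntidiagonal.mem_antidiagonal] at h ⊢
      lia
    · rintro ⟨⟨x, x'⟩, ⟨y, y'⟩, ⟨w, w'⟩⟩ h
      simp only [Finset.mem_sigma, Finset.HasAntidiagonal.mem_antidiagonal] at h ⊢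
      lia
    · rintro ⟨⟨x, x'⟩, ⟨y, y'⟩, ⟨w, w'⟩⟩ h
      simp only [Finset.mem_sigma, Finset.HasAntidiagonal.mem_antidiagonal] at h
      obtain ⟨-, rfl, rfl⟩ := h
      rfl
    · rintro ⟨⟨x, x'⟩, ⟨y, y'⟩, ⟨w, w'⟩⟩ h
      simp only [Finset.mem_sigma, Finset.HasAntidiagonal.mem_antidiagonal] at h
      obtain ⟨-, rfl, rfl⟩ := h
      rfl
    · rintro ⟨⟨x, x'⟩, ⟨y, y'⟩, ⟨w, w'⟩⟩ h
      rfl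

/-- The ring homomorphism `f(u) ↦ f(u + c)` of `A((u⁻¹))`, for an integer `c`. -/
def shiftHom {A : Type*} [Ring A] (c : ℤ) : LaurentSeries A →+* LaurentSeries A where
  toFun := shiftSeries c
  map_one' := by
    have h : ∀ l < (0 : ℤ), (1 : LaurentSeries A).coeff l = 0 := fun l hl => by
      simp [HahnSeries.coeff_one, hl.ne]
    ext N
    by_cases hN : N < 0
    · rw [shiftSeries_coeff_lt c _ 0 h N hN, h N hN]
    · obtain ⟨s, rfl⟩ : ∃ s : ℕ, N = 0 + s := ⟨N.toNat, by lia⟩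
      rw [shiftSeries_coeff_add c _ 0 h,
        Finset.Nat.sum_antidiagonal_eq_sum_range_succ
          (fun p q => (c ^ p * Ring.choose (-(0 + (q : ℤ))) p) •
            (1 : LaurentSeries A).coeff (0 + q)),
        Finset.sum_eq_single s]
      · rcases s with _ | s
        · simp
        · simp [HahnSeries.coeff_one, Ring.choose_zero_succ]
          lia
      · intro p hp hps
        have : p < s := by simp at hp; lia
        rw [HahnSeries.coeff_one, if_neg (by lia), smul_zero]
      · simp
  map_mul' := shiftSeries_mul c
  map_zero' := by
    ext N
    change ∑ᶠ p : ℕ, (c ^ p * Ring.choose ((p : ℤ) - N) p) • (0 : A) = 0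
    simp
  map_add' f g := by
    obtain ⟨B, hB⟩ : ∃ B : ℤ, ∀ l < B, f.coeff l = 0 :=
      ⟨f.order, fun l hl => HahnSeries.coeff_eq_zero_of_lt_order hl⟩
    obtain ⟨B', hB'⟩ : ∃ B : ℤ, ∀ l < B, g.coeff l = 0 :=
      ⟨g.order, fun l hl => HahnSeries.coeff_eq_zero_of_lt_order hl⟩
    have h1 : ∀ l < min B B', f.coeff l = 0 := fun l hl => hB l (by lia)
    have h2 : ∀ l < min B B', g.coeff l = 0 := fun l hl => hB' l (by lia)
    have h3 : ∀ l < min B B', (f + g).coeff l = 0 := fun l hl => by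
      rw [HahnSeries.coeff_add, h1 l hl, h2 l hl, add_zero]
    ext N
    rw [HahnSeries.coeff_add]
    by_cases hN : N < min B B'
    · rw [shiftSeries_coeff_lt c _ _ h1 N hN, shiftSeries_coeff_lt c _ _ h2 N hN,
        shiftSeries_coeff_lt c _ _ h3 N hN, add_zero]
    · obtain ⟨s, hs⟩ : ∃ s : ℕ, N = min B B' + s := ⟨(N - min B B').toNat, by lia⟩
      rw [hs, shiftSeries_coeff_add c _ _ h1, shiftSeries_coeff_add c _ _ h2,
        shiftSeries_coeff_add c _ _ h3, ← Finset.sum_add_distrib]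
      simp only [HahnSeries.coeff_add, smul_add]

/-- `Multiplicative ℕ` acts on `A((u⁻¹))` by powers of `f(u) ↦ f(u + 1)`. -/
instance shiftAction {A : Type*} [Ring A] :
    MulSemiringAction (Multiplicative ℕ) (LaurentSeries A) where
  smul k f := (shiftHom 1)^[k.toAdd] f
  one_smul _ := rfl
  mul_smul k l f := Function.iterate_add_apply _ k.toAdd l.toAdd f
  smul_zero k := iterate_map_zero (shiftHom 1) k.toAdd
  smul_add k := iterate_map_add (shiftHom 1) k.toAdd
  smul_one k := iterate_map_one (shiftHom 1) k.toAdd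
  smul_mul k := iterate_map_mul (shiftHom 1) k.toAdd

/-- The algebra `D(A)` of difference operators `∑ₖ bₖ(u) τ^k` with `bₖ(u) ∈ A((u⁻¹))` and
`τ f(u) = f(u + 1) τ`.  The coefficient of `u^(-l) τ^k` in `P` is `(P.coeff k).coeff l`. -/
abbrev DiffOp (A : Type*) [Ring A] := SkewPolynomial (LaurentSeries A)

/-- A series `f(u) ∈ A((u⁻¹))`, as a difference operator. -/
def ofSeries {A : Type*} [Ring A] : LaurentSeries A →+* DiffOp A := SkewPolynomial.CRingHom

/-- The shift operator `τ`. -/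
def tau {A : Type*} [Ring A] : DiffOp A := SkewPolynomial.X

/-- An element of `A`, as a difference operator. -/
def ofConst {A : Type*} [Ring A] : A →+* DiffOp A := ofSeries.comp HahnSeries.C

/-- A polynomial `p(u)` with scalar coefficients, as a difference operator. -/
def ofPoly {F A : Type*} [Field F] [Ring A] [Algebra F A] (p : Polynomial F) : DiffOp A :=
  ofSeries (Polynomial.aeval (HahnSeries.single (-1 : ℤ) (1 : A)) p)

/-- The polynomial `(u + c)(u + c - 1) ⋯ (u + c - j + 1)`. -/
def fallingPoly {F : Type*} [Field F] (c : F) (j : ℕ) : Polynomial F :=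
  (descPochhammer F j).comp (Polynomial.X + Polynomial.C c)

/-- The polynomial `∏ᵢ (u - zᵢ)`. -/
def rootsPoly {n : ℕ} (F : Type*) [Field F] [Algebra ℂ F] (z : Fin n → ℂ) : Polynomial F :=
  ∏ i, (Polynomial.X - Polynomial.C (algebraMap ℂ F (z i)))

/-- The matrix `(δ_{kl} + E_{kl} / (u - c))`, where `1 / (u - c) = ∑_{r ≥ 0} c^r u^(-r-1)`: the
action of the Yangian generators `t_{kl}(u)` on an evaluation module with parameter `c`, on which
`e_{kl}` acts by `E k l`. -/
def evalMatrix {F A : Type*} [Field F] [Ring A] [Algebra F A] {m : ℕ} (c : F)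
    (E : Fin m → Fin m → A) : Matrix (Fin m) (Fin m) (LaurentSeries A) := fun k l =>
  (if k = l then 1 else 0) + HahnSeries.ofPowerSeries ℤ A (PowerSeries.mk fun
    | 0 => 0
    | r + 1 => c ^ r • E k l)

/-- The generating operator of the Bethe algebra with twist `C = (c₁, …, c_m)`,
`∑_σ sgn(σ) D_{σ(1),1} ⋯ D_{σ(m),m}` with `D_{ij} = cᵢ δ_{ij} τ - t_{ij}(u - j + 1)`
(the index `j : Fin m` here is `j - 1` there). -/
def betheOperator {F A : Type*} [Field F] [Ring A] [Algebra F A] {m : ℕ} (C : Fin m → F)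
    (t : Matrix (Fin m) (Fin m) (LaurentSeries A)) : DiffOp A :=
  ∑ σ : Equiv.Perm (Fin m), (Equiv.Perm.sign σ : ℤ) • (List.ofFn fun j : Fin m =>
    (if σ j = j then ofConst (algebraMap F A (C (σ j))) * tau else 0) -
      ofSeries (shiftHom (-(j : ℤ)) (t (σ j) j))).prod

/-- The `F`-subalgebra generated by all coefficients of a difference operator. -/
def coeffAlgebra {F A : Type*} [Field F] [Ring A] [Algebra F A] (P : DiffOp A) :
    Subalgebra F A :=
  Algebra.adjoin F {x | ∃ (k : ℕ) (l : ℤ), x = (P.coeff k).coeff l}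

/-- `P` is the operator induced by `Q` through `f`: each coefficient of `P`, an element of
`F ⊗ End W` acting on `F ⊗ W`, is intertwined by `f` with the same coefficient of `Q`.  For
injective `f` (and finite-dimensional `W`) this says that the coefficients of `Q` preserve the
image of `f`, and that `P` is obtained from `Q` by restriction to this image and conjugation
with `f`; in particular it determines `P`. -/
def IsInduced {F W V : Type*} [Field F] [Algebra ℂ F] [AddCommGroup W] [Module ℂ W]
    [AddCommGroup V] [Module F V] (f : F ⊗[ℂ] W →ₗ[F] V)
    (P : DiffOp (F ⊗[ℂ] Module.End ℂ W)) (Q : DiffOp (Module.End F V)) : Prop :=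
  ∀ (k : ℕ) (l : ℤ),
    f ∘ₗ LinearMap.tensorProductEnd ℂ F W ((P.coeff k).coeff l) = ((Q.coeff k).coeff l) ∘ₗ f

/-! ## The `gl_m`-module `S^(m)(a) = S^{a₁} ℂ^m ⊗ ⋯ ⊗ S^{aₙ} ℂ^m` -/

/-- The symmetric power `S^a ℂ^m`: homogeneous polynomials of degree `a` in the basis vectors
of `ℂ^m`. -/
def SymPow (m a : ℕ) : Type := MvPolynomial.homogeneousSubmodule (Fin m) ℂ a

instance (m a : ℕ) : AddCommGroup (SymPow m a) :=
  inferInstanceAs (AddCommGroup (MvPolynomial.homogeneousSubmodule (Fin m) ℂ a))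

instance (m a : ℕ) : Module ℂ (SymPow m a) :=
  inferInstanceAs (Module ℂ (MvPolynomial.homogeneousSubmodule (Fin m) ℂ a))

theorem symGen_mem {m a : ℕ} (k l : Fin m) (p : MvPolynomial (Fin m) ℂ)
    (hp : p ∈ MvPolynomial.homogeneousSubmodule (Fin m) ℂ a) :
    MvPolynomial.X k * MvPolynomial.pderiv l p ∈
      MvPolynomial.homogeneousSubmodule (Fin m) ℂ a := by
  rw [MvPolynomial.mem_homogeneousSubmodule] at hp ⊢
  rcases a with _ | a
  · rw [← MvPolynomial.totalDegree_zero_iff_isHomogeneous,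
      MvPolynomial.totalDegree_eq_zero_iff_eq_C] at hp
    rw [hp]
    simpa using MvPolynomial.isHomogeneous_zero _ _ _
  · have := (MvPolynomial.isHomogeneous_X ℂ k).mul (hp.pderiv (i := l))
    simpa [add_comm] using this

/-- The action of `e_{kl}` on `S^a ℂ^m`, by `x_k ∂/∂x_l`. -/
def symGen {m a : ℕ} (k l : Fin m) : Module.End ℂ (SymPow m a) where
  toFun p := ⟨MvPolynomial.X k * MvPolynomial.pderiv l p.1, symGen_mem k l p.1 p.2⟩
  map_add' p q := Subtype.ext <| by
    change MvPolynomial.X k * MvPolynomial.pderiv l (p.1 + q.1) =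
      MvPolynomial.X k * MvPolynomial.pderiv l p.1 + MvPolynomial.X k * MvPolynomial.pderiv l q.1
    rw [map_add, mul_add]
  map_smul' c p := Subtype.ext <| by
    change MvPolynomial.X k * MvPolynomial.pderiv l (c • p.1) =
      c • (MvPolynomial.X k * MvPolynomial.pderiv l p.1)
    rw [Derivation.map_smul, mul_smul_comm]

/-- `S^(m)(a) = S^{a₁} ℂ^m ⊗ ⋯ ⊗ S^{aₙ} ℂ^m`. -/
def SymTensor {n : ℕ} (m : ℕ) (a : Fin n → ℕ) : Type := ⨂[ℂ] i : Fin n, SymPow m (a i)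

instance {n : ℕ} (m : ℕ) (a : Fin n → ℕ) : AddCommGroup (SymTensor m a) :=
  inferInstanceAs (AddCommGroup (⨂[ℂ] i : Fin n, SymPow m (a i)))

instance {n : ℕ} (m : ℕ) (a : Fin n → ℕ) : Module ℂ (SymTensor m a) :=
  inferInstanceAs (Module ℂ (⨂[ℂ] i : Fin n, SymPow m (a i)))

/-- `e_{kl}` acting on the `i`-th tensor factor of `S^(m)(a)`. -/
def siteGen {n m : ℕ} (a : Fin n → ℕ) (i : Fin n) (k l : Fin m) :
    Module.End ℂ (SymTensor m a) :=
  PiTensorProduct.map (R := ℂ) (s := fun i => SymPow m (a i)) (t := fun i => SymPow m (a i))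
    (Function.update (fun _ => LinearMap.id) i (symGen k l))

/-- The weight subspace `S^(m)(a)[b]`. -/
def weightSpace {n m : ℕ} (a : Fin n → ℕ) (b : Fin m → ℕ) : Submodule ℂ (SymTensor m a) :=
  ⨅ j : Fin m, Module.End.eigenspace (∑ i, siteGen a i j j) (b j : ℂ)

/-! ## Verma modules -/

section verma

attribute [local instance 100] LieRing.ofAssociativeRing

variable (F : Type*) [Field F]

/-- The universal enveloping algebra `U(gl_m)` over `F`. -/
abbrev EnvGl (m : ℕ) := UniversalEnvelopingAlgebra F (Matrix (Fin m) (Fin m) F)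

variable {F} {m : ℕ}
/-- The generator `e_{kl}` of `U(gl_m)`. -/
def envGen (k l : Fin m) : EnvGl F m :=
  UniversalEnvelopingAlgebra.ι F (Matrix.single k l (1 : F))

/-- The left ideal generated by `e_{kl}`, `k < l`, and `e_{kk} - μ_k`. -/
def vermaIdeal (μ : Fin m → F) : Submodule (EnvGl F m) (EnvGl F m) :=
  Submodule.span (EnvGl F m) ({x : EnvGl F m | ∃ k l : Fin m, k < l ∧ x = envGen k l} ∪
    {x : EnvGl F m | ∃ k : Fin m, x = envGen k k - algebraMap F (EnvGl F m) (μ k)})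

/-- The Verma module `M_μ` of highest weight `μ`. -/
def Verma (μ : Fin m → F) := EnvGl F m ⧸ vermaIdeal μ

instance (μ : Fin m → F) : AddCommGroup (Verma μ) :=
  inferInstanceAs (AddCommGroup (EnvGl F m ⧸ vermaIdeal μ))

instance (μ : Fin m → F) : Module (EnvGl F m) (Verma μ) :=
  inferInstanceAs (Module (EnvGl F m) (EnvGl F m ⧸ vermaIdeal μ))

instance (μ : Fin m → F) : Module F (Verma μ) :=
  inferInstanceAs (Module F (EnvGl F m ⧸ vermaIdeal μ))

instance (μ : Fin m → F) : IsScalarTower F (EnvGl F m) (Verma μ) :=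
  inferInstanceAs (IsScalarTower F (EnvGl F m) (EnvGl F m ⧸ vermaIdeal μ))

/-- The highest weight vector `v_μ`. -/
def vermaVec (μ : Fin m → F) : Verma μ := (vermaIdeal μ).mkQ 1

/-- The action of `e_{kl}` on `M_μ`. -/
def vermaGen (μ : Fin m → F) (k l : Fin m) : Module.End F (Verma μ) :=
  Algebra.lsmul F F (Verma μ) (envGen k l : EnvGl F m)

/-- The span of all weight vectors of `M_μ` of weights distinct from `μ`. -/
def vermaLower (μ : Fin m → F) : Submodule F (Verma μ) :=
  ⨆ (η : Fin m → F) (_ : η ≠ μ), ⨅ k : Fin m, Module.End.eigenspace (vermaGen μ k k) (η k)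

end verma

/-! ## Singular vectors, the map `θ`, and the Yangian action -/

section tensor
variable {F : Type*} [Field F] [Algebra ℂ F] {m n : ℕ}

variable (F) in
/-- `S^(m)(a)` with scalars extended to `F`. -/
def SymTensorOver (m : ℕ) (a : Fin n → ℕ) : Type _ := F ⊗[ℂ] SymTensor m a

instance (a : Fin n → ℕ) : AddCommGroup (SymTensorOver F m a) :=
  inferInstanceAs (AddCommGroup (F ⊗[ℂ] SymTensor m a))

instance (a : Fin n → ℕ) : Module F (SymTensorOver F m a) :=
  inferInstanceAs (Module F (F ⊗[ℂ] SymTensor m a))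

variable (F) in
/-- `e_{kl}` acting on the `i`-th tensor factor of `S^(m)(a)`, over `F`. -/
def siteGenOver (a : Fin n → ℕ) (i : Fin n) (k l : Fin m) :
    Module.End F (SymTensorOver F m a) :=
  LinearMap.baseChange (M := SymTensor m a) (N := SymTensor m a) F (siteGen a i k l)

/-- `S^(m)(a) ⊗ M_μ`, over `F`. -/
def FullTensor (a : Fin n → ℕ) (μ : Fin m → F) : Type _ :=
  SymTensorOver F m a ⊗[F] Verma μ

instance (a : Fin n → ℕ) (μ : Fin m → F) : AddCommGroup (FullTensor a μ) :=
  inferInstanceAs (AddCommGroup (SymTensorOver F m a ⊗[F] Verma μ))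

instance (a : Fin n → ℕ) (μ : Fin m → F) : Module F (FullTensor a μ) :=
  inferInstanceAs (Module F (SymTensorOver F m a ⊗[F] Verma μ))

/-- `e_{kl}` acting on the `i`-th factor of `S^{a₁} ⊗ ⋯ ⊗ S^{aₙ} ⊗ M_μ`. -/
def fullSiteGen (a : Fin n → ℕ) (μ : Fin m → F) (i : Fin n) (k l : Fin m) :
    Module.End F (FullTensor a μ) :=
  LinearMap.rTensor (Verma μ) (siteGenOver F a i k l)

/-- `e_{kl}` acting on the last factor `M_μ` of `S^(m)(a) ⊗ M_μ`. -/
def fullVermaGen (a : Fin n → ℕ) (μ : Fin m → F) (k l : Fin m) :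
    Module.End F (FullTensor a μ) :=
  LinearMap.lTensor (SymTensorOver F m a) (vermaGen μ k l)

/-- The action of `e_{kl}` on the tensor product `S^(m)(a) ⊗ M_μ`. -/
def fullGen (a : Fin n → ℕ) (μ : Fin m → F) (k l : Fin m) :
    Module.End F (FullTensor a μ) :=
  ∑ i, fullSiteGen a μ i k l + fullVermaGen a μ k l

/-- The singular vectors of weight `μ + b` in `S^(m)(a) ⊗ M_μ`. -/
def singularSpace (a : Fin n → ℕ) (b : Fin m → ℕ) (μ : Fin m → F) :
    Submodule F (FullTensor a μ) :=
  (⨅ (k : Fin m) (l : Fin m) (_ : k < l), LinearMap.ker (fullGen a μ k l)) ⊓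
    ⨅ j : Fin m, (fullGen a μ j j).eigenspace (μ j + b j)

/-- The inclusion of `S^(m)(a)[b]` into `S^(m)(a)`, over `F`. -/
def weightIncl (F : Type*) [Field F] [Algebra ℂ F] (a : Fin n → ℕ) (b : Fin m → ℕ) :
    F ⊗[ℂ] weightSpace a b →ₗ[F] SymTensorOver F m a :=
  LinearMap.baseChange F (weightSpace a b).subtype

/-- The map `w ↦ w ⊗ v_μ`. -/
def tensorVermaVec (a : Fin n → ℕ) (μ : Fin m → F) :
    SymTensorOver F m a →ₗ[F] FullTensor a μ :=
  (TensorProduct.mk F (SymTensorOver F m a) (Verma μ)).flip (vermaVec μ)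

/-- The span of all `w ⊗ v` with `v` a weight vector of `M_μ` of weight distinct from `μ`. -/
def lowerTensor (a : Fin n → ℕ) (μ : Fin m → F) : Submodule F (FullTensor a μ) :=
  LinearMap.range (M₂ := SymTensorOver F m a ⊗[F] Verma μ)
    (LinearMap.lTensor (SymTensorOver F m a) (vermaLower μ).subtype)

/-- `θ` sends a singular vector `v` to its component along `v_μ`: `v = θ(v) ⊗ v_μ + ∑ᵢ wᵢ ⊗ vᵢ` with
weight vectors `vᵢ ∈ M_μ` of weights distinct from `μ`. -/
def IsTheta (a : Fin n → ℕ) (b : Fin m → ℕ) (μ : Fin m → F)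
    (θ : singularSpace a b μ →ₗ[F] F ⊗[ℂ] weightSpace a b) : Prop :=
  ∀ v : singularSpace a b μ,
    (v : FullTensor a μ) - tensorVermaVec a μ (weightIncl F a b (θ v)) ∈ lowerTensor a μ

/-- The action of the `t_{kl}(u)` on the `Y(gl_m)`-module
`S^{a₁} ℂ^m(z₁) ⊗ ⋯ ⊗ S^{aₙ} ℂ^m(zₙ) ⊗ M_μ`, through the comultiplication
`t_{kl}(u) ↦ ∑ᵢ t_{ki}(u) ⊗ t_{il}(u)`. -/
def monodromyFull (a : Fin n → ℕ) (μ : Fin m → F) (z : Fin n → ℂ) :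
    Matrix (Fin m) (Fin m) (LaurentSeries (Module.End F (FullTensor a μ))) :=
  (List.ofFn fun i => evalMatrix (algebraMap ℂ F (z i)) (fullSiteGen a μ i)).prod *
    evalMatrix (0 : F) (fullVermaGen a μ)

/-- The action of the `t_{kl}(u)` on the `Y(gl_m)`-module `S^{a₁} ℂ^m(z₁) ⊗ ⋯ ⊗ S^{aₙ} ℂ^m(zₙ)`. -/
def monodromy (F : Type*) [Field F] [Algebra ℂ F] (m : ℕ) (a : Fin n → ℕ) (z : Fin n → ℂ) :
    Matrix (Fin m) (Fin m) (LaurentSeries (Module.End F (SymTensorOver F m a))) :=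
  (List.ofFn fun i => evalMatrix (algebraMap ℂ F (z i))
    (siteGenOver F a i)).prod

end tensor

/-! ## Rational functions, the degree and the leading terms -/

/-- The field of rational functions in `m` variables over `ℂ`.  It serves both as `ℂ(λ^(m))` and
as `ℂ(ξ)`. -/
def RatFun (m : ℕ) : Type := FractionRing (MvPolynomial (Fin m) ℂ)

instance (m : ℕ) : Field (RatFun m) :=
  inferInstanceAs (Field (FractionRing (MvPolynomial (Fin m) ℂ)))

instance (m : ℕ) : Algebra (MvPolynomial (Fin m) ℂ) (RatFun m) :=
  inferInstanceAs (Algebra (MvPolynomial (Fin m) ℂ) (FractionRing (MvPolynomial (Fin m) ℂ)))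

instance (m : ℕ) : IsFractionRing (MvPolynomial (Fin m) ℂ) (RatFun m) :=
  inferInstanceAs
    (IsFractionRing (MvPolynomial (Fin m) ℂ) (FractionRing (MvPolynomial (Fin m) ℂ)))

instance (m : ℕ) : Algebra ℂ (RatFun m) :=
  inferInstanceAs (Algebra ℂ (FractionRing (MvPolynomial (Fin m) ℂ)))

instance (m : ℕ) : IsScalarTower ℂ (MvPolynomial (Fin m) ℂ) (RatFun m) :=
  inferInstanceAs
    (IsScalarTower ℂ (MvPolynomial (Fin m) ℂ) (FractionRing (MvPolynomial (Fin m) ℂ)))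

/-- The `i`-th variable (`λ_{n+i}`, respectively `ξᵢ`). -/
def ratVar {m : ℕ} (i : Fin m) : RatFun m :=
  algebraMap (MvPolynomial (Fin m) ℂ) (RatFun m) (MvPolynomial.X i)

/-- `λ_{n+i} ↦ r ξᵢ`, from polynomials in `λ^(m)` to `ℂ(ξ)((r⁻¹))`. -/
def scalePoly (m : ℕ) : MvPolynomial (Fin m) ℂ →+* LaurentSeries (RatFun m) :=
  MvPolynomial.eval₂Hom (HahnSeries.C.comp (algebraMap ℂ (RatFun m)))
    fun i => HahnSeries.single (-1 : ℤ) (ratVar i)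

theorem scalePoly_monomial {m : ℕ} (s : Fin m →₀ ℕ) (c : ℂ) :
    scalePoly m (MvPolynomial.monomial s c) = HahnSeries.single (-(s.degree : ℤ))
      (algebraMap (MvPolynomial (Fin m) ℂ) (RatFun m) (MvPolynomial.monomial s c)) := by
  have h : ∀ t : Finset (Fin m), ∏ i ∈ t, HahnSeries.single (-1 : ℤ) (ratVar i) ^ s i =
      HahnSeries.single (-((∑ i ∈ t, s i : ℕ) : ℤ)) (∏ i ∈ t, ratVar (m := m) i ^ s i) := by
    intro t
    induction t using Finset.cons_induction with
    | empty => simp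
    | cons i t hi ih =>
      rw [Finset.prod_cons, Finset.prod_cons, Finset.sum_cons, ih, HahnSeries.single_pow,
        HahnSeries.single_mul_single]
      congr 2
      push_cast
      rw [nsmul_eq_mul]
      ring
  rw [scalePoly, MvPolynomial.coe_eval₂Hom, MvPolynomial.eval₂_monomial, Finsupp.prod, h,
    RingHom.comp_apply, HahnSeries.C_apply, HahnSeries.single_mul_single, zero_add,
    Finsupp.degree_apply, IsScalarTower.algebraMap_apply ℂ (MvPolynomial (Fin m) ℂ) (RatFun m),
    MvPolynomial.algebraMap_eq]
  have h2 : MvPolynomial.monomial s c =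
      MvPolynomial.C c * ∏ i ∈ s.support, MvPolynomial.X (R := ℂ) i ^ s i :=
    MvPolynomial.monomial_eq
  rw [h2, RingHom.map_mul, map_prod]
  simp only [RingHom.map_pow, ratVar]

theorem scalePoly_coeff {m : ℕ} (p : MvPolynomial (Fin m) ℂ) (d : ℕ) :
    (scalePoly m p).coeff (-(d : ℤ)) =
      algebraMap (MvPolynomial (Fin m) ℂ) (RatFun m) (MvPolynomial.homogeneousComponent d p) := by
  induction p using MvPolynomial.induction_on' with
  | add p q hp hq => rw [map_add, HahnSeries.coeff_add, hp, hq, map_add, map_add]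
  | monomial s c =>
    rw [scalePoly_monomial]
    by_cases h : s.degree = d
    · rw [← h, HahnSeries.coeff_single_same, MvPolynomial.homogeneousComponent_of_mem
        (n := s.degree) (MvPolynomial.isHomogeneous_monomial c rfl), if_pos rfl]
    · rw [HahnSeries.coeff_single_of_ne (by lia), MvPolynomial.homogeneousComponent_of_mem
        (n := s.degree) (MvPolynomial.isHomogeneous_monomial c rfl), if_neg (Ne.symm h), map_zero]

theorem scalePoly_injective (m : ℕ) : Function.Injective (scalePoly m) := by
  rw [injective_iff_map_eq_zero]
  intro p hp
  rw [← MvPolynomial.sum_homogeneousComponent p]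
  refine Finset.sum_eq_zero fun d _ => ?_
  have := scalePoly_coeff p d
  rw [hp] at this
  exact IsFractionRing.injective (MvPolynomial (Fin m) ℂ) (RatFun m)
    (by rw [← this, map_zero, HahnSeries.coeff_zero])

/-- `π : ℂ(λ^(m)) → ℂ(ξ)((r⁻¹))`, `λ_{n+i} ↦ r ξᵢ`. -/
def scale (m : ℕ) : RatFun m →+* LaurentSeries (RatFun m) :=
  IsFractionRing.lift (scalePoly_injective m)

/-- The coefficient of `r^k` in `π(p) ∈ ℂ(ξ)((r⁻¹))`. -/
def rCoeff {m : ℕ} (k : ℤ) : RatFun m →ₗ[ℂ] RatFun m where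
  toFun p := (scale m p).coeff (-k)
  map_add' p q := by rw [map_add, HahnSeries.coeff_add]
  map_smul' c p := by
    have h : scale m (algebraMap ℂ (RatFun m) c) = HahnSeries.C (algebraMap ℂ (RatFun m) c) := by
      rw [IsScalarTower.algebraMap_apply ℂ (MvPolynomial (Fin m) ℂ) (RatFun m), scale,
        IsFractionRing.lift_algebraMap, MvPolynomial.algebraMap_eq, scalePoly,
        MvPolynomial.coe_eval₂Hom, MvPolynomial.eval₂_C]
      rfl
    rw [Algebra.smul_def, map_mul, h, HahnSeries.C_mul_eq_smul, HahnSeries.coeff_smul,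
      RingHom.id_apply, smul_eq_mul, Algebra.smul_def]

/-- The filtration component of degree `i` of `ℂ(λ^(m)) ⊗ V`: the span of all `p ⊗ v` with
`deg p ≤ i`, where `deg p` is the degree in `r` of `π(p)`. -/
def degLE (m : ℕ) (V : Type*) [AddCommGroup V] [Module ℂ V] (i : ℤ) :
    Submodule ℂ (RatFun m ⊗[ℂ] V) :=
  Submodule.span ℂ
    {x | ∃ (p : RatFun m) (v : V), (∀ k : ℤ, i < k → rCoeff k p = 0) ∧ x = p ⊗ₜ[ℂ] v}

/-- The `i`-th leading term: `∑ pₛ ⊗ vₛ ↦ ∑ (coefficient of r^i in π(pₛ)) ⊗ vₛ`.  On elements of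
degree `≤ i` this is the projection to the `i`-th graded component, with values in
`ℂ(ξ) ⊗ V`. -/
def gr {m : ℕ} {V : Type*} [AddCommGroup V] [Module ℂ V] (i : ℤ) :
    RatFun m ⊗[ℂ] V →ₗ[ℂ] RatFun m ⊗[ℂ] V :=
  LinearMap.rTensor V (rCoeff i)

/-! ## The operators of the duality -/

/-- The evaluation points `zᵢ = λ^(n)ᵢ + aᵢ - i`, `i = 1, …, n`. -/
def evalPoint {n : ℕ} (a : Fin n → ℕ) (lam : Fin n → ℂ) (i : Fin n) : ℂ :=
  lam i + a i - ((i : ℕ) + 1)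

/-- The expansion
`u(u-1)⋯(u-m+1) ∏ᵢ (u - zᵢ) P = ∑_{i ≤ m} ∑_{j ≤ n} D_{ij} (u+n)(u+n-1)⋯(u+n-j+1) ((u-m+1) d)^i`,
where `d = τ - 1`. -/
def IsExpansion {F A : Type*} [Field F] [Algebra ℂ F] [Ring A] [Algebra F A] {n m : ℕ}
    (z : Fin n → ℂ) (P : DiffOp A) (D : Fin (m + 1) → Fin (n + 1) → A) : Prop :=
  ofPoly (fallingPoly (0 : F) m * rootsPoly F z) * P =
    ∑ i : Fin (m + 1), ∑ j : Fin (n + 1), ofConst (D i j) * ofPoly (fallingPoly (n : F) j) *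
      (ofPoly (Polynomial.X - Polynomial.C ((m : F) - 1)) * (tau - 1)) ^ (i : ℕ)

end

end BetheDuality

open BetheDuality

/-! Everything is read off from principal quantum minors. Choosing in every column of the column
determinant either the `τ`-term or the `t`-term, and moving all `τ` to the right, writes the
operator with twist `C` as the sum over subsets `I` of `(-1)^|I| ∏_{s ∉ I} c_s · M_I(u) τ^(m-|I|)`,
where `M_I` is the principal minor of `t(u)` on `I` (`betheOperator_expand`). For `C = 1`, the
coefficient of `d^i` is the combination of the `M_I` with weights `(-1)^|I| binom(m-|I|, i)`, so
only `|I| ≤ m - i` contribute.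

Leading terms. On `S(a) ⊗ M` the monodromy matrix is that of the sites times `1 + e/u`. Column
determinants are multiplicative (`colDet_colDet`), so `u(u-1)⋯(u-|I|+1) M_I` is a sum of column
determinants of the sites times products of `|I|` entries `(u-s)δ + e`. Give degree one to each `λ`
and to each lowering operator of `M`. Seen through the highest weight component, such an entry has
degree one and leading term `δ_{ab} λ_a`; the product therefore has degree `|I|` and leading term
`∏_{s ∈ I} ξ_s` times the minor of the sites. In `u(u-1)⋯(u-m+i+1)` times the coefficient of `d^i`,
smaller subsets have too low a degree, and those with `|I| = m - i` form exactly the coefficient of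
`τ^i` in the XXX operator (`seriesLead_binomCoeff`). Finally `u(u-1)⋯(u-m+1) d^i` equals
`u(u-1)⋯(u-m+i+1)` times the `i`-th falling factorial of the Euler operator `(u-m+1)d`. The passage
to powers of the Euler operator is unitriangular and adds to the `i`-th coefficient only
contributions of larger index, which have smaller degree.

Polynomiality in `u`. On a symmetric power `e_{ab}` acts as `x_a ∂_b`, and antisymmetrization kills
the normally ordered quadratic terms. Hence a whole quantum minor of one site has only a simple pole
(`colDet_rankOne`), and the prefactors of the expansion clear all denominators. The degree is at
most `n`, because the entries of the untwisted operator are `δ d + O(1/u)`, which makes the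
coefficient of `d^i` of order `u^(-(m-i))`.

The map `θ`. For generic `λ`, a vector killed by `Z = ∑_{i<j} e_{ji} E_{ij}`, with `e` acting on `M`
and `E` on the tensor product, is singular (`singular_of_lowSum`). The part of `Z` acting on `M`
alone is diagonal, and away from the highest weight its eigenvalues are affine functions of `λ` with
nonzero linear part. The mixed part raises weights of the sites and is nilpotent, even after
composition with operators on `M`. So the singular vector with given top component is a terminating
Neumann series (`thetaInv`). Each of its steps applies one lowering operator and divides by one
eigenvalue of degree one, so the series has degree zero and conjugation with `θ` does not disturb
leading terms. The coefficients of the untwisted operator preserve singular vectors since they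
commute with `gl_m`; those of the twisted operator preserve weight spaces since they commute with
the diagonal elements. That the highest weight vector of `M` is nonzero is seen in a model on
rational functions of matrix entries (`vermaVec_ne_zero`). -/

namespace BetheDuality

noncomputable section

/-! ## Ordered products and column determinants -/

section OrderedProducts
variable {A : Type*} [Ring A] {k m : ℕ}

/-- The product `F 0 * F 1 * ⋯ * F (k - 1)`. -/
def oprod (F : Fin k → A) : A := (List.ofFn F).prod

@[simp] theorem oprod_zero (F : Fin 0 → A) : oprod F = 1 := by simp [oprod]

theorem oprod_succ (F : Fin (k + 1) → A) : oprod F = F 0 * oprod fun s => F s.succ := by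
  simp [oprod, List.ofFn_succ]

theorem oprod_castSucc (F : Fin (k + 1) → A) :
    oprod F = (oprod fun s : Fin k => F s.castSucc) * F (Fin.last k) := by
  rw [oprod, oprod, List.ofFn_succ_last]
  simp

theorem oprod_sum {ι : Type*} [Fintype ι] (F : Fin k → ι → A) :
    (oprod fun s => ∑ x, F s x) = ∑ h : Fin k → ι, oprod fun s => F s (h s) := by
  induction k with
  | zero => simp
  | succ k ih =>
    rw [oprod_succ, ih, Finset.sum_mul_sum, ← Fintype.sum_prod_type',
      ← (Fin.consEquiv fun _ => ι).sum_comp]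
    refine Fintype.sum_congr _ _ fun x => ?_
    rw [oprod_succ]
    simp [Fin.consEquiv]

theorem oprod_mul (F G : Fin k → A) (h : ∀ s t, Commute (F s) (G t)) :
    (oprod fun s => F s * G s) = oprod F * oprod G := by
  induction k with
  | zero => simp
  | succ k ih =>
    have hc : ∀ (j : ℕ) (F' : Fin j → A) (y : A), (∀ s, Commute (F' s) y) →
        Commute (oprod F') y := by
      intro j
      induction j with
      | zero => intro F' y _; simp
      | succ j ih =>
        intro F' y hy
        rw [oprod_succ]
        exact (hy 0).mul_left (ih _ _ fun s => hy _)
    rw [oprod_castSucc, oprod_castSucc F, oprod_castSucc G, ih _ _ fun s t => h _ _]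
    have := hc k (fun s => G s.castSucc) (F (Fin.last k)) fun s => (h _ _).symm
    simp only [mul_assoc]
    congr 1
    rw [← mul_assoc, this.eq, mul_assoc]

/-- Leibniz rule for the inner derivation of `x`. -/
theorem oprod_commutator (x : A) (F : Fin k → A) :
    x * oprod F - oprod F * x =
      ∑ r, oprod (Function.update F r (x * F r - F r * x)) := by
  induction k with
  | zero => simp
  | succ k ih =>
    rw [Fin.sum_univ_succ, oprod_succ, oprod_succ]
    have h1 : (fun s : Fin k => Function.update F 0 (x * F 0 - F 0 * x) s.succ) =
        fun s => F s.succ := by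
      ext s; simp
    have h2 : ∀ r : Fin k, oprod (Function.update F r.succ (x * F r.succ - F r.succ * x)) =
        F 0 * oprod (Function.update (fun s : Fin k => F s.succ) r
          (x * F r.succ - F r.succ * x)) := by
      intro r
      rw [oprod_succ, Function.update_of_ne (Fin.succ_ne_zero r).symm]
      congr 2
      funext s
      by_cases hs : s = r
      · subst hs; simp
      · rw [Function.update_of_ne hs, Function.update_of_ne (by simpa using hs)]
    rw [h1, Finset.sum_congr rfl fun r _ => h2 r, ← Finset.mul_sum, ← ih]
    simp only [Function.update_self]
    noncomm_ring

theorem oprod_update_sub (F : Fin k → A) (r : Fin k) (x y : A) :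
    oprod (Function.update F r (x - y)) =
      oprod (Function.update F r x) - oprod (Function.update F r y) := by
  induction k with
  | zero => exact r.elim0
  | succ k ih =>
    simp only [oprod_succ]
    refine Fin.cases ?_ (fun r => ?_) r
    · simp [sub_mul]
    · have : ∀ z, (fun s : Fin k => Function.update F r.succ z s.succ) =
          Function.update (fun s => F s.succ) r z := by
        intro z
        ext s
        by_cases hs : s = r
        · subst hs; simp
        · rw [Function.update_of_ne hs, Function.update_of_ne (by simpa using hs)]
      rw [this, this, this, ih]
      have h0 : ∀ z, Function.update F r.succ z 0 = F 0 := fun z =>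
        Function.update_of_ne (Fin.succ_ne_zero r).symm _ _
      rw [h0, h0, h0, mul_sub]

theorem oprod_eq_zero (F : Fin k → A) (r : Fin k) (h : F r = 0) : oprod F = 0 :=
  List.prod_eq_zero (by rw [List.mem_ofFn]; exact ⟨r, h⟩)

theorem map_oprod {B : Type*} [Ring B] (g : A →+* B) (F : Fin k → A) :
    g (oprod F) = oprod fun s => g (F s) := by
  rw [oprod, map_list_prod, List.map_ofFn]
  rfl

/-- Isolates two neighbouring factors. The second clause records that the outer factors do not see
them, so that only the inner pair changes when neighbouring indices are exchanged. -/
theorem oprod_split (s : ℕ) (hs : s + 1 < k) :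
    ∃ pre post : (Fin k → A) → A,
      (∀ F : Fin k → A, oprod F = pre F * (F ⟨s, by lia⟩ * F ⟨s + 1, hs⟩) * post F) ∧
      (∀ F G : Fin k → A, (∀ i : Fin k, (i : ℕ) ≠ s → (i : ℕ) ≠ s + 1 → F i = G i) →
        pre F = pre G ∧ post F = post G) := by
  induction k generalizing s with
  | zero => lia
  | succ k ih =>
    rcases s with _ | s
    · obtain ⟨k, rfl⟩ : ∃ j, k = j + 1 := ⟨k - 1, by lia⟩
      refine ⟨fun _ => 1, fun F => oprod fun i : Fin k => F i.succ.succ, ?_, ?_⟩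
      · intro F
        rw [oprod_succ, oprod_succ]
        simp only [one_mul, mul_assoc]
        rfl
      · intro F G h
        refine ⟨rfl, ?_⟩
        simp only
        congr 1
        funext i
        exact h _ (by simp) (by simp)
    · obtain ⟨pre, post, h1, h2⟩ := ih s (by lia)
      refine ⟨fun F => F 0 * pre fun i => F i.succ, fun F => post fun i => F i.succ, ?_, ?_⟩
      · intro F
        rw [oprod_succ, h1]
        simp only [mul_assoc]
        rfl
      · intro F G h
        have := h2 (fun i => F i.succ) (fun i => G i.succ) fun i hi hi' =>
          h _ (by simpa using hi) (by simpa using hi')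
        exact ⟨by simp only [this.1, h 0 (by simp) (by simp)], this.2⟩

/-- A function of `k` indices is alternating if permuting the indices multiplies it with the
sign of the permutation. -/
def IsAlt {ι : Type*} (α : (Fin k → ι) → A) : Prop :=
  ∀ (h : Fin k → ι) (σ : Equiv.Perm (Fin k)), α (h ∘ σ) = (Equiv.Perm.sign σ : ℤ) • α h

theorem IsAlt.swap {ι : Type*} {α : (Fin k → ι) → A} (hα : IsAlt α) (h : Fin k → ι)
    {s t : Fin k} (hst : s ≠ t) : α (h ∘ Equiv.swap s t) = -α h := by
  rw [hα, Equiv.Perm.sign_swap hst]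
  simp

/-- Exchanging the two equal arguments gives only `α h = -α h`, hence the assumption on `x + x`. -/
theorem IsAlt.eq_zero {ι : Type*} {α : (Fin k → ι) → A} (hα : IsAlt α)
    (h2 : ∀ x : A, x + x = 0 → x = 0) (h : Fin k → ι)
    {s t : Fin k} (hst : s ≠ t) (hh : h s = h t) : α h = 0 := by
  apply h2
  have h1 := hα.swap h hst
  have : h ∘ Equiv.swap s t = h := by
    ext i
    simp only [Function.comp_apply, Equiv.swap_apply_def]
    split_ifs with h3 h4
    · rw [h3, hh]
    · rw [h4, hh]
    · rfl
  rw [this] at h1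
  exact add_eq_zero_iff_eq_neg.2 h1

/-- Adjacent transpositions generate the symmetric group. -/
theorem isAlt_of_adjacent {ι : Type*} (α : (Fin k → ι) → A)
    (hα : ∀ (s : ℕ) (hs : s + 1 < k) (h : Fin k → ι),
      α (h ∘ Equiv.swap ⟨s, by lia⟩ ⟨s + 1, hs⟩) = -α h) : IsAlt α := by
  rcases k with _ | k
  · intro h σ
    have : σ = 1 := Subsingleton.elim _ _
    subst this
    simp
  intro h σ
  have hσ : σ ∈ Submonoid.closure
      (Set.range fun i : Fin k => Equiv.swap i.castSucc i.succ) := by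
    rw [Equiv.Perm.mclosure_swap_castSucc_succ]; trivial
  induction hσ using Submonoid.closure_induction generalizing h with
  | mem x hx =>
    obtain ⟨i, rfl⟩ := hx
    have := hα i (by lia) h
    rw [Equiv.Perm.sign_swap (by simp [Fin.ext_iff])]
    rw [Units.val_neg, Units.val_one, neg_smul, one_smul]
    exact this
  | one => simp
  | mul x y _ _ hx hy =>
    have : h ∘ (x * y : Equiv.Perm (Fin (k + 1))) = (h ∘ x) ∘ y := rfl
    rw [this, hy, hx, Equiv.Perm.sign_mul]
    push_cast
    rw [mul_comm, mul_smul]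

/-- The alternating function of `h` with value `sgn σ` at `h = g ∘ σ`. -/
def altDelta {ι : Type*} [DecidableEq ι] (g : Fin k → ι) (h : Fin k → ι) : A :=
  ∑ σ : Equiv.Perm (Fin k), if h = g ∘ σ then (((Equiv.Perm.sign σ : ℤˣ) : ℤ) : A) else 0

theorem isAlt_altDelta {ι : Type*} [DecidableEq ι] (g : Fin k → ι) :
    IsAlt (altDelta g : (Fin k → ι) → A) := by
  intro h ρ
  rw [altDelta, altDelta, Finset.smul_sum, ← Equiv.sum_comp (Equiv.mulRight ρ)]
  refine Finset.sum_congr rfl fun σ _ => ?_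
  have : h ∘ ρ = g ∘ (σ * ρ : Equiv.Perm (Fin k)) ↔ h = g ∘ σ := by
    constructor
    · intro h1
      ext i
      have := congrFun h1 (ρ⁻¹ i)
      simpa using this
    · rintro rfl
      rfl
  simp only [Equiv.coe_mulRight, this]
  split_ifs
  · rw [Equiv.Perm.sign_mul, zsmul_eq_mul]
    push_cast
    rw [Int.cast_comm]
  · simp

theorem altDelta_eq_zero {ι : Type*} [DecidableEq ι] (g h : Fin k → ι)
    {s t : Fin k} (hst : s ≠ t) (hg : g s = g t) : (altDelta g h : A) = 0 := by
  rw [altDelta]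
  -- Left multiplication by the transposition of `s` and `t` leaves `g ∘ σ` unchanged and reverses
  -- the sign, so the terms cancel in pairs.
  refine Finset.sum_involution (fun σ _ => Equiv.swap s t * σ) ?_ ?_ ?_ ?_
  · intro σ _
    have : g ∘ (Equiv.swap s t * σ : Equiv.Perm (Fin k)) = g ∘ σ := by
      ext i
      simp only [Function.comp_apply, Equiv.Perm.coe_mul, Equiv.swap_apply_def]
      split_ifs with h3 h4
      · rw [h3, hg]
      · rw [h4, hg]
      · rfl
    rw [this, Equiv.Perm.sign_mul, Equiv.Perm.sign_swap hst]
    split_ifs <;> simp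
  · intro σ _ _ h
    have := Equiv.Perm.sign_swap hst
    rw [mul_eq_right.1 h] at this
    simp at this
  · simp
  · intro σ _
    simp [← mul_assoc]

/-- The alternating function `α`, transformed by the matrices `T 0, …, T (k - 1)`:
`f ↦ ∑ₕ α(h) T₀(h₀, f₀) ⋯ T_{k-1}(h_{k-1}, f_{k-1})`. -/
def colDet {ι : Type*} [Fintype ι] (α : (Fin k → ι) → A) (T : Fin k → Matrix ι ι A)
    (f : Fin k → ι) : A :=
  ∑ h : Fin k → ι, α h * oprod fun s => T s (h s) (f s)

theorem colDet_altDelta {ι : Type*} [Fintype ι] [DecidableEq ι] (g f : Fin k → ι)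
    (T : Fin k → Matrix ι ι A) :
    colDet (altDelta g) T f = ∑ σ : Equiv.Perm (Fin k), (Equiv.Perm.sign σ : ℤ) •
      oprod fun s => T s (g (σ s)) (f s) := by
  simp only [colDet, altDelta, Finset.sum_mul]
  rw [Finset.sum_comm]
  refine Finset.sum_congr rfl fun σ _ => ?_
  rw [Finset.sum_eq_single (g ∘ σ)]
  · simp
  · intro b _ hb
    simp [hb]
  · simp

/-- The relation between consecutive matrices under which `colDet` is alternating. -/
def AdjAlt {ι : Type*} (X Y : Matrix ι ι A) : Prop :=
  ∀ a b k l : ι, X a k * Y b l - X b k * Y a l + (X a l * Y b k - X b l * Y a k) = 0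

/-- Only neighbouring columns have to be exchanged. Adding the exchanged value and symmetrizing the
sum over `h` with respect to the same exchange of rows produces the four terms of `AdjAlt`; this
gives twice the wanted identity. -/
theorem isAlt_colDet {ι : Type*} [Fintype ι] (h2 : ∀ x : A, x + x = 0 → x = 0)
    (α : (Fin k → ι) → A) (hα : IsAlt α) (T : Fin k → Matrix ι ι A)
    (hT : ∀ (s : ℕ) (hs : s + 1 < k), AdjAlt (T ⟨s, by lia⟩) (T ⟨s + 1, hs⟩)) :
    IsAlt (colDet α T) := by
  refine isAlt_of_adjacent _ fun s hs f => ?_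
  obtain ⟨pre, post, h1, h3⟩ := oprod_split (A := A) s hs
  rw [← add_eq_zero_iff_eq_neg]
  apply h2
  set p : Fin k := ⟨s, by lia⟩
  set q : Fin k := ⟨s + 1, hs⟩
  have hpq : p ≠ q := by simp [p, q]
  set w := Equiv.swap p q
  have hw : ∀ f : Fin k → ι, ∀ i : Fin k, (i : ℕ) ≠ s → (i : ℕ) ≠ s + 1 → (f ∘ w) i = f i := by
    intro f i hi hi'
    simp only [Function.comp_apply, w]
    rw [Equiv.swap_apply_of_ne_of_ne] <;> simpa [p, q, Fin.ext_iff]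
  -- The four products differ only in the factors at `p` and `q`; the sign from `α` makes their sum
  -- a multiple of the relation `AdjAlt`.
  have key : ∀ (h f : Fin k → ι), α h * (oprod fun s => T s (h s) (f s)) +
      α (h ∘ w) * (oprod fun s => T s ((h ∘ w) s) (f s)) +
      (α h * (oprod fun s => T s (h s) ((f ∘ w) s)) +
      α (h ∘ w) * (oprod fun s => T s ((h ∘ w) s) ((f ∘ w) s))) = 0 := by
    intro h f
    rw [show α (h ∘ w) = -α h from hα.swap h hpq]
    simp only [h1]
    have e1 := h3 (fun s => T s ((h ∘ w) s) (f s)) (fun s => T s (h s) (f s))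
      fun i hi hi' => by rw [hw h i hi hi']
    have e2 := h3 (fun s => T s (h s) ((f ∘ w) s)) (fun s => T s (h s) (f s))
      fun i hi hi' => by rw [hw f i hi hi']
    have e3 := h3 (fun s => T s ((h ∘ w) s) ((f ∘ w) s)) (fun s => T s (h s) (f s))
      fun i hi hi' => by rw [hw h i hi hi', hw f i hi hi']
    rw [e1.1, e1.2, e2.1, e2.2, e3.1, e3.2]
    have hadj := hT s hs (h p) (h q) (f p) (f q)
    have hwp : w p = q := Equiv.swap_apply_left _ _
    have hwq : w q = p := Equiv.swap_apply_right _ _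
    simp only [Function.comp_apply, hwp, hwq]
    set P := pre fun s => T s (h s) (f s)
    set Q := post fun s => T s (h s) (f s)
    change T p (h p) (f p) * T q (h q) (f q) - T p (h q) (f p) * T q (h p) (f q) +
      (T p (h p) (f q) * T q (h q) (f p) - T p (h q) (f q) * T q (h p) (f p)) = 0 at hadj
    have : ∀ x y z t : A, α h * (P * x * Q) + -α h * (P * y * Q) +
        (α h * (P * z * Q) + -α h * (P * t * Q)) = α h * (P * (x - y + (z - t)) * Q) := by
      intro x y z t; noncomm_ring
    rw [this, hadj]
    simp
  -- The exchange of rows permutes the summation indices.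
  have hre : ∀ f : Fin k → ι, ∑ h : Fin k → ι, α (h ∘ w) *
      (oprod fun s => T s ((h ∘ w) s) (f s)) = colDet α T f := by
    intro f
    rw [colDet, ← (Equiv.arrowCongr w (Equiv.refl ι)).sum_comp]
    refine Finset.sum_congr rfl fun h _ => ?_
    have : (Equiv.arrowCongr w (Equiv.refl ι)) h = h ∘ w := by
      ext i; simp [w]
    have hww : (h ∘ w) ∘ w = h := by ext i; simp [w]
    rw [this, hww]
  have := Finset.sum_congr rfl fun h (_ : h ∈ (Finset.univ : Finset (Fin k → ι))) => key h f
  simp only [Finset.sum_add_distrib] at this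
  rw [hre, hre] at this
  simp only [Finset.sum_const_zero] at this
  change colDet α T f + colDet α T f + (colDet α T (f ∘ w) + colDet α T (f ∘ w)) = 0 at this
  rw [← this]
  abel

/-- Multiplicativity of quantum minors, in the style of Cauchy–Binet. No alternation is needed: the
sum runs over all index functions, and mutual commutation of the two families separates the ordered
products. -/
theorem colDet_colDet {ι : Type*} [Fintype ι] (α : (Fin k → ι) → A)
    (T S : Fin k → Matrix ι ι A)
    (hTS : ∀ s t a b c d, Commute (T s a b) (S t c d)) (f : Fin k → ι) :
    colDet (colDet α T) S f = colDet α (fun s => T s * S s) f := by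
  simp only [colDet, Finset.sum_mul, Matrix.mul_apply]
  rw [Finset.sum_comm]
  refine Finset.sum_congr rfl fun h _ => ?_
  rw [oprod_sum, Finset.mul_sum]
  refine Finset.sum_congr rfl fun h' _ => ?_
  rw [oprod_mul _ _ fun s t => hTS _ _ _ _ _ _, mul_assoc]

/-- The column determinant of matrices on which `x` acts as the matrix unit `e_{ij}`. -/
theorem commute_colDet_of_gl {m : ℕ} (h2 : ∀ x : A, x + x = 0 → x = 0)
    (T : Fin m → Matrix (Fin m) (Fin m) A)
    (hT : ∀ (s : ℕ) (hs : s + 1 < m), AdjAlt (T ⟨s, by lia⟩) (T ⟨s + 1, hs⟩))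
    (x : A) (i j : Fin m)
    (hx : ∀ s a b, x * T s a b - T s a b * x =
      (if j = a then T s i b else 0) - (if b = i then T s a j else 0)) :
    Commute x (colDet (altDelta id) T id) := by
  -- By the Leibniz rule, `x` acts on rows by replacing the index `j` by `i`, and on columns by
  -- replacing `i` by `j`.
  have h1 : x * colDet (altDelta id) T id - colDet (altDelta id) T id * x =
      colDet (altDelta (Function.update id j i)) T id -
        colDet (altDelta id) T (Function.update id i j) := by
    simp only [colDet_altDelta, Finset.mul_sum, Finset.sum_mul]
    rw [← Finset.sum_sub_distrib, ← Finset.sum_sub_distrib]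
    refine Finset.sum_congr rfl fun σ _ => ?_
    rw [mul_smul_comm, smul_mul_assoc, ← smul_sub, ← smul_sub, oprod_commutator]
    congr 1
    simp only [hx, oprod_update_sub, Finset.sum_sub_distrib]
    congr 1
    · rw [Finset.sum_eq_single (σ⁻¹ j)]
      · congr 1
        ext s
        by_cases hs : s = σ⁻¹ j
        · subst hs; simp
        · have : σ s ≠ j := by rintro rfl; simp at hs
          rw [Function.update_of_ne hs, Function.update_of_ne this]
      · intro r _ hr
        have : j ≠ σ r := by rintro rfl; simp at hr
        exact oprod_eq_zero _ r (by simp [this])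
      · simp
    · rw [Finset.sum_eq_single i]
      · congr 1
        ext s
        by_cases hs : s = i
        · subst hs; simp
        · simp [Function.update_of_ne hs]
      · intro r _ hr
        exact oprod_eq_zero _ r (by simp [hr])
      · simp
  have h3 : x * colDet (altDelta id) T id - colDet (altDelta id) T id * x = 0 := by
    rw [h1]
    by_cases hij : i = j
    · subst hij
      have : Function.update (id : Fin m → Fin m) i i = id := Function.update_eq_self i id
      rw [this, sub_self]
    -- For `i ≠ j` both replacements produce a repeated index, of a row in `e1` and of a column in
    -- `e2`. Only the column case needs the relations between consecutive matrices.
    · have e1 : colDet (altDelta (Function.update id j i)) T id = 0 := by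
        refine Finset.sum_eq_zero fun h _ => ?_
        rw [altDelta_eq_zero _ _ hij (by simp [Function.update_of_ne hij]), zero_mul]
      have e2 : colDet (altDelta id) T (Function.update id i j) = 0 :=
        (isAlt_colDet h2 _ (isAlt_altDelta _) T hT).eq_zero h2 _ hij
          (by simp [Function.update_of_ne (Ne.symm hij)])
      rw [e1, e2, sub_zero]
  exact sub_eq_zero.1 h3

/-- The diagonal elements of `gl_m` commute with principal column determinants. -/
theorem commute_colDet_of_diag {m : ℕ}
    (T : Fin m → Matrix (Fin m) (Fin m) A) (x : A) (j : Fin m)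
    (hx : ∀ s a b, x * T s a b - T s a b * x =
      (if j = a then T s a b else 0) - (if b = j then T s a b else 0)) :
    Commute x (colDet (altDelta id) T id) := by
  rw [colDet_altDelta]
  refine Commute.sum_right _ _ _ fun σ _ => Commute.smul_right ?_ _
  refine sub_eq_zero.1 ?_
  rw [oprod_commutator]
  simp only [hx, oprod_update_sub, Finset.sum_sub_distrib]
  simp only [id_eq]
  have hu : ∀ r, Function.update (fun s => T s (σ s) s) r (T r (σ r) r) =
      fun s => T s (σ s) s := fun r => Function.update_eq_self r (fun s => T s (σ s) s)
  -- In the term of each `σ`, one contribution comes from the position `σ⁻¹ j`, where the row index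
  -- is `j`, and one from the column `j`. Both return the full product, so they cancel without any
  -- alternation.
  rw [Finset.sum_eq_single (σ⁻¹ j), Finset.sum_eq_single j]
  · have : j = σ (σ⁻¹ j) := by simp
    rw [if_pos this, if_pos rfl, hu, hu]
    simp
  · intro r _ hr
    exact oprod_eq_zero _ r (by simp [hr])
  · simp
  · intro r _ hr
    have : j ≠ σ r := by rintro rfl; simp at hr
    exact oprod_eq_zero _ r (by simp [this])
  · simp

end OrderedProducts

/-! ## Column determinants of rank one type -/

section RankOne
variable {A : Type*} [Ring A] {ι : Type*} {k : ℕ}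

theorem colDet_castSucc [Fintype ι] (α : (Fin (k + 1) → ι) → A) (T : Fin (k + 1) → Matrix ι ι A)
    (f : Fin (k + 1) → ι) :
    colDet α T f = ∑ c, colDet (fun h => α (Fin.snoc h c : Fin (k + 1) → ι))
      (fun s => T s.castSucc) (fun s => f s.castSucc) * T (Fin.last k) c (f (Fin.last k)) := by
  simp only [colDet, Finset.sum_mul]
  rw [← Fintype.sum_prod_type', ← (Fin.snocEquiv fun _ => ι).sum_comp]
  refine Fintype.sum_congr _ _ fun x => ?_
  rw [oprod_castSucc, mul_assoc]
  simp [Fin.snocEquiv]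

theorem isAlt_snoc {α : (Fin (k + 1) → ι) → A} (hα : IsAlt α) (c : ι) :
    IsAlt fun h : Fin k → ι => α (Fin.snoc h c : Fin (k + 1) → ι) := by
  refine isAlt_of_adjacent _ fun s hs h => ?_
  rw [← hα.swap _ (s := (⟨s, by lia⟩ : Fin k).castSucc) (t := (⟨s + 1, hs⟩ : Fin k).castSucc)
    (by simp [Fin.ext_iff])]
  congr 1
  ext i
  refine Fin.lastCases ?_ (fun i => ?_) i
  · rw [Function.comp_apply, Equiv.swap_apply_of_ne_of_ne]
    · simp
    · exact (Fin.castSucc_lt_last _).ne'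
    · exact (Fin.castSucc_lt_last _).ne'
  · rw [Function.comp_apply, Fin.snoc_castSucc, ← (Fin.castSucc_injective k).map_swap]
    simp

/-- The matrix with entries `δ_{ab} + y E_{ab}`. -/
def linearMatrix [DecidableEq ι] (y : A) (E : ι → ι → A) : Matrix ι ι A :=
  fun a b => (if a = b then 1 else 0) + y * E a b

/-- For `E a b = x_a ∂_b` the normally ordered part of a product of two entries is symmetric in the
row indices and is killed by `α`; what remains is linear in `E`. The successive denominators `v - s`
thereby collapse to the single denominator `v`, which is why each symmetric power costs one linear
factor only. -/
theorem colDet_rankOne [Fintype ι] [DecidableEq ι] (h2 : ∀ x : A, x + x = 0 → x = 0)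
    (E : ι → ι → A)
    (hE : ∀ a b c d, E a b * E c d - E c b * E a d =
      (if b = c then E a d else 0) - (if a = b then E c d else 0))
    (v : A) (w : ℕ → A) (hw : ∀ s x, Commute (w s) x)
    (hvw : ∀ s : ℕ, w s * (v - s) = 1) (α : (Fin k → ι) → A) (hα : IsAlt α) (f : Fin k → ι) :
    v * colDet α (fun s => linearMatrix (w s) E) f =
      v * α f + ∑ r, ∑ c, α (Function.update f r c) * E c (f r) := by
  induction k with
  | zero => simp [colDet, Subsingleton.elim f default]
  | succ k ih =>
    set b := f (Fin.last k) with hb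
    set f' : Fin k → ι := fun s => f s.castSucc with hf'
    have hf : f = (Fin.snoc f' b : Fin (k + 1) → ι) := by
      ext i
      refine Fin.lastCases ?_ (fun i => ?_) i <;> simp [f', b]
    rw [colDet_castSucc, Finset.mul_sum]
    have e1 : ∀ c, v * (colDet (fun h => α (Fin.snoc h c : Fin (k + 1) → ι))
        (fun s : Fin k => linearMatrix (w s.castSucc) E) f' *
          linearMatrix (w (Fin.last k)) E c b) =
        (v * α (Fin.snoc f' c : Fin (k + 1) → ι) + ∑ r, ∑ c',
          α (Fin.snoc (Function.update f' r c') c : Fin (k + 1) → ι) * E c' (f' r)) *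
          ((if c = b then 1 else 0) + w k * E c b) := by
      intro c
      rw [← mul_assoc]
      have := ih _ (isAlt_snoc hα c) f'
      simp only [Fin.val_castSucc, Fin.val_last]
      rw [this, linearMatrix]
    rw [Finset.sum_congr rfl fun c _ => e1 c]
    set L := ∑ c, α (Fin.snoc f' c : Fin (k + 1) → ι) * E c b with hL
    -- Antisymmetry in `c`, `c'` turns twice the sum of the products `E c' (f' r) * E c b` into a
    -- sum of exchange differences. The relation `hE` makes these linear, and each of the two
    -- resulting sums equals `-L`.
    have hX : ∀ r : Fin k, ∑ c, ∑ c', α (Fin.snoc (Function.update f' r c') c : Fin (k + 1) → ι) *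
        E c' (f' r) * E c b = -L := by
      intro r
      set β : ι → ι → A := fun c' c =>
        α (Fin.snoc (Function.update f' r c') c : Fin (k + 1) → ι) with hβ
      have hanti : ∀ c c', β c c' = -β c' c := by
        intro c c'
        simp only [hβ]
        rw [← hα.swap _ (Fin.castSucc_lt_last r).ne]
        congr 1
        ext i
        refine Fin.lastCases ?_ (fun i => ?_) i
        · simp only [Function.comp_apply, Equiv.swap_apply_right, Fin.snoc_last,
            Fin.snoc_castSucc, Function.update_self]
        · by_cases hi : i = r
          · subst hi
            simp only [Function.comp_apply, Equiv.swap_apply_left, Fin.snoc_last,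
              Fin.snoc_castSucc, Function.update_self]
          · rw [Function.comp_apply, Equiv.swap_apply_of_ne_of_ne (by simpa using hi)
              (Fin.castSucc_lt_last _).ne]
            simp [Function.update_of_ne hi]
      have hβd : ∀ c, β (f' r) c = α (Fin.snoc f' c : Fin (k + 1) → ι) := by
        intro c
        have : Function.update f' r (f' r) = f' := Function.update_eq_self r f'
        simp only [hβ, this]
      have h3 : ∑ c, ∑ c', β c' c * E c' (f' r) * E c b +
          ∑ c, ∑ c', β c' c * E c' (f' r) * E c b =
          ∑ c, ∑ c', β c' c * (E c' (f' r) * E c b - E c (f' r) * E c' b) := by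
        simp only [mul_sub, Finset.sum_sub_distrib]
        rw [sub_eq_add_neg]
        congr 1
        · simp only [mul_assoc]
        · rw [Finset.sum_comm, ← Finset.sum_neg_distrib]
          refine Finset.sum_congr rfl fun c _ => ?_
          rw [← Finset.sum_neg_distrib]
          refine Finset.sum_congr rfl fun c' _ => ?_
          rw [hanti c c', mul_assoc, neg_mul]
      have h4 : ∑ c, ∑ c', β c' c * E c' (f' r) * E c b +
          ∑ c, ∑ c', β c' c * E c' (f' r) * E c b = -L + -L := by
        rw [h3]
        simp only [hE, mul_sub, Finset.sum_sub_distrib, mul_ite, mul_zero]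
        rw [sub_eq_add_neg]
        congr 1
        · rw [Finset.sum_comm]
          simp only [Finset.sum_ite_eq, Finset.mem_univ, if_true]
          rw [hL, ← Finset.sum_neg_distrib]
          refine Finset.sum_congr rfl fun c _ => ?_
          rw [hanti, hβd, neg_mul]
        · simp only [Finset.sum_ite_eq', Finset.mem_univ, if_true]
          simp only [hβd, hL]
      have h5 : (∑ c, ∑ c', β c' c * E c' (f' r) * E c b + L) +
          (∑ c, ∑ c', β c' c * E c' (f' r) * E c b + L) = 0 := by
        rw [add_add_add_comm, h4]
        abel
      exact eq_neg_of_add_eq_zero_left (h2 _ h5)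
    have hwk : ∀ x y : A, x * (w k * y) = w k * (x * y) := fun x y => by
      rw [← mul_assoc, ← (hw k x).eq, mul_assoc]
    simp only [mul_add, add_mul, Finset.sum_add_distrib, hwk, Finset.sum_mul, mul_ite, mul_one,
      mul_zero, Finset.sum_ite_eq', Finset.mem_univ, if_true, ← Finset.mul_sum]
    rw [Fin.sum_univ_castSucc]
    have e2 : ∑ c, ∑ r, ∑ c', α (Fin.snoc (Function.update f' r c') c : Fin (k + 1) → ι) *
        E c' (f' r) * E c b = -(k * L) := by
      rw [Finset.sum_comm, Finset.sum_congr rfl fun r _ => hX r]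
      simp
    have e3 : ∑ c, v * α (Fin.snoc f' c : Fin (k + 1) → ι) * E c b = v * L := by
      rw [hL, Finset.mul_sum]
      simp only [mul_assoc]
    have e4 : ∀ (r : Fin k) (c : ι), Function.update f r.castSucc c =
        (Fin.snoc (Function.update f' r c) b : Fin (k + 1) → ι) := by
      intro r c
      rw [Fin.snoc_update, ← hf]
    have e5 : ∀ (c : ι), Function.update f (Fin.last k) c =
        (Fin.snoc f' c : Fin (k + 1) → ι) := by
      intro c
      conv_lhs => rw [hf]
      rw [Fin.update_snoc_last]
    simp only [e4, e5, ← hL, ← hb]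
    rw [e2, e3, ← hf]
    -- The `k` corrections `-L` turn the numerator `v` into `v - k`, which cancels against `w k`:
    -- the new pole disappears.
    have e6 : w k * (v * L) + w k * (-(k * L)) = L := by
      rw [← mul_add, ← sub_eq_add_neg, ← sub_mul, ← mul_assoc, hvw, one_mul]
    conv_rhs => rw [← e6]
    simp only [hf']
    abel

end RankOne

/-! ## Scalar series and coefficientwise maps -/

section Series

theorem exists_coeff_eq_zero {A : Type*} [Zero A] (f : LaurentSeries A) :
    ∃ B : ℤ, ∀ l < B, f.coeff l = 0 := by
  classical
  by_cases h : f = 0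
  · exact ⟨0, fun l _ => by simp [h]⟩
  · exact ⟨f.order, fun l hl => HahnSeries.coeff_eq_zero_of_lt_order hl⟩

/-- The series with coefficients in the image of `F`. -/
def scSeries (F A : Type*) [Field F] [Ring A] [Algebra F A] :
    LaurentSeries F →+* LaurentSeries A where
  toFun f := f.map (algebraMap F A)
  map_one' := by ext l; simp [HahnSeries.coeff_one, apply_ite (algebraMap F A)]
  map_mul' f g := HahnSeries.map_mul (algebraMap F A : F →ₙ+* A)
  map_zero' := by ext l; simp
  map_add' f g := by ext l; simp

/-- Applying an additive map to all coefficients. -/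
def mapSeries {A B : Type*} [AddCommGroup A] [AddCommGroup B] (g : A →+ B) :
    LaurentSeries A →+ LaurentSeries B where
  toFun f := f.map g
  map_zero' := by ext l; simp
  map_add' f g := by ext l; simp

variable {F A B : Type*} [Field F] [Ring A] [Algebra F A] [Ring B] [Algebra F B]

theorem scSeries_coeff (f : LaurentSeries F) (l : ℤ) :
    (scSeries F A f).coeff l = algebraMap F A (f.coeff l) := rfl

theorem mapSeries_coeff {A B : Type*} [AddCommGroup A] [AddCommGroup B] (g : A →+ B)
    (f : LaurentSeries A) (l : ℤ) : (mapSeries g f).coeff l = g (f.coeff l) := rfl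

theorem scSeries_C (c : F) : scSeries F A (HahnSeries.C c) = HahnSeries.C (algebraMap F A c) := by
  ext l
  rw [scSeries_coeff, HahnSeries.C_apply, HahnSeries.C_apply, HahnSeries.coeff_single,
    HahnSeries.coeff_single]
  split_ifs <;> simp

theorem scSeries_single (l : ℤ) (c : F) :
    scSeries F A (HahnSeries.single l c) = HahnSeries.single l (algebraMap F A c) := by
  ext j
  rw [scSeries_coeff, HahnSeries.coeff_single, HahnSeries.coeff_single]
  split_ifs <;> simp

theorem ext_of_coeff_add {f g : LaurentSeries A} (B : ℤ) (hf : ∀ l < B, f.coeff l = 0)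
    (hg : ∀ l < B, g.coeff l = 0) (h : ∀ s : ℕ, f.coeff (B + s) = g.coeff (B + s)) : f = g := by
  ext l
  by_cases hl : l < B
  · rw [hf l hl, hg l hl]
  · have := h (l - B).toNat
    rwa [show B + ((l - B).toNat : ℤ) = l by lia] at this

theorem coeff_mul_lt {f g : LaurentSeries A} {B B' : ℤ} (hB : ∀ l < B, f.coeff l = 0)
    (hB' : ∀ l < B', g.coeff l = 0) : ∀ l < B + B', (f * g).coeff l = 0 := by
  intro l hl
  rw [HahnSeries.coeff_mul]
  refine Finset.sum_eq_zero fun x hx => ?_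
  simp only [Finset.mem_antidiagonal, HahnSeries.mem_support] at hx
  have h1 : B ≤ x.1 := by by_contra h'; exact hx.1 (hB _ (by lia))
  have h2 : B' ≤ x.2 := by by_contra h'; exact hx.2.1 (hB' _ (by lia))
  lia

theorem scSeries_commute (f : LaurentSeries F) (g : LaurentSeries A) :
    Commute (scSeries F A f) g := by
  obtain ⟨B, hB⟩ := exists_coeff_eq_zero f
  obtain ⟨B', hB'⟩ := exists_coeff_eq_zero g
  have hB1 : ∀ l < B, (scSeries F A f).coeff l = 0 := fun l hl => by
    rw [scSeries_coeff, hB l hl, map_zero]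
  refine ext_of_coeff_add (B + B') (coeff_mul_lt hB1 hB')
    (by rw [add_comm]; exact coeff_mul_lt hB' hB1) fun s => ?_
  rw [coeff_mul_add _ _ B B' hB1 hB', add_comm B B', coeff_mul_add _ _ B' B hB' hB1,
    ← Finset.sum_equiv (Equiv.prodComm ℕ ℕ) (s := Finset.HasAntidiagonal.antidiagonal s)
    (t := Finset.HasAntidiagonal.antidiagonal s)]
  · intro x
    simp [add_comm]
  · intro x _
    exact (Algebra.commutes (f.coeff (B + x.2)) (g.coeff (B' + x.1))).symm

/-- Every coefficient of a product is a finite sum, so linearity over `F` extends to linearity over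
scalar Laurent series. -/
theorem mapSeries_scSeries_mul (g : A →ₗ[F] B) (x : LaurentSeries F) (f : LaurentSeries A) :
    mapSeries g.toAddMonoidHom (scSeries F A x * f) =
      scSeries F B x * mapSeries g.toAddMonoidHom f := by
  obtain ⟨b, hb⟩ := exists_coeff_eq_zero x
  obtain ⟨b', hb'⟩ := exists_coeff_eq_zero f
  have h1 : ∀ l < b, (scSeries F A x).coeff l = 0 := fun l hl => by
    rw [scSeries_coeff, hb l hl, map_zero]
  have h2 : ∀ l < b, (scSeries F B x).coeff l = 0 := fun l hl => by
    rw [scSeries_coeff, hb l hl, map_zero]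
  have h3 : ∀ l < b', (mapSeries g.toAddMonoidHom f).coeff l = 0 := fun l hl => by
    rw [mapSeries_coeff, hb' l hl, map_zero]
  refine ext_of_coeff_add (b + b') (fun l hl => ?_) (coeff_mul_lt h2 h3) fun s => ?_
  · rw [mapSeries_coeff, coeff_mul_lt h1 hb' l hl, map_zero]
  · rw [mapSeries_coeff, coeff_mul_add _ _ _ _ h1 hb', coeff_mul_add _ _ _ _ h2 h3, map_sum]
    refine Finset.sum_congr rfl fun y _ => ?_
    simp only [scSeries_coeff, mapSeries_coeff, ← Algebra.smul_def]
    exact g.map_smul _ _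

/-- Multiplying the coefficients with a constant. -/
theorem coeff_C_mul (a : A) (f : LaurentSeries A) (l : ℤ) :
    (HahnSeries.C a * f).coeff l = a * f.coeff l := by
  rw [HahnSeries.C_mul_eq_smul, HahnSeries.coeff_smul, smul_eq_mul]

theorem coeff_mul_C (a : A) (f : LaurentSeries A) (l : ℤ) :
    (f * HahnSeries.C a).coeff l = f.coeff l * a := by
  rw [HahnSeries.C_apply, HahnSeries.coeff_mul_single_zero]

/-! ### Shifts -/

theorem shiftHom_C (c : ℤ) (a : A) : shiftHom c (HahnSeries.C a) = HahnSeries.C a := by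
  have h : ∀ l < (0 : ℤ), (HahnSeries.C a : LaurentSeries A).coeff l = 0 := fun l hl => by
    rw [HahnSeries.C_apply, HahnSeries.coeff_single_of_ne hl.ne]
  refine ext_of_coeff_add 0 (shiftSeries_coeff_lt c _ 0 h) h fun s => ?_
  refine (shiftSeries_coeff_add c _ 0 h s).trans ?_
  rw [Finset.Nat.sum_antidiagonal_eq_sum_range_succ
    (fun p q => (c ^ p * Ring.choose (-(0 + (q : ℤ))) p) •
      (HahnSeries.C a : LaurentSeries A).coeff (0 + q)), Finset.sum_eq_single s]
  · rcases s with _ | s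
    · simp
    · have : (0 : ℤ) + ((s + 1 : ℕ) : ℤ) ≠ 0 := by lia
      rw [HahnSeries.C_apply, HahnSeries.coeff_single_of_ne this]
      simp [Ring.choose_zero_succ]
  · intro p hp hps
    have : p < s := by simp at hp; lia
    rw [HahnSeries.C_apply, HahnSeries.coeff_single_of_ne (by lia), smul_zero]
  · simp

theorem shiftHom_shiftHom (c d : ℤ) (f : LaurentSeries A) :
    shiftHom c (shiftHom d f) = shiftHom (c + d) f := by
  obtain ⟨B, hB⟩ := exists_coeff_eq_zero f
  have h1 := shiftSeries_coeff_lt d f B hB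
  refine ext_of_coeff_add B (shiftSeries_coeff_lt c _ B h1) (shiftSeries_coeff_lt _ f B hB)
    fun s => ?_
  refine (shiftSeries_coeff_add c _ B h1 s).trans
    (Eq.trans ?_ (shiftSeries_coeff_add _ f B hB s).symm)
  have e1 : ∀ x ∈ Finset.HasAntidiagonal.antidiagonal s,
      (c ^ x.1 * Ring.choose (-(B + (x.2 : ℤ))) x.1) • (shiftSeries d f).coeff (B + x.2) =
      ∑ y ∈ Finset.HasAntidiagonal.antidiagonal x.2,
        ((c ^ x.1 * Ring.choose (-(B + (x.2 : ℤ))) x.1) *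
          (d ^ y.1 * Ring.choose (-(B + (y.2 : ℤ))) y.1)) • f.coeff (B + y.2) := by
    intro x _
    rw [shiftSeries_coeff_add d f B hB, Finset.smul_sum]
    simp only [mul_smul]
  have e2 : ∀ x ∈ Finset.HasAntidiagonal.antidiagonal s,
      ((c + d) ^ x.1 * Ring.choose (-(B + (x.2 : ℤ))) x.1) • f.coeff (B + x.2) =
      ∑ y ∈ Finset.HasAntidiagonal.antidiagonal x.1,
        ((c ^ y.1 * d ^ y.2) * (x.1.choose y.1 * Ring.choose (-(B + (x.2 : ℤ))) x.1)) •
          f.coeff (B + x.2) := by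
    intro x _
    rw [← Finset.sum_smul, (Commute.all c d).add_pow', Finset.sum_mul]
    congr 1
    refine Finset.sum_congr rfl fun y _ => ?_
    rw [nsmul_eq_mul]
    ring
  rw [Finset.sum_congr rfl e1, Finset.sum_congr rfl e2]
  simp_rw [Finset.sum_sigma']
  refine Finset.sum_nbij'
    (fun i => ⟨(i.1.1 + i.2.1, i.2.2), (i.1.1, i.2.1)⟩)
    (fun i => ⟨(i.2.1, i.2.2 + i.1.2), (i.2.2, i.1.2)⟩) ?_ ?_ ?_ ?_ ?_
  · rintro ⟨⟨x, x'⟩, ⟨y, y'⟩⟩ h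
    simp only [Finset.mem_sigma, Finset.HasAntidiagonal.mem_antidiagonal] at h ⊢
    lia
  · rintro ⟨⟨x, x'⟩, ⟨y, y'⟩⟩ h
    simp only [Finset.mem_sigma, Finset.HasAntidiagonal.mem_antidiagonal] at h ⊢
    lia
  · rintro ⟨⟨x, x'⟩, ⟨y, y'⟩⟩ h
    simp only [Finset.mem_sigma, Finset.HasAntidiagonal.mem_antidiagonal] at h
    obtain ⟨-, rfl⟩ := h
    rfl
  · rintro ⟨⟨x, x'⟩, ⟨y, y'⟩⟩ h
    simp only [Finset.mem_sigma, Finset.HasAntidiagonal.mem_antidiagonal] at h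
    obtain ⟨-, rfl⟩ := h
    rfl
  · rintro ⟨⟨x, x'⟩, ⟨y, y'⟩⟩ h
    simp only [Finset.mem_sigma, Finset.HasAntidiagonal.mem_antidiagonal] at h
    obtain ⟨-, rfl⟩ := h
    simp only
    congr 1
    -- Trinomial revision for binomial coefficients with an arbitrary integer as upper index.
    have := Ring.choose_add_smul_choose (-(B + ((y + y' : ℕ) : ℤ))) x y
    rw [show -(B + ((y + y' : ℕ) : ℤ)) + (y : ℤ) = -(B + (y' : ℤ)) by push_cast; ring,
      nsmul_eq_mul, ← Nat.choose_symm_add] at this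
    rw [this]
    ring

theorem shiftHom_zero (f : LaurentSeries A) : shiftHom 0 f = f := by
  obtain ⟨B, hB⟩ := exists_coeff_eq_zero f
  refine ext_of_coeff_add B (shiftSeries_coeff_lt 0 f B hB) hB fun s => ?_
  refine (shiftSeries_coeff_add 0 f B hB s).trans ?_
  rw [Finset.sum_eq_single (0, s)]
  · simp
  · rintro ⟨x, y⟩ h h'
    simp only [Finset.HasAntidiagonal.mem_antidiagonal] at h
    rcases x with _ | x
    · simp at h
      simp [h] at h'
    · simp
  · simp

theorem shiftHom_scSeries (c : ℤ) (f : LaurentSeries F) :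
    shiftHom c (scSeries F A f) = scSeries F A (shiftHom c f) := by
  obtain ⟨B, hB⟩ := exists_coeff_eq_zero f
  have hB1 : ∀ l < B, (scSeries F A f).coeff l = 0 := fun l hl => by
    rw [scSeries_coeff, hB l hl, map_zero]
  refine ext_of_coeff_add B (shiftSeries_coeff_lt c _ B hB1) (fun l hl => ?_) fun s => ?_
  · rw [scSeries_coeff]
    have : (shiftHom c f).coeff l = 0 := shiftSeries_coeff_lt c _ B hB l hl
    rw [this, map_zero]
  · refine (shiftSeries_coeff_add c _ B hB1 s).trans ?_
    rw [scSeries_coeff]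
    have : (shiftHom c f).coeff (B + s) = _ := shiftSeries_coeff_add c f B hB s
    rw [this, map_sum]
    refine Finset.sum_congr rfl fun x _ => ?_
    rw [scSeries_coeff, map_zsmul]

/-- The variable `u`. -/
def uSeries (F : Type*) [Field F] : LaurentSeries F := HahnSeries.single (-1 : ℤ) 1

theorem shiftHom_uSeries (c : ℤ) : shiftHom c (uSeries F) = uSeries F + HahnSeries.C (c : F) := by
  have h : ∀ l < (-1 : ℤ), (uSeries F).coeff l = 0 := fun l hl => by
    rw [uSeries, HahnSeries.coeff_single_of_ne hl.ne]
  refine ext_of_coeff_add (-1) (shiftSeries_coeff_lt c _ _ h) (fun l hl => ?_) fun s => ?_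
  · rw [HahnSeries.coeff_add, h l hl, HahnSeries.C_apply, HahnSeries.coeff_single_of_ne (by lia),
      add_zero]
  refine (shiftSeries_coeff_add c _ _ h s).trans ?_
  rw [Finset.sum_eq_single (s, 0)]
  · rw [uSeries, HahnSeries.coeff_add, HahnSeries.C_apply]
    rcases s with _ | _ | s
    · simp
    · simp
    · have h3 : (-1 : ℤ) + ((s + 1 + 1 : ℕ) : ℤ) ≠ -1 := by lia
      have h4 : (-1 : ℤ) + ((s + 1 + 1 : ℕ) : ℤ) ≠ 0 := by lia
      rw [HahnSeries.coeff_single_of_ne h3, HahnSeries.coeff_single_of_ne h4]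
      have : Ring.choose (1 : ℤ) (s + 2) = 0 := by
        have := Ring.choose_natCast (R := ℤ) 1 (s + 2)
        push_cast at this
        rw [this, Nat.choose_eq_zero_of_lt (by lia)]
        rfl
      simp [this]
  · rintro ⟨x, y⟩ h h'
    simp only [Finset.HasAntidiagonal.mem_antidiagonal] at h
    have : y ≠ 0 := by rintro rfl; simp at h; simp [h] at h'
    rw [uSeries, HahnSeries.coeff_single_of_ne (by lia), smul_zero]
  · simp

theorem algebraMap_series (c : F) :
    algebraMap F (LaurentSeries A) c = HahnSeries.C (algebraMap F A c) := rfl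

/-- A polynomial in `u`, as a series. -/
def polySeries {F : Type*} [Field F] (p : Polynomial F) : LaurentSeries F :=
  Polynomial.eval₂RingHom HahnSeries.C (uSeries F) p

theorem ofPoly_eq (p : Polynomial F) :
    (ofPoly p : DiffOp A) = ofSeries (scSeries F A (polySeries p)) := by
  rw [ofPoly]
  congr 1
  induction p using Polynomial.induction_on' with
  | add p q hp hq => simp only [polySeries, map_add] at hp hq ⊢; rw [hp, hq]
  | monomial j c =>
    rw [polySeries, Polynomial.aeval_monomial, Polynomial.coe_eval₂RingHom,
      Polynomial.eval₂_monomial, map_mul, map_pow,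
      uSeries, scSeries_single, (algebraMap F A).map_one, algebraMap_series, scSeries_C]

theorem polySeries_mul (p q : Polynomial F) :
    polySeries (p * q) = polySeries p * polySeries q := map_mul _ _ _

theorem polySeries_X : polySeries (Polynomial.X : Polynomial F) = uSeries F := by
  simp [polySeries]

theorem polySeries_C (c : F) : polySeries (Polynomial.C c) = HahnSeries.C c := by
  simp [polySeries]

theorem polySeries_monomial (j : ℕ) (c : F) :
    polySeries (Polynomial.monomial j c) = HahnSeries.single (-(j : ℤ)) c := by
  rw [polySeries, Polynomial.coe_eval₂RingHom, Polynomial.eval₂_monomial, uSeries, HahnSeries.single_pow,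
    HahnSeries.C_apply, HahnSeries.single_mul_single]
  simp

theorem polySeries_coeff (p : Polynomial F) (j : ℕ) : (polySeries p).coeff (-(j : ℤ)) = p.coeff j := by
  induction p using Polynomial.induction_on' with
  | add p q hp hq =>
    have : polySeries (p + q) = polySeries p + polySeries q := map_add _ _ _
    rw [this, HahnSeries.coeff_add, hp, hq, Polynomial.coeff_add]
  | monomial i c =>
    rw [polySeries_monomial, HahnSeries.coeff_single, Polynomial.coeff_monomial]
    by_cases h : i = j
    · simp [h]
    · rw [if_neg h, if_neg (by lia)]

theorem polySeries_coeff_pos (p : Polynomial F) (l : ℤ) (hl : 0 < l) :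
    (polySeries p).coeff l = 0 := by
  induction p using Polynomial.induction_on' with
  | add p q hp hq =>
    have : polySeries (p + q) = polySeries p + polySeries q := map_add _ _ _
    rw [this, HahnSeries.coeff_add, hp, hq, add_zero]
  | monomial i c =>
    rw [polySeries_monomial, HahnSeries.coeff_single_of_ne (by lia)]

theorem polySeries_ne_zero {p : Polynomial F} (hp : p ≠ 0) : polySeries p ≠ 0 := by
  intro h
  apply hp
  ext j
  rw [← polySeries_coeff, h, HahnSeries.coeff_zero, Polynomial.coeff_zero]

/-- Series that are polynomials in `u`. -/
def polySubring (A : Type*) [Ring A] : Subring (LaurentSeries A) where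
  carrier := {f | ∀ l > 0, f.coeff l = 0}
  mul_mem' := by
    intro f g hf hg l hl
    rw [HahnSeries.coeff_mul]
    refine Finset.sum_eq_zero fun x hx => ?_
    simp only [Finset.mem_antidiagonal, HahnSeries.mem_support] at hx
    have h1 : x.1 ≤ 0 := by by_contra h'; exact hx.1 (hf _ (by lia))
    have h2 : x.2 ≤ 0 := by by_contra h'; exact hx.2.1 (hg _ (by lia))
    lia
  one_mem' := by
    intro l hl
    simp [HahnSeries.coeff_one, hl.ne']
  add_mem' := by
    intro f g hf hg l hl
    rw [HahnSeries.coeff_add, hf l hl, hg l hl, add_zero]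
  zero_mem' := by intro l _; simp
  neg_mem' := by
    intro f hf l hl
    rw [HahnSeries.coeff_neg, hf l hl, neg_zero]

theorem C_mem_polySubring (a : A) : HahnSeries.C a ∈ polySubring A := by
  intro l hl
  rw [HahnSeries.C_apply, HahnSeries.coeff_single_of_ne hl.ne']

theorem scSeries_polySeries_mem (p : Polynomial F) :
    scSeries F A (polySeries p) ∈ polySubring A := by
  intro l hl
  rw [scSeries_coeff, polySeries_coeff_pos p l hl, map_zero]

/-- The inverse of `u - c` is `∑ c^r u^(-r-1)`. -/
theorem evalMatrix_eq {m : ℕ} (c : F) (E : Fin m → Fin m → A) (k l : Fin m) :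
    evalMatrix c E k l = (if k = l then 1 else 0) +
      scSeries F A (polySeries (Polynomial.X - Polynomial.C c))⁻¹ * HahnSeries.C (E k l) := by
  have h1 : (polySeries (Polynomial.X - Polynomial.C c))⁻¹ =
      HahnSeries.ofPowerSeries ℤ F (PowerSeries.mk fun
        | 0 => 0
        | r + 1 => c ^ r) := by
    have h0 : ∀ l < (1 : ℤ), (HahnSeries.ofPowerSeries ℤ F (PowerSeries.mk fun
        | 0 => 0
        | r + 1 => c ^ r)).coeff l = 0 := by
      intro l hl
      rw [HahnSeries.ofPowerSeries_apply]
      rcases lt_or_ge l 0 with hl0 | hl0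
      · refine HahnSeries.embDomain_of_notMem_range ?_
        rintro ⟨y, hy⟩
        simp at hy
        lia
      · have : l = ((0 : ℕ) : ℤ) := by lia
        rw [this]
        have := HahnSeries.ofPowerSeries_apply_coeff (Γ := ℤ) (PowerSeries.mk fun
          | 0 => (0 : F)
          | r + 1 => c ^ r) 0
        rw [HahnSeries.ofPowerSeries_apply] at this
        exact this.trans (by simp)
    have h3 : ∀ s : ℕ, (HahnSeries.ofPowerSeries ℤ F (PowerSeries.mk fun
        | 0 => 0
        | r + 1 => c ^ r)).coeff (1 + s) = c ^ s := by
      intro s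
      have := HahnSeries.ofPowerSeries_apply_coeff (Γ := ℤ) (PowerSeries.mk fun
          | 0 => (0 : F)
          | r + 1 => c ^ r) (s + 1)
      push_cast at this
      rw [add_comm, this, PowerSeries.coeff_mk]
    refine inv_eq_of_mul_eq_one_right ?_
    set G := HahnSeries.ofPowerSeries ℤ F (PowerSeries.mk fun
        | 0 => 0
        | r + 1 => c ^ r)
    have hp : polySeries (Polynomial.X - Polynomial.C c) =
        HahnSeries.single (-1 : ℤ) 1 - HahnSeries.C c := by
      have : polySeries (Polynomial.X - Polynomial.C c) =
        polySeries Polynomial.X - polySeries (Polynomial.C c) := map_sub _ _ _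
      rw [this, polySeries_X, polySeries_C, uSeries]
    rw [hp, sub_mul]
    ext l
    have e1 : (HahnSeries.single (-1 : ℤ) (1 : F) * G).coeff l = G.coeff (l + 1) := by
      have := HahnSeries.coeff_single_mul_add (r := (1 : F)) (x := G) (a := l + 1) (b := (-1 : ℤ))
      simpa using this
    rw [HahnSeries.coeff_sub, e1, HahnSeries.C_mul_eq_smul, HahnSeries.coeff_smul,
      HahnSeries.coeff_one]
    rcases lt_trichotomy l 0 with h | h | h
    · rw [h0 _ (by lia), h0 _ (by lia), if_neg h.ne]; simp
    · subst h
      have := h3 0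
      simp at this
      rw [h0 0 (by lia)]
      simp [this]
    · obtain ⟨s, rfl⟩ : ∃ s : ℕ, l = 1 + s := ⟨(l - 1).toNat, by lia⟩
      have := h3 (s + 1)
      push_cast at this
      rw [h3, if_neg h.ne', show (1 : ℤ) + s + 1 = 1 + (s + 1) by ring, this, smul_eq_mul, pow_succ']
      ring
  rw [evalMatrix, h1]
  congr 1
  · split_ifs <;> simp
  ext j
  rw [coeff_mul_C, scSeries_coeff]
  rcases lt_or_ge j 0 with hl0 | hl0
  · rw [HahnSeries.ofPowerSeries_apply, HahnSeries.ofPowerSeries_apply,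
      HahnSeries.embDomain_of_notMem_range, HahnSeries.embDomain_of_notMem_range]
    · simp
    · rintro ⟨y, hy⟩
      simp at hy
      lia
    · rintro ⟨y, hy⟩
      simp at hy
      lia
  · obtain ⟨s, rfl⟩ : ∃ s : ℕ, j = s := ⟨j.toNat, by lia⟩
    rw [HahnSeries.ofPowerSeries_apply_coeff, HahnSeries.ofPowerSeries_apply_coeff,
      PowerSeries.coeff_mk, PowerSeries.coeff_mk]
    rcases s with _ | s
    · simp
    · simp [Algebra.smul_def]

end Series

/-! ## Difference operators -/

section DiffOps
variable {A : Type*} [Ring A]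

theorem phi_eq (f : LaurentSeries A) : SkewPolynomial.φ f = shiftHom 1 f := rfl

theorem tau_mul_ofSeries (f : LaurentSeries A) :
    tau * ofSeries f = ofSeries (shiftHom 1 f) * tau := by
  have h1 := SkewPolynomial.monomial_mul_C (n := 1) (a := (1 : LaurentSeries A)) (b := f)
  have h2 := SkewPolynomial.C_mul_monomial (a := shiftHom 1 f) (n := 1) (b := (1 : LaurentSeries A))
  rw [Function.iterate_one, phi_eq, one_mul] at h1
  rw [mul_one] at h2
  exact h1.trans h2.symm

theorem tau_pow_mul_ofSeries (k : ℕ) (f : LaurentSeries A) :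
    tau ^ k * ofSeries f = ofSeries (shiftHom (k : ℤ) f) * tau ^ k := by
  induction k with
  | zero => simp [shiftHom_zero]
  | succ k ih =>
    rw [pow_succ', mul_assoc, ih, ← mul_assoc, tau_mul_ofSeries, shiftHom_shiftHom, mul_assoc]
    congr 4
    push_cast
    ring

theorem ofSeries_mul_tau_pow (f : LaurentSeries A) (k : ℕ) :
    ofSeries f * tau ^ k = SkewPolynomial.monomial k f :=
  SkewPolynomial.C_mul_X_pow_eq_monomial (n := k)

theorem coeff_ofSeries_mul_tau_pow (f : LaurentSeries A) (k j : ℕ) :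
    (ofSeries f * tau ^ k).coeff j = if k = j then f else 0 := by
  rw [ofSeries_mul_tau_pow, SkewPolynomial.coeff_monomial]

theorem diffOp_induction {p : DiffOp A → Prop} (hadd : ∀ P Q, p P → p Q → p (P + Q))
    (hmon : ∀ f k, p (ofSeries f * tau ^ k)) (h0 : p 0) (P : DiffOp A) : p P := by
  rw [← SkewPolynomial.sum_monomial P, SkewPolynomial.sum_def']
  exact Finset.sum_induction _ p hadd h0 fun k _ => by
    have := hmon (P.coeff k.toAdd) k.toAdd
    rw [ofSeries_mul_tau_pow] at this
    exact this

/-- Taking a coefficient, as an additive map. -/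
def coeffHom (k : ℕ) : DiffOp A →+ LaurentSeries A where
  toFun P := P.coeff k
  map_zero' := SkewPolynomial.coeff_zero k
  map_add' P Q := SkewPolynomial.coeff_add P Q k

theorem coeff_ofSeries_mul (f : LaurentSeries A) (P : DiffOp A) (k : ℕ) :
    (ofSeries f * P).coeff k = f * P.coeff k := by
  induction P using diffOp_induction with
  | hadd P Q hP hQ => rw [mul_add, SkewPolynomial.coeff_add, hP, hQ, SkewPolynomial.coeff_add,
      mul_add]
  | hmon g j =>
    rw [← mul_assoc, ← map_mul, coeff_ofSeries_mul_tau_pow, coeff_ofSeries_mul_tau_pow]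
    split_ifs <;> simp
  | h0 => simp

theorem coeff_mul_ofConst (P : DiffOp A) (x : A) (k : ℕ) :
    (P * ofConst x).coeff k = P.coeff k * HahnSeries.C x := by
  induction P using diffOp_induction with
  | hadd P Q hP hQ => rw [add_mul, SkewPolynomial.coeff_add, hP, hQ, SkewPolynomial.coeff_add,
      add_mul]
  | hmon g j =>
    rw [mul_assoc, ofConst, RingHom.comp_apply, tau_pow_mul_ofSeries, shiftHom_C, ← mul_assoc,
      ← map_mul, coeff_ofSeries_mul_tau_pow, coeff_ofSeries_mul_tau_pow]
    split_ifs <;> simp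
  | h0 => simp

theorem coeff_tau_mul_succ (P : DiffOp A) (k : ℕ) :
    (tau * P).coeff (k + 1) = shiftHom 1 (P.coeff k) := by
  induction P using diffOp_induction with
  | hadd P Q hP hQ => rw [mul_add, SkewPolynomial.coeff_add, hP, hQ, SkewPolynomial.coeff_add,
      map_add]
  | hmon g j =>
    rw [← mul_assoc, tau_mul_ofSeries, mul_assoc, ← pow_succ', coeff_ofSeries_mul_tau_pow,
      coeff_ofSeries_mul_tau_pow]
    simp only [add_left_inj]
    split_ifs <;> simp
  | h0 => simp

theorem coeff_tau_mul_zero (P : DiffOp A) : (tau * P).coeff 0 = 0 := by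
  induction P using diffOp_induction with
  | hadd P Q hP hQ => rw [mul_add, SkewPolynomial.coeff_add, hP, hQ, add_zero]
  | hmon g j =>
    rw [← mul_assoc, tau_mul_ofSeries, mul_assoc, ← pow_succ', coeff_ofSeries_mul_tau_pow]
    simp
  | h0 => simp

/-- Constants commute with `u` and `τ`, so commutation with an operator is the same as commutation
with its coefficients. -/
theorem commute_ofConst_coeff {x : A} {P : DiffOp A} (h : Commute (ofConst x) P) (k : ℕ) (l : ℤ) :
    Commute x ((P.coeff k).coeff l) := by
  have h1 := congrArg (fun Q : DiffOp A => (Q.coeff k).coeff l) h.eq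
  rw [coeff_mul_ofConst, ofConst, RingHom.comp_apply, coeff_ofSeries_mul, coeff_C_mul,
    coeff_mul_C] at h1
  exact h1

theorem ofConst_mul_tau (x : A) : (ofConst x : DiffOp A) * tau = tau * ofConst x := by
  rw [ofConst, RingHom.comp_apply, tau_mul_ofSeries, shiftHom_C]

/-- The relation `x + x = 0 → x = 0`, in the form in which it is used. -/
def TwoFree (A : Type*) [Ring A] : Prop := ∀ x : A, x + x = 0 → x = 0

theorem twoFree_of_algebra (F A : Type*) [Field F] [CharZero F] [Ring A] [Algebra F A] :
    TwoFree A := by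
  intro x hx
  rw [← two_smul F x] at hx
  have := congrArg ((2 : F)⁻¹ • ·) hx
  simpa [smul_smul] using this

theorem TwoFree.series (h : TwoFree A) : TwoFree (LaurentSeries A) := by
  intro x hx
  ext l
  exact h _ (by rw [← HahnSeries.coeff_add, hx, HahnSeries.coeff_zero])

theorem TwoFree.diffOp (h : TwoFree A) : TwoFree (DiffOp A) := by
  intro x hx
  ext k : 1
  rw [SkewPolynomial.coeff_zero]
  exact h.series _ (by rw [← SkewPolynomial.coeff_add, hx, SkewPolynomial.coeff_zero])

end DiffOps

/-! ## Relations in matrices of series -/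

section Relations
variable {A : Type*} [Ring A] {ι : Type*}

/-- The relations of the standard generators of `gl`. -/
def GlRel [DecidableEq ι] (E : ι → ι → A) : Prop :=
  ∀ i j k l, E i j * E k l - E k l * E i j =
    (if j = k then E i l else 0) - (if l = i then E k j else 0)

/-- The relations satisfied by operators of the form `x_a ∂_b`. -/
def RankOneRel [DecidableEq ι] (E : ι → ι → A) : Prop :=
  ∀ a b c d, E a b * E c d - E c b * E a d =
    (if b = c then E a d else 0) - (if a = b then E c d else 0)

theorem GlRel.map {B : Type*} [Ring B] [DecidableEq ι] {E : ι → ι → A} (hE : GlRel E)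
    (g : A →+* B) : GlRel fun a b => g (E a b) := by
  intro i j k l
  simp only [← map_mul, ← map_sub, hE i j k l]
  rw [map_sub]
  congr 1 <;> split_ifs <;> simp

theorem RankOneRel.map {B : Type*} [Ring B] [DecidableEq ι] {E : ι → ι → A} (hE : RankOneRel E)
    (g : A →+* B) : RankOneRel fun a b => g (E a b) := by
  intro i j k l
  simp only [← map_mul, ← map_sub, hE i j k l]
  rw [map_sub]
  congr 1 <;> split_ifs <;> simp

/-- The relation `AdjAlt` can be read in two ways: its difference over rows is antisymmetric under
exchange of the columns, and its sum over columns is symmetric under exchange of the rows. In a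
product the middle indices pair an antisymmetric expression `U` with a symmetric expression `V`, and
the sum vanishes. -/
theorem adjAlt_mul [Fintype ι] (h2 : TwoFree A) {X Y X' Y' : Matrix ι ι A}
    (hX : AdjAlt X X') (hY : AdjAlt Y Y')
    (hc : ∀ a b c d, Commute (X' a b) (Y c d)) : AdjAlt (X * Y) (X' * Y') := by
  intro a b k l
  have e : ∀ a b k l, (X * Y) a k * (X' * Y') b l =
      ∑ p, ∑ q, X a p * X' b q * (Y p k * Y' q l) := by
    intro a b k l
    rw [Matrix.mul_apply, Matrix.mul_apply, Finset.sum_mul_sum]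
    refine Finset.sum_congr rfl fun p _ => Finset.sum_congr rfl fun q _ => ?_
    rw [mul_assoc, ← mul_assoc (Y p k), ← (hc b q p k).eq]
    noncomm_ring
  set U := fun p q => X a p * X' b q - X b p * X' a q
  set V := fun p q => Y p k * Y' q l + Y p l * Y' q k
  have h1 : (X * Y) a k * (X' * Y') b l - (X * Y) b k * (X' * Y') a l +
      ((X * Y) a l * (X' * Y') b k - (X * Y) b l * (X' * Y') a k) =
      ∑ p, ∑ q, U p q * V p q := by
    rw [e, e, e, e]
    simp only [← Finset.sum_add_distrib, ← Finset.sum_sub_distrib]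
    refine Finset.sum_congr rfl fun p _ => Finset.sum_congr rfl fun q _ => ?_
    simp only [U, V]
    noncomm_ring
  rw [h1]
  apply h2
  have h3 : ∑ p, ∑ q, U p q * V p q = ∑ p, ∑ q, U q p * V q p := Finset.sum_comm
  nth_rewrite 2 [h3]
  simp only [← Finset.sum_add_distrib]
  refine Finset.sum_eq_zero fun p _ => Finset.sum_eq_zero fun q _ => ?_
  have hU : U q p = -U p q := by
    have := hX a b p q
    simp only [U]
    rw [eq_neg_iff_add_eq_zero, ← this]
    abel
  have hV : V q p = V p q := by
    have := hY p q k l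
    simp only [V]
    rw [← sub_eq_zero, ← neg_eq_zero, ← this]
    abel
  rw [hU, hV]
  noncomm_ring

/-- The hypothesis `hww` is the difference relation between `1/(u-c)` and `1/(u-c-1)`; it is what
the commutation relations of `gl` require of consecutive spectral parameters. -/
theorem adjAlt_linearMatrix [DecidableEq ι] {E : ι → ι → A} (hE : GlRel E) (w w' : A)
    (hw : ∀ x, Commute w x) (hw' : ∀ x, Commute w' x) (hww : w' = w + w * w') :
    AdjAlt (linearMatrix w E) (linearMatrix w' E) := by
  intro a b k l
  have h1 := hE a k b l
  have h3 := hE a l b k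
  have key : ∀ d1 d2 d3 d4 e1 e2 e3 e4 : A, (d1 = 0 ∨ d1 = 1) → (d2 = 0 ∨ d2 = 1) →
      (d3 = 0 ∨ d3 = 1) → (d4 = 0 ∨ d4 = 1) →
      e1 * e2 - e2 * e1 + (e3 * e4 - e4 * e3) = d4 * e3 - d3 * e4 + (d2 * e1 - d1 * e2) →
      (d1 + w * e1) * (d2 + w' * e2) - (d4 + w * e4) * (d3 + w' * e3) +
        ((d3 + w * e3) * (d4 + w' * e4) - (d2 + w * e2) * (d1 + w' * e1)) = 0 := by
    intro d1 d2 d3 d4 e1 e2 e3 e4 hd1 hd2 hd3 hd4 he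
    have hc : ∀ x y : A, w * x * (w' * y) = w * w' * (x * y) := by
      intro x y
      rw [mul_assoc, ← mul_assoc x, ← (hw' x).eq]
      noncomm_ring
    have hd : ∀ d : A, d = 0 ∨ d = 1 → (∀ x, Commute d x) := by
      rintro d (rfl | rfl) x <;> simp
    -- The linear terms carry the factor `w' - w` and the quadratic ones, grouped into commutators,
    -- the factor `w * w'`. By `he` the two brackets agree, and `hww` identifies the factors.
    have e5 : (d1 + w * e1) * (d2 + w' * e2) - (d4 + w * e4) * (d3 + w' * e3) +
        ((d3 + w * e3) * (d4 + w' * e4) - (d2 + w * e2) * (d1 + w' * e1)) =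
        w * w' * (e1 * e2 - e2 * e1 + (e3 * e4 - e4 * e3)) -
          (w' - w) * (d4 * e3 - d3 * e4 + (d2 * e1 - d1 * e2)) := by
      simp only [add_mul, mul_add, hc, mul_sub, sub_mul]
      have f1 : ∀ x d : A, (d = 0 ∨ d = 1) → w * x * d = w * (d * x) := by
        intro x d h
        rw [mul_assoc, (hd d h x).eq]
      have f2 : ∀ x d : A, (d = 0 ∨ d = 1) → d * (w' * x) = w' * (d * x) := by
        intro x d h
        rw [← mul_assoc, (hd d h w').eq, mul_assoc]
      rw [f1 e1 d2 hd2, f1 e4 d3 hd3, f1 e3 d4 hd4, f1 e2 d1 hd1, f2 e2 d1 hd1, f2 e3 d4 hd4,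
        f2 e4 d3 hd3, f2 e1 d2 hd2, (hd d1 hd1 d2).eq, (hd d3 hd3 d4).eq]
      abel
    rw [e5, he, sub_eq_zero]
    congr 1
    nth_rewrite 2 [hww]
    simp
  refine key (if a = k then 1 else 0) (if b = l then 1 else 0) (if a = l then 1 else 0)
    (if b = k then 1 else 0) (E a k) (E b l) (E a l) (E b k) ?_ ?_ ?_ ?_ ?_
  · split_ifs <;> simp
  · split_ifs <;> simp
  · split_ifs <;> simp
  · split_ifs <;> simp
  · rw [h1, h3]
    simp only [eq_comm (a := k) (b := b), eq_comm (a := l) (b := b), eq_comm (a := k) (b := a),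
      eq_comm (a := l) (b := a), ite_mul, one_mul, zero_mul]

/-- The elements `X i j` act on the entries of `t` by commutators as the standard generators of
`gl` act on matrix units. -/
def GlAct [DecidableEq ι] (X : ι → ι → A) (t : Matrix ι ι (LaurentSeries A)) : Prop :=
  ∀ i j a b, HahnSeries.C (X i j) * t a b - t a b * HahnSeries.C (X i j) =
    (if j = a then t i b else 0) - (if b = i then t a j else 0)

/-- Each factor is transformed by its own generators. Summed over the middle index, the column term
of the left factor cancels the row term of the right factor. -/
theorem glAct_mul [Fintype ι] [DecidableEq ι] {X Y : ι → ι → A}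
    {t s : Matrix ι ι (LaurentSeries A)} (hX : GlAct X t) (hY : GlAct Y s)
    (hXs : ∀ i j a b, Commute (HahnSeries.C (X i j)) (s a b))
    (hYt : ∀ i j a b, Commute (HahnSeries.C (Y i j)) (t a b)) :
    GlAct (fun i j => X i j + Y i j) (t * s) := by
  intro i j a b
  simp only [map_add, Matrix.mul_apply, Finset.mul_sum, Finset.sum_mul]
  rw [← Finset.sum_sub_distrib]
  have e : ∀ p, (HahnSeries.C (X i j) + HahnSeries.C (Y i j)) * (t a p * s p b) -
      t a p * s p b * (HahnSeries.C (X i j) + HahnSeries.C (Y i j)) =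
      ((if j = a then t i p else 0) - (if p = i then t a j else 0)) * s p b +
      t a p * ((if j = p then s i b else 0) - (if b = i then s p j else 0)) := by
    intro p
    rw [← hX i j a p, ← hY i j p b]
    have h1 := (hXs i j p b).eq
    have h2 := (hYt i j a p).eq
    have h3 : (HahnSeries.C (X i j) + HahnSeries.C (Y i j)) * (t a p * s p b) =
        HahnSeries.C (X i j) * t a p * s p b + HahnSeries.C (Y i j) * t a p * s p b := by
      noncomm_ring
    have h4 : t a p * s p b * (HahnSeries.C (X i j) + HahnSeries.C (Y i j)) =
        t a p * (s p b * HahnSeries.C (X i j)) + t a p * s p b * HahnSeries.C (Y i j) := by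
      noncomm_ring
    rw [h3, h4, h2, ← h1]
    noncomm_ring
  rw [Finset.sum_congr rfl fun p _ => e p]
  simp only [Finset.sum_add_distrib, sub_mul, mul_sub, Finset.sum_sub_distrib, ite_mul, mul_ite,
    zero_mul, mul_zero, Finset.sum_ite_eq, Finset.sum_ite_eq', Finset.mem_univ, if_true]
  split_ifs <;> simp <;> abel

end Relations

/-! ## The Bethe operator -/

section Bethe
variable {F A : Type*} [Field F] [Ring A] [Algebra F A] {m : ℕ}

/-- The entries `cᵢ δ_{ij} τ - t_{ij}(u - s)`. -/
def betheEntry (C : Fin m → F) (t : Matrix (Fin m) (Fin m) (LaurentSeries A)) (s : Fin m) :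
    Matrix (Fin m) (Fin m) (DiffOp A) := fun a b =>
  (if a = b then ofConst (algebraMap F A (C a)) * tau else 0) -
    ofSeries (shiftHom (-(s : ℤ)) (t a b))

theorem betheOperator_eq_colDet (C : Fin m → F) (t : Matrix (Fin m) (Fin m) (LaurentSeries A)) :
    betheOperator C t = colDet (altDelta id) (betheEntry C t) id := by
  rw [colDet_altDelta]
  rfl

theorem ofConst_algebraMap_commute_ofSeries (c : F) (f : LaurentSeries A) :
    Commute (ofConst (algebraMap F A c)) (ofSeries f) := by
  have h : (ofConst (algebraMap F A c) : DiffOp A) =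
      ofSeries (scSeries F A (HahnSeries.C c)) := by
    rw [scSeries_C]; rfl
  rw [h]
  exact (scSeries_commute _ f).map ofSeries

/-- The twist terms are diagonal with scalar coefficients and commute among themselves. In the mixed
terms, `τ` moves past an entry of the next column and undoes exactly the extra shift by `-1` of that
column, so they cancel in pairs. Only the relation for `t` itself remains. -/
theorem adjAlt_betheEntry (C : Fin m → F) (t : Matrix (Fin m) (Fin m) (LaurentSeries A))
    (ht : AdjAlt t (t.map (shiftHom (-1)))) (s : ℕ) (hs : s + 1 < m) :
    AdjAlt (betheEntry C t ⟨s, by lia⟩) (betheEntry C t ⟨s + 1, hs⟩) := by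
  intro a b k l
  set K : Fin m → Fin m → DiffOp A := fun a b =>
    if a = b then ofConst (algebraMap F A (C a)) * tau else 0
  set S : Fin m → Fin m → DiffOp A := fun a b => ofSeries (shiftHom (-(s : ℤ)) (t a b))
  set S' : Fin m → Fin m → DiffOp A := fun a b => ofSeries (shiftHom (-((s + 1 : ℕ) : ℤ)) (t a b))
  change (K a k - S a k) * (K b l - S' b l) - (K b k - S b k) * (K a l - S' a l) +
    ((K a l - S a l) * (K b k - S' b k) - (K b l - S b l) * (K a k - S' a k)) = 0
  have hS : S a k * S' b l - S b k * S' a l + (S a l * S' b k - S b l * S' a k) = 0 := by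
    have h := congrArg (fun f => ofSeries (shiftHom (-(s : ℤ)) f)) (ht a b k l)
    simp only [map_add, map_sub, map_mul, Matrix.map_apply, shiftHom_shiftHom, map_zero] at h
    have e : -((s + 1 : ℕ) : ℤ) = -(s : ℤ) + -1 := by push_cast; ring
    simp only [S, S', e]
    exact h
  have hKS : ∀ i j p q, K i j * S' p q = S p q * K i j := by
    intro i j p q
    simp only [K, S, S']
    split_ifs with h
    · rw [mul_assoc, tau_mul_ofSeries, shiftHom_shiftHom, ← mul_assoc,
        (ofConst_algebraMap_commute_ofSeries _ _).eq, mul_assoc]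
      congr 4
      push_cast
      ring
    · simp
  have hKK : ∀ i j p q, K i j * K p q = K p q * K i j := by
    intro i j p q
    simp only [K]
    split_ifs with h h'
    · rw [mul_assoc, ← mul_assoc tau, ← ofConst_mul_tau, mul_assoc, ← mul_assoc,
        mul_assoc (ofConst _) tau, ← mul_assoc tau, ← ofConst_mul_tau, ← mul_assoc,
        ← mul_assoc, ← mul_assoc, ← map_mul, ← map_mul, ← map_mul, ← map_mul, mul_comm (C i)]
    · simp
    · simp
    · simp
  have e1 : (K a k - S a k) * (K b l - S' b l) - (K b k - S b k) * (K a l - S' a l) +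
    ((K a l - S a l) * (K b k - S' b k) - (K b l - S b l) * (K a k - S' a k)) =
      (K a k * K b l - K b l * K a k) + (K a l * K b k - K b k * K a l) +
      (S a k * S' b l - S b k * S' a l + (S a l * S' b k - S b l * S' a k)) +
      (S b l * K a k - K a k * S' b l) + (K b k * S' a l - S a l * K b k) +
      (S b k * K a l - K a l * S' b k) + (K b l * S' a k - S a k * K b l) := by
    simp only [sub_mul, mul_sub]; abel
  rw [e1, hS, hKS, hKS, hKS, hKS, hKK a k, hKK a l]
  simp

/-- The coefficients of the Bethe operator without twist commute with `gl_m`. -/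
theorem commute_betheOperator_one [CharZero F] (t : Matrix (Fin m) (Fin m) (LaurentSeries A))
    (ht : AdjAlt t (t.map (shiftHom (-1)))) {X : Fin m → Fin m → A} (hX : GlAct X t)
    (i j : Fin m) (k : ℕ) (l : ℤ) :
    Commute (X i j) (((betheOperator (fun _ => (1 : F)) t).coeff k).coeff l) := by
  apply commute_ofConst_coeff
  rw [betheOperator_eq_colDet]
  refine commute_colDet_of_gl (A := DiffOp A) (twoFree_of_algebra F A).diffOp
    (betheEntry (fun _ => (1 : F)) t)
    (adjAlt_betheEntry (fun _ => (1 : F)) t ht) (ofConst (X i j)) i j ?_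
  intro s a b
  simp only [betheEntry, map_one, one_mul]
  have h := congrArg (fun f => ofSeries (shiftHom (-(s : ℤ)) f)) (hX i j a b)
  simp only [map_sub, map_mul, shiftHom_C] at h
  have hτ : ∀ p q : Fin m, (if p = q then (tau : DiffOp A) else 0) * ofConst (X i j) =
      ofConst (X i j) * (if p = q then (tau : DiffOp A) else 0) := by
    intro p q
    split_ifs
    · rw [ofConst_mul_tau]
    · simp
  have e : ofConst (X i j) * ((if a = b then tau else 0) - ofSeries (shiftHom (-(s : ℤ)) (t a b))) -
      ((if a = b then tau else 0) - ofSeries (shiftHom (-(s : ℤ)) (t a b))) * ofConst (X i j) =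
      -(ofSeries (HahnSeries.C (X i j)) * ofSeries (shiftHom (-(s : ℤ)) (t a b)) -
        ofSeries (shiftHom (-(s : ℤ)) (t a b)) * ofSeries (HahnSeries.C (X i j))) := by
    rw [mul_sub, sub_mul, hτ]
    change _ - ofSeries (HahnSeries.C (X i j)) * _ - (_ - _ * ofSeries (HahnSeries.C (X i j))) = _
    abel
  rw [e, h]
  -- Terms with `τ` appear on the right only for `j = a` and `b = i`, where there are two of them;
  -- they cancel because all twists are equal.
  by_cases h1 : j = a <;> by_cases h3 : b = i
  · subst h1; subst h3
    simp
  · have : i ≠ b := fun h => h3 h.symm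
    simp [h1, h3, this]
  · have : a ≠ j := fun h => h1 h.symm
    simp [h1, h3, this]
  · simp [h1, h3]

/-- The coefficients of the Bethe operator have weight zero. -/
theorem commute_betheOperator_diag (C : Fin m → F) (t : Matrix (Fin m) (Fin m) (LaurentSeries A))
    {X : Fin m → Fin m → A} (hX : GlAct X t) (j : Fin m) (k : ℕ) (l : ℤ) :
    Commute (X j j) (((betheOperator C t).coeff k).coeff l) := by
  apply commute_ofConst_coeff
  rw [betheOperator_eq_colDet]
  refine commute_colDet_of_diag _ _ j fun s a b => ?_
  simp only [betheEntry]
  have h := congrArg (fun f => ofSeries (shiftHom (-(s : ℤ)) f)) (hX j j a b)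
  simp only [map_sub, map_mul, shiftHom_C] at h
  set K := (if a = b then (ofConst (algebraMap F A (C a)) * tau : DiffOp A) else 0) with hK
  have hτ : K * ofConst (X j j) = ofConst (X j j) * K := by
    rw [hK]
    split_ifs
    · rw [mul_assoc, ← ofConst_mul_tau, ← mul_assoc, ← mul_assoc, ← map_mul, ← map_mul,
        Algebra.commutes]
    · simp
  have e : ofConst (X j j) * (K - ofSeries (shiftHom (-(s : ℤ)) (t a b))) -
      (K - ofSeries (shiftHom (-(s : ℤ)) (t a b))) * ofConst (X j j) =
      -(ofSeries (HahnSeries.C (X j j)) * ofSeries (shiftHom (-(s : ℤ)) (t a b)) -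
        ofSeries (shiftHom (-(s : ℤ)) (t a b)) * ofSeries (HahnSeries.C (X j j))) := by
    rw [mul_sub, sub_mul, hτ]
    change _ - ofSeries (HahnSeries.C (X j j)) * _ - (_ - _ * ofSeries (HahnSeries.C (X j j))) = _
    abel
  rw [e, h]
  -- For a diagonal generator, the two terms with `τ` belong to the same index and cancel for every
  -- twist.
  by_cases h1 : j = a <;> by_cases h3 : b = j
  · subst h1; subst h3
    simp
  · subst h1
    have : j ≠ b := fun h => h3 h.symm
    simp [hK, h3, this]
  · subst h3
    have : a ≠ b := fun h => h1 h.symm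
    simp [hK, h1, this]
  · simp [h1, h3]

/-! ### The order at infinity -/

/-- The coefficient of `d^i` in an operator of degree at most `N` in `τ = 1 + d`. -/
def binomCoeff (N i : ℕ) (P : DiffOp A) : LaurentSeries A :=
  ∑ k ∈ Finset.range (N + 1), k.choose i • P.coeff k

/-- `P` is a combination of `d^i`, `i ≤ N`, with coefficients of order `N - i` at infinity. -/
def HasOrder (N : ℕ) (P : DiffOp A) : Prop :=
  (∀ k, N < k → P.coeff k = 0) ∧
    ∀ (i : ℕ) (l : ℤ), l < (N : ℤ) - i → (binomCoeff N i P).coeff l = 0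

theorem HasOrder.add {N : ℕ} {P Q : DiffOp A} (hP : HasOrder N P) (hQ : HasOrder N Q) :
    HasOrder N (P + Q) := by
  refine ⟨fun k hk => by rw [SkewPolynomial.coeff_add, hP.1 k hk, hQ.1 k hk, add_zero],
    fun i l hl => ?_⟩
  have : binomCoeff N i (P + Q) = binomCoeff N i P + binomCoeff N i Q := by
    simp only [binomCoeff, SkewPolynomial.coeff_add, smul_add, Finset.sum_add_distrib]
  rw [this, HahnSeries.coeff_add, hP.2 i l hl, hQ.2 i l hl, add_zero]

theorem HasOrder.zero (N : ℕ) : HasOrder N (0 : DiffOp A) :=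
  ⟨fun k _ => SkewPolynomial.coeff_zero k, fun i l _ => by simp [binomCoeff]⟩

theorem HasOrder.zsmul {N : ℕ} {P : DiffOp A} (hP : HasOrder N P) (z : ℤ) :
    HasOrder N (z • P) := by
  have h : ∀ k, (z • P).coeff k = z • P.coeff k := fun k => map_zsmul (coeffHom k) z P
  refine ⟨fun k hk => by rw [h, hP.1 k hk, smul_zero], fun i l hl => ?_⟩
  have : binomCoeff N i (z • P) = z • binomCoeff N i P := by
    simp only [binomCoeff, h, Finset.smul_sum]
    exact Finset.sum_congr rfl fun k _ => smul_comm _ _ _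
  rw [this, HahnSeries.coeff_smul, hP.2 i l hl, smul_zero]

theorem HasOrder.one : HasOrder 0 (1 : DiffOp A) := by
  refine ⟨fun k hk => ?_, fun i l hl => ?_⟩
  · rw [SkewPolynomial.coeff_one, if_neg hk.ne]
  · rw [binomCoeff]
    simp only [zero_add, Finset.range_one, Finset.sum_singleton]
    rcases i with _ | i
    · rw [Nat.choose_zero_right, one_smul, SkewPolynomial.coeff_one_zero, HahnSeries.coeff_one,
        if_neg]
      push_cast at hl
      lia
    · simp

theorem HasOrder.ofSeries_mul {N : ℕ} {P : DiffOp A} (hP : HasOrder N P) {g : LaurentSeries A}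
    (hg : ∀ l < (1 : ℤ), g.coeff l = 0) : HasOrder (N + 1) (ofSeries g * P) := by
  refine ⟨fun k hk => by rw [coeff_ofSeries_mul, hP.1 k (by lia), mul_zero], fun i l hl => ?_⟩
  have : binomCoeff (N + 1) i (ofSeries g * P) = g * binomCoeff N i P := by
    simp only [binomCoeff, coeff_ofSeries_mul]
    rw [Finset.sum_range_succ, hP.1 (N + 1) (by lia), mul_zero, smul_zero, add_zero,
      Finset.mul_sum]
    simp only [mul_smul_comm]
  rw [this]
  exact coeff_mul_lt hg (hP.2 i) l (by push_cast at hl; lia)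

/-- A unit shift changes only lower order terms: the difference `f(u+1) - f(u)` gains one order at
infinity. -/
theorem shiftHom_sub_coeff (f : LaurentSeries A) (B : ℤ) (hB : ∀ l < B, f.coeff l = 0)
    (l : ℤ) (hl : l < B + 1) : (shiftHom 1 f - f).coeff l = 0 := by
  by_cases h : l < B
  · have : (shiftHom 1 f).coeff l = 0 := shiftSeries_coeff_lt 1 f B hB l h
    rw [HahnSeries.coeff_sub, this, hB l h, sub_zero]
  · obtain rfl : l = B + ((0 : ℕ) : ℤ) := by push_cast; lia
    have : (shiftHom 1 f).coeff (B + ((0 : ℕ) : ℤ)) = _ := shiftSeries_coeff_add 1 f B hB 0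
    rw [HahnSeries.coeff_sub, this]
    simp

/-- From `d f = f(u+1) d + (f(u+1) - f(u))`: the first term raises the power of `d`, the second
gains an order at infinity. -/
theorem HasOrder.sub_one_mul {N : ℕ} {P : DiffOp A} (hP : HasOrder N P) :
    HasOrder (N + 1) ((tau - 1) * P) := by
  have hc : ∀ k, ((tau - 1) * P).coeff k = (tau * P).coeff k - P.coeff k := fun k => by
    rw [sub_mul, one_mul, SkewPolynomial.coeff_sub]
  refine ⟨fun k hk => ?_, fun i l hl => ?_⟩
  · obtain ⟨k, rfl⟩ : ∃ j, k = j + 1 := ⟨k - 1, by lia⟩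
    rw [hc, coeff_tau_mul_succ, hP.1 k (by lia), hP.1 (k + 1) (by lia), map_zero, sub_zero]
  have h1 : binomCoeff (N + 1) i ((tau - 1) * P) =
      ∑ k ∈ Finset.range (N + 1), (k + 1).choose i • shiftHom 1 (P.coeff k) -
        binomCoeff N i P := by
    simp only [binomCoeff, hc, smul_sub, Finset.sum_sub_distrib]
    congr 1
    · rw [Finset.sum_range_succ', coeff_tau_mul_zero, smul_zero, add_zero]
      simp only [coeff_tau_mul_succ]
    · rw [Finset.sum_range_succ, hP.1 (N + 1) (by lia), smul_zero, add_zero]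
  rcases i with _ | i
  · have h3 : binomCoeff (N + 1) 0 ((tau - 1) * P) =
        shiftHom 1 (binomCoeff N 0 P) - binomCoeff N 0 P := by
      rw [h1]
      simp [binomCoeff]
    rw [h3]
    exact shiftHom_sub_coeff _ _ (hP.2 0) l (by push_cast at hl ⊢; lia)
  · have h3 : binomCoeff (N + 1) (i + 1) ((tau - 1) * P) =
        shiftHom 1 (binomCoeff N i P) +
          (shiftHom 1 (binomCoeff N (i + 1) P) - binomCoeff N (i + 1) P) := by
      rw [h1, ← add_sub_assoc, ← map_add]
      congr 1
      simp only [binomCoeff, ← Finset.sum_add_distrib, ← add_smul, map_sum, map_nsmul,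
        Nat.choose_succ_succ]
    rw [h3, HahnSeries.coeff_add, shiftHom_sub_coeff _ _ (hP.2 (i + 1)) l
      (by push_cast at hl ⊢; lia), add_zero]
    exact shiftSeries_coeff_lt 1 _ _ (hP.2 i) l (by push_cast at hl; lia)

/-- With trivial twist, every entry is `δ d` plus a series of order `1/u`, and each of these two
kinds of factor raises the total order by one. -/
theorem hasOrder_betheOperator_one (t : Matrix (Fin m) (Fin m) (LaurentSeries A))
    (ht : ∀ a b, ∀ l < (1 : ℤ), (t a b - if a = b then 1 else 0).coeff l = 0) :
    HasOrder m (betheOperator (fun _ => (1 : F)) t) := by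
  rw [betheOperator_eq_colDet, colDet_altDelta]
  have hsum : ∀ (s : Finset (Equiv.Perm (Fin m))) (P : Equiv.Perm (Fin m) → DiffOp A),
      (∀ σ, HasOrder m (P σ)) → HasOrder m (∑ σ ∈ s, P σ) := by
    intro s P hP
    exact Finset.sum_induction _ _ (fun _ _ => HasOrder.add) (HasOrder.zero m) fun σ _ => hP σ
  refine hsum _ _ fun σ => HasOrder.zsmul ?_ _
  have hent : ∀ (s a b : Fin m) (N : ℕ) (P : DiffOp A), HasOrder N P →
      HasOrder (N + 1) (betheEntry (fun _ => (1 : F)) t s a b * P) := by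
    intro s a b N P hP
    have e : betheEntry (fun _ => (1 : F)) t s a b =
        (if a = b then tau - 1 else 0) +
          ofSeries (-shiftHom (-(s : ℤ)) (t a b - if a = b then 1 else 0)) := by
      simp only [betheEntry, map_one, one_mul, map_neg, map_sub]
      split_ifs <;> simp
    rw [e, add_mul]
    refine HasOrder.add ?_ (hP.ofSeries_mul fun l hl => ?_)
    · split_ifs
      · exact hP.sub_one_mul
      · rw [zero_mul]; exact HasOrder.zero _
    · have : (shiftHom (-(s : ℤ)) (t a b - if a = b then 1 else 0)).coeff l = 0 :=
        shiftSeries_coeff_lt _ _ 1 (ht a b) l hl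
      rw [HahnSeries.coeff_neg, this, neg_zero]
  have hprod : ∀ (N : ℕ) (G : Fin N → DiffOp A),
      (∀ s, ∃ s' a b, G s = betheEntry (fun _ => (1 : F)) t s' a b) → HasOrder N (oprod G) := by
    intro N
    induction N with
    | zero => intro G _; simpa using HasOrder.one
    | succ N ih =>
      intro G hG
      rw [oprod_succ]
      obtain ⟨s', a, b, h⟩ := hG 0
      rw [h]
      exact hent _ _ _ _ _ (ih _ fun s => hG s.succ)
  exact hprod m _ fun s => ⟨s, _, _, rfl⟩

/-! ### Expansion in principal minors -/

/-- Exactly `e r - r` of the factors to the left of position `e r` contain `τ`. Moving them to the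
right turns the argument `u - e r` into `u - r`, so the factors selected by `p` become consecutive
shifts. -/
theorem oprod_mixed (C : Fin m → F) (x : Fin m → LaurentSeries A) (p : Fin m → Prop)
    [DecidablePred p] (k : ℕ) (e : Fin k → Fin m) (he : StrictMono e)
    (hp : ∀ s, p s ↔ ∃ r, e r = s) :
    (oprod fun s : Fin m => if p s then ofSeries (shiftHom (-(s : ℤ)) (x s)) else
      ofConst (algebraMap F A (C s)) * tau) =
    ofConst (algebraMap F A (∏ s, if p s then 1 else C s)) *
      ofSeries (oprod fun r : Fin k => shiftHom (-(r : ℤ)) (x (e r))) * tau ^ (m - k) := by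
  induction m generalizing k with
  | zero =>
    have : k = 0 := by
      by_contra h
      exact (e ⟨0, by lia⟩).elim0
    subst this
    simp
  | succ m ih =>
    rw [oprod_castSucc, Fin.prod_univ_castSucc]
    by_cases hl : p (Fin.last m)
    · obtain ⟨r, hr⟩ := (hp _).1 hl
      obtain ⟨k, rfl⟩ : ∃ j, k = j + 1 := ⟨k - 1, by have := r.2; lia⟩
      have hrl : r = Fin.last k := by
        by_contra h
        have : r < Fin.last k := lt_of_le_of_ne (Fin.le_last r) h
        have := he this
        rw [hr] at this
        exact absurd (Fin.le_last _) (not_le.2 this)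
      subst hrl
      have hlt : ∀ r : Fin k, (e r.castSucc : ℕ) < m := by
        intro r
        have := he (Fin.castSucc_lt_last r)
        rw [hr] at this
        exact this
      have hkm : k ≤ m := by
        have hinj : Function.Injective fun r : Fin k => (⟨e r.castSucc, hlt r⟩ : Fin m) := by
          intro a b h
          simp only [Fin.mk.injEq] at h
          exact Fin.castSucc_injective _ (he.injective (Fin.ext h))
        simpa using Fintype.card_le_of_injective _ hinj
      have := ih (fun s => C s.castSucc) (fun s => x s.castSucc) (fun s => p s.castSucc) k
        (fun r => ⟨e r.castSucc, hlt r⟩) (fun a b h => he (by simpa using h)) (by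
          intro s
          rw [hp]
          constructor
          · rintro ⟨r, h⟩
            have hr' : r ≠ Fin.last k := by
              rintro rfl
              rw [hr] at h
              exact (Fin.castSucc_lt_last s).ne h.symm
            obtain ⟨r, rfl⟩ := Fin.exists_castSucc_eq.2 hr'
            exact ⟨r, Fin.ext (by simp [h])⟩
          · rintro ⟨r, h⟩
            exact ⟨r.castSucc, by rw [← h]; rfl⟩)
      simp only [Fin.val_castSucc]
      rw [this, if_pos hl, if_pos hl, mul_one, oprod_castSucc, hr, map_mul, mul_assoc, mul_assoc,
        tau_pow_mul_ofSeries, shiftHom_shiftHom, ← mul_assoc (ofSeries _),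
        Nat.add_sub_add_right, ← mul_assoc]
      simp only [Fin.val_last, Fin.val_castSucc]
      congr 6
      rw [Nat.cast_sub hkm]
      ring
    · have hlt : ∀ r : Fin k, (e r : ℕ) < m := by
        intro r
        have : e r ≠ Fin.last m := fun h => hl ((hp _).2 ⟨r, h⟩)
        exact Fin.lt_last_iff_ne_last.2 this
      have hkm : k ≤ m := by
        have hinj : Function.Injective fun r : Fin k => (⟨e r, hlt r⟩ : Fin m) := by
          intro a b h
          simp only [Fin.mk.injEq] at h
          exact he.injective (Fin.ext h)
        simpa using Fintype.card_le_of_injective _ hinj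
      have := ih (fun s => C s.castSucc) (fun s => x s.castSucc) (fun s => p s.castSucc) k
        (fun r => ⟨e r, hlt r⟩) (fun a b h => he h) (by
          intro s
          rw [hp]
          constructor
          · rintro ⟨r, h⟩
            exact ⟨r, Fin.ext (by simp [h])⟩
          · rintro ⟨r, h⟩
            exact ⟨r, by rw [← h]; rfl⟩)
      simp only [Fin.val_castSucc]
      rw [this, if_neg hl, if_neg hl, map_mul, map_mul, Nat.succ_sub hkm, pow_succ]
      have hτ : ∀ j : ℕ, tau ^ j * (ofConst (algebraMap F A (C (Fin.last m))) : DiffOp A) =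
          ofConst (algebraMap F A (C (Fin.last m))) * tau ^ j := by
        intro j
        rw [ofConst, RingHom.comp_apply, tau_pow_mul_ofSeries, shiftHom_C]
      rw [mul_assoc, ← mul_assoc (tau ^ _), hτ]
      simp only [mul_assoc]
      congr 1
      refine ((mul_assoc _ _ _).symm.trans ?_).trans (mul_assoc _ _ _)
      exact congrArg (· * _) (ofConst_algebraMap_commute_ofSeries _ _).eq.symm

/-- The alternating function of `h : Fin k → Fin m` obtained from the sign of a permutation by
extending `h` by the identity outside the range of `e`. -/
def altExtend {k : ℕ} (B : Type*) [Ring B] (e : Fin k → Fin m) (h : Fin k → Fin m) : B :=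
  altDelta (id : Fin m → Fin m) (Function.extend e h id)

/-- A permutation of the arguments extends to the ambient index set by the identity, with the same
sign. -/
theorem isAlt_altExtend {k : ℕ} {B : Type*} [Ring B] (e : Fin k → Fin m)
    (he : Function.Injective e) : IsAlt (altExtend B e) := by
  intro h σ
  have h1 : Function.extend e (h ∘ σ) id =
      Function.extend e h id ∘ σ.viaFintypeEmbedding ⟨e, he⟩ := by
    ext1 s
    by_cases hs : ∃ r, e r = s
    · obtain ⟨r, rfl⟩ := hs
      have : σ.viaFintypeEmbedding ⟨e, he⟩ (e r) = e (σ r) :=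
        Equiv.Perm.viaFintypeEmbedding_apply_image σ ⟨e, he⟩ r
      rw [Function.comp_apply, this, he.extend_apply, he.extend_apply, Function.comp_apply]
    · have : σ.viaFintypeEmbedding ⟨e, he⟩ s = s :=
        Equiv.Perm.viaFintypeEmbedding_apply_notMem_range σ ⟨e, he⟩ (b := s)
          (by rintro ⟨r, hr⟩; exact hs ⟨r, hr⟩)
      rw [Function.extend_apply' _ _ _ hs, Function.comp_apply, this,
        Function.extend_apply' _ _ _ hs]
  rw [altExtend, altExtend, h1, isAlt_altDelta id _ _, Equiv.Perm.viaFintypeEmbedding_sign]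

theorem map_altDelta {B B' : Type*} [Ring B] [Ring B'] (g : B →+* B') {k : ℕ} {ι : Type*}
    [DecidableEq ι] (f h : Fin k → ι) : g (altDelta f h) = altDelta f h := by
  rw [altDelta, altDelta, map_sum]
  refine Finset.sum_congr rfl fun σ _ => ?_
  split_ifs <;> simp

/-- The principal quantum minor of `t` with rows and columns in `I`. -/
def principalMinor (t : Matrix (Fin m) (Fin m) (LaurentSeries A)) (I : Finset (Fin m)) :
    LaurentSeries A :=
  colDet (altExtend (LaurentSeries A) (I.orderEmbOfFin rfl))
    (fun s => t.map (shiftHom (-(s : ℤ)))) (I.orderEmbOfFin rfl)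

/-- The set `I` collects the columns in which the `t`-term is chosen. In the others the diagonal
twist term forces the permutation to be the identity, which leaves the principal minor on `I`. -/
theorem betheOperator_expand (C : Fin m → F) (t : Matrix (Fin m) (Fin m) (LaurentSeries A)) :
    betheOperator C t = ∑ I : Finset (Fin m),
      ofSeries (HahnSeries.C (algebraMap F A ((-1) ^ I.card * ∏ s, if s ∈ I then 1 else C s)) *
        principalMinor t I) * tau ^ (m - I.card) := by
  rw [betheOperator_eq_colDet]
  have h1 : ∀ h : Fin m → Fin m, (oprod fun s => betheEntry C t s (h s) (id s)) =
      ∑ I : Finset (Fin m), oprod fun s => if s ∈ I then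
        ofSeries (shiftHom (-(s : ℤ)) (-t (h s) s)) else
        if h s = s then ofConst (algebraMap F A (C s)) * tau else 0 := by
    intro h
    have e1 : ∀ s, betheEntry C t s (h s) (id s) = ∑ x : Bool, if x = true then
        ofSeries (shiftHom (-(s : ℤ)) (-t (h s) s)) else
        if h s = s then ofConst (algebraMap F A (C s)) * tau else 0 := by
      intro s
      rw [Fintype.sum_bool]
      simp only [betheEntry, id_eq, if_true, Bool.false_eq_true, if_false, map_neg]
      by_cases hs : h s = s
      · rw [if_pos hs, if_pos hs, hs]; abel
      · rw [if_neg hs, if_neg hs]; abel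
    simp only [e1]
    rw [oprod_sum]
    refine Fintype.sum_equiv (Equiv.ofBijective (fun p : Fin m → Bool => Finset.univ.filter (p · = true))
      ⟨?_, ?_⟩) _ _ ?_
    · intro p q hpq
      funext s
      have := Finset.ext_iff.1 hpq s
      simp only [Finset.mem_filter, Finset.mem_univ, true_and] at this
      exact Bool.eq_iff_iff.2 this
    · intro I
      exact ⟨fun s => decide (s ∈ I), by simp⟩
    · intro p
      refine congrArg oprod (funext fun s => if_congr ?_ rfl rfl)
      change _ ↔ s ∈ Finset.univ.filter (p · = true)
      simp
  simp only [colDet, h1, Finset.mul_sum]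
  rw [Finset.sum_comm]
  refine Finset.sum_congr rfl fun I _ => ?_
  set e := I.orderEmbOfFin rfl with he
  have hmem : ∀ s, s ∈ I ↔ ∃ r, e r = s := by
    intro s
    have : Set.range e = I := Finset.range_orderEmbOfFin I rfl
    rw [← Finset.mem_coe, ← this]
    rfl
  have hext : Function.Injective fun h' : Fin I.card → Fin m => Function.extend e h' id := by
    intro h h' hh
    ext1 r
    have := congrFun hh (e r)
    simpa [e.injective.extend_apply] using this
  have h3 : ∀ h' : Fin I.card → Fin m, (oprod fun s => if s ∈ I then
        ofSeries (shiftHom (-(s : ℤ)) (-t (Function.extend e h' id s) s)) else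
        if Function.extend e h' id s = s then ofConst (algebraMap F A (C s)) * tau else 0) =
      ofConst (algebraMap F A ((-1) ^ I.card * ∏ s, if s ∈ I then 1 else C s)) *
      ofSeries (oprod fun r : Fin I.card => shiftHom (-(r : ℤ)) (t (h' r) (e r))) *
        tau ^ (m - I.card) := by
    intro h'
    have e1 : ∀ s, (if s ∈ I then
        ofSeries (shiftHom (-(s : ℤ)) (-t (Function.extend e h' id s) s)) else
        if Function.extend e h' id s = s then ofConst (algebraMap F A (C s)) * tau else 0) =
        if s ∈ I then ofSeries (shiftHom (-(s : ℤ)) (-t (Function.extend e h' id s) s)) else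
        ofConst (algebraMap F A (C s)) * tau := by
      intro s
      split_ifs with h4 h5
      · rfl
      · rfl
      · exact absurd (Function.extend_apply' h' id s fun ⟨r, hr⟩ => h4 ((hmem s).2 ⟨r, hr⟩)) h5
    simp only [e1]
    rw [oprod_mixed C (fun s => -t (Function.extend e h' id s) s) (fun s => s ∈ I) I.card e
      e.strictMono hmem]
    have e2 : ∀ (k : ℕ) (G : Fin k → LaurentSeries A),
        (oprod fun r => -G r) = (-1) ^ k * oprod G := by
      intro k G
      induction k with
      | zero => simp
      | succ k ih => rw [oprod_succ, oprod_succ, ih, pow_succ', neg_mul, neg_mul, one_mul, neg_mul,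
          ← mul_assoc, ← mul_assoc, ((Commute.neg_one_left (G 0)).pow_left k).eq]
    simp only [e.injective.extend_apply, map_neg]
    rw [e2, map_mul, map_pow, map_neg, map_one, map_mul, map_pow, map_neg, map_one, map_mul,
      map_pow, map_neg, map_one, ← mul_assoc,
      ((Commute.neg_one_left (ofConst (algebraMap F A (∏ s, if s ∈ I then 1 else C s)) :
        DiffOp A)).pow_left _).eq]
  symm
  refine Eq.trans ?_ (Finset.sum_of_injOn (fun h' : Fin I.card → Fin m =>
    Function.extend e h' id) hext.injOn (fun _ _ => Finset.mem_coe.2 (Finset.mem_univ _)) ?_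
    (s := Finset.univ) (f := fun h' => altDelta id (Function.extend e h' id) *
      (ofConst (algebraMap F A ((-1) ^ I.card * ∏ s, if s ∈ I then 1 else C s)) *
      ofSeries (oprod fun r : Fin I.card => shiftHom (-(r : ℤ)) (t (h' r) (e r))) *
        tau ^ (m - I.card))) ?_)
  · rw [principalMinor, colDet, Finset.mul_sum, map_sum, Finset.sum_mul]
    refine Finset.sum_congr rfl fun h' _ => ?_
    rw [(ofSeries (A := A)).map_mul, (ofSeries (A := A)).map_mul, altExtend, map_altDelta, ← he]
    change ofConst _ * _ * _ = _
    have hz : ∀ (g h : Fin m → Fin m) (Q : DiffOp A), Commute (altDelta g h) Q := by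
      intro g h Q
      refine Commute.sum_left _ _ _ fun σ _ => ?_
      split_ifs
      · exact Int.cast_commute _ _
      · simp
    rw [← mul_assoc, ← (hz _ _ (ofConst _)).eq]
    simp only [mul_assoc]
    rfl
  -- A function that is not the identity outside `I` meets a vanishing twist term.
  · intro h _ hh
    have : ∃ s, s ∉ I ∧ h s ≠ s := by
      by_contra hcon
      push Not at hcon
      apply hh
      refine ⟨fun r => h (e r), by simp, ?_⟩
      ext1 s
      by_cases hs : s ∈ I
      · obtain ⟨r, rfl⟩ := (hmem s).1 hs
        exact e.injective.extend_apply _ _ _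
      · simp only
        rw [Function.extend_apply' _ _ _ fun ⟨r, hr⟩ => hs ((hmem s).2 ⟨r, hr⟩), hcon s hs]
        rfl
    obtain ⟨s, hs, hs'⟩ := this
    rw [oprod_eq_zero _ s (by simp [hs, hs']), mul_zero]
  · intro h' _
    rw [h3]

end Bethe

/-! ## Products of evaluation matrices -/

section Sites
variable {F A : Type*} [Field F] [Ring A] [Algebra F A] {m : ℕ}

/-- The series `1 / (u - c)`. -/
def invLinear (F A : Type*) [Field F] [Ring A] [Algebra F A] (c : F) : LaurentSeries A :=
  scSeries F A (polySeries (Polynomial.X - Polynomial.C c))⁻¹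

/-- The series `u - c`. -/
def linearSeries (F A : Type*) [Field F] [Ring A] [Algebra F A] (c : F) : LaurentSeries A :=
  scSeries F A (polySeries (Polynomial.X - Polynomial.C c))

theorem invLinear_mul_linearSeries (c : F) : invLinear F A c * linearSeries F A c = 1 := by
  rw [invLinear, linearSeries, ← map_mul, inv_mul_cancel₀, map_one]
  exact polySeries_ne_zero (Polynomial.X_sub_C_ne_zero c)

theorem linearSeries_mul_invLinear (c : F) : linearSeries F A c * invLinear F A c = 1 := by
  rw [invLinear, linearSeries, ← map_mul, mul_inv_cancel₀, map_one]
  exact polySeries_ne_zero (Polynomial.X_sub_C_ne_zero c)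

theorem linearSeries_eq (c : F) :
    linearSeries F A c = scSeries F A (uSeries F) - HahnSeries.C (algebraMap F A c) := by
  rw [linearSeries, polySeries, map_sub, map_sub]
  change scSeries F A (polySeries Polynomial.X) - scSeries F A (polySeries (Polynomial.C c)) = _
  rw [polySeries_X, polySeries_C, scSeries_C]

theorem linearSeries_commute (c : F) (f : LaurentSeries A) : Commute (linearSeries F A c) f :=
  scSeries_commute _ _

theorem invLinear_commute (c : F) (f : LaurentSeries A) : Commute (invLinear F A c) f :=
  scSeries_commute _ _

theorem linearSeries_mem (c : F) : linearSeries F A c ∈ polySubring A :=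
  scSeries_polySeries_mem _

theorem linearSeries_sub_natCast (c : F) (s : ℕ) :
    linearSeries F A c - (s : LaurentSeries A) = linearSeries F A (c + s) := by
  rw [linearSeries_eq, linearSeries_eq, map_add, map_add, map_natCast, map_natCast]
  abel

theorem shiftHom_linearSeries (c : F) (s : ℕ) :
    shiftHom (-(s : ℤ)) (linearSeries F A c) = linearSeries F A (c + s) := by
  rw [← linearSeries_sub_natCast, linearSeries_eq, map_sub, shiftHom_C, shiftHom_scSeries,
    shiftHom_uSeries, map_add, scSeries_C]
  push_cast
  rw [map_neg, map_natCast]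
  abel

theorem eq_invLinear {c : F} {x : LaurentSeries A} (h : x * linearSeries F A c = 1) :
    x = invLinear F A c := by
  rw [← mul_one x, ← linearSeries_mul_invLinear c, ← mul_assoc, h, one_mul]

theorem shiftHom_invLinear (c : F) (s : ℕ) :
    shiftHom (-(s : ℤ)) (invLinear F A c) = invLinear F A (c + s) :=
  eq_invLinear <| by
    rw [← shiftHom_linearSeries, ← map_mul, invLinear_mul_linearSeries, map_one]

theorem evalMatrix_eq_linearMatrix (c : F) (E : Fin m → Fin m → A) :
    evalMatrix c E = linearMatrix (invLinear F A c) fun a b => HahnSeries.C (E a b) := by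
  ext1 a b
  exact evalMatrix_eq c E a b

theorem evalMatrix_map_shift (c : F) (E : Fin m → Fin m → A) (s : ℕ) :
    (evalMatrix c E).map (shiftHom (-(s : ℤ))) = evalMatrix (c + s) E := by
  ext1 a b
  simp only [evalMatrix_eq_linearMatrix, Matrix.map_apply, linearMatrix]
  rw [map_add, map_mul, shiftHom_C, shiftHom_invLinear]
  split_ifs <;> simp

theorem commute_evalMatrix {y : LaurentSeries A} (c : F) (E : Fin m → Fin m → A) (a b : Fin m)
    (h : Commute y (HahnSeries.C (E a b))) : Commute y (evalMatrix c E a b) := by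
  simp only [evalMatrix_eq_linearMatrix, linearMatrix]
  refine Commute.add_right ?_ ((invLinear_commute _ _).symm.mul_right h)
  split_ifs
  · exact Commute.one_right _
  · exact Commute.zero_right _

theorem linearSeries_mul_evalMatrix (c : F) (E : Fin m → Fin m → A) (a b : Fin m) :
    linearSeries F A c * evalMatrix c E a b =
      (if a = b then linearSeries F A c else 0) + HahnSeries.C (E a b) := by
  simp only [evalMatrix_eq_linearMatrix, linearMatrix]
  rw [mul_add, ← mul_assoc, linearSeries_mul_invLinear, one_mul]
  split_ifs <;> simp

/-- Here `w` and `w'` are `1/(u-c)` and `1/(u-c-1)`. -/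
theorem adjAlt_evalMatrix {E : Fin m → Fin m → A} (hE : GlRel E) (c : F) :
    AdjAlt (evalMatrix c E) ((evalMatrix c E).map (shiftHom (-1))) := by
  have h1 := evalMatrix_map_shift c E 1
  rw [Nat.cast_one] at h1
  rw [h1, evalMatrix_eq_linearMatrix, evalMatrix_eq_linearMatrix]
  refine adjAlt_linearMatrix (hE.map _) _ _ (invLinear_commute c) (invLinear_commute _) ?_
  symm
  refine eq_invLinear ?_
  have h2 := linearSeries_sub_natCast (A := A) c 1
  have e : invLinear F A c * linearSeries F A (c + ((1 : ℕ) : F)) = 1 - invLinear F A c := by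
    rw [← h2, mul_sub, invLinear_mul_linearSeries, Nat.cast_one, mul_one]
  rw [add_mul, mul_assoc, invLinear_mul_linearSeries, mul_one, e]
  abel

theorem glAct_evalMatrix {E : Fin m → Fin m → A} (hE : GlRel E) (c : F) :
    GlAct E (evalMatrix c E) := by
  intro i j a b
  have h := congrArg (fun x => invLinear F A c * HahnSeries.C x) (hE i j a b)
  simp only [map_sub, map_mul] at h
  simp only [evalMatrix_eq_linearMatrix, linearMatrix]
  have e1 : HahnSeries.C (E i j) * ((if a = b then 1 else 0) +
      invLinear F A c * HahnSeries.C (E a b)) - ((if a = b then 1 else 0) +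
      invLinear F A c * HahnSeries.C (E a b)) * HahnSeries.C (E i j) =
      invLinear F A c * (HahnSeries.C (E i j) * HahnSeries.C (E a b) -
        HahnSeries.C (E a b) * HahnSeries.C (E i j)) := by
    rw [mul_add, add_mul, ← mul_assoc (HahnSeries.C (E i j)), ← (invLinear_commute c _).eq,
      mul_assoc, mul_assoc, mul_sub]
    split_ifs
    · simp
    · simp
  rw [e1, h]
  by_cases h1 : j = a <;> by_cases h3 : b = i
  · subst h1; subst h3
    by_cases h4 : j = b
    · subst h4; simp
    · simp [mul_sub]
  · subst h1
    have : i ≠ b := fun h => h3 h.symm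
    simp [h3, this]
  · subst h3
    have : a ≠ j := fun h => h1 h.symm
    simp [h1, this]
  · simp [h1, h3]

theorem evalMatrix_sub_coeff (c : F) (E : Fin m → Fin m → A) (a b : Fin m) (l : ℤ) (hl : l < 1) :
    (evalMatrix c E a b - if a = b then 1 else 0).coeff l = 0 := by
  obtain ⟨p, hp, h0⟩ : ∃ p : PowerSeries A, PowerSeries.coeff 0 p = 0 ∧
      evalMatrix c E a b - (if a = b then (1 : LaurentSeries A) else 0) =
        HahnSeries.ofPowerSeries ℤ A p := by
    refine ⟨PowerSeries.mk fun
      | 0 => 0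
      | r + 1 => c ^ r • E a b, ?_, ?_⟩
    rotate_left
    · rw [evalMatrix]
      split_ifs <;> simp <;> rfl
    · rw [PowerSeries.coeff_mk]
  rw [h0]
  rcases lt_or_ge l 0 with h | h
  · rw [HahnSeries.ofPowerSeries_apply]
    refine HahnSeries.embDomain_of_notMem_range ?_
    rintro ⟨k, hk⟩
    simp at hk
    lia
  · obtain rfl : l = ((0 : ℕ) : ℤ) := by push_cast; lia
    rw [HahnSeries.ofPowerSeries_apply_coeff, hp]

theorem mul_sub_delta_coeff {t s : Matrix (Fin m) (Fin m) (LaurentSeries A)}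
    (ht : ∀ a b, ∀ l < (1 : ℤ), (t a b - if a = b then 1 else 0).coeff l = 0)
    (hs : ∀ a b, ∀ l < (1 : ℤ), (s a b - if a = b then 1 else 0).coeff l = 0) (a b : Fin m)
    (l : ℤ) (hl : l < 1) : ((t * s) a b - if a = b then 1 else 0).coeff l = 0 := by
  have h1 : t = 1 + (t - 1) := by abel
  have h2 : s = 1 + (s - 1) := by abel
  have h3 : (t * s) a b - (if a = b then 1 else 0) = (t a b - if a = b then 1 else 0) +
      (s a b - if a = b then 1 else 0) +
      ∑ c, (t a c - if a = c then 1 else 0) * (s c b - if c = b then 1 else 0) := by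
    simp only [mul_sub, sub_mul, Matrix.mul_apply, Finset.sum_sub_distrib]
    simp
    abel
  rw [h3, HahnSeries.coeff_add, HahnSeries.coeff_add, ht a b l hl, hs a b l hl, zero_add, zero_add,
    HahnSeries.coeff_sum]
  exact Finset.sum_eq_zero fun c _ => coeff_mul_lt (ht a c) (hs c b) l (by lia)

/-- The product of the evaluation matrices attached to a list of parameters and generators. -/
def sitesMatrix (L : List (F × (Fin m → Fin m → A))) :
    Matrix (Fin m) (Fin m) (LaurentSeries A) :=
  (L.map fun p => evalMatrix p.1 p.2).prod

theorem sitesMatrix_cons (p : F × (Fin m → Fin m → A)) (L : List (F × (Fin m → Fin m → A))) :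
    sitesMatrix (p :: L) = evalMatrix p.1 p.2 * sitesMatrix L := by
  rw [sitesMatrix, List.map_cons, List.prod_cons, sitesMatrix]

theorem commute_sitesMatrix {L : List (F × (Fin m → Fin m → A))} {y : LaurentSeries A}
    (h : ∀ p ∈ L, ∀ a b, Commute y (HahnSeries.C (p.2 a b))) (a b : Fin m) :
    Commute y (sitesMatrix L a b) := by
  induction L generalizing a with
  | nil =>
    simp only [sitesMatrix, List.map_nil, List.prod_nil, Matrix.one_apply]
    split_ifs
    · exact Commute.one_right _
    · exact Commute.zero_right _
  | cons p L ih =>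
    rw [sitesMatrix_cons, Matrix.mul_apply]
    refine Commute.sum_right _ _ _ fun c _ => Commute.mul_right ?_ (ih (fun q hq =>
      h q (List.mem_cons_of_mem _ hq)) c)
    exact commute_evalMatrix _ _ _ _ (h p List.mem_cons_self a c)

theorem sitesMatrix_sub_coeff (L : List (F × (Fin m → Fin m → A))) (a b : Fin m) (l : ℤ)
    (hl : l < 1) : (sitesMatrix L a b - if a = b then 1 else 0).coeff l = 0 := by
  induction L generalizing a b l with
  | nil => simp [sitesMatrix, Matrix.one_apply]
  | cons p L ih =>
    rw [sitesMatrix_cons]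
    exact mul_sub_delta_coeff (evalMatrix_sub_coeff p.1 p.2) ih a b l hl


/-- Generators of commuting copies of `gl`. -/
def CommutingSites (L : List (F × (Fin m → Fin m → A))) : Prop :=
  (∀ p ∈ L, GlRel p.2) ∧
    L.Pairwise fun p q => ∀ a b c d, Commute (p.2 a b) (q.2 c d)


theorem CommutingSites.of_cons {p : F × (Fin m → Fin m → A)}
    {L : List (F × (Fin m → Fin m → A))} (h : CommutingSites (p :: L)) :
    GlRel p.2 ∧ (∀ q ∈ L, ∀ a b c d, Commute (p.2 a b) (q.2 c d)) ∧ CommutingSites L :=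
  ⟨h.1 p List.mem_cons_self, (List.pairwise_cons.1 h.2).1,
    fun q hq => h.1 q (List.mem_cons_of_mem _ hq), (List.pairwise_cons.1 h.2).2⟩

theorem shiftHom_commute_of_C {x : A} {f : LaurentSeries A} (h : Commute (HahnSeries.C x) f)
    (c : ℤ) : Commute (HahnSeries.C x) (shiftHom c f) := by
  have := h.map (shiftHom c)
  rwa [shiftHom_C] at this

theorem matrix_map_mul_shift (t s : Matrix (Fin m) (Fin m) (LaurentSeries A)) (c : ℤ) :
    (t * s).map (shiftHom c) = t.map (shiftHom c) * s.map (shiftHom c) :=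
  Matrix.map_mul

theorem CommutingSites.commute_cons {p : F × (Fin m → Fin m → A)}
    {L : List (F × (Fin m → Fin m → A))} (h : CommutingSites (p :: L)) (k l : ℤ) (a b c d : Fin m) :
    Commute ((evalMatrix p.1 p.2).map (shiftHom k) a b) ((sitesMatrix L).map (shiftHom l) c d) := by
  simp only [Matrix.map_apply]
  have h1 : ∀ x y, Commute (HahnSeries.C (p.2 x y)) (shiftHom l (sitesMatrix L c d)) := fun x y =>
    shiftHom_commute_of_C (commute_sitesMatrix (fun q hq a' b' =>
      (h.of_cons.2.1 q hq x y a' b').map HahnSeries.C) c d) l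
  have h2 : shiftHom l (sitesMatrix L c d) =
      shiftHom k (shiftHom (l - k) (sitesMatrix L c d)) := by
    rw [shiftHom_shiftHom, add_sub_cancel]
  rw [h2]
  refine Commute.map ?_ (shiftHom k)
  refine (commute_evalMatrix _ _ _ _ ?_).symm
  exact (shiftHom_commute_of_C (commute_sitesMatrix (fun q hq a' b' =>
      (h.of_cons.2.1 q hq a b a' b').map HahnSeries.C) c d) _).symm

theorem adjAlt_sitesMatrix (h2 : TwoFree A) {L : List (F × (Fin m → Fin m → A))}
    (hL : CommutingSites L) : AdjAlt (sitesMatrix L) ((sitesMatrix L).map (shiftHom (-1))) := by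
  induction L with
  | nil =>
    intro a b k l
    simp only [sitesMatrix, List.map_nil, List.prod_nil, Matrix.map_apply, Matrix.one_apply]
    simp only [apply_ite (shiftHom (-1)), map_one, map_zero, mul_ite, mul_one, mul_zero]
    split_ifs <;> simp
  | cons p L ih =>
    rw [sitesMatrix_cons, matrix_map_mul_shift]
    refine adjAlt_mul h2.series (adjAlt_evalMatrix hL.of_cons.1 _) (ih hL.of_cons.2.2) ?_
    intro a b c d
    have := hL.commute_cons (-1) 0 a b c d
    simpa only [Matrix.map_apply, shiftHom_zero] using this

theorem glAct_sitesMatrix {L : List (F × (Fin m → Fin m → A))} (hL : CommutingSites L) :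
    GlAct (fun i j => (L.map fun p => p.2 i j).sum) (sitesMatrix L) := by
  induction L with
  | nil =>
    intro i j a b
    simp only [sitesMatrix, List.map_nil, List.prod_nil, List.sum_nil, map_zero, zero_mul, mul_zero,
      Matrix.one_apply]
    split_ifs <;> simp_all
  | cons p L ih =>
    rw [sitesMatrix_cons]
    refine glAct_mul (X := p.2) (glAct_evalMatrix hL.of_cons.1 _) (ih hL.of_cons.2.2) ?_ ?_
    · intro i j a b
      exact commute_sitesMatrix (fun q hq c d => (hL.of_cons.2.1 q hq i j c d).map HahnSeries.C) a b
    · intro i j a b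
      refine commute_evalMatrix _ _ _ _ (Commute.map ?_ HahnSeries.C)
      have : ∀ (L' : List (F × (Fin m → Fin m → A))), (∀ q ∈ L', q ∈ L) →
          Commute ((L'.map fun p => p.2 i j).sum) (p.2 a b) := by
        intro L' hL'
        induction L' with
        | nil => simp
        | cons q L' ih' =>
          rw [List.map_cons, List.sum_cons]
          exact Commute.add_left (hL.of_cons.2.1 q (hL' q List.mem_cons_self) a b i j).symm
            (ih' fun r hr => hL' r (List.mem_cons_of_mem _ hr))
      exact this L fun q hq => hq

/-! ### Denominators of the quantum minors -/

theorem colDet_mul_left {B : Type*} [Ring B] {ι : Type*} [Fintype ι] {k : ℕ} (x : B)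
    (α : (Fin k → ι) → B) (T : Fin k → Matrix ι ι B) (f : Fin k → ι) :
    colDet (fun h => x * α h) T f = x * colDet α T f := by
  simp only [colDet, Finset.mul_sum, mul_assoc]

theorem IsAlt.mul_left {B : Type*} [Ring B] {ι : Type*} {k : ℕ} {α : (Fin k → ι) → B}
    (hα : IsAlt α) (x : B) : IsAlt fun h => x * α h := by
  intro h σ
  change x * α (h ∘ σ) = _ • (x * α h)
  rw [hα h σ, mul_smul_comm]

/-- `∏ (u - c)` over the parameters of a list of sites. -/
def sitesDenom (L : List (F × (Fin m → Fin m → A))) : LaurentSeries A :=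
  (L.map fun p => linearSeries F A p.1).prod

/-- The sites are absorbed one at a time. By `colDet_rankOne`, each needs only its own factor `u -
c`, although the column determinant involves all its shifts. The induction is over arbitrary
alternating polynomial functions `α`, since absorbing a site replaces `α` by another such function.
-/
theorem colDet_sitesMatrix (h2 : TwoFree A) {L : List (F × (Fin m → Fin m → A))}
    (hL : CommutingSites L) (hR : ∀ p ∈ L, RankOneRel p.2) {k : ℕ}
    (α : (Fin k → Fin m) → LaurentSeries A) (hα : IsAlt α) (hp : ∀ f, α f ∈ polySubring A)
    (f : Fin k → Fin m) :
    sitesDenom L * colDet α (fun s => (sitesMatrix L).map (shiftHom (-(s : ℤ)))) f ∈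
        polySubring A := by
  induction L generalizing α with
  | nil =>
    have : ∀ s : Fin k, (sitesMatrix ([] : List (F × (Fin m → Fin m → A)))).map
        (shiftHom (-(s : ℤ))) = 1 := by
      intro s
      ext1 a b
      simp only [sitesMatrix, List.map_nil, List.prod_nil, Matrix.map_apply, Matrix.one_apply]
      split_ifs <;> simp
    simp only [this, sitesDenom, List.map_nil, List.prod_nil, one_mul, colDet]
    refine Subring.sum_mem _ fun h _ => Subring.mul_mem _ (hp h) ?_
    have h3 : ∀ j (G : Fin j → LaurentSeries A), (∀ r, G r ∈ polySubring A) →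
        oprod G ∈ polySubring A := by
      intro j G hG
      exact Subring.list_prod_mem _ fun x hx => by
        obtain ⟨r, rfl⟩ := List.mem_ofFn.1 hx
        exact hG r
    refine h3 _ _ fun r => ?_
    rw [Matrix.one_apply]
    split_ifs
    · exact Subring.one_mem _
    · exact Subring.zero_mem _
  | cons p L ih =>
    have e1 : ∀ s : Fin k, (sitesMatrix (p :: L)).map (shiftHom (-(s : ℤ))) =
        (evalMatrix p.1 p.2).map (shiftHom (-(s : ℤ))) *
          (sitesMatrix L).map (shiftHom (-(s : ℤ))) := fun s => by
      rw [sitesMatrix_cons, matrix_map_mul_shift]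
    simp only [e1]
    rw [← colDet_colDet α (fun s => (evalMatrix p.1 p.2).map (shiftHom (-(s : ℤ))))
      (fun s => (sitesMatrix L).map (shiftHom (-(s : ℤ))))
      fun s t a b c d => hL.commute_cons _ _ a b c d]
    have e2 : sitesDenom (p :: L) = sitesDenom L * linearSeries F A p.1 := by
      rw [sitesDenom, List.map_cons, List.prod_cons, (linearSeries_commute _ _).eq]
      rfl
    rw [e2, mul_assoc, ← colDet_mul_left]
    have e3 : ∀ s : Fin k, (evalMatrix p.1 p.2).map (shiftHom (-(s : ℤ))) =
        linearMatrix (invLinear F A (p.1 + (s : ℕ))) fun a b => HahnSeries.C (p.2 a b) := fun s => by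
      rw [evalMatrix_map_shift, evalMatrix_eq_linearMatrix]
    have hw : ∀ s : ℕ, invLinear F A (p.1 + s) * (linearSeries F A p.1 - s) = 1 := fun s => by
      rw [linearSeries_sub_natCast, invLinear_mul_linearSeries]
    have key := fun f => colDet_rankOne h2.series (fun a b => HahnSeries.C (p.2 a b))
      ((hR p List.mem_cons_self).map (HahnSeries.C : A →+* LaurentSeries A)) (linearSeries F A p.1)
      (fun s => invLinear F A (p.1 + s)) (fun s => invLinear_commute _) hw α hα f
    -- The induction continues with the function obtained from the first site, multiplied by its
    -- denominator.
    refine ih hL.of_cons.2.2 (fun q hq => hR q (List.mem_cons_of_mem _ hq)) _ ?_ ?_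
    · refine IsAlt.mul_left (isAlt_colDet h2.series α hα _ ?_) _
      intro s hs
      have h5 := adjAlt_evalMatrix hL.of_cons.1 (p.1 + (s : ℕ))
      have h6 : (evalMatrix (p.1 + (s : ℕ)) p.2).map (shiftHom (-1)) =
          (evalMatrix p.1 p.2).map (shiftHom (-((s + 1 : ℕ) : ℤ))) := by
        have := evalMatrix_map_shift (p.1 + (s : ℕ)) p.2 1
        rw [Nat.cast_one] at this
        rw [this, evalMatrix_map_shift, add_assoc]
        push_cast
        rfl
      rw [h6, ← evalMatrix_map_shift] at h5
      exact h5
    · intro g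
      simp only [e3]
      rw [key g]
      refine Subring.add_mem _ (Subring.mul_mem _ (linearSeries_mem _) (hp g)) ?_
      refine Subring.sum_mem _ fun r _ => Subring.sum_mem _ fun c _ => ?_
      exact Subring.mul_mem _ (hp _) (C_mem_polySubring _)

/-- The series `u (u - 1) ⋯ (u - k + 1)`. -/
def fallingSeries (F A : Type*) [Field F] [Ring A] [Algebra F A] (k : ℕ) : LaurentSeries A :=
  scSeries F A (polySeries (fallingPoly 0 k))

theorem fallingSeries_zero : fallingSeries F A 0 = 1 := by
  simp [fallingSeries, fallingPoly, polySeries]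

theorem fallingPoly_succ (c : F) (k : ℕ) :
    fallingPoly c (k + 1) = fallingPoly c k * (Polynomial.X + Polynomial.C (c - k)) := by
  rw [fallingPoly, descPochhammer_succ_right, Polynomial.mul_comp, fallingPoly]
  congr 1
  simp
  ring

theorem fallingSeries_succ (k : ℕ) :
    fallingSeries F A (k + 1) = fallingSeries F A k * linearSeries F A (k : F) := by
  rw [fallingSeries, fallingPoly_succ, polySeries_mul, map_mul, linearSeries, fallingSeries]
  congr 4
  simp [sub_eq_add_neg]

theorem fallingSeries_commute (k : ℕ) (f : LaurentSeries A) : Commute (fallingSeries F A k) f :=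
  scSeries_commute _ _

/-- The polynomials `(u - s) δ_{ab} + e_{ab}`. -/
def polyEntry (F : Type*) {A : Type*} [Field F] [Ring A] [Algebra F A] (E : Fin m → Fin m → A)
    (s : ℕ) (a b : Fin m) : LaurentSeries A :=
  (if a = b then linearSeries F A (s : F) else 0) + HahnSeries.C (E a b)

/-- The rank one argument is not used for the last tensor factor, so all denominators `u - s` of its
entries are cleared. -/
theorem fallingSeries_mul_oprod (E : Fin m → Fin m → A) {k : ℕ} (h f : Fin k → Fin m) :
    fallingSeries F A k * oprod (fun s : Fin k =>
      (evalMatrix (0 : F) E).map (shiftHom (-(s : ℤ))) (h s) (f s)) =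
      oprod fun s : Fin k => polyEntry F E s (h s) (f s) := by
  induction k with
  | zero => simp [fallingSeries_zero]
  | succ k ih =>
    rw [oprod_castSucc, oprod_castSucc]
    have := ih (fun s => h s.castSucc) (fun s => f s.castSucc)
    simp only [Fin.val_castSucc]
    rw [← this, fallingSeries_succ, mul_assoc, ← mul_assoc (linearSeries _ _ _),
      (linearSeries_commute _ _).eq, mul_assoc, mul_assoc]
    congr 2
    rw [evalMatrix_map_shift, zero_add]
    exact linearSeries_mul_evalMatrix _ _ _ _

/-- The alternating function attached to a quantum minor of the site part of a monodromy matrix. -/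
def minorCoeff (t : Matrix (Fin m) (Fin m) (LaurentSeries A)) (I : Finset (Fin m)) :
    (Fin I.card → Fin m) → LaurentSeries A :=
  colDet (altExtend (LaurentSeries A) (I.orderEmbOfFin rfl))
    fun s => t.map (shiftHom (-(s : ℤ)))

theorem principalMinor_eq_minorCoeff (t : Matrix (Fin m) (Fin m) (LaurentSeries A))
    (I : Finset (Fin m)) : principalMinor t I = minorCoeff t I (I.orderEmbOfFin rfl) := rfl

/-- Separates the sites, which enter through `minorCoeff`, from the last tensor factor, which enters
polynomially. -/
theorem fallingSeries_mul_principalMinor (t : Matrix (Fin m) (Fin m) (LaurentSeries A))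
    (E : Fin m → Fin m → A) (h : ∀ a b c d, Commute (t a b) (HahnSeries.C (E c d)))
    (I : Finset (Fin m)) :
    fallingSeries F A I.card * principalMinor (t * evalMatrix (0 : F) E) I =
      ∑ g, minorCoeff t I g *
        oprod fun s : Fin I.card => polyEntry F E s (g s) (I.orderEmbOfFin rfl s) := by
  rw [principalMinor]
  have e1 : ∀ s : Fin I.card, (t * evalMatrix (0 : F) E).map (shiftHom (-(s : ℤ))) =
      t.map (shiftHom (-(s : ℤ))) * (evalMatrix (0 : F) E).map (shiftHom (-(s : ℤ))) := fun s =>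
    matrix_map_mul_shift _ _ _
  simp only [e1]
  rw [← colDet_colDet]
  · rw [colDet, Finset.mul_sum]
    refine Finset.sum_congr rfl fun g _ => ?_
    rw [← mul_assoc, (fallingSeries_commute _ _).eq, mul_assoc, fallingSeries_mul_oprod]
    rfl
  · intro s s' a b c d
    rw [evalMatrix_map_shift]
    refine commute_evalMatrix _ _ _ _ ?_
    exact (shiftHom_commute_of_C (h a b c d).symm _).symm

theorem altDelta_mem {B : Type*} [Ring B] (R : Subring B) {k : ℕ} {ι : Type*}
    [DecidableEq ι] (f h : Fin k → ι) : altDelta f h ∈ R := by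
  refine Subring.sum_mem _ fun σ _ => ?_
  split_ifs
  · exact intCast_mem _ _
  · exact Subring.zero_mem _

theorem sitesDenom_mul_minorCoeff_mem (h2 : TwoFree A) {L : List (F × (Fin m → Fin m → A))}
    (hL : CommutingSites L) (hR : ∀ p ∈ L, RankOneRel p.2) (I : Finset (Fin m))
    (g : Fin I.card → Fin m) :
    sitesDenom L * minorCoeff (sitesMatrix L) I g ∈ polySubring A :=
  colDet_sitesMatrix h2 hL hR _ (isAlt_altExtend _ (I.orderEmbOfFin rfl).injective)
    (fun _ => altDelta_mem _ _ _) _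

theorem sitesDenom_mul_principalMinor_mem (h2 : TwoFree A) {L : List (F × (Fin m → Fin m → A))}
    (hL : CommutingSites L) (hR : ∀ p ∈ L, RankOneRel p.2) (E : Fin m → Fin m → A)
    (h : ∀ p ∈ L, ∀ a b c d, Commute (p.2 a b) (E c d)) (I : Finset (Fin m)) :
    sitesDenom L * (fallingSeries F A I.card *
      principalMinor (sitesMatrix L * evalMatrix (0 : F) E) I) ∈ polySubring A := by
  rw [fallingSeries_mul_principalMinor _ _ fun a b c d => (commute_sitesMatrix
    (fun p hp a' b' => ((h p hp a' b' c d).map HahnSeries.C).symm) a b).symm, Finset.mul_sum]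
  refine Subring.sum_mem _ fun g _ => ?_
  rw [← mul_assoc]
  refine Subring.mul_mem _ (sitesDenom_mul_minorCoeff_mem h2 hL hR I g) ?_
  refine Subring.list_prod_mem _ fun x hx => ?_
  obtain ⟨s, rfl⟩ := List.mem_ofFn.1 hx
  refine Subring.add_mem _ ?_ (C_mem_polySubring _)
  split_ifs
  · exact linearSeries_mem _
  · exact Subring.zero_mem _

end Sites

/-! ## Nonvanishing of the highest weight vector of a Verma module -/

section DualNumbers
variable {K A L : Type*} [Field K] [CommRing A] [Algebra K A] [Field L] [Algebra A L] [Algebra K L]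
  [IsScalarTower K A L]

/-- The map `a ↦ a + ε D a` defined by a derivation. -/
def dualFun (D : Derivation K A A) (a : A) : TrivSqZeroExt L L :=
  ((algebraMap A L a, algebraMap A L (D a)) : L × L)

/-- The homomorphism `a ↦ a + ε D a` defined by a derivation. -/
def dualHom (D : Derivation K A A) : A →+* TrivSqZeroExt L L where
  toFun := dualFun D
  map_one' := TrivSqZeroExt.ext (map_one (algebraMap A L)) <| by
    change algebraMap A L (D 1) = 0
    rw [D.map_one_eq_zero, map_zero]
  map_mul' a b := TrivSqZeroExt.ext (map_mul (algebraMap A L) a b) <| by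
    rw [TrivSqZeroExt.snd_mul]
    change algebraMap A L (D (a * b)) = algebraMap A L a * algebraMap A L (D b) +
      algebraMap A L (D a) * algebraMap A L b
    rw [D.leibniz, map_add, smul_eq_mul, smul_eq_mul, map_mul, map_mul, mul_comm (algebraMap A L b)]
  map_zero' := TrivSqZeroExt.ext (map_zero (algebraMap A L)) <| by
    change algebraMap A L (D 0) = 0
    rw [map_zero, map_zero]
  map_add' a b := TrivSqZeroExt.ext (map_add (algebraMap A L) a b) <| by
    change algebraMap A L (D (a + b)) = algebraMap A L (D a) + algebraMap A L (D b)
    rw [map_add, map_add]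

theorem fst_dualHom (D : Derivation K A A) (a : A) :
    (dualHom (L := L) D a).fst = algebraMap A L a := rfl

theorem snd_dualHom (D : Derivation K A A) (a : A) :
    (dualHom (L := L) D a).snd = algebraMap A L (D a) := rfl

variable [IsDomain A] [IsFractionRing A L]

theorem isUnit_dualHom (D : Derivation K A A) (y : nonZeroDivisors A) :
    IsUnit (dualHom (L := L) D y) := by
  rw [TrivSqZeroExt.isUnit_iff_isUnit_fst, fst_dualHom]
  exact IsLocalization.map_units L y

/-- The extension of a derivation to the field of fractions, with its dual number form. -/
def dualLift (D : Derivation K A A) : L →+* TrivSqZeroExt L L :=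
  IsLocalization.lift (M := nonZeroDivisors A) (isUnit_dualHom (L := L) D)

theorem dualLift_algebraMap (D : Derivation K A A) (a : A) :
    dualLift (L := L) D (algebraMap A L a) = dualHom D a :=
  IsLocalization.lift_eq _ _

theorem fst_dualLift (D : Derivation K A A) (x : L) : (dualLift (L := L) D x).fst = x := by
  have h : (TrivSqZeroExt.fstHom L L L).toRingHom.comp (dualLift (L := L) D) = RingHom.id L := by
    refine IsLocalization.ringHom_ext (nonZeroDivisors A) (RingHom.ext fun a => ?_)
    change (dualLift (L := L) D (algebraMap A L a)).fst = algebraMap A L a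
    rw [dualLift_algebraMap, fst_dualHom]
  exact RingHom.congr_fun h x

/-- The extension of a derivation to the field of fractions. -/
def derivLift (D : Derivation K A A) : Derivation K L L where
  toFun x := (dualLift (L := L) D x).snd
  map_add' x y := by rw [map_add, TrivSqZeroExt.snd_add]
  map_smul' c x := by
    rw [Algebra.smul_def, map_mul, IsScalarTower.algebraMap_apply K A L, dualLift_algebraMap,
      TrivSqZeroExt.snd_mul, fst_dualHom, snd_dualHom, D.map_algebraMap, map_zero,
      ← IsScalarTower.algebraMap_apply K A L]
    simp [Algebra.smul_def]
  map_one_eq_zero' := by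
    change (dualLift (L := L) D 1).snd = 0
    rw [map_one, TrivSqZeroExt.snd_one]
  leibniz' x y := by
    change (dualLift (L := L) D (x * y)).snd = x * (dualLift (L := L) D y).snd +
      y * (dualLift (L := L) D x).snd
    rw [map_mul, TrivSqZeroExt.snd_mul, fst_dualLift, fst_dualLift]
    simp [mul_comm]

theorem derivLift_algebraMap (D : Derivation K A A) (a : A) :
    derivLift (L := L) D (algebraMap A L a) = algebraMap A L (D a) := by
  change (dualLift (L := L) D (algebraMap A L a)).snd = _
  rw [dualLift_algebraMap, snd_dualHom]

variable (A) in
-- The quotient rule, cleared of denominators.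
theorem deriv_ext_fraction {D D' : Derivation K L L}
    (h : ∀ a : A, D (algebraMap A L a) = D' (algebraMap A L a)) : D = D' := by
  refine Derivation.ext fun x => ?_
  obtain ⟨a, b, hb, rfl⟩ := IsFractionRing.div_surjective (A := A) x
  have hb0 : algebraMap A L b ≠ 0 :=
    IsFractionRing.to_map_ne_zero_of_mem_nonZeroDivisors hb
  have h1 : ∀ E : Derivation K L L, algebraMap A L b * E (algebraMap A L a / algebraMap A L b) =
      E (algebraMap A L a) - (algebraMap A L a / algebraMap A L b) * E (algebraMap A L b) := by
    intro E
    have := E.leibniz (algebraMap A L b) (algebraMap A L a / algebraMap A L b)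
    rw [mul_div_cancel₀ _ hb0, smul_eq_mul, smul_eq_mul] at this
    rw [this]
    ring
  have h2 := h1 D
  rw [h a, h b, ← h1 D'] at h2
  exact mul_left_cancel₀ hb0 h2

/-- Encoding the derivation as the ring homomorphism `a ↦ a + ε D a` makes it commute with the
determinant. Since only row `j` acquires an `ε`-part, linearity in that row yields the derivative.
-/
theorem derivLift_det (D : Derivation K A A) {k : ℕ} (M : Matrix (Fin k) (Fin k) A) (j : Fin k)
    (v : Fin k → A) (hj : ∀ c, D (M j c) = v c) (h : ∀ p, p ≠ j → ∀ c, D (M p c) = 0) :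
    algebraMap A L (D M.det) = algebraMap A L (M.updateRow j v).det := by
  rw [← snd_dualHom (L := L), RingHom.map_det]
  have e : (dualHom (L := L) D).mapMatrix M = (M.map (TrivSqZeroExt.inlHom L L |>.comp
      (algebraMap A L))).updateRow j ((M.map (TrivSqZeroExt.inlHom L L |>.comp
      (algebraMap A L))) j + (TrivSqZeroExt.inr 1 : TrivSqZeroExt L L) •
        fun c => TrivSqZeroExt.inl (algebraMap A L (v c))) := by
    ext1 p c
    by_cases hp : p = j
    · subst hp
      rw [Matrix.updateRow_self]
      refine TrivSqZeroExt.ext ?_ ?_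
      · rw [RingHom.mapMatrix_apply, Matrix.map_apply, fst_dualHom]
        simp [-DualNumber.inr_eq_smul_eps]
      · rw [RingHom.mapMatrix_apply, Matrix.map_apply, snd_dualHom, hj]
        simp [-DualNumber.inr_eq_smul_eps]
    · rw [Matrix.updateRow_ne hp]
      refine TrivSqZeroExt.ext ?_ ?_
      · rw [RingHom.mapMatrix_apply, Matrix.map_apply, fst_dualHom]
        simp
      · rw [RingHom.mapMatrix_apply, Matrix.map_apply, snd_dualHom, h p hp]
        simp
  have e2 : ∀ N : Matrix (Fin k) (Fin k) A, (N.map (TrivSqZeroExt.inlHom L L |>.comp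
      (algebraMap A L))).det = TrivSqZeroExt.inl (algebraMap A L N.det) := fun N =>
    (RingHom.map_det ((TrivSqZeroExt.inlHom L L).comp (algebraMap A L)) N).symm
  have e3 : (M.map (TrivSqZeroExt.inlHom L L |>.comp (algebraMap A L))).updateRow j
      (fun c => TrivSqZeroExt.inl (algebraMap A L (v c))) =
      (M.updateRow j v).map (TrivSqZeroExt.inlHom L L |>.comp (algebraMap A L)) := by
    rw [Matrix.map_updateRow]
    rfl
  rw [e, Matrix.det_updateRow_add, Matrix.det_updateRow_smul, Matrix.updateRow_eq_self, e3, e2, e2]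
  simp

end DualNumbers

/-! ### Vector fields and semi-invariants on rational functions of a matrix -/

section Model
variable (K : Type*) [Field K] (m : ℕ)

/-- The polynomial functions on `m × m` matrices. -/
abbrev MatPoly := MvPolynomial (Fin m × Fin m) K

/-- The rational functions on `m × m` matrices. -/
abbrev MatRat := FractionRing (MatPoly K m)

variable {m}

/-- The vector field `∑_c x_{ic} ∂/∂x_{jc}`. -/
def matDeriv (i j : Fin m) : Derivation K (MatPoly K m) (MatPoly K m) :=
  MvPolynomial.mkDerivation K fun p => if p.1 = j then MvPolynomial.X (i, p.2) else 0

/-- The vector field `∑_c x_{ic} ∂/∂x_{jc}` on rational functions. -/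
def ratDeriv (i j : Fin m) : Derivation K (MatRat K m) (MatRat K m) :=
  derivLift (matDeriv K i j)

theorem matDeriv_X (i j : Fin m) (p : Fin m × Fin m) :
    matDeriv K i j (MvPolynomial.X p) = if p.1 = j then MvPolynomial.X (i, p.2) else 0 :=
  MvPolynomial.mkDerivation_X _ _ _

theorem matDeriv_lie (i j k l : Fin m) :
    ⁅matDeriv K i j, matDeriv K k l⁆ =
      (if j = k then matDeriv K i l else 0) - (if l = i then matDeriv K k j else 0) := by
  refine MvPolynomial.derivation_ext fun p => ?_
  rw [Derivation.commutator_apply, matDeriv_X, matDeriv_X, Derivation.sub_apply]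
  have e : ∀ (q : Prop) [Decidable q] (D : Derivation K (MatPoly K m) (MatPoly K m)) f,
      (if q then D else 0) f = if q then D f else 0 := by
    intro q _ D f
    split_ifs <;> rfl
  rw [e, e, apply_ite (matDeriv K i j), apply_ite (matDeriv K k l), matDeriv_X, matDeriv_X,
    matDeriv_X, matDeriv_X, map_zero, map_zero]
  simp only [eq_comm (a := k) (b := j), eq_comm (a := i) (b := l)]
  split_ifs <;> simp_all

theorem ratDeriv_lie (i j k l : Fin m) (x : MatRat K m) :
    ratDeriv K i j (ratDeriv K k l x) - ratDeriv K k l (ratDeriv K i j x) =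
      (if j = k then ratDeriv K i l x else 0) - (if l = i then ratDeriv K k j x else 0) := by
  have h : ⁅ratDeriv K i j, ratDeriv K k l⁆ =
      (if j = k then ratDeriv K i l else 0) - (if l = i then ratDeriv K k j else 0) := by
    refine deriv_ext_fraction (MatPoly K m) fun a => ?_
    have h1 := congrArg (algebraMap (MatPoly K m) (MatRat K m))
      (DFunLike.congr_fun (matDeriv_lie K i j k l) a)
    rw [Derivation.commutator_apply] at h1 ⊢
    simp only [ratDeriv, derivLift_algebraMap] at h1 ⊢
    rw [map_sub] at h1
    rw [h1]
    split_ifs <;> simp [derivLift_algebraMap]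
  have h2 := DFunLike.congr_fun h x
  rw [Derivation.commutator_apply] at h2
  rw [h2]
  split_ifs <;> simp

/-- The leading minor of size `k`. -/
def leadingMinor (k : ℕ) (hk : k ≤ m) : MatPoly K m :=
  (Matrix.of fun a b : Fin k => (MvPolynomial.X (Fin.castLE hk a, Fin.castLE hk b) :
    MatPoly K m)).det

theorem leadingMinor_ne_zero (k : ℕ) (hk : k ≤ m) : leadingMinor K k hk ≠ 0 := by
  intro h
  -- Evaluation at the identity matrix.
  have h1 := congrArg (MvPolynomial.aeval (fun p : Fin m × Fin m => if p.1 = p.2 then (1 : K)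
    else 0)) h
  rw [leadingMinor, AlgHom.map_det, map_zero] at h1
  have h2 : (MvPolynomial.aeval (fun p : Fin m × Fin m => if p.1 = p.2 then (1 : K)
      else 0)).mapMatrix (Matrix.of fun a b : Fin k =>
      (MvPolynomial.X (Fin.castLE hk a, Fin.castLE hk b) : MatPoly K m)) = 1 := by
    ext a b
    simp [Matrix.one_apply]
  rw [h2, Matrix.det_one] at h1
  exact one_ne_zero h1

/-- The vector field replaces row `j` by row `i`. For `i < j < k` a row is repeated, for `i = j < k`
nothing changes, and for `k ≤ j` the row does not occur in the minor. -/
theorem ratDeriv_leadingMinor (i j : Fin m) (hij : i ≤ j) (k : ℕ) (hk : k ≤ m) :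
    ratDeriv K i j (algebraMap _ _ (leadingMinor K k hk)) =
      if i = j ∧ (i : ℕ) < k then algebraMap _ _ (leadingMinor K k hk) else 0 := by
  rw [ratDeriv, derivLift_algebraMap]
  by_cases hj : (j : ℕ) < k
  · have hi : (i : ℕ) < k := lt_of_le_of_lt hij hj
    rw [leadingMinor, derivLift_det (L := MatRat K m) (matDeriv K i j) _ ⟨j, hj⟩
      (fun c => MvPolynomial.X (i, Fin.castLE hk c))]
    · by_cases h : i = j
      · subst h
        rw [if_pos ⟨rfl, hj⟩]
        congr 2
        ext1 a b
        by_cases ha : a = ⟨i, hj⟩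
        · subst ha
          rw [Matrix.updateRow_self]
          rfl
        · rw [Matrix.updateRow_ne ha]
      · rw [if_neg fun h' => h h'.1, Matrix.det_zero_of_row_eq (i := ⟨i, hi⟩) (j := ⟨j, hj⟩),
          map_zero]
        · exact fun h' => h (Fin.ext (Fin.mk.inj h'))
        · rw [Matrix.updateRow_self, Matrix.updateRow_ne fun h' => h (Fin.ext (Fin.mk.inj h'))]
          rfl
    · intro c
      rw [Matrix.of_apply, matDeriv_X]
      exact if_pos (Fin.ext rfl)
    · intro p hp c
      rw [Matrix.of_apply, matDeriv_X, if_neg]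
      intro h
      have h' : (p : ℕ) = j := congrArg Fin.val h
      exact hp (Fin.ext h')
  · have : ¬ (i = j ∧ (i : ℕ) < k) := by
      rintro ⟨rfl, h⟩
      exact hj h
    rw [if_neg this, leadingMinor]
    rcases Nat.eq_zero_or_pos k with rfl | hk0
    · simp
    · rw [derivLift_det (L := MatRat K m) (matDeriv K i j) _ ⟨0, hk0⟩ 0]
      · rw [Matrix.det_eq_zero_of_row_eq_zero ⟨0, hk0⟩, map_zero]
        intro c
        rw [Matrix.updateRow_self]
        rfl
      · intro c
        rw [Matrix.of_apply, matDeriv_X, if_neg]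
        · rfl
        · intro h
          have := congrArg Fin.val h
          simp at this
          lia
      · intro p _ c
        rw [Matrix.of_apply, matDeriv_X, if_neg]
        intro h
        have := congrArg Fin.val h
        simp at this
        have := p.2
        lia

/-- Ratios of consecutive leading minors: semi-invariants of weight a coordinate vector. -/
theorem exists_semiinvariants : ∃ g : Fin m → MatRat K m, (∀ k, g k ≠ 0) ∧
    (∀ i j k, i < j → ratDeriv K i j (g k) = 0) ∧
    ∀ i k, ratDeriv K i i (g k) = if i = k then g k else 0 := by
  have hinj := IsFractionRing.injective (MatPoly K m) (MatRat K m)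
  set Δ : (k : ℕ) → k ≤ m → MatRat K m := fun k hk => algebraMap _ _ (leadingMinor K k hk)
  have hΔ : ∀ k hk, Δ k hk ≠ 0 := fun k hk h =>
    leadingMinor_ne_zero K k hk (hinj (h.trans (map_zero _).symm))
  -- The product rule for a minor written as the preceding minor times the ratio. The conditions `i
  -- < k + 1` and `i < k` differ only at `i = k`.
  have key : ∀ (k : Fin m) (i j : Fin m), i ≤ j →
      Δ k k.2.le * ratDeriv K i j (Δ (k + 1) k.2 / Δ k k.2.le) =
        (if i = j ∧ i = k then Δ (k + 1) k.2 else 0) := by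
    intro k i j hij
    have h1 := (ratDeriv K i j).leibniz (Δ k k.2.le) (Δ (k + 1) k.2 / Δ k k.2.le)
    rw [mul_div_cancel₀ _ (hΔ _ _), ratDeriv_leadingMinor K i j hij,
      ratDeriv_leadingMinor K i j hij, smul_eq_mul, smul_eq_mul] at h1
    rw [← sub_eq_iff_eq_add] at h1
    rw [← h1]
    change (if _ then Δ _ _ else 0) - _ * (if _ then Δ _ _ else 0) = _
    by_cases hij' : i = j
    · subst hij'
      simp only [true_and]
      rcases lt_trichotomy (i : ℕ) k with h | h | h
      · rw [if_pos (by lia), if_pos h, if_neg (fun h' => by rw [h'] at h; exact lt_irrefl _ h),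
          div_mul_cancel₀ _ (hΔ _ _), sub_self]
      · rw [if_pos (by lia), if_neg (by lia), if_pos (Fin.ext h), mul_zero, sub_zero]
      · rw [if_neg (by lia), if_neg (by lia), if_neg (fun h' => by
          rw [h'] at h; exact lt_irrefl _ h), mul_zero, sub_zero]
    · simp [hij']
  refine ⟨fun k => Δ (k + 1) k.2 / Δ k k.2.le, fun k => div_ne_zero (hΔ _ _) (hΔ _ _), ?_, ?_⟩
  · intro i j k hij
    have := key k i j hij.le
    rw [if_neg fun h => hij.ne h.1] at this
    exact (mul_eq_zero.1 this).resolve_left (hΔ _ _)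
  · intro i k
    have := key k i i le_rfl
    simp only [true_and] at this
    apply mul_left_cancel₀ (hΔ k k.2.le)
    rw [this]
    split_ifs
    · rw [mul_div_cancel₀ _ (hΔ _ _)]
    · rw [mul_zero]

end Model

/-! ### Representations of the enveloping algebra from operators satisfying the `gl` relations -/

section Env
attribute [local instance 100] LieRing.ofAssociativeRing
variable {F B : Type*} [Field F] [Ring B] [Algebra F B] {m : ℕ}

/-- The representation of the Lie algebra of matrices defined by operators satisfying the
relations of the standard generators. -/
def glLieHom (E : Fin m → Fin m → B) (hE : GlRel E) : Matrix (Fin m) (Fin m) F →ₗ⁅F⁆ B where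
  toFun x := ∑ i, ∑ j, x i j • E i j
  map_add' x y := by
    simp only [Matrix.add_apply, add_smul, Finset.sum_add_distrib]
  map_smul' c x := by
    simp only [Matrix.smul_apply, smul_assoc, Finset.smul_sum, RingHom.id_apply]
  map_lie' := by
    intro x y
    rw [LieRing.of_associative_ring_bracket, LieRing.of_associative_ring_bracket]
    have h1 : (∑ i, ∑ j, x i j • E i j) * (∑ k, ∑ l, y k l • E k l) -
        (∑ k, ∑ l, y k l • E k l) * (∑ i, ∑ j, x i j • E i j) =
        ∑ i, ∑ j, ∑ k, ∑ l, (x i j * y k l) • (E i j * E k l - E k l * E i j) := by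
      have h3 : (∑ k, ∑ l, y k l • E k l) * (∑ i, ∑ j, x i j • E i j) =
          ∑ i, ∑ j, ∑ k, ∑ l, (x i j * y k l) • (E k l * E i j) := by
        simp only [Finset.mul_sum]
        refine Finset.sum_congr rfl fun i _ => Finset.sum_congr rfl fun j _ => ?_
        simp only [Finset.sum_mul, smul_mul_smul_comm, mul_comm (y _ _)]
      have h4 : (∑ i, ∑ j, x i j • E i j) * (∑ k, ∑ l, y k l • E k l) =
          ∑ i, ∑ j, ∑ k, ∑ l, (x i j * y k l) • (E i j * E k l) := by
        simp only [Finset.sum_mul]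
        refine Finset.sum_congr rfl fun i _ => Finset.sum_congr rfl fun j _ => ?_
        simp only [Finset.mul_sum, smul_mul_smul_comm]
      rw [h3, h4]
      simp only [smul_sub, Finset.sum_sub_distrib]
    rw [h1]
    simp only [hE _ _ _ _, smul_sub, Finset.sum_sub_distrib, Matrix.sub_apply, sub_smul,
      Matrix.mul_apply, Finset.sum_smul, smul_ite, smul_zero]
    congr 1
    · refine Finset.sum_congr rfl fun i _ => ?_
      rw [Finset.sum_comm]
      refine Finset.sum_congr rfl fun j _ => ?_
      rw [Finset.sum_comm]
      simp
    · simp only [mul_comm (y _ _)]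
      calc _ = ∑ k, ∑ j, ∑ i, (x i j * y k i) • E k j := by
            refine Finset.sum_congr rfl fun k _ => Finset.sum_congr rfl fun j _ => ?_
            rfl
        _ = ∑ i, ∑ j, ∑ k, (x i j * y k i) • E k j := by
            rw [Finset.sum_comm]
            conv_lhs => enter [2, j]; rw [Finset.sum_comm]
            rw [Finset.sum_comm]
        _ = _ := by
            refine Finset.sum_congr rfl fun i _ => Finset.sum_congr rfl fun j _ =>
              Finset.sum_congr rfl fun k _ => ?_
            simp

/-- The representation of `U(gl_m)` defined by operators satisfying the relations of the standard
generators. -/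
def glLift (E : Fin m → Fin m → B) (hE : GlRel E) : EnvGl F m →ₐ[F] B :=
  UniversalEnvelopingAlgebra.lift F (glLieHom E hE)

theorem glLift_envGen (E : Fin m → Fin m → B) (hE : GlRel E) (k l : Fin m) :
    glLift (F := F) E hE (envGen k l) = E k l := by
  rw [glLift, envGen, UniversalEnvelopingAlgebra.lift_ι_apply]
  change ∑ i, ∑ j, Matrix.single k l (1 : F) i j • E i j = _
  rw [Finset.sum_eq_single k, Finset.sum_eq_single l]
  · simp
  · intro j _ hj
    simp [hj.symm]
  · simp
  · intro i _ hi
    simp [hi.symm]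
  · simp

theorem glRel_envGen : GlRel (envGen : Fin m → Fin m → EnvGl F m) := by
  intro i j k l
  have h : envGen i j * envGen k l - envGen k l * envGen i j =
      UniversalEnvelopingAlgebra.ι F ⁅Matrix.single i j (1 : F), Matrix.single k l 1⁆ := by
    rw [LieHom.map_lie, LieRing.of_associative_ring_bracket]
    rfl
  rw [h, LieRing.of_associative_ring_bracket, map_sub]
  congr 1
  · split_ifs with hjk
    · subst hjk
      rw [Matrix.single_mul_single_same, one_mul]
      rfl
    · rw [Matrix.single_mul_single_of_ne _ _ _ _ hjk, map_zero]
  · split_ifs with hli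
    · subst hli
      rw [Matrix.single_mul_single_same, one_mul]
      rfl
    · rw [Matrix.single_mul_single_of_ne _ _ _ _ hli, map_zero]

theorem env_hom_ext {f g : EnvGl F m →ₐ[F] B} (h : ∀ k l, f (envGen k l) = g (envGen k l)) :
    f = g := by
  refine UniversalEnvelopingAlgebra.hom_ext _ (LieHom.ext fun y => ?_)
  change f (UniversalEnvelopingAlgebra.ι F y) = g (UniversalEnvelopingAlgebra.ι F y)
  have e : UniversalEnvelopingAlgebra.ι F y = ∑ i, ∑ j, y i j • (envGen i j : EnvGl F m) := by
    conv_lhs => rw [Matrix.matrix_eq_sum_single y]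
    rw [map_sum]
    refine Finset.sum_congr rfl fun i _ => ?_
    rw [map_sum]
    refine Finset.sum_congr rfl fun j _ => ?_
    have : Matrix.single i j (y i j) = y i j • Matrix.single i j (1 : F) := by
      rw [Matrix.smul_single, smul_eq_mul, mul_one]
    rw [this, map_smul]
    rfl
  rw [e]
  simp only [map_sum, map_smul, h]

/-- The universal property lifts the generators to a homomorphism into `T`, whose composition with
the inclusion is the identity. -/
theorem env_subalgebra_eq_top (T : Subalgebra F (EnvGl F m)) (h : ∀ k l, envGen k l ∈ T) :
    T = ⊤ := by
  have hE : GlRel fun k l : Fin m => (⟨envGen k l, h k l⟩ : T) := by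
    intro i j k l
    refine Subtype.ext ?_
    have h2 := glRel_envGen (F := F) i j k l
    have e : ∀ (q : Prop) [Decidable q] (a b : Fin m),
        (((if q then (⟨envGen a b, h a b⟩ : T) else 0) : T) : EnvGl F m) =
          if q then envGen a b else 0 := by
      intro q _ a b
      split_ifs <;> rfl
    rw [Subalgebra.coe_sub, Subalgebra.coe_sub, e, e]
    exact h2
  have h4 : T.val.comp (glLift (F := F) _ hE) = AlgHom.id F (EnvGl F m) := by
    refine env_hom_ext fun k l => ?_
    rw [AlgHom.comp_apply, glLift_envGen]
    rfl
  rw [eq_top_iff]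
  intro x _
  have := DFunLike.congr_fun h4 x
  rw [AlgHom.id_apply, AlgHom.comp_apply] at this
  rw [← this]
  exact Subtype.property _

/-- A subspace stable under the generators is stable under `U(gl_m)`. -/
theorem env_smul_mem {V : Type*} [AddCommGroup V] [Module F V] [Module (EnvGl F m) V]
    [IsScalarTower F (EnvGl F m) V] (W : Submodule F V)
    (h : ∀ k l, ∀ w ∈ W, (envGen k l : EnvGl F m) • w ∈ W) (x : EnvGl F m) (w : V)
    (hw : w ∈ W) : x • w ∈ W := by
  let T : Subalgebra F (EnvGl F m) :=
    { carrier := {x | ∀ w ∈ W, x • w ∈ W}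
      mul_mem' := by
        intro x y hx hy w hw
        rw [mul_smul]
        exact hx _ (hy _ hw)
      add_mem' := by
        intro x y hx hy w hw
        rw [add_smul]
        exact W.add_mem (hx _ hw) (hy _ hw)
      algebraMap_mem' := by
        intro c w hw
        rw [algebraMap_smul]
        exact W.smul_mem _ hw }
  have hT : x ∈ T := by
    rw [env_subalgebra_eq_top T h]
    exact Algebra.mem_top
  exact hT w hw

end Env

/-! ## Verma modules -/

section VermaModule
variable {F : Type*} [Field F] {m : ℕ} (μ : Fin m → F)

/-- The operators `e_{ij}` on rational functions, twisted by the character `μ`. -/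
def twistedGen (g : Fin m → MatRat F m) (i j : Fin m) : Module.End F (MatRat F m) :=
  (ratDeriv F i j : MatRat F m →ₗ[F] MatRat F m) +
    LinearMap.mulLeft F (∑ k, algebraMap F _ (μ k) * (ratDeriv F i j (g k) / g k))

/-- Formally, the twist is the conjugation of the vector fields by `∏ g_k^{μ_k}`. Rigorously, the
added logarithmic derivatives form a cocycle. -/
theorem glRel_twistedGen (g : Fin m → MatRat F m) (hg : ∀ k, g k ≠ 0) :
    GlRel (twistedGen μ g) := by
  intro i j k l
  set φ : Fin m → Fin m → MatRat F m := fun i j =>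
    ∑ k, algebraMap F _ (μ k) * (ratDeriv F i j (g k) / g k) with hφ
  -- The cocycle identity: products of two first derivatives are symmetric and cancel, and the
  -- second derivatives combine to a commutator.
  have hφ2 : ∀ i j k l, ratDeriv F i j (φ k l) - ratDeriv F k l (φ i j) =
      (if j = k then φ i l else 0) - (if l = i then φ k j else 0) := by
    intro i j k l
    have h0 : ∀ a b c d, ratDeriv F a b (φ c d) = ∑ k, algebraMap F _ (μ k) *
        (ratDeriv F a b (ratDeriv F c d (g k)) / g k -
          ratDeriv F a b (g k) * ratDeriv F c d (g k) / g k ^ 2) := by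
      intro a b c d
      rw [hφ, map_sum]
      refine Finset.sum_congr rfl fun k _ => ?_
      rw [Derivation.leibniz, Derivation.map_algebraMap, smul_zero, add_zero, smul_eq_mul,
        Derivation.leibniz_div, smul_eq_mul, smul_eq_mul, smul_eq_mul]
      congr 1
      have := hg k
      field_simp
    rw [h0, h0, ← Finset.sum_sub_distrib]
    have h1 : ∀ r, algebraMap F (MatRat F m) (μ r) *
        (ratDeriv F i j (ratDeriv F k l (g r)) / g r -
          ratDeriv F i j (g r) * ratDeriv F k l (g r) / g r ^ 2) -
        algebraMap F (MatRat F m) (μ r) *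
        (ratDeriv F k l (ratDeriv F i j (g r)) / g r -
          ratDeriv F k l (g r) * ratDeriv F i j (g r) / g r ^ 2) =
        (if j = k then algebraMap F (MatRat F m) (μ r) * (ratDeriv F i l (g r) / g r) else 0) -
        (if l = i then algebraMap F (MatRat F m) (μ r) * (ratDeriv F k j (g r) / g r) else 0) := by
      intro r
      have h2 := ratDeriv_lie F i j k l (g r)
      have h3 : ∀ (q : Prop) [Decidable q] (x : MatRat F m),
          (if q then algebraMap F (MatRat F m) (μ r) * (x / g r) else 0) =
            algebraMap F (MatRat F m) (μ r) * ((if q then x else 0) / g r) := by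
        intro q _ x
        split_ifs <;> simp
      rw [h3, h3, ← mul_sub, ← mul_sub, ← sub_div, ← h2]
      ring
    rw [Finset.sum_congr rfl fun r _ => h1 r, Finset.sum_sub_distrib]
    congr 1
    · split_ifs
      · rfl
      · exact Finset.sum_const_zero
    · split_ifs
      · rfl
      · exact Finset.sum_const_zero
  refine LinearMap.ext fun x => ?_
  have happ : ∀ a b y, twistedGen μ g a b y = ratDeriv F a b y + φ a b * y := fun a b y => rfl
  have hite : ∀ (q : Prop) [Decidable q] a b, (if q then twistedGen μ g a b else 0) x =
      (if q then ratDeriv F a b x else 0) + (if q then φ a b else 0) * x := by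
    intro q _ a b
    split_ifs
    · exact happ _ _ _
    · simp
  rw [LinearMap.sub_apply, LinearMap.sub_apply, hite, hite, Module.End.mul_apply,
    Module.End.mul_apply, happ, happ, happ, happ, map_add, map_add, Derivation.leibniz,
    Derivation.leibniz, smul_eq_mul, smul_eq_mul, smul_eq_mul, smul_eq_mul]
  linear_combination ratDeriv_lie F i j k l x + x * hφ2 i j k l

/-- In the twisted model, the constant `1` stands for `∏ g_k^{μ_k}`, a highest weight vector of
weight `μ` because the `g_k` are semi-invariant. The generators of the Verma ideal annihilate it,
but the unit of the enveloping algebra does not, so the ideal is proper. -/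
theorem vermaVec_ne_zero : vermaVec μ ≠ 0 := by
  obtain ⟨g, hg, hg1, hg2⟩ := exists_semiinvariants F (m := m)
  have hE := glRel_twistedGen μ g hg
  -- The annihilator of the function `1`, as a left ideal.
  let N : Submodule (EnvGl F m) (EnvGl F m) :=
    { carrier := {x | glLift (F := F) _ hE x 1 = 0}
      add_mem' := by
        intro x y hx hy
        change glLift (F := F) _ hE (x + y) 1 = 0
        rw [map_add, LinearMap.add_apply, hx, hy, add_zero]
      zero_mem' := by
        change glLift (F := F) _ hE 0 1 = 0
        rw [map_zero, LinearMap.zero_apply]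
      smul_mem' := by
        intro c x hx
        change glLift (F := F) _ hE (c * x) 1 = 0
        rw [map_mul, Module.End.mul_apply, hx, map_zero] }
  have hN : vermaIdeal μ ≤ N := by
    refine Submodule.span_le.2 ?_
    have happ : ∀ a b, twistedGen μ g a b 1 =
        ∑ k, algebraMap F _ (μ k) * (ratDeriv F a b (g k) / g k) := by
      intro a b
      change ratDeriv F a b 1 + _ * 1 = _
      rw [Derivation.map_one_eq_zero, zero_add, mul_one]
    rintro x (⟨k, l, hkl, rfl⟩ | ⟨k, rfl⟩)
    · change glLift (F := F) _ hE (envGen k l) 1 = 0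
      rw [glLift_envGen, happ]
      refine Finset.sum_eq_zero fun r _ => ?_
      rw [hg1 k l r hkl, zero_div, mul_zero]
    · change glLift (F := F) _ hE (envGen k k - algebraMap F _ (μ k)) 1 = 0
      rw [map_sub, glLift_envGen, AlgHom.commutes, LinearMap.sub_apply, happ,
        Finset.sum_eq_single k]
      · rw [hg2, if_pos rfl, div_self (hg k), mul_one, Module.algebraMap_end_apply,
          Algebra.smul_def, mul_one, sub_self]
      · intro r _ hr
        rw [hg2, if_neg hr.symm, zero_div, mul_zero]
      · simp
  intro h
  have h1 : (1 : EnvGl F m) ∈ vermaIdeal μ := (Submodule.Quotient.mk_eq_zero _).1 h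
  have h2 : glLift (F := F) _ hE 1 1 = 0 := hN h1
  have h3 : glLift (F := F) _ hE 1 = 1 := map_one _
  rw [h3] at h2
  exact one_ne_zero (α := MatRat F m) h2

theorem glRel_vermaGen : GlRel (vermaGen μ) :=
  (glRel_envGen (F := F)).map (Algebra.lsmul F F (Verma μ) : EnvGl F m →ₐ[F] _).toRingHom

theorem vermaGen_vermaVec (k l : Fin m) :
    vermaGen μ k l (vermaVec μ) = (vermaIdeal μ).mkQ (envGen k l) := by
  have : (envGen k l : EnvGl F m) • (vermaIdeal μ).mkQ 1 = (vermaIdeal μ).mkQ (envGen k l) := by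
    rw [← map_smul, smul_eq_mul, mul_one]
  exact this

theorem vermaGen_vermaVec_of_lt {k l : Fin m} (h : k < l) :
    vermaGen μ k l (vermaVec μ) = 0 := by
  rw [vermaGen_vermaVec]
  exact (Submodule.Quotient.mk_eq_zero _).2 (Submodule.subset_span (Or.inl ⟨k, l, h, rfl⟩))

theorem vermaGen_vermaVec_diag (k : Fin m) :
    vermaGen μ k k (vermaVec μ) = μ k • vermaVec μ := by
  rw [vermaGen_vermaVec]
  have h : (vermaIdeal μ).mkQ (envGen k k - algebraMap F _ (μ k)) = 0 :=
    (Submodule.Quotient.mk_eq_zero _).2 (Submodule.subset_span (Or.inr ⟨k, rfl⟩))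
  rw [map_sub, sub_eq_zero] at h
  rw [h, Algebra.algebraMap_eq_smul_one]
  rfl

/-- A subspace containing the highest weight vector and stable under the generators is the
whole Verma module. -/
theorem verma_eq_top (W : Submodule F (Verma μ)) (h0 : vermaVec μ ∈ W)
    (h : ∀ k l, ∀ w ∈ W, vermaGen μ k l w ∈ W) : W = ⊤ := by
  rw [eq_top_iff]
  rintro v -
  obtain ⟨x, rfl⟩ := (vermaIdeal μ).mkQ_surjective v
  have e : (vermaIdeal μ).mkQ x = x • vermaVec μ := by
    have : x • (vermaIdeal μ).mkQ 1 = (vermaIdeal μ).mkQ x := by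
      rw [← map_smul, smul_eq_mul, mul_one]
    exact this.symm
  have h2 := env_smul_mem (V := Verma μ) W h x (vermaVec μ) h0
  rw [← e] at h2
  exact h2

end VermaModule

/-! ### The Casimir element and its lowering–raising part -/

section Casimir
variable {A : Type*} [Ring A] {m : ℕ}

/-- The sum of all `e_{ji} e_{ij}` with `i < j`. -/
def lowCasimir (E : Fin m → Fin m → A) : A :=
  ∑ i, ∑ j, if i < j then E j i * E i j else 0

/-- In the Leibniz expansion the contributions of the inner indices cancel in pairs after renaming.
-/
theorem GlRel.commute_casimir {E : Fin m → Fin m → A} (hE : GlRel E) (k l : Fin m) :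
    E k l * (∑ i, ∑ j, E i j * E j i) = (∑ i, ∑ j, E i j * E j i) * E k l := by
  rw [← sub_eq_zero]
  have h1 : E k l * (∑ i, ∑ j, E i j * E j i) - (∑ i, ∑ j, E i j * E j i) * E k l =
      ∑ i, ∑ j, ((E k l * E i j - E i j * E k l) * E j i +
        E i j * (E k l * E j i - E j i * E k l)) := by
    simp only [Finset.mul_sum, Finset.sum_mul]
    rw [← Finset.sum_sub_distrib]
    refine Finset.sum_congr rfl fun i _ => ?_
    rw [← Finset.sum_sub_distrib]
    refine Finset.sum_congr rfl fun j _ => ?_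
    noncomm_ring
  rw [h1]
  simp only [hE _ _ _ _, sub_mul, mul_sub, ite_mul, mul_ite, zero_mul, mul_zero,
    Finset.sum_add_distrib, Finset.sum_sub_distrib]
  simp only [Finset.sum_ite_eq, Finset.sum_ite_eq', Finset.mem_univ, if_true]
  rw [Finset.sum_comm (f := fun i j => if l = i then E k j * E j i else 0),
    Finset.sum_comm (f := fun i j => if i = k then E i j * E j l else 0)]
  simp

/-- Reordering the products with `i < j` by the commutation relations. Thus, up to the central
Casimir element, twice the lowering–raising part depends on the diagonal generators only, and it
acts by a scalar on each weight space of a highest weight module. -/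
theorem GlRel.two_lowCasimir {E : Fin m → Fin m → A} (hE : GlRel E) :
    lowCasimir E + lowCasimir E = (∑ i, ∑ j, E i j * E j i) - (∑ i, E i i * E i i) -
      ∑ i, ∑ j, if i < j then E i i - E j j else 0 := by
  have h1 : ∀ i j, E i j * E j i = (if i < j then E j i * E i j else 0) +
      (if j < i then E i j * E j i else 0) + (if i = j then E i j * E j i else 0) +
      (if i < j then E i i - E j j else 0) := by
    intro i j
    rcases lt_trichotomy i j with h | h | h
    · have := hE i j j i
      rw [if_pos rfl, if_pos rfl, sub_eq_iff_eq_add] at this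
      rw [if_pos h, if_neg h.not_gt, if_neg h.ne, if_pos h, this]
      abel
    · subst h; simp
    · rw [if_neg h.not_gt, if_pos h, if_neg h.ne', if_neg h.not_gt]
      abel
  have h2 : (∑ i, ∑ j, E i j * E j i) = lowCasimir E + lowCasimir E + (∑ i, E i i * E i i) +
      ∑ i, ∑ j, if i < j then E i i - E j j else 0 := by
    rw [Finset.sum_congr rfl fun i _ => Finset.sum_congr rfl fun j _ => h1 i j]
    simp only [Finset.sum_add_distrib]
    congr 2
    · congr 1
      rw [Finset.sum_comm]
      rfl
    · simp
  rw [h2]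
  abel

end Casimir

/-! ### Operators with a spanning family of eigenvectors -/

section Diagonal
variable {F V ι : Type*} [Field F] [AddCommGroup V] [Module F V]

theorem disjoint_eigenspace_span (f : Module.End F V) (w : ι → V) (c : ι → F)
    (h : ∀ i, f (w i) = c i • w i) (d : F) (hd : ∀ i, c i ≠ d) :
    Disjoint (f.eigenspace d) (Submodule.span F (Set.range w)) := by
  refine (f.eigenspaces_iSupIndep d).mono_right ?_
  refine Submodule.span_le.2 ?_
  rintro _ ⟨i, rfl⟩
  exact Submodule.mem_iSup_of_mem (c i) (Submodule.mem_iSup_of_mem (hd i)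
    (Module.End.mem_eigenspace_iff.2 (h i)))

/-- An operator with a spanning family of eigenvectors with nonzero eigenvalues is invertible. -/
theorem exists_inverse_of_eigenvectors (f : Module.End F V) (w : ι → V) (c : ι → F)
    (h : ∀ i, f (w i) = c i • w i) (hw : Submodule.span F (Set.range w) = ⊤)
    (hc : ∀ i, c i ≠ 0) : ∃ T : Module.End F V, f * T = 1 ∧ T * f = 1 ∧
      ∀ i, T (w i) = (c i)⁻¹ • w i := by
  have hinj : Function.Injective f := by
    rw [← LinearMap.ker_eq_bot, eq_bot_iff]
    have := disjoint_eigenspace_span f w c h 0 hc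
    rw [hw, disjoint_top, Module.End.eigenspace_zero] at this
    exact this.le
  have hsurj : Function.Surjective f := by
    rw [← LinearMap.range_eq_top, eq_top_iff, ← hw]
    refine Submodule.span_le.2 ?_
    rintro _ ⟨i, rfl⟩
    refine ⟨(c i)⁻¹ • w i, ?_⟩
    rw [map_smul, h, smul_smul, inv_mul_cancel₀ (hc i), one_smul]
  set e := LinearEquiv.ofBijective f ⟨hinj, hsurj⟩
  refine ⟨e.symm, LinearMap.ext fun x => e.apply_symm_apply x,
    LinearMap.ext fun x => e.symm_apply_apply x, fun i => ?_⟩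
  apply hinj
  change e (e.symm _) = _
  rw [e.apply_symm_apply, map_smul, h, smul_smul, inv_mul_cancel₀ (hc i), one_smul]

end Diagonal

/-! ### Words of lowering operators, weights and the top projection of a Verma module -/

section Words
variable {F : Type*} [Field F] {m : ℕ} (μ : Fin m → F)

/-- A product of operators `e_{ij}` applied to the highest weight vector. -/
def vermaWord : List (Fin m × Fin m) → Verma μ
  | [] => vermaVec μ
  | p :: L => vermaGen μ p.1 p.2 (vermaWord L)

/-- A list of indices of lowering operators. -/
def IsLow (L : List (Fin m × Fin m)) : Prop := ∀ p ∈ L, p.2 < p.1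

/-- The weight of a product of operators `e_{ij}`. -/
def wordWeight : List (Fin m × Fin m) → Fin m → ℤ
  | [] => 0
  | p :: L => wordWeight L + (Pi.single p.1 1 - Pi.single p.2 1)

theorem IsLow.cons {p : Fin m × Fin m} {L : List (Fin m × Fin m)} (h : IsLow (p :: L)) :
    p.2 < p.1 ∧ IsLow L :=
  ⟨h p List.mem_cons_self, fun q hq => h q (List.mem_cons_of_mem _ hq)⟩

/-- Each lowering letter increases the height `∑ k · (weight)_k` by the difference of its indices,
which is at least one. In particular nonempty words do not have weight zero. -/
theorem height_wordWeight {L : List (Fin m × Fin m)} (hL : IsLow L) :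
    (L.length : ℤ) ≤ ∑ k : Fin m, (k : ℤ) * wordWeight L k := by
  induction L with
  | nil => simp [wordWeight]
  | cons p L ih =>
    have h1 := ih hL.cons.2
    have h2 := hL.cons.1
    have h3 : ∑ k : Fin m, (k : ℤ) * wordWeight (p :: L) k =
        ∑ k : Fin m, (k : ℤ) * wordWeight L k + ((p.1 : ℕ) - (p.2 : ℕ)) := by
      simp only [wordWeight, Pi.add_apply, Pi.sub_apply, mul_add, mul_sub, Finset.sum_add_distrib,
        Finset.sum_sub_distrib, Pi.single_apply, mul_ite, mul_one, mul_zero, Finset.sum_ite_eq',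
        Finset.mem_univ, if_true]
    rw [h3, List.length_cons]
    push_cast
    have h4 : (((p.2 : ℕ) : ℤ)) + 1 ≤ ((p.1 : ℕ) : ℤ) := by
      have : (p.2 : ℕ) < p.1 := h2
      exact_mod_cast this
    linarith

theorem vermaGen_comm (i j k l : Fin m) (v : Verma μ) :
    vermaGen μ i j (vermaGen μ k l v) = vermaGen μ k l (vermaGen μ i j v) +
      ((if j = k then vermaGen μ i l v else 0) - (if l = i then vermaGen μ k j v else 0)) := by
  have h := LinearMap.congr_fun (glRel_vermaGen μ i j k l) v
  rw [LinearMap.sub_apply, LinearMap.sub_apply, sub_eq_iff_eq_add'] at h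
  rw [← Module.End.mul_apply, h]
  split_ifs <;> rfl

theorem vermaGen_diag_word (k : Fin m) (L : List (Fin m × Fin m)) :
    vermaGen μ k k (vermaWord μ L) = (μ k + (wordWeight L k : F)) • vermaWord μ L := by
  induction L with
  | nil => simp [vermaWord, wordWeight, vermaGen_vermaVec_diag]
  | cons p L ih =>
    rw [vermaWord, vermaGen_comm, ih, map_smul, wordWeight, Pi.add_apply, Pi.sub_apply,
      Pi.single_apply, Pi.single_apply]
    by_cases h1 : k = p.1 <;> by_cases h2 : k = p.2
    · have h3 : p.2 = k := h2.symm
      simp only [← h1, h3, if_true]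
      simp
    · have h3 : p.2 ≠ k := fun h => h2 h.symm
      simp only [← h1, h2, h3, if_true, if_false]
      push_cast
      module
    · have h3 : p.2 = k := h2.symm
      simp only [h1, h3, if_true, if_false]
      push_cast
      module
    · have h3 : p.2 ≠ k := fun h => h2 h.symm
      simp only [h1, h2, h3, if_false]
      simp

/-- The span of the words in lowering operators is the whole Verma module. -/
theorem span_vermaWord :
    Submodule.span F (Set.range fun L : {L : List (Fin m × Fin m) // IsLow L} =>
      vermaWord μ L) = ⊤ := by
  set W := Submodule.span F (Set.range fun L : {L : List (Fin m × Fin m) // IsLow L} =>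
      vermaWord μ L) with hW
  have hmem : ∀ L, IsLow L → vermaWord μ L ∈ W := fun L hL =>
    Submodule.subset_span ⟨⟨L, hL⟩, rfl⟩
  have hlow : ∀ p : Fin m × Fin m, p.2 < p.1 → ∀ w ∈ W, vermaGen μ p.1 p.2 w ∈ W := by
    intro p hp w hw
    refine Submodule.span_induction (p := fun w _ => vermaGen μ p.1 p.2 w ∈ W) ?_ ?_ ?_ ?_ hw
    · rintro _ ⟨L, rfl⟩
      refine hmem (p :: L) fun q hq => ?_
      rcases List.mem_cons.1 hq with rfl | hq
      · exact hp
      · exact L.2 q hq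
    · rw [map_zero]; exact W.zero_mem
    · intro x y _ _ hx hy
      rw [map_add]; exact W.add_mem hx hy
    · intro c x _ hx
      rw [map_smul]; exact W.smul_mem _ hx
  refine verma_eq_top μ W (hmem [] fun _ h => absurd h List.not_mem_nil) ?_
  -- A generator is commuted past the first letter, which leaves generators acting on a shorter
  -- word; on the empty word the relations of the highest weight vector apply.
  have hword : ∀ L, IsLow L → ∀ k l, vermaGen μ k l (vermaWord μ L) ∈ W := by
    intro L
    induction L with
    | nil =>
      intro _ k l
      rcases lt_trichotomy k l with h | h | h
      · rw [vermaWord, vermaGen_vermaVec_of_lt μ h]; exact W.zero_mem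
      · subst h
        rw [vermaWord, vermaGen_vermaVec_diag]
        exact W.smul_mem _ (hmem [] fun _ h => absurd h List.not_mem_nil)
      · exact hlow (k, l) h _ (hmem [] fun _ h => absurd h List.not_mem_nil)
    | cons p L ih =>
      intro hL k l
      rw [vermaWord, vermaGen_comm]
      refine W.add_mem (hlow p hL.cons.1 _ (ih hL.cons.2 k l)) (W.sub_mem ?_ ?_)
      · split_ifs
        · exact ih hL.cons.2 _ _
        · exact W.zero_mem
      · split_ifs
        · exact ih hL.cons.2 _ _
        · exact W.zero_mem
  intro k l w hw
  refine Submodule.span_induction (p := fun w _ => vermaGen μ k l w ∈ W) ?_ ?_ ?_ ?_ hw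
  · rintro _ ⟨L, rfl⟩
    exact hword L L.2 k l
  · rw [map_zero]; exact W.zero_mem
  · intro x y _ _ hx hy
    rw [map_add]; exact W.add_mem hx hy
  · intro c x _ hx
    rw [map_smul]; exact W.smul_mem _ hx

theorem verma_linearMap_ext {V : Type*} [AddCommGroup V] [Module F V] {f g : Verma μ →ₗ[F] V}
    (h : ∀ L, IsLow L → f (vermaWord μ L) = g (vermaWord μ L)) : f = g :=
  LinearMap.ext_on_range (span_vermaWord μ) fun L => h L L.2

/-- The action of the Casimir element on a highest weight vector of weight `η`. -/
def casimirValue (η : Fin m → F) : F :=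
  ∑ i, η i * η i + ∑ i, ∑ j, if i < j then η i - η j else 0

/-- The eigenvalue of `∑_{i<j} e_{ji} e_{ij}` on the vectors of weight `μ + γ` of `M_μ`. -/
def lowEigenvalue (γ : Fin m → ℤ) : F :=
  (casimirValue μ - casimirValue fun k => μ k + (γ k : F)) / 2

/-- The Casimir element is central, hence acts on all words by its value on the highest weight
vector. On a weight vector, `two_lowCasimir` then determines the lowering–raising part. -/
theorem lowCasimir_word [CharZero F] (L : List (Fin m × Fin m)) :
    lowCasimir (vermaGen μ) (vermaWord μ L) = lowEigenvalue μ (wordWeight L) • vermaWord μ L := by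
  have hE := glRel_vermaGen μ
  set Ω : Module.End F (Verma μ) := ∑ i, ∑ j, vermaGen μ i j * vermaGen μ j i with hΩ
  have hdiag : ∀ (η : Fin m → F) (v : Verma μ), (∀ k, vermaGen μ k k v = η k • v) →
      Ω v = casimirValue η • v + (lowCasimir (vermaGen μ) v + lowCasimir (vermaGen μ) v) := by
    intro η v hv
    have h := LinearMap.congr_fun hE.two_lowCasimir v
    rw [LinearMap.add_apply, LinearMap.sub_apply, LinearMap.sub_apply] at h
    rw [h, casimirValue, add_smul, Finset.sum_smul, Finset.sum_smul, LinearMap.sum_apply,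
      LinearMap.sum_apply]
    have h1 : ∀ i, (vermaGen μ i i * vermaGen μ i i) v = (η i * η i) • v := fun i => by
      rw [Module.End.mul_apply, hv, map_smul, hv, smul_smul]
    have h2 : ∀ i j, (if i < j then vermaGen μ i i - vermaGen μ j j else 0) v =
        (if i < j then η i - η j else 0) • v := fun i j => by
      split_ifs
      · rw [LinearMap.sub_apply, hv, hv, sub_smul]
      · rw [LinearMap.zero_apply, zero_smul]
    simp only [h1, h2, Finset.sum_smul, LinearMap.sum_apply]
    abel
  have h0 : Ω (vermaVec μ) = casimirValue μ • vermaVec μ := by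
    rw [hdiag μ _ (vermaGen_vermaVec_diag μ)]
    have : lowCasimir (vermaGen μ) (vermaVec μ) = 0 := by
      rw [lowCasimir, LinearMap.sum_apply]
      refine Finset.sum_eq_zero fun i _ => ?_
      rw [LinearMap.sum_apply]
      refine Finset.sum_eq_zero fun j _ => ?_
      split_ifs with h
      · rw [Module.End.mul_apply, vermaGen_vermaVec_of_lt μ h, map_zero]
      · rfl
    rw [this, add_zero, add_zero]
  have hΩw : Ω (vermaWord μ L) = casimirValue μ • vermaWord μ L := by
    induction L with
    | nil => exact h0
    | cons p L ih =>
      have h := LinearMap.congr_fun (hE.commute_casimir p.1 p.2) (vermaWord μ L)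
      rw [Module.End.mul_apply, Module.End.mul_apply] at h
      rw [vermaWord, ← h, ih, map_smul]
  rw [hdiag _ _ fun k => vermaGen_diag_word μ k L] at hΩw
  rw [lowEigenvalue, div_eq_inv_mul, mul_smul, sub_smul, ← hΩw, add_sub_cancel_left, ← two_smul F,
    smul_smul, inv_mul_cancel₀ two_ne_zero, one_smul]

/-- Highest weights for which the eigenvalues in the construction of singular vectors do not
vanish. -/
def IsGeneric : Prop :=
  (∀ L : List (Fin m × Fin m), IsLow L → L ≠ [] → lowEigenvalue μ (wordWeight L) ≠ 0) ∧
  ∀ k l : Fin m, k < l → ∀ L : List (Fin m × Fin m), IsLow L →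
    lowEigenvalue μ (wordWeight L) + (μ k + (wordWeight L k : F)) -
      (μ l + (wordWeight L l : F)) ≠ 0

variable {μ}

theorem lowEigenvalue_nil : lowEigenvalue μ (wordWeight []) = 0 := by
  simp [lowEigenvalue, wordWeight]

/-- The projection of a Verma module to its highest weight component. -/
theorem exists_vermaProj [CharZero F] (hμ : IsGeneric μ) : ∃ ε : Verma μ →ₗ[F] F,
    ε (vermaVec μ) = 1 ∧ ∀ L, IsLow L → L ≠ [] → ε (vermaWord μ L) = 0 := by
  set W := Submodule.span F (Set.range fun L : {L : List (Fin m × Fin m) // IsLow L ∧ L ≠ []} =>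
      vermaWord μ L) with hW
  have hd := disjoint_eigenspace_span (lowCasimir (vermaGen μ))
    (fun L : {L : List (Fin m × Fin m) // IsLow L ∧ L ≠ []} => vermaWord μ L)
    (fun L => lowEigenvalue μ (wordWeight L)) (fun L => lowCasimir_word μ L) 0
    fun L => hμ.1 L L.2.1 L.2.2
  -- The highest weight vector is a nonzero eigenvector of eigenvalue zero, while the span of the
  -- nonempty words lies in a sum of eigenspaces of nonzero eigenvalues.
  have hv : vermaVec μ ∉ W := by
    intro h
    refine vermaVec_ne_zero μ (Submodule.disjoint_def.1 hd _ ?_ h)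
    rw [Module.End.mem_eigenspace_iff]
    have := lowCasimir_word μ []
    rwa [lowEigenvalue_nil] at this
  obtain ⟨f, hf, hfW⟩ := Submodule.exists_le_ker_of_notMem hv
  refine ⟨(f (vermaVec μ))⁻¹ • f, ?_, fun L hL hL' => ?_⟩
  · rw [LinearMap.smul_apply, smul_eq_mul, inv_mul_cancel₀ hf]
  · have : f (vermaWord μ L) = 0 := hfW (Submodule.subset_span ⟨⟨L, hL, hL'⟩, rfl⟩)
    rw [LinearMap.smul_apply, this, smul_zero]

/-- The projection of a Verma module to its highest weight component. -/
def IsVermaProj (ε : Verma μ →ₗ[F] F) : Prop :=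
  ε (vermaVec μ) = 1 ∧ ∀ L, IsLow L → L ≠ [] → ε (vermaWord μ L) = 0

variable {ε : Verma μ →ₗ[F] F}

theorem IsVermaProj.gen_diag (hε : IsVermaProj ε) (k : Fin m) (v : Verma μ) :
    ε (vermaGen μ k k v) = μ k * ε v := by
  have : ε ∘ₗ vermaGen μ k k = μ k • ε := by
    refine verma_linearMap_ext μ fun L hL => ?_
    rw [LinearMap.comp_apply, LinearMap.smul_apply, vermaGen_diag_word, map_smul]
    rcases L with _ | ⟨p, L⟩
    · simp [wordWeight]
    · rw [hε.2 _ hL (List.cons_ne_nil _ _), smul_zero, smul_zero]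
  exact LinearMap.congr_fun this v

theorem IsVermaProj.gen_low (hε : IsVermaProj ε) {i j : Fin m} (hij : i < j) (v : Verma μ) :
    ε (vermaGen μ j i v) = 0 := by
  have : ε ∘ₗ vermaGen μ j i = 0 := by
    refine verma_linearMap_ext μ fun L hL => ?_
    refine hε.2 ((j, i) :: L) (fun q hq => ?_) (List.cons_ne_nil _ _)
    rcases List.mem_cons.1 hq with rfl | hq
    · exact hij
    · exact hL q hq
  exact LinearMap.congr_fun this v

/-- A weight vector `v` with `k`-th weight `η k` satisfies `η k * ε v = μ k * ε v`. -/
theorem IsVermaProj.lower_le_ker (hε : IsVermaProj ε) : vermaLower μ ≤ LinearMap.ker ε := by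
  refine iSup_le fun η => iSup_le fun hη v hv => ?_
  obtain ⟨k, hk⟩ := Function.ne_iff.1 hη
  have h1 := (Submodule.mem_iInf _).1 hv k
  rw [Module.End.mem_eigenspace_iff] at h1
  have h2 := hε.gen_diag k v
  rw [h1, map_smul, smul_eq_mul, ← sub_eq_zero, ← sub_mul] at h2
  exact (mul_eq_zero.1 h2).resolve_left (sub_ne_zero.2 hk)

theorem vermaWord_mem_lower [CharZero F] {L : List (Fin m × Fin m)} (hL : IsLow L)
    (hL' : L ≠ []) : vermaWord μ L ∈ vermaLower μ := by
  refine Submodule.mem_iSup_of_mem (fun k => μ k + (wordWeight L k : F)) ?_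
  refine Submodule.mem_iSup_of_mem ?_ ((Submodule.mem_iInf _).2 fun k =>
    Module.End.mem_eigenspace_iff.2 (vermaGen_diag_word μ k L))
  intro h
  have h1 : ∀ k, wordWeight L k = 0 := fun k => by
    have := congrFun h k
    simpa using this
  have h2 := height_wordWeight hL
  simp only [h1, mul_zero, Finset.sum_const_zero] at h2
  have : 0 < L.length := List.length_pos_of_ne_nil hL'
  lia

theorem IsVermaProj.sub_mem_lower [CharZero F] (hε : IsVermaProj ε) (v : Verma μ) :
    v - ε v • vermaVec μ ∈ vermaLower μ := by
  have : (vermaLower μ).mkQ ∘ₗ (LinearMap.id - ε.smulRight (vermaVec μ)) = 0 := by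
    refine verma_linearMap_ext μ fun L hL => ?_
    rw [LinearMap.comp_apply, LinearMap.zero_apply, Submodule.mkQ_apply,
      Submodule.Quotient.mk_eq_zero, LinearMap.sub_apply, LinearMap.smulRight_apply]
    rcases L with _ | ⟨p, L⟩
    · have : ε (vermaWord μ []) = 1 := hε.1
      rw [this, one_smul]
      simp [vermaWord]
    · rw [hε.2 _ hL (List.cons_ne_nil _ _), zero_smul, sub_zero]
      exact vermaWord_mem_lower hL (List.cons_ne_nil _ _)
  have h := LinearMap.congr_fun this v
  exact (Submodule.Quotient.mk_eq_zero _).1 h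

/-- The inverse of `∑_{i<j} e_{ji} e_{ij}` on the vectors of lower weight. -/
theorem exists_lowCasimir_inverse [CharZero F] (hμ : IsGeneric μ) (hε : IsVermaProj ε) :
    ∃ T : Module.End F (Verma μ), (∀ v, lowCasimir (vermaGen μ) (T v) = v - ε v • vermaVec μ) ∧
      (∀ v, T (lowCasimir (vermaGen μ) v) = v - ε v • vermaVec μ) ∧ (∀ v, ε (T v) = ε v) ∧
      (∀ k v, T (vermaGen μ k k v) = vermaGen μ k k (T v)) ∧
      ∀ L, IsLow L → L ≠ [] → T (vermaWord μ L) =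
        (lowEigenvalue μ (wordWeight L))⁻¹ • vermaWord μ L := by
  -- The low Casimir element annihilates the highest weight vector. Adding the projection onto that
  -- vector gives it the eigenvalue `1` and makes the operator invertible.
  obtain ⟨T, hT1, hT2, hT3⟩ := exists_inverse_of_eigenvectors
    (lowCasimir (vermaGen μ) + ε.smulRight (vermaVec μ))
    (fun L : {L : List (Fin m × Fin m) // IsLow L} => vermaWord μ L)
    (fun L => if (L : List (Fin m × Fin m)) = [] then 1 else lowEigenvalue μ (wordWeight L))
    (by
      rintro ⟨L, hL⟩
      rw [LinearMap.add_apply, lowCasimir_word, LinearMap.smulRight_apply]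
      rcases L with _ | ⟨p, L⟩
      · have : ε (vermaWord μ []) = 1 := hε.1
        rw [lowEigenvalue_nil, this, zero_smul, zero_add]
        rfl
      · rw [hε.2 _ hL (List.cons_ne_nil _ _), zero_smul, add_zero, if_neg (List.cons_ne_nil _ _)])
    (span_vermaWord μ) (by
      rintro ⟨L, hL⟩
      split_ifs with h
      · exact one_ne_zero
      · exact hμ.1 L hL h)
  have hεT : ∀ v, ε (T v) = ε v := by
    have : ε ∘ₗ T = ε := by
      refine verma_linearMap_ext μ fun L hL => ?_
      rw [LinearMap.comp_apply, hT3 ⟨L, hL⟩, map_smul]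
      rcases L with _ | ⟨p, L⟩
      · simp
      · rw [hε.2 _ hL (List.cons_ne_nil _ _), smul_zero]
    exact fun v => LinearMap.congr_fun this v
  have hT0 : T (vermaVec μ) = vermaVec μ := by
    have : T (vermaWord μ []) = _ := hT3 ⟨[], fun _ h => absurd h List.not_mem_nil⟩
    rwa [if_pos rfl, inv_one, one_smul] at this
  refine ⟨T, fun v => ?_, fun v => ?_, hεT, fun k v => ?_, fun L hL hL' => ?_⟩
  · have h := LinearMap.congr_fun hT1 v
    rw [Module.End.mul_apply, LinearMap.add_apply, LinearMap.smulRight_apply, hεT,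
      Module.End.one_apply] at h
    exact eq_sub_of_add_eq h
  · have h := LinearMap.congr_fun hT2 v
    rw [Module.End.mul_apply, LinearMap.add_apply, LinearMap.smulRight_apply, map_add, map_smul,
      hT0, Module.End.one_apply] at h
    exact eq_sub_of_add_eq h
  · have : T ∘ₗ vermaGen μ k k = vermaGen μ k k ∘ₗ T := by
      refine verma_linearMap_ext μ fun L hL => ?_
      rw [LinearMap.comp_apply, LinearMap.comp_apply, hT3 ⟨L, hL⟩, map_smul, vermaGen_diag_word,
        map_smul, hT3 ⟨L, hL⟩, smul_comm]
    exact LinearMap.congr_fun this v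
  · rw [hT3 ⟨L, hL⟩, if_neg hL']

/-- The second half of `IsGeneric` is the nonvanishing of the eigenvalues of this operator. It
arises when `e_{kl}` is commuted past the sum characterizing singular vectors. -/
theorem exists_lowCasimir_diag_inverse [CharZero F] (hμ : IsGeneric μ) {k l : Fin m}
    (hkl : k < l) : ∃ T : Module.End F (Verma μ),
      T * (lowCasimir (vermaGen μ) + vermaGen μ k k - vermaGen μ l l) = 1 := by
  obtain ⟨T, -, hT, -⟩ := exists_inverse_of_eigenvectors
    (lowCasimir (vermaGen μ) + vermaGen μ k k - vermaGen μ l l)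
    (fun L : {L : List (Fin m × Fin m) // IsLow L} => vermaWord μ L)
    (fun L => lowEigenvalue μ (wordWeight L) + (μ k + (wordWeight L k : F)) -
      (μ l + (wordWeight L l : F)))
    (by
      rintro ⟨L, hL⟩
      rw [LinearMap.sub_apply, LinearMap.add_apply, lowCasimir_word, vermaGen_diag_word,
        vermaGen_diag_word, sub_smul, add_smul (lowEigenvalue _ _)])
    (span_vermaWord μ) fun L => hμ.2 k l hkl L L.2
  exact ⟨T, hT⟩

end Words

/-! ## The operators on `S^(m)(a)` -/

section SymTensorModule
variable {m n : ℕ}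

theorem symGen_coe {a : ℕ} (k l : Fin m) (p : SymPow m a) :
    (symGen k l p).1 = MvPolynomial.X k * MvPolynomial.pderiv l p.1 := rfl

theorem pderiv_comm' {σ : Type*} (k l : σ) (p : MvPolynomial σ ℂ) :
    MvPolynomial.pderiv k (MvPolynomial.pderiv l p) =
      MvPolynomial.pderiv l (MvPolynomial.pderiv k p) := by
  classical
  have h : ⁅MvPolynomial.pderiv (R := ℂ) k, MvPolynomial.pderiv (R := ℂ) l⁆ = 0 := by
    refine MvPolynomial.derivation_ext fun i => ?_
    rw [Derivation.commutator_apply, MvPolynomial.pderiv_X, MvPolynomial.pderiv_X]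
    simp only [Pi.single_apply, apply_ite (MvPolynomial.pderiv (R := ℂ) _), map_zero,
      Derivation.map_one_eq_zero, ite_self, sub_self]
    rfl
  have := DFunLike.congr_fun h p
  rw [Derivation.commutator_apply] at this
  exact sub_eq_zero.1 this

theorem symGen_symGen {a : ℕ} (i j k l : Fin m) (p : SymPow m a) :
    (symGen i j (symGen k l p)).1 =
      (if j = k then MvPolynomial.X i * MvPolynomial.pderiv l p.1 else 0) +
        MvPolynomial.X i * MvPolynomial.X k *
          MvPolynomial.pderiv j (MvPolynomial.pderiv l p.1) := by
  rw [symGen_coe, symGen_coe, Derivation.leibniz, MvPolynomial.pderiv_X, smul_eq_mul, smul_eq_mul,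
    Pi.single_apply]
  simp only [eq_comm (a := k) (b := j)]
  split_ifs <;> ring

theorem symPow_coe_ite {a : ℕ} (q : Prop) [Decidable q] (i j : Fin m) (p : SymPow m a) :
    ((if q then symGen i j else 0 : Module.End ℂ (SymPow m a)) p).1 =
      if q then MvPolynomial.X i * MvPolynomial.pderiv j p.1 else 0 := by
  split_ifs <;> rfl

theorem glRel_symGen (a : ℕ) : GlRel (symGen : Fin m → Fin m → Module.End ℂ (SymPow m a)) := by
  intro i j k l
  refine LinearMap.ext fun p => Subtype.ext ?_
  change (symGen i j (symGen k l p)).1 - (symGen k l (symGen i j p)).1 =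
    ((if j = k then symGen i l else 0 : Module.End ℂ (SymPow m a)) p).1 -
      ((if l = i then symGen k j else 0 : Module.End ℂ (SymPow m a)) p).1
  rw [symGen_symGen, symGen_symGen, symPow_coe_ite, symPow_coe_ite, pderiv_comm' l j]
  ring

theorem rankOneRel_symGen (a : ℕ) :
    RankOneRel (symGen : Fin m → Fin m → Module.End ℂ (SymPow m a)) := by
  intro i j k l
  refine LinearMap.ext fun p => Subtype.ext ?_
  change (symGen i j (symGen k l p)).1 - (symGen k j (symGen i l p)).1 =
    ((if j = k then symGen i l else 0 : Module.End ℂ (SymPow m a)) p).1 -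
      ((if i = j then symGen k l else 0 : Module.End ℂ (SymPow m a)) p).1
  rw [symGen_symGen, symGen_symGen, symPow_coe_ite, symPow_coe_ite]
  simp only [eq_comm (a := j) (b := i)]
  ring

/-- The homomorphism placing an operator in the `i`-th tensor factor. -/
def slotHom (a : Fin n → ℕ) (i : Fin n) :
    Module.End ℂ (SymPow m (a i)) →+* Module.End ℂ (SymTensor m a) where
  toFun f := PiTensorProduct.map (R := ℂ) (s := fun i => SymPow m (a i))
    (t := fun i => SymPow m (a i)) (Function.update (fun _ => LinearMap.id) i f)
  map_one' := by
    have : Function.update (fun j => (LinearMap.id : Module.End ℂ (SymPow m (a j)))) i 1 =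
        fun j => LinearMap.id := Function.update_eq_self i _
    rw [this]
    exact PiTensorProduct.map_id
  map_mul' f g := by
    have : Function.update (fun j => (LinearMap.id : Module.End ℂ (SymPow m (a j)))) i (f * g) =
        fun j => Function.update (fun j => (LinearMap.id : Module.End ℂ (SymPow m (a j)))) i f j ∘ₗ
          Function.update (fun j => (LinearMap.id : Module.End ℂ (SymPow m (a j)))) i g j := by
      ext1 j
      by_cases h : j = i
      · subst h; simp only [Function.update_self]; rfl
      · simp only [Function.update_of_ne h]; rfl
    rw [this]
    exact PiTensorProduct.map_comp _ _
  map_zero' := by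
    have := PiTensorProduct.map_update_smul (R := ℂ) (s := fun i => SymPow m (a i))
      (t := fun i => SymPow m (a i)) (fun _ => LinearMap.id) i 0 0
    rw [zero_smul, zero_smul] at this
    exact this
  map_add' f g := PiTensorProduct.map_update_add _ _ _ _

theorem slotHom_commute (a : Fin n → ℕ) {i j : Fin n} (hij : i ≠ j)
    (f : Module.End ℂ (SymPow m (a i))) (g : Module.End ℂ (SymPow m (a j))) :
    Commute (slotHom a i f) (slotHom a j g) := by
  have h : ∀ s, Function.update (fun j => (LinearMap.id : Module.End ℂ (SymPow m (a j)))) i f s ∘ₗ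
      Function.update (fun j => (LinearMap.id : Module.End ℂ (SymPow m (a j)))) j g s =
      Function.update (fun j => (LinearMap.id : Module.End ℂ (SymPow m (a j)))) j g s ∘ₗ
      Function.update (fun j => (LinearMap.id : Module.End ℂ (SymPow m (a j)))) i f s := by
    intro s
    by_cases h1 : s = i
    · subst h1
      rw [Function.update_of_ne hij]
      rfl
    · rw [Function.update_of_ne h1]
      rfl
  have e1 := PiTensorProduct.map_comp (R := ℂ)
    (Function.update (fun j => (LinearMap.id : Module.End ℂ (SymPow m (a j)))) i f)
    (Function.update (fun j => (LinearMap.id : Module.End ℂ (SymPow m (a j)))) j g)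
  have e2 := PiTensorProduct.map_comp (R := ℂ)
    (Function.update (fun j => (LinearMap.id : Module.End ℂ (SymPow m (a j)))) j g)
    (Function.update (fun j => (LinearMap.id : Module.End ℂ (SymPow m (a j)))) i f)
  rw [funext h] at e1
  exact e1.symm.trans e2

theorem glRel_siteGen (a : Fin n → ℕ) (i : Fin n) :
    GlRel (siteGen a i : Fin m → Fin m → Module.End ℂ (SymTensor m a)) :=
  (glRel_symGen (a i)).map (slotHom a i)

theorem rankOneRel_siteGen (a : Fin n → ℕ) (i : Fin n) :
    RankOneRel (siteGen a i : Fin m → Fin m → Module.End ℂ (SymTensor m a)) :=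
  (rankOneRel_symGen (a i)).map (slotHom a i)

theorem siteGen_commute (a : Fin n → ℕ) {i j : Fin n} (hij : i ≠ j) (k l k' l' : Fin m) :
    Commute (siteGen a i k l : Module.End ℂ (SymTensor m a)) (siteGen a j k' l') :=
  slotHom_commute a hij _ _

theorem GlRel.sum {A ι κ : Type*} [Ring A] [DecidableEq ι] [DecidableEq κ] (s : Finset κ)
    (E : κ → ι → ι → A) (hE : ∀ r, GlRel (E r))
    (hc : ∀ r r', r ≠ r' → ∀ i j k l, Commute (E r i j) (E r' k l)) :
    GlRel fun i j => ∑ r ∈ s, E r i j := by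
  intro i j k l
  simp only [Finset.sum_mul_sum]
  rw [Finset.sum_comm (f := fun i_1 j_1 => E i_1 k l * E j_1 i j), ← Finset.sum_sub_distrib]
  have h : ∀ r ∈ s, (∑ r' ∈ s, E r i j * E r' k l) - ∑ r' ∈ s, E r' k l * E r i j =
      (if j = k then E r i l else 0) - (if l = i then E r k j else 0) := by
    intro r hr
    rw [← Finset.sum_sub_distrib, Finset.sum_eq_single r]
    · exact hE r i j k l
    · intro r' _ hr'
      rw [(hc r r' hr'.symm i j k l).eq, sub_self]
    · exact fun h => absurd hr h
  rw [Finset.sum_congr rfl h, Finset.sum_sub_distrib]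
  congr 1 <;> split_ifs <;> simp

/-- The action of `e_{kl}` on `S^(m)(a)`. -/
def siteSum (a : Fin n → ℕ) (k l : Fin m) : Module.End ℂ (SymTensor m a) :=
  ∑ i, siteGen a i k l

theorem glRel_siteSum (a : Fin n → ℕ) :
    GlRel (siteSum a : Fin m → Fin m → Module.End ℂ (SymTensor m a)) :=
  GlRel.sum Finset.univ _ (glRel_siteGen a) fun _ _ h => siteGen_commute a h

instance (a : ℕ) : Module.Finite ℂ (SymPow m a) :=
  Module.Finite.iff_fg.2 (MvPolynomial.homogeneousSubmodule_fg (Fin m) ℂ a)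

instance (a : Fin n → ℕ) : Module.Finite ℂ (SymTensor m a) :=
  inferInstanceAs (Module.Finite ℂ (⨂[ℂ] i : Fin n, SymPow m (a i)))

/-! ### Nilpotency of the raising operators -/

/-- The component of a homogeneous polynomial along a monomial. -/
def monoPart {a : ℕ} (d : Fin m →₀ ℕ) (p : SymPow m a) : SymPow m a :=
  ⟨MvPolynomial.monomial d (MvPolynomial.coeff d p.1), by
    rw [MvPolynomial.mem_homogeneousSubmodule]
    by_cases h : MvPolynomial.coeff d p.1 = 0
    · rw [h, map_zero]
      exact MvPolynomial.isHomogeneous_zero _ _ _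
    · have h2 : p.1.IsHomogeneous a := (MvPolynomial.mem_homogeneousSubmodule _ _).1 p.2
      refine MvPolynomial.isHomogeneous_monomial _ ?_
      rw [Finsupp.degree_eq_weight_one]
      exact h2 h⟩

theorem sum_monoPart {a : ℕ} (p : SymPow m a) : ∑ d ∈ p.1.support, monoPart d p = p := by
  refine Subtype.ext ?_
  have : ∀ s : Finset (Fin m →₀ ℕ), (∑ d ∈ s, monoPart d p).1 =
      ∑ d ∈ s, MvPolynomial.monomial d (MvPolynomial.coeff d p.1) := by
    intro s
    exact map_sum (MvPolynomial.homogeneousSubmodule (Fin m) ℂ a).subtype _ _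
  rw [this]
  exact p.1.support_sum_monomial_coeff

theorem symGen_monoPart {a : ℕ} (k : Fin m) (d : Fin m →₀ ℕ) (p : SymPow m a) :
    symGen k k (monoPart d p) = (d k : ℂ) • monoPart d p := by
  refine Subtype.ext ?_
  change MvPolynomial.X k * MvPolynomial.pderiv k (MvPolynomial.monomial d _) =
    (d k : ℂ) • MvPolynomial.monomial d _
  rw [MvPolynomial.pderiv_monomial, MvPolynomial.X, MvPolynomial.monomial_mul, one_mul,
    MvPolynomial.smul_monomial, smul_eq_mul, mul_comm]
  by_cases h : d k = 0
  · rw [h]; simp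
  · rw [add_tsub_cancel_of_le]
    rw [Finsupp.single_le_iff]
    lia

/-- A pure tensor. -/
def symTprod (a : Fin n → ℕ) (f : ∀ i, SymPow m (a i)) : SymTensor m a :=
  PiTensorProduct.tprod ℂ f

theorem span_symTprod (a : Fin n → ℕ) :
    Submodule.span ℂ (Set.range (symTprod (m := m) a)) = ⊤ :=
  PiTensorProduct.span_tprod_eq_top

theorem siteGen_tprod (a : Fin n → ℕ) (i : Fin n) (k l : Fin m) (f : ∀ i, SymPow m (a i)) :
    siteGen a i k l (symTprod a f) =
      symTprod a (Function.update f i (symGen k l (f i))) := by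
  have h := PiTensorProduct.map_tprod (R := ℂ) (s := fun i => SymPow m (a i))
    (t := fun i => SymPow m (a i)) (Function.update (fun _ => LinearMap.id) i (symGen k l)) f
  refine h.trans (congrArg (symTprod a) ?_)
  ext1 j
  by_cases hj : j = i
  · subst hj; simp
  · simp [Function.update_of_ne hj]

/-- The operator `∑ k e_{kk}` on `S^(m)(a)`. -/
def heightOp (a : Fin n → ℕ) : Module.End ℂ (SymTensor m a) :=
  ∑ k : Fin m, (k : ℕ) • siteSum a k k

theorem heightOp_monoPart (a : Fin n → ℕ) (f : ∀ i, SymPow m (a i)) (d : Fin n → Fin m →₀ ℕ) :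
    heightOp a (symTprod a fun i => monoPart (d i) (f i)) =
      ((∑ k : Fin m, (k : ℕ) * ∑ i, d i k : ℕ) : ℂ) •
        symTprod a fun i => monoPart (d i) (f i) := by
  rw [heightOp, LinearMap.sum_apply]
  push_cast
  rw [Finset.sum_smul]
  refine Finset.sum_congr rfl fun k _ => ?_
  rw [LinearMap.smul_apply, mul_smul, Nat.cast_smul_eq_nsmul ℂ (k : ℕ)]
  congr 1
  rw [siteSum, LinearMap.sum_apply, Finset.sum_smul]
  refine Finset.sum_congr rfl fun i _ => ?_
  rw [siteGen_tprod, symGen_monoPart]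
  refine (MultilinearMap.map_update_smul (PiTensorProduct.tprod ℂ) _ i _ _).trans ?_
  rw [Function.update_eq_self]
  rfl

/-- Tensor products of monomials are eigenvectors. Their eigenvalues are natural numbers, bounded
because the total degree of the monomials is `∑ i, a i` and each index is less than `m`. -/
theorem iSup_heightOp (a : Fin n → ℕ) :
    (⨆ t ∈ Finset.range (m * ∑ i, a i + 1), (heightOp (m := m) a).eigenspace (t : ℂ)) = ⊤ := by
  rw [eq_top_iff]
  refine le_trans (le_of_eq (span_symTprod a).symm) (Submodule.span_le.2 ?_)
  rintro _ ⟨f, rfl⟩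
  have h1 : f = fun i => ∑ d ∈ (f i).1.support, monoPart d (f i) :=
    funext fun i => (sum_monoPart (f i)).symm
  have h0 := MultilinearMap.map_sum_finset (PiTensorProduct.tprod ℂ)
    (fun i d => monoPart d (f i)) fun i => (f i).1.support
  rw [← h1] at h0
  have h00 : symTprod a f = ∑ d ∈ Fintype.piFinset fun i => (f i).1.support,
      symTprod a fun i => monoPart (d i) (f i) := h0
  rw [h00]
  refine Submodule.sum_mem _ fun d hd => ?_
  rw [Fintype.mem_piFinset] at hd
  refine Submodule.mem_iSup_of_mem (∑ k : Fin m, (k : ℕ) * ∑ i, d i k) ?_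
  refine Submodule.mem_iSup_of_mem ?_ (Module.End.mem_eigenspace_iff.2 (heightOp_monoPart a f d))
  rw [Finset.mem_range, Nat.lt_succ_iff, Finset.mul_sum]
  have h2 : ∀ i, ∑ k, d i k = a i := by
    intro i
    have h3 : (f i).1.IsHomogeneous (a i) := (MvPolynomial.mem_homogeneousSubmodule _ _).1 (f i).2
    have h4 := h3 (MvPolynomial.mem_support_iff.1 (hd i))
    rw [← Finsupp.degree_eq_sum, Finsupp.degree_eq_weight_one]
    exact h4
  calc ∑ k : Fin m, (k : ℕ) * ∑ i, d i k ≤ ∑ k : Fin m, m * ∑ i, d i k :=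
        Finset.sum_le_sum fun k _ => Nat.mul_le_mul_right _ k.2.le
    _ = ∑ i, m * a i := by
        rw [← Finset.mul_sum, Finset.sum_comm, Finset.mul_sum]
        simp only [h2]

/-- Operators lowering an eigenvalue that takes finitely many natural values are jointly
nilpotent. -/
theorem list_prod_eq_zero_of_lowering {V : Type*} [AddCommGroup V] [Module ℂ V]
    (h : Module.End ℂ V) (H : ℕ) (hH : (⨆ t ∈ Finset.range (H + 1), h.eigenspace (t : ℂ)) = ⊤)
    (L : List (Module.End ℂ V)) (hL : ∀ x ∈ L, ∃ d : ℕ, 0 < d ∧ h * x = x * h - d • x)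
    (hlen : H < L.length) : L.prod = 0 := by
  have h1 : ∀ (L : List (Module.End ℂ V)), (∀ x ∈ L, ∃ d : ℕ, 0 < d ∧ h * x = x * h - d • x) →
      ∃ D : ℕ, L.length ≤ D ∧ ∀ (c : ℂ) (v : V), h v = c • v →
        h (L.prod v) = (c - D) • L.prod v := by
    intro L
    induction L with
    | nil =>
      intro _
      exact ⟨0, le_rfl, fun c v hv => by simpa using hv⟩
    | cons x L ih =>
      intro hL
      obtain ⟨D, hD, hD'⟩ := ih fun y hy => hL y (List.mem_cons_of_mem _ hy)
      obtain ⟨d, hd, hx⟩ := hL x List.mem_cons_self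
      refine ⟨D + d, by rw [List.length_cons]; lia, fun c v hv => ?_⟩
      have h2 := LinearMap.congr_fun hx (L.prod v)
      rw [LinearMap.sub_apply, Module.End.mul_apply, Module.End.mul_apply, LinearMap.smul_apply,
        hD' c v hv, map_smul, ← Nat.cast_smul_eq_nsmul ℂ, ← sub_smul] at h2
      rw [List.prod_cons, Module.End.mul_apply, h2]
      push_cast
      congr 1
      ring
  obtain ⟨D, hD, hD'⟩ := h1 L hL
  have h3 : ∀ t ∈ Finset.range (H + 1), h.eigenspace (t : ℂ) ≤ LinearMap.ker L.prod := by
    intro t ht v hv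
    have h4 := hD' t v (Module.End.mem_eigenspace_iff.1 hv)
    have h5 := h.eigenspaces_iSupIndep ((t : ℂ) - D)
    -- The product shifts the eigenvalue `t` to `t - D`, which is negative since `D ≥ L.length > H ≥
    -- t`. The eigenspaces that span `V` therefore all belong to other eigenvalues.
    have h6 : (⨆ j, ⨆ (_ : j ≠ (t : ℂ) - D), h.eigenspace j) = ⊤ := by
      rw [eq_top_iff, ← hH]
      refine iSup_le fun s => iSup_le fun _ => ?_
      refine le_iSup_of_le (s : ℂ) (le_iSup_of_le ?_ le_rfl)
      intro h7
      have h8 : ((s + D : ℕ) : ℂ) = (t : ℂ) := by push_cast; rw [h7]; ring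
      have h9 : s + D = t := by exact_mod_cast h8
      have := Finset.mem_range.1 ht
      lia
    rw [h6, disjoint_top] at h5
    rw [LinearMap.mem_ker, ← Submodule.mem_bot ℂ, ← h5]
    exact Module.End.mem_eigenspace_iff.2 h4
  refine LinearMap.ker_eq_top.1 (eq_top_iff.2 ?_)
  rw [← hH]
  exact iSup_le fun t => iSup_le fun ht => h3 t ht

/-- A raising operator `e_{ij}`, `i < j`, lowers the eigenvalue of `heightOp` by `j - i > 0`, and
that eigenvalue takes only the values `0, …, m * ∑ i, a i`. -/
theorem siteSum_raising_nilpotent (a : Fin n → ℕ) (L : List (Fin m × Fin m))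
    (hL : ∀ p ∈ L, p.1 < p.2) (hlen : m * ∑ i, a i < L.length) :
    (L.map fun p => siteSum a p.1 p.2).prod = 0 := by
  refine list_prod_eq_zero_of_lowering (heightOp a) _ (iSup_heightOp a) _ ?_
    (by rwa [List.length_map])
  intro x hx
  obtain ⟨p, hp, rfl⟩ := List.mem_map.1 hx
  have hlt : (p.1 : ℕ) < p.2 := hL p hp
  refine ⟨p.2 - p.1, by lia, ?_⟩
  have h1 : ∀ k, siteSum a k k * siteSum a p.1 p.2 - siteSum a p.1 p.2 * siteSum a k k =
      (if k = p.1 then siteSum a p.1 p.2 else 0) - if k = p.2 then siteSum a p.1 p.2 else 0 := by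
    intro k
    rw [glRel_siteSum a k k p.1 p.2]
    congr 1
    · split_ifs with h
      · rw [h]
      · rfl
    · by_cases h : k = p.2
      · rw [if_pos h, if_pos h.symm, h]
      · rw [if_neg h, if_neg fun h' => h h'.symm]
  have h2 : heightOp a * siteSum a p.1 p.2 - siteSum a p.1 p.2 * heightOp a =
      (p.1 : ℕ) • siteSum a p.1 p.2 - (p.2 : ℕ) • siteSum a p.1 p.2 := by
    rw [heightOp, Finset.sum_mul, Finset.mul_sum, ← Finset.sum_sub_distrib]
    simp only [smul_mul_assoc, mul_smul_comm, ← smul_sub, h1]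
    simp only [smul_sub, smul_ite, smul_zero, Finset.sum_sub_distrib, Finset.sum_ite_eq',
      Finset.mem_univ, if_true]
  rw [sub_eq_iff_eq_add] at h2
  obtain ⟨d, hd⟩ := Nat.exists_eq_add_of_le hlt.le
  rw [h2, hd, Nat.add_sub_cancel_left, add_smul]
  abel

end SymTensorModule

/-! ## Singular vectors -/

section LowIdentity
variable {A : Type*} [Ring A] {m : ℕ}

/-- With `E = X + Y`, the four families of terms overlap. For `k < l`, only `Y k i * E i l` with `k
≤ i < l` and `Y j l * E k j` with `k < j ≤ l` survive, which permits an induction on `l - k`. -/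
theorem commutator_lowSum {X Y : Fin m → Fin m → A} (hX : GlRel X) (hY : GlRel Y)
    (hc : ∀ i j k l, Commute (X i j) (Y k l)) (k l : Fin m) :
    (X k l + Y k l) * (∑ i, ∑ j, if i < j then Y j i * (X i j + Y i j) else 0) -
      (∑ i, ∑ j, if i < j then Y j i * (X i j + Y i j) else 0) * (X k l + Y k l) =
    (∑ i, ((if i < l then Y k i * (X i l + Y i l) else 0) -
      if i < k then Y k i * (X i l + Y i l) else 0)) -
    ∑ j, ((if k < j then Y j l * (X k j + Y k j) else 0) -
      if l < j then Y j l * (X k j + Y k j) else 0) := by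
  have hE : GlRel fun i j => X i j + Y i j := by
    intro i j k l
    have h1 := hX i j k l
    have h2 := hY i j k l
    have h3 : (X i j + Y i j) * (X k l + Y k l) - (X k l + Y k l) * (X i j + Y i j) =
        (X i j * X k l - X k l * X i j) + (Y i j * Y k l - Y k l * Y i j) +
        (X i j * Y k l - Y k l * X i j) - (X k l * Y i j - Y i j * X k l) := by noncomm_ring
    rw [h3, h1, h2, (hc i j k l).eq, (hc k l i j).eq, sub_self, sub_self]
    by_cases h1 : j = k <;> by_cases h2 : l = i <;> simp only [h1, h2, if_true, if_false] <;> abel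
  have hEY : ∀ i j k l, (X i j + Y i j) * Y k l - Y k l * (X i j + Y i j) =
      (if j = k then Y i l else 0) - (if l = i then Y k j else 0) := by
    intro i j k l
    rw [← hY i j k l, add_mul, mul_add, (hc i j k l).eq]
    abel
  have h1 : ∀ i j, (X k l + Y k l) * (if i < j then Y j i * (X i j + Y i j) else 0) -
      (if i < j then Y j i * (X i j + Y i j) else 0) * (X k l + Y k l) =
      (if l = j then if i < j then Y k i * (X i j + Y i j) else 0 else 0) -
      (if i = k then if i < j then Y j l * (X i j + Y i j) else 0 else 0) +
      ((if l = i then if i < j then Y j i * (X k j + Y k j) else 0 else 0) -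
      (if j = k then if i < j then Y j i * (X i l + Y i l) else 0 else 0)) := by
    intro i j
    by_cases hij : i < j
    · simp only [if_pos hij]
      have e : (X k l + Y k l) * (Y j i * (X i j + Y i j)) -
          (Y j i * (X i j + Y i j)) * (X k l + Y k l) =
          ((X k l + Y k l) * Y j i - Y j i * (X k l + Y k l)) * (X i j + Y i j) +
          Y j i * ((X k l + Y k l) * (X i j + Y i j) - (X i j + Y i j) * (X k l + Y k l)) := by
        noncomm_ring
      rw [e, hEY, hE k l i j]
      simp only [sub_mul, mul_sub, ite_mul, mul_ite, zero_mul, mul_zero]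
    · simp [hij]
  have h2 : (X k l + Y k l) * (∑ i, ∑ j, if i < j then Y j i * (X i j + Y i j) else 0) -
      (∑ i, ∑ j, if i < j then Y j i * (X i j + Y i j) else 0) * (X k l + Y k l) =
      ∑ i, ∑ j, ((X k l + Y k l) * (if i < j then Y j i * (X i j + Y i j) else 0) -
      (if i < j then Y j i * (X i j + Y i j) else 0) * (X k l + Y k l)) := by
    simp only [Finset.mul_sum, Finset.sum_mul, Finset.sum_sub_distrib]
  rw [h2, Finset.sum_congr rfl fun i _ => Finset.sum_congr rfl fun j _ => h1 i j]
  simp only [Finset.sum_add_distrib, Finset.sum_sub_distrib]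
  have s1 : (∑ i, ∑ j, if l = j then if i < j then Y k i * (X i j + Y i j) else 0 else 0) =
      ∑ i, if i < l then Y k i * (X i l + Y i l) else 0 := by simp
  have s2 : (∑ i, ∑ j, if i = k then if i < j then Y j l * (X i j + Y i j) else 0 else 0) =
      ∑ j, if k < j then Y j l * (X k j + Y k j) else 0 := by
    rw [Finset.sum_comm]; simp
  have s3 : (∑ i, ∑ j, if l = i then if i < j then Y j i * (X k j + Y k j) else 0 else 0) =
      ∑ j, if l < j then Y j l * (X k j + Y k j) else 0 := by
    rw [Finset.sum_comm]; simp
  have s4 : (∑ i, ∑ j, if j = k then if i < j then Y j i * (X i l + Y i l) else 0 else 0) =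
      ∑ i, if i < k then Y k i * (X i l + Y i l) else 0 := by simp
  rw [s1, s2, s3, s4]
  abel

end LowIdentity

/-! ### Operators on the tensor product and nilpotency of the mixed Casimir part -/

section Full
variable {F : Type*} [Field F] [Algebra ℂ F] {m n : ℕ} (a : Fin n → ℕ) (μ : Fin m → F)

variable (F) in
/-- Extension of scalars of the operators on `S^(m)(a)`. -/
def overHom : Module.End ℂ (SymTensor m a) →+* Module.End F (SymTensorOver F m a) :=
  (Module.End.baseChangeHom ℂ F (SymTensor m a)).toRingHom

/-- The operators on `S^(m)(a) ⊗ M` acting on the first factor. -/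
def siteHom : Module.End F (SymTensorOver F m a) →ₐ[F] Module.End F (FullTensor a μ) :=
  Module.End.rTensorAlgHom F (SymTensorOver F m a) (Verma μ)

/-- The operators on `S^(m)(a) ⊗ M` acting on the last factor. -/
def vermaHom : Module.End F (Verma μ) →ₐ[F] Module.End F (FullTensor a μ) :=
  Module.End.lTensorAlgHom F (Verma μ) (SymTensorOver F m a)

variable {a μ}

/-- A pure tensor in `S^(m)(a) ⊗ M`. -/
def fullTmul (s : SymTensorOver F m a) (v : Verma μ) : FullTensor a μ :=
  (s ⊗ₜ[F] v : SymTensorOver F m a ⊗[F] Verma μ)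

theorem siteHom_tmul (x : Module.End F (SymTensorOver F m a)) (s : SymTensorOver F m a)
    (v : Verma μ) : siteHom a μ x (fullTmul s v) = fullTmul (x s) v := rfl

theorem vermaHom_tmul (x : Module.End F (Verma μ)) (s : SymTensorOver F m a)
    (v : Verma μ) : vermaHom a μ x (fullTmul s v) = fullTmul s (x v) := rfl

theorem full_linearMap_ext {V : Type*} [AddCommGroup V] [Module F V]
    {f g : FullTensor a μ →ₗ[F] V} (h : ∀ s v, f (fullTmul s v) = g (fullTmul s v)) : f = g :=
  TensorProduct.ext' (M := SymTensorOver F m a) (N := Verma μ) h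

theorem siteHom_commute (x : Module.End F (SymTensorOver F m a)) (y : Module.End F (Verma μ)) :
    Commute (siteHom a μ x) (vermaHom a μ y) :=
  full_linearMap_ext fun _ _ => rfl

theorem siteGenOver_eq (i : Fin n) (k l : Fin m) :
    siteGenOver F a i k l = overHom F a (siteGen a i k l) := rfl

theorem fullSiteGen_eq (i : Fin n) (k l : Fin m) :
    fullSiteGen a μ i k l = siteHom a μ (siteGenOver F a i k l) := rfl

theorem fullVermaGen_eq (k l : Fin m) :
    fullVermaGen a μ k l = vermaHom a μ (vermaGen μ k l) := rfl

/-- The action of `e_{kl}` on the first factor of `S^(m)(a) ⊗ M`. -/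
def fullSiteSum (a : Fin n → ℕ) (μ : Fin m → F) (k l : Fin m) : Module.End F (FullTensor a μ) :=
  siteHom a μ (overHom F a (siteSum a k l))

theorem fullGen_eq (k l : Fin m) :
    fullGen a μ k l = fullSiteSum a μ k l + fullVermaGen a μ k l := by
  rw [fullGen, fullSiteSum, siteSum, map_sum, map_sum]
  rfl

theorem glRel_fullSiteSum : GlRel (fullSiteSum a μ) :=
  ((glRel_siteSum a).map (overHom F a)).map (siteHom a μ).toRingHom

theorem glRel_fullVermaGen : GlRel (fullVermaGen a μ) :=
  (glRel_vermaGen μ).map (vermaHom a μ).toRingHom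

theorem fullSiteSum_commute (i j : Fin m) (y : Module.End F (Verma μ)) :
    Commute (fullSiteSum a μ i j) (vermaHom a μ y) :=
  siteHom_commute _ _

/-- Operators that raise the weight of the first factor are nilpotent. -/
theorem raising_nilpotent (B : Fin m → Fin m → Module.End F (Verma μ)) :
    (∑ i, ∑ j, if i < j then vermaHom a μ (B i j) * fullSiteSum a μ i j else 0) ^
      (m * ∑ i, a i + 1) = 0 := by
  set X := ∑ i, ∑ j, if i < j then vermaHom a μ (B i j) * fullSiteSum a μ i j else 0 with hX
  -- Operators on the Verma module commute with those on the sites and are collected in front. The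
  -- `r`-th power thus lies in the span of terms whose site part is a word of `r` raising operators.
  have key : ∀ r : ℕ, X ^ r ∈ Submodule.span F {x | ∃ (L : List (Fin m × Fin m))
      (y : Module.End F (Verma μ)), (∀ p ∈ L, p.1 < p.2) ∧ L.length = r ∧
      x = vermaHom a μ y * siteHom a μ (overHom F a (L.map fun p => siteSum a p.1 p.2).prod)} := by
    intro r
    induction r with
    | zero =>
      refine Submodule.subset_span ⟨[], 1, fun _ h => absurd h List.not_mem_nil, rfl, ?_⟩
      simp
    | succ r ih =>
      rw [pow_succ']
      refine Submodule.span_induction (p := fun x _ => X * x ∈ _) ?_ ?_ ?_ ?_ ih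
      · rintro _ ⟨L, y, hL, hr, rfl⟩
        rw [hX, Finset.sum_mul]
        refine Submodule.sum_mem _ fun i _ => ?_
        rw [Finset.sum_mul]
        refine Submodule.sum_mem _ fun j _ => ?_
        split_ifs with hij
        · refine Submodule.subset_span ⟨(i, j) :: L, B i j * y, ?_, by rw [List.length_cons, hr],
            ?_⟩
          · intro p hp
            rcases List.mem_cons.1 hp with rfl | hp
            · exact hij
            · exact hL p hp
          · rw [List.map_cons, List.prod_cons, map_mul, map_mul, map_mul, mul_assoc, mul_assoc,
              ← mul_assoc (fullSiteSum a μ i j), (fullSiteSum_commute i j y).eq, mul_assoc]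
            rfl
        · rw [zero_mul]; exact Submodule.zero_mem _
      · rw [mul_zero]; exact Submodule.zero_mem _
      · intro x y _ _ hx hy
        rw [mul_add]; exact Submodule.add_mem _ hx hy
      · intro c x _ hx
        rw [mul_smul_comm]; exact Submodule.smul_mem _ c hx
  have h := key (m * ∑ i, a i + 1)
  rw [← Submodule.mem_bot F]
  refine Submodule.span_le.2 ?_ h
  rintro _ ⟨L, y, hL, hr, rfl⟩
  rw [siteSum_raising_nilpotent a L hL (by lia), map_zero, map_zero, mul_zero]
  exact Submodule.zero_mem _

/-- The sum of all `e_{ij} ⊗ e_{ji}` with `i < j`. -/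
def mixedCasimir (a : Fin n → ℕ) (μ : Fin m → F) : Module.End F (FullTensor a μ) :=
  ∑ i, ∑ j, if i < j then fullVermaGen a μ j i * fullSiteSum a μ i j else 0

theorem lowSum_eq : (∑ i, ∑ j, if i < j then fullVermaGen a μ j i *
      (fullSiteSum a μ i j + fullVermaGen a μ i j) else 0) =
    vermaHom a μ (lowCasimir (vermaGen μ)) + mixedCasimir a μ := by
  rw [lowCasimir, map_sum, mixedCasimir, ← Finset.sum_add_distrib]
  refine Finset.sum_congr rfl fun i _ => ?_
  rw [map_sum, ← Finset.sum_add_distrib]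
  refine Finset.sum_congr rfl fun j _ => ?_
  split_ifs
  · rw [mul_add, map_mul, add_comm]
    rfl
  · rw [map_zero, add_zero]

theorem vermaHom_mul_mixedCasimir (T : Module.End F (Verma μ)) :
    vermaHom a μ T * mixedCasimir a μ = ∑ i, ∑ j, if i < j then
      vermaHom a μ (T * vermaGen μ j i) * fullSiteSum a μ i j else 0 := by
  rw [mixedCasimir, Finset.mul_sum]
  refine Finset.sum_congr rfl fun i _ => ?_
  rw [Finset.mul_sum]
  refine Finset.sum_congr rfl fun j _ => ?_
  split_ifs
  · rw [map_mul, mul_assoc]; rfl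
  · rw [mul_zero]

theorem vermaHom_mul_mixedCasimir_nilpotent (T : Module.End F (Verma μ)) :
    (vermaHom a μ T * mixedCasimir a μ) ^ (m * ∑ i, a i + 1) = 0 := by
  rw [vermaHom_mul_mixedCasimir]
  exact raising_nilpotent fun i j => T * vermaGen μ j i

/-- A vector killed by the sum of all `e_{ji} E_{ij}` is singular. -/
theorem singular_of_lowSum [CharZero F] (hμ : IsGeneric μ) (v : FullTensor a μ)
    (hv : vermaHom a μ (lowCasimir (vermaGen μ)) v + mixedCasimir a μ v = 0) (k l : Fin m)
    (hkl : k < l) : fullGen a μ k l v = 0 := by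
  -- Induction on `l - k`: the surviving commutator terms apply to `v` generators with a smaller
  -- gap, already known to kill it, except for the two terms with `i = k` and `j = l`.
  obtain ⟨d, hd⟩ : ∃ d : ℕ, (l : ℕ) - k = d := ⟨_, rfl⟩
  induction d using Nat.strong_induction_on generalizing k l with
  | _ d ih =>
  set Z := ∑ i, ∑ j, if i < j then fullVermaGen a μ j i *
      (fullSiteSum a μ i j + fullVermaGen a μ i j) else 0 with hZ
  have hZv : Z v = 0 := by
    rw [lowSum_eq] at hZ
    rw [hZ, LinearMap.add_apply, hv]
  have hZu (u : FullTensor a μ) :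
      Z u = vermaHom a μ (lowCasimir (vermaGen μ)) u + mixedCasimir a μ u := by
    rw [← LinearMap.add_apply, ← lowSum_eq]
  have hcomm := LinearMap.congr_fun (commutator_lowSum (glRel_fullSiteSum (a := a) (μ := μ))
    (glRel_fullVermaGen (a := a) (μ := μ)) (fun i j k l => fullSiteSum_commute i j _) k l) v
  rw [← hZ] at hcomm
  simp only [← fullGen_eq] at hcomm
  rw [LinearMap.sub_apply, Module.End.mul_apply, Module.End.mul_apply, hZv, map_zero,
    LinearMap.sub_apply] at hcomm
  have e1 : (∑ i, ((if i < l then fullVermaGen a μ k i * fullGen a μ i l else 0) -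
      if i < k then fullVermaGen a μ k i * fullGen a μ i l else 0)) v =
      fullVermaGen a μ k k (fullGen a μ k l v) := by
    rw [LinearMap.sum_apply, Finset.sum_eq_single k]
    · rw [if_pos hkl, if_neg (lt_irrefl _), sub_zero, Module.End.mul_apply]
    · intro i _ hi
      by_cases h1 : i < l
      · by_cases h2 : i < k
        · rw [if_pos h1, if_pos h2, sub_self]; rfl
        · have h3 : k < i := lt_of_le_of_ne (not_lt.1 h2) hi.symm
          rw [if_pos h1, if_neg h2, sub_zero, Module.End.mul_apply,
            ih ((l : ℕ) - i) (by have : (k : ℕ) < i := h3; have : (i : ℕ) < l := h1; lia)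
              i l h1 rfl, map_zero]
      · have h2 : ¬ i < k := fun h => h1 (h.trans hkl)
        rw [if_neg h1, if_neg h2, sub_self]; rfl
    · simp
  have e2 : (∑ j, ((if k < j then fullVermaGen a μ j l * fullGen a μ k j else 0) -
      if l < j then fullVermaGen a μ j l * fullGen a μ k j else 0)) v =
      fullVermaGen a μ l l (fullGen a μ k l v) := by
    rw [LinearMap.sum_apply, Finset.sum_eq_single l]
    · rw [if_pos hkl, if_neg (lt_irrefl _), sub_zero, Module.End.mul_apply]
    · intro j _ hj
      by_cases h1 : k < j
      · by_cases h2 : l < j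
        · rw [if_pos h1, if_pos h2, sub_self]; rfl
        · have h3 : j < l := lt_of_le_of_ne (not_lt.1 h2) hj
          rw [if_pos h1, if_neg h2, sub_zero, Module.End.mul_apply,
            ih ((j : ℕ) - k) (by have : (j : ℕ) < l := h3; have : (k : ℕ) < j := h1; lia)
              k j h1 rfl, map_zero]
      · have h2 : ¬ l < j := fun h => h1 (hkl.trans h)
        rw [if_neg h1, if_neg h2, sub_self]; rfl
    · simp
  rw [e1, e2, hZu, zero_sub] at hcomm
  -- What remains says that the low Casimir element plus `e_{kk} - e_{ll}` maps `u` to minus its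
  -- image under the mixed part. Inverting it gives `u = -T (mixed u)`, and iteration forces `u = 0`
  -- by nilpotency.
  obtain ⟨T, hT⟩ := exists_lowCasimir_diag_inverse hμ hkl
  set u := fullGen a μ k l v with hu
  have hT2 : vermaHom a μ T (vermaHom a μ (lowCasimir (vermaGen μ)) u +
      fullVermaGen a μ k k u - fullVermaGen a μ l l u) = u := by
    have := LinearMap.congr_fun (congrArg (vermaHom a μ) hT) u
    rw [map_mul, map_one, map_sub, map_add] at this
    exact this
  have h1 : vermaHom a μ (lowCasimir (vermaGen μ)) u +
      fullVermaGen a μ k k u - fullVermaGen a μ l l u = -mixedCasimir a μ u := by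
    rw [add_sub_assoc, ← hcomm]
    abel
  rw [h1, map_neg] at hT2
  have h2 : ∀ r : ℕ, u = (-1 : F) ^ r • ((vermaHom a μ T * mixedCasimir a μ) ^ r) u := by
    intro r
    induction r with
    | zero => simp
    | succ r ihr =>
      nth_rewrite 1 [ihr]
      nth_rewrite 1 [← hT2]
      rw [map_neg, pow_succ, pow_succ, Module.End.mul_apply, mul_neg_one, neg_smul, smul_neg]
      rfl
  rw [h2 (m * ∑ i, a i + 1), vermaHom_mul_mixedCasimir_nilpotent, LinearMap.zero_apply, smul_zero]

end Full

/-! ## The map `θ` -/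

theorem commute_diag_weightZero {A : Type*} [Ring A] {m : ℕ} {X Y : Fin m → Fin m → A}
    (hX : GlRel X) (hY : GlRel Y) (hc : ∀ i j k l, Commute (X i j) (Y k l)) (k i j : Fin m) :
    Commute (X k k + Y k k) (Y j i * X i j) := by
  have h1 := hX k k i j
  have h2 := hY k k j i
  have e : (X k k + Y k k) * (Y j i * X i j) - (Y j i * X i j) * (X k k + Y k k) =
      Y j i * (X k k * X i j - X i j * X k k) + (Y k k * Y j i - Y j i * Y k k) * X i j +
      ((X k k * Y j i - Y j i * X k k) * X i j -
        Y j i * (X i j * Y k k - Y k k * X i j)) := by noncomm_ring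
  rw [h1, h2, (hc k k j i).eq, (hc i j k k).eq, sub_self, sub_self, zero_mul, mul_zero,
    sub_zero, add_zero] at e
  rw [commute_iff_eq, ← sub_eq_zero, e]
  by_cases h3 : k = i <;> by_cases h4 : k = j
  · subst h3; subst h4; simp
  · subst h3; simp [h4, Ne.symm h4]
  · subst h4; simp [h3, Ne.symm h3]
  · simp [h3, h4, Ne.symm h3, Ne.symm h4]

section Theta
variable {F : Type*} [Field F] [Algebra ℂ F] {m n : ℕ} (a : Fin n → ℕ) (b : Fin m → ℕ)
  {μ : Fin m → F}

theorem weightIncl_injective : Function.Injective (weightIncl F a b) :=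
  Module.Flat.lTensor_preserves_injective_linearMap (M := F) (weightSpace a b).subtype
    (Submodule.injective_subtype _)

/-- The weight space is the kernel of a linear map over `ℂ`, and flat base change preserves kernels.
-/
theorem mem_range_weightIncl (x : SymTensorOver F m a)
    (hx : ∀ j, overHom F a (siteSum a j j) x = (b j : F) • x) :
    x ∈ LinearMap.range (weightIncl F a b) := by
  set g : SymTensor m a →ₗ[ℂ] Fin m → SymTensor m a :=
    LinearMap.pi fun j => siteSum a j j - (b j : ℂ) • LinearMap.id with hg
  have hker : Function.Exact (weightSpace a b).subtype g := by
    rw [LinearMap.exact_iff, Submodule.range_subtype]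
    ext s
    rw [LinearMap.mem_ker, weightSpace, Submodule.mem_iInf]
    simp only [Module.End.mem_eigenspace_iff]
    constructor
    · intro h j
      have := congrFun h j
      rw [hg, LinearMap.pi_apply, LinearMap.sub_apply] at this
      exact sub_eq_zero.1 this
    · intro h
      funext j
      rw [hg, LinearMap.pi_apply, LinearMap.sub_apply]
      exact sub_eq_zero.2 (h j)
  have hex := Module.Flat.lTensor_exact F hker
  refine (hex x).1 ?_
  apply (TensorProduct.piRight ℂ ℂ F fun _ : Fin m => SymTensor m a).injective
  rw [map_zero]
  funext j
  have hcomp : ∀ y : F ⊗[ℂ] SymTensor m a,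
      TensorProduct.piRight ℂ ℂ F (fun _ : Fin m => SymTensor m a) (LinearMap.lTensor F g y) j =
      LinearMap.lTensor F (siteSum a j j) y - (b j : ℂ) • y := by
    intro y
    induction y with
    | zero => simp
    | add x y hx hy => rw [map_add, map_add, Pi.add_apply, hx, hy, map_add, smul_add]; abel
    | tmul c s =>
      rw [LinearMap.lTensor_tmul, TensorProduct.piRight_apply, TensorProduct.piRightHom_tmul,
        LinearMap.lTensor_tmul]
      change c ⊗ₜ[ℂ] (siteSum a j j s - (b j : ℂ) • s) = _
      rw [TensorProduct.tmul_sub, TensorProduct.tmul_smul]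
  refine (hcomp x).trans ?_
  have h := hx j
  have h2 : ((b j : F) • x : SymTensorOver F m a) = ((b j : ℂ) • (show F ⊗[ℂ] SymTensor m a from x)) := by
    rw [Nat.cast_smul_eq_nsmul, Nat.cast_smul_eq_nsmul]
    rfl
  rw [h2] at h
  exact sub_eq_zero.2 h

theorem weightIncl_weight (w : F ⊗[ℂ] weightSpace a b) (j : Fin m) :
    overHom F a (siteSum a j j) (weightIncl F a b w) = (b j : F) • weightIncl F a b w := by
  induction w with
  | zero => simp
  | add x y hx hy => rw [map_add, map_add, hx, hy, smul_add]
  | tmul c s =>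
    have h : siteSum a j j s.1 = (b j : ℂ) • s.1 :=
      Module.End.mem_eigenspace_iff.1 ((Submodule.mem_iInf _).1 s.2 j)
    change c ⊗ₜ[ℂ] siteSum a j j s.1 = (b j : F) • c ⊗ₜ[ℂ] s.1
    rw [h, Nat.cast_smul_eq_nsmul, Nat.cast_smul_eq_nsmul, TensorProduct.tmul_smul]

variable {a} (μ) in
/-- The component along the highest weight vector. -/
def topPart (ε : Verma μ →ₗ[F] F) : FullTensor a μ →ₗ[F] SymTensorOver F m a :=
  (TensorProduct.rid F (SymTensorOver F m a)).toLinearMap ∘ₗ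
    LinearMap.lTensor (SymTensorOver F m a) ε

variable {a b} {ε : Verma μ →ₗ[F] F}

theorem fullTmul_sub (s : SymTensorOver F m a) (v w : Verma μ) :
    fullTmul s (v - w) = fullTmul s v - fullTmul s w :=
  TensorProduct.tmul_sub (R := F) _ _ _

theorem fullTmul_smul (c : F) (s : SymTensorOver F m a) (v : Verma μ) :
    fullTmul s (c • v) = c • fullTmul s v :=
  TensorProduct.tmul_smul (R := F) _ _ _

theorem smul_fullTmul (c : F) (s : SymTensorOver F m a) (v : Verma μ) :
    fullTmul (c • s) v = c • fullTmul s v :=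
  (TensorProduct.smul_tmul' (R := F) _ _ _).symm

theorem topPart_tmul (s : SymTensorOver F m a) (v : Verma μ) :
    topPart μ ε (fullTmul s v) = ε v • s := rfl

theorem tensorVermaVec_apply (s : SymTensorOver F m a) :
    tensorVermaVec a μ s = fullTmul s (vermaVec μ) := rfl

theorem topPart_siteHom (x : Module.End F (SymTensorOver F m a)) (v : FullTensor a μ) :
    topPart μ ε (siteHom a μ x v) = x (topPart μ ε v) := by
  have : topPart μ ε ∘ₗ siteHom a μ x = x ∘ₗ topPart μ ε := full_linearMap_ext fun s v => by
    rw [LinearMap.comp_apply, siteHom_tmul, topPart_tmul, LinearMap.comp_apply, topPart_tmul,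
      map_smul]
  exact LinearMap.congr_fun this v

theorem topPart_vermaHom (x : Module.End F (Verma μ)) (v : FullTensor a μ) :
    topPart μ ε (vermaHom a μ x v) = topPart μ (ε ∘ₗ x) v := by
  have : topPart μ ε ∘ₗ vermaHom a μ x = topPart μ (ε ∘ₗ x) := full_linearMap_ext fun s v => rfl
  exact LinearMap.congr_fun this v

theorem topPart_zero : topPart μ 0 = (0 : FullTensor a μ →ₗ[F] SymTensorOver F m a) :=
  full_linearMap_ext fun s v => by
    rw [topPart_tmul, LinearMap.zero_apply, zero_smul, LinearMap.zero_apply]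

namespace IsVermaProj

theorem topPart_tensorVermaVec (hε : IsVermaProj ε) (s : SymTensorOver F m a) :
    topPart μ ε (tensorVermaVec a μ s) = s := by
  rw [tensorVermaVec_apply, topPart_tmul, hε.1, one_smul]

theorem topPart_diag (hε : IsVermaProj ε) (k : Fin m) (v : FullTensor a μ) :
    topPart μ ε (fullVermaGen a μ k k v) = μ k • topPart μ ε v := by
  have : topPart μ ε ∘ₗ fullVermaGen a μ k k = μ k • topPart μ ε :=
    full_linearMap_ext fun s v => by
      change ε (vermaGen μ k k v) • s = μ k • ε v • s
      rw [hε.gen_diag, mul_smul]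
  exact LinearMap.congr_fun this v

theorem topPart_low (hε : IsVermaProj ε) {i j : Fin m} (hij : i < j) (v : FullTensor a μ) :
    topPart μ ε (fullVermaGen a μ j i v) = 0 := by
  have : ε ∘ₗ vermaGen μ j i = 0 := LinearMap.ext fun v => hε.gen_low hij v
  rw [fullVermaGen_eq, topPart_vermaHom, this, topPart_zero, LinearMap.zero_apply]

theorem topPart_mixedCasimir (hε : IsVermaProj ε) (v : FullTensor a μ) :
    topPart μ ε (mixedCasimir a μ v) = 0 := by
  rw [mixedCasimir, LinearMap.sum_apply, map_sum]
  refine Finset.sum_eq_zero fun i _ => ?_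
  rw [LinearMap.sum_apply, map_sum]
  refine Finset.sum_eq_zero fun j _ => ?_
  split_ifs with h
  · rw [Module.End.mul_apply, hε.topPart_low h]
  · rw [LinearMap.zero_apply, map_zero]

theorem topPart_lowerTensor (hε : IsVermaProj ε) {x : FullTensor a μ}
    (hx : x ∈ lowerTensor a μ) : topPart μ ε x = 0 := by
  obtain ⟨y, rfl⟩ := hx
  have : (topPart μ ε : FullTensor a μ →ₗ[F] _) ∘ₗ
      (LinearMap.lTensor (SymTensorOver F m a) (vermaLower μ).subtype) = 0 := by
    refine TensorProduct.ext' fun s v => ?_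
    change ε v.1 • s = 0
    rw [hε.lower_le_ker v.2, zero_smul]
  exact LinearMap.congr_fun this y

theorem sub_topPart_mem [CharZero F] (hε : IsVermaProj ε) (x : FullTensor a μ) :
    x - tensorVermaVec a μ (topPart μ ε x) ∈ lowerTensor a μ := by
  have : (lowerTensor a μ).mkQ ∘ₗ (LinearMap.id - tensorVermaVec a μ ∘ₗ topPart μ ε) = 0 := by
    refine full_linearMap_ext fun s v => ?_
    rw [LinearMap.comp_apply, LinearMap.zero_apply, Submodule.mkQ_apply,
      Submodule.Quotient.mk_eq_zero, LinearMap.sub_apply, LinearMap.comp_apply, topPart_tmul]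
    refine ⟨(s ⊗ₜ[F] ⟨_, hε.sub_mem_lower v⟩ : SymTensorOver F m a ⊗[F] vermaLower μ), ?_⟩
    rw [map_smul]
    change fullTmul s (v - ε v • vermaVec μ) = _
    rw [fullTmul_sub, fullTmul_smul]
    rfl
  exact (Submodule.Quotient.mk_eq_zero _).1 (LinearMap.congr_fun this x)

/-- The projection `ε` kills the lower part and is `1` on the highest weight vector, so the defining
condition of `θ` prescribes its value through `topPart`. Uniqueness then follows from injectivity of
`weightIncl`. -/
theorem isTheta_iff [CharZero F] (hε : IsVermaProj ε)
    (θ : singularSpace a b μ →ₗ[F] F ⊗[ℂ] weightSpace a b) :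
    IsTheta a b μ θ ↔ ∀ v : singularSpace a b μ, weightIncl F a b (θ v) = topPart μ ε v.1 := by
  refine forall_congr' fun v => ⟨fun h => ?_, fun h => ?_⟩
  · have := hε.topPart_lowerTensor h
    rw [map_sub, hε.topPart_tensorVermaVec, sub_eq_zero] at this
    exact this.symm
  · rw [h]
    exact hε.sub_topPart_mem _

end IsVermaProj

theorem mem_singularSpace {v : FullTensor a μ} : v ∈ singularSpace a b μ ↔
    (∀ k l, k < l → fullGen a μ k l v = 0) ∧ ∀ j, fullGen a μ j j v = (μ j + b j) • v := by
  simp only [singularSpace, Submodule.mem_inf, Submodule.mem_iInf, LinearMap.mem_ker,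
    Module.End.mem_eigenspace_iff]

variable (a b μ) in
/-- The singular vectors with given highest weight components. -/
def thetaInv (T : Module.End F (Verma μ)) : F ⊗[ℂ] weightSpace a b →ₗ[F] FullTensor a μ :=
  (∑ p ∈ Finset.range (m * ∑ i, a i + 1), (-(vermaHom a μ T * mixedCasimir a μ)) ^ p) ∘ₗ
    tensorVermaVec a μ ∘ₗ weightIncl F a b

/-- An inverse of `∑_{i<j} e_{ji} e_{ij}` on the vectors of lower weight. -/
structure IsCasimirInverse (ε : Verma μ →ₗ[F] F) (T : Module.End F (Verma μ)) : Prop where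
  casimir_apply (v : Verma μ) : lowCasimir (vermaGen μ) (T v) = v - ε v • vermaVec μ
  apply_casimir (v : Verma μ) : T (lowCasimir (vermaGen μ) v) = v - ε v • vermaVec μ
  proj_apply (v : Verma μ) : ε (T v) = ε v
  diag (k : Fin m) (v : Verma μ) : T (vermaGen μ k k v) = vermaGen μ k k (T v)

variable {T : Module.End F (Verma μ)}

theorem neg_mixedCasimir_nilpotent (T : Module.End F (Verma μ)) :
    (-(vermaHom a μ T * mixedCasimir a μ)) ^ (m * ∑ i, a i + 1) = 0 := by
  rw [neg_pow, vermaHom_mul_mixedCasimir_nilpotent, mul_zero]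

/-- The geometric series is finite by nilpotency, so it satisfies its fixed point equation exactly.
-/
theorem thetaInv_eq (T : Module.End F (Verma μ)) (w : F ⊗[ℂ] weightSpace a b) :
    thetaInv a b μ T w = tensorVermaVec a μ (weightIncl F a b w) -
      vermaHom a μ T (mixedCasimir a μ (thetaInv a b μ T w)) := by
  set X := -(vermaHom a μ T * mixedCasimir a μ) with hX
  have h := mul_neg_geom_sum X (m * ∑ i, a i + 1)
  rw [neg_mixedCasimir_nilpotent, sub_zero] at h
  have h2 := LinearMap.congr_fun h (tensorVermaVec a μ (weightIncl F a b w))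
  rw [sub_mul, one_mul, LinearMap.sub_apply, Module.End.mul_apply, Module.End.one_apply] at h2
  change thetaInv a b μ T w - X (thetaInv a b μ T w) = _ at h2
  rw [← h2, hX, LinearMap.neg_apply, Module.End.mul_apply]
  abel

namespace IsCasimirInverse

theorem topPart_apply (hT : IsCasimirInverse ε T) (v : FullTensor a μ) :
    topPart μ ε (vermaHom a μ T v) = topPart μ ε v := by
  rw [topPart_vermaHom, show ε ∘ₗ T = ε from LinearMap.ext hT.proj_apply]

theorem full_casimir_apply (hT : IsCasimirInverse ε T) (v : FullTensor a μ) :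
    vermaHom a μ (lowCasimir (vermaGen μ)) (vermaHom a μ T v) =
      v - tensorVermaVec a μ (topPart μ ε v) := by
  have : vermaHom a μ (lowCasimir (vermaGen μ)) ∘ₗ vermaHom a μ T =
      LinearMap.id - tensorVermaVec a μ ∘ₗ topPart μ ε := full_linearMap_ext fun s v => by
    change fullTmul s (lowCasimir (vermaGen μ) (T v)) =
      fullTmul s v - tensorVermaVec a μ (ε v • s)
    rw [hT.casimir_apply, map_smul, fullTmul_sub, fullTmul_smul]
    rfl
  exact LinearMap.congr_fun this v

theorem full_apply_casimir (hT : IsCasimirInverse ε T) (v : FullTensor a μ) :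
    vermaHom a μ T (vermaHom a μ (lowCasimir (vermaGen μ)) v) =
      v - tensorVermaVec a μ (topPart μ ε v) := by
  have : vermaHom a μ T ∘ₗ vermaHom a μ (lowCasimir (vermaGen μ)) =
      LinearMap.id - tensorVermaVec a μ ∘ₗ topPart μ ε := full_linearMap_ext fun s v => by
    change fullTmul s (T (lowCasimir (vermaGen μ) v)) =
      fullTmul s v - tensorVermaVec a μ (ε v • s)
    rw [hT.apply_casimir, map_smul, fullTmul_sub, fullTmul_smul]
    rfl
  exact LinearMap.congr_fun this v

theorem topPart_thetaInv (hε : IsVermaProj ε) (hT : IsCasimirInverse ε T)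
    (w : F ⊗[ℂ] weightSpace a b) : topPart μ ε (thetaInv a b μ T w) = weightIncl F a b w := by
  rw [thetaInv_eq, map_sub, hε.topPart_tensorVermaVec, hT.topPart_apply,
    hε.topPart_mixedCasimir, sub_zero]

/-- All operators in the geometric series have weight zero. -/
theorem fullGen_thetaInv (hT : IsCasimirInverse ε T) (w : F ⊗[ℂ] weightSpace a b) (j : Fin m) :
    fullGen a μ j j (thetaInv a b μ T w) = (μ j + b j) • thetaInv a b μ T w := by
  have h1 : Commute (fullGen a μ j j) (mixedCasimir a μ) := by
    rw [fullGen_eq, mixedCasimir]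
    refine Commute.sum_right _ _ _ fun i _ => Commute.sum_right _ _ _ fun k _ => ?_
    split_ifs
    · exact commute_diag_weightZero glRel_fullSiteSum glRel_fullVermaGen
        (fun i j k l => fullSiteSum_commute i j _) _ _ _
    · exact Commute.zero_right _
  have h2 : Commute (fullGen a μ j j) (vermaHom a μ T) := by
    rw [fullGen_eq]
    refine (fullSiteSum_commute j j T).add_left ?_
    have h3 : vermaGen μ j j * T = T * vermaGen μ j j :=
      LinearMap.ext fun v => (hT.diag j v).symm
    rw [fullVermaGen_eq, commute_iff_eq, ← map_mul, ← map_mul, h3]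
  have h4 : Commute (fullGen a μ j j)
      (∑ p ∈ Finset.range (m * ∑ i, a i + 1), (-(vermaHom a μ T * mixedCasimir a μ)) ^ p) :=
    Commute.sum_right _ _ _ fun p _ => ((h2.mul_right h1).neg_right).pow_right p
  have h5 : fullGen a μ j j (tensorVermaVec a μ (weightIncl F a b w)) =
      (μ j + b j) • tensorVermaVec a μ (weightIncl F a b w) := by
    rw [fullGen_eq, LinearMap.add_apply, fullSiteSum, fullVermaGen_eq, tensorVermaVec_apply,
      siteHom_tmul, vermaHom_tmul, weightIncl_weight, vermaGen_vermaVec_diag, add_comm, add_smul,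
      fullTmul_smul, smul_fullTmul]
  rw [thetaInv, LinearMap.comp_apply]
  rw [← Module.End.mul_apply, h4.eq, Module.End.mul_apply]
  rw [LinearMap.comp_apply, h5, map_smul]

/-- Applying the low Casimir element to the fixed point equation gives the equation of
`singular_of_lowSum`: the highest weight term is killed, and `T` is inverted exactly because the
mixed part has no top component. -/
theorem thetaInv_mem [CharZero F] (hμ : IsGeneric μ) (hε : IsVermaProj ε)
    (hT : IsCasimirInverse ε T) (w : F ⊗[ℂ] weightSpace a b) :
    thetaInv a b μ T w ∈ singularSpace a b μ := by
  refine mem_singularSpace.2 ⟨fun k l hkl => singular_of_lowSum hμ _ ?_ k l hkl,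
    hT.fullGen_thetaInv w⟩
  have h0 : vermaHom a μ (lowCasimir (vermaGen μ))
      (tensorVermaVec a μ (weightIncl F a b w)) = 0 := by
    have h := lowCasimir_word μ []
    rw [lowEigenvalue_nil, zero_smul] at h
    have h' : lowCasimir (vermaGen μ) (vermaVec μ) = 0 := h
    rw [tensorVermaVec_apply, vermaHom_tmul, h']
    exact TensorProduct.tmul_zero _ _
  nth_rewrite 1 [thetaInv_eq]
  rw [map_sub, h0, hT.full_casimir_apply, hε.topPart_mixedCasimir, map_zero, sub_zero, zero_sub,
    neg_add_cancel]

/-- A singular vector is killed by the low Casimir element plus the mixed part. Without top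
component it then satisfies `v = -T (mixed v)`, and nilpotency gives `v = 0`. -/
theorem eq_zero_of_topPart (hT : IsCasimirInverse ε T) {v : FullTensor a μ}
    (hv : v ∈ singularSpace a b μ) (h0 : topPart μ ε v = 0) : v = 0 := by
  have h1 : vermaHom a μ (lowCasimir (vermaGen μ)) v + mixedCasimir a μ v = 0 := by
    rw [← LinearMap.add_apply, ← lowSum_eq, LinearMap.sum_apply]
    refine Finset.sum_eq_zero fun i _ => ?_
    rw [LinearMap.sum_apply]
    refine Finset.sum_eq_zero fun j _ => ?_
    split_ifs with h
    · rw [← fullGen_eq, Module.End.mul_apply, (mem_singularSpace.1 hv).1 i j h, map_zero]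
    · rfl
  have h2 := hT.full_apply_casimir v
  rw [h0, map_zero, sub_zero, eq_neg_of_add_eq_zero_left h1, map_neg] at h2
  have h3 : ∀ r : ℕ, ((-(vermaHom a μ T * mixedCasimir a μ)) ^ r) v = v := by
    intro r
    induction r with
    | zero => rfl
    | succ r ih =>
      rw [pow_succ, Module.End.mul_apply, LinearMap.neg_apply, Module.End.mul_apply, h2, ih]
  rw [← h3 (m * ∑ i, a i + 1), neg_mixedCasimir_nilpotent, LinearMap.zero_apply]

theorem exists_theta [CharZero F] (hμ : IsGeneric μ) (hε : IsVermaProj ε)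
    (hT : IsCasimirInverse ε T) : ∃ θ : singularSpace a b μ ≃ₗ[F] F ⊗[ℂ] weightSpace a b,
      IsTheta a b μ θ.toLinearMap ∧
      (∀ θ' : singularSpace a b μ →ₗ[F] F ⊗[ℂ] weightSpace a b,
        IsTheta a b μ θ' → θ' = θ.toLinearMap) ∧
      (singularSpace a b μ).subtype ∘ₗ θ.symm.toLinearMap = thetaInv a b μ T := by
  set f : F ⊗[ℂ] weightSpace a b →ₗ[F] singularSpace a b μ :=
    (thetaInv a b μ T).codRestrict _ (hT.thetaInv_mem hμ hε) with hf
  have htop : ∀ w, topPart μ ε (f w).1 = weightIncl F a b w := hT.topPart_thetaInv hε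
  have hbij : Function.Bijective f := by
    constructor
    · intro w w' h
      apply weightIncl_injective (F := F) a b
      rw [← htop, ← htop, h]
    · intro v
      -- The total weight is `μ + b` and the top component carries weight `μ` in the Verma factor,
      -- which leaves weight `b` for the sites.
      obtain ⟨w, hw⟩ := mem_range_weightIncl a b (topPart μ ε v.1) fun j => by
        have h := (mem_singularSpace.1 v.2).2 j
        rw [fullGen_eq, LinearMap.add_apply] at h
        have h2 := congrArg (topPart μ ε) h
        rw [map_add, hε.topPart_diag, fullSiteSum, topPart_siteHom, map_smul, add_smul,
          add_comm] at h2
        exact add_left_cancel h2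
      refine ⟨w, Subtype.ext (sub_eq_zero.1 (hT.eq_zero_of_topPart
        ((singularSpace a b μ).sub_mem (f w).2 v.2) ?_))⟩
      rw [map_sub, htop, hw, sub_self]
  set e := LinearEquiv.ofBijective f hbij with he
  refine ⟨e.symm, ?_, ?_, ?_⟩
  · rw [hε.isTheta_iff]
    intro v
    obtain ⟨w, rfl⟩ := e.surjective v
    rw [LinearEquiv.coe_coe, LinearEquiv.symm_apply_apply]
    exact (htop w).symm
  · intro θ' h'
    rw [hε.isTheta_iff] at h'
    refine LinearMap.ext fun v => weightIncl_injective (F := F) a b ?_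
    obtain ⟨w, rfl⟩ := e.surjective v
    rw [h', LinearEquiv.coe_coe, LinearEquiv.symm_apply_apply]
    exact htop w
  · rfl

end IsCasimirInverse

end Theta

/-! ## Degrees of rational functions -/

section Degree
variable {m : ℕ}

/-- Rational functions of degree at most `d`. -/
def RDeg (d : ℤ) (p : RatFun m) : Prop := ∀ k, d < k → rCoeff k p = 0

theorem rCoeff_apply (k : ℤ) (p : RatFun m) : rCoeff k p = (scale m p).coeff (-k) := rfl

theorem RDeg.coeff_lt {d : ℤ} {p : RatFun m} (hp : RDeg d p) (l : ℤ) (hl : l < -d) :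
    (scale m p).coeff l = 0 := by
  have := hp (-l) (by lia)
  rwa [rCoeff_apply, neg_neg] at this

theorem RDeg.mono {d e : ℤ} {p : RatFun m} (hp : RDeg d p) (h : d ≤ e) : RDeg e p :=
  fun k hk => hp k (h.trans_lt hk)

theorem RDeg.zero (d : ℤ) : RDeg d (0 : RatFun m) := fun _ _ => map_zero _

theorem RDeg.add {d : ℤ} {p q : RatFun m} (hp : RDeg d p) (hq : RDeg d q) : RDeg d (p + q) :=
  fun k hk => by rw [map_add, hp k hk, hq k hk, add_zero]

theorem RDeg.neg {d : ℤ} {p : RatFun m} (hp : RDeg d p) : RDeg d (-p) :=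
  fun k hk => by rw [map_neg, hp k hk, neg_zero]

theorem RDeg.mul {d e : ℤ} {p q : RatFun m} (hp : RDeg d p) (hq : RDeg e q) :
    RDeg (d + e) (p * q) := fun k hk => by
  rw [rCoeff_apply, map_mul, HahnSeries.coeff_mul]
  refine Finset.sum_eq_zero fun x hx => ?_
  have h := (Finset.mem_antidiagonal.1 hx).2.2
  by_cases h1 : x.1 < -d
  · rw [hp.coeff_lt _ h1, zero_mul]
  · have h2 : x.2 < -e := by omega
    rw [hq.coeff_lt _ h2, mul_zero]

theorem RDeg.rCoeff_mul {d e : ℤ} {p q : RatFun m} (hp : RDeg d p) (hq : RDeg e q) :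
    rCoeff (d + e) (p * q) = rCoeff d p * rCoeff e q := by
  have h := coeff_mul_add (scale m p) (scale m q) (-d) (-e) hp.coeff_lt hq.coeff_lt 0
  simp only [Nat.cast_zero, add_zero, Finset.Nat.antidiagonal_zero, Finset.sum_singleton] at h
  rw [rCoeff_apply, map_mul, neg_add, h]
  rfl

theorem scale_algebraMap (p : MvPolynomial (Fin m) ℂ) :
    scale m (algebraMap _ _ p) = scalePoly m p :=
  IsFractionRing.lift_algebraMap _ _

theorem scale_ratVar (i : Fin m) : scale m (ratVar i) = HahnSeries.single (-1 : ℤ) (ratVar i) := by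
  rw [ratVar, scale_algebraMap, scalePoly, MvPolynomial.coe_eval₂Hom, MvPolynomial.eval₂_X]
  rfl

theorem scale_const (c : ℂ) :
    scale m (algebraMap ℂ (RatFun m) c) = HahnSeries.C (algebraMap ℂ (RatFun m) c) := by
  rw [IsScalarTower.algebraMap_apply ℂ (MvPolynomial (Fin m) ℂ) (RatFun m), scale_algebraMap,
    MvPolynomial.algebraMap_eq, scalePoly, MvPolynomial.coe_eval₂Hom, MvPolynomial.eval₂_C]
  rfl

theorem rDeg_ratVar (i : Fin m) : RDeg 1 (ratVar i) := fun k hk => by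
  rw [rCoeff_apply, scale_ratVar, HahnSeries.coeff_single_of_ne (by lia)]

theorem rCoeff_ratVar (i : Fin m) : rCoeff 1 (ratVar i) = ratVar i := by
  rw [rCoeff_apply, scale_ratVar, HahnSeries.coeff_single_same]

theorem rDeg_const (c : ℂ) : RDeg 0 (algebraMap ℂ (RatFun m) c) := fun k hk => by
  rw [rCoeff_apply, scale_const, HahnSeries.C_apply, HahnSeries.coeff_single_of_ne (by lia)]

theorem rCoeff_const (c : ℂ) :
    rCoeff 0 (algebraMap ℂ (RatFun m) c) = algebraMap ℂ (RatFun m) c := by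
  rw [rCoeff_apply, scale_const, HahnSeries.C_apply, neg_zero, HahnSeries.coeff_single_same]

/-- Orders of Laurent series over a field are additive. The nonvanishing coefficient says that the
degree of `p` is exactly `d`. -/
theorem RDeg.inv {d : ℤ} {p : RatFun m} (hp : RDeg d p) (h0 : rCoeff d p ≠ 0) :
    RDeg (-d) p⁻¹ := by
  have hp0 : p ≠ 0 := fun h => h0 (by rw [h, map_zero])
  have hs0 : scale m p ≠ 0 := (map_ne_zero _).2 hp0
  have hord : (scale m p).order = -d := by
    refine le_antisymm (HahnSeries.order_le_of_coeff_ne_zero h0) ?_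
    by_contra h
    exact HahnSeries.coeff_order_eq_zero.not.2 hs0 (hp.coeff_lt _ (not_le.1 h))
  have h1 : scale m p⁻¹ ≠ 0 := (map_ne_zero _).2 (inv_ne_zero hp0)
  have h2 : (scale m p).order + (scale m p⁻¹).order = 0 := by
    rw [← HahnSeries.order_mul hs0 h1, ← map_mul, mul_inv_cancel₀ hp0, map_one,
      HahnSeries.order_one]
  intro k hk
  rw [rCoeff_apply]
  exact HahnSeries.coeff_eq_zero_of_lt_order (by lia)

instance : CharZero (RatFun m) := charZero_of_injective_algebraMap (algebraMap ℂ (RatFun m)).injective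

theorem linearForm_ne_zero {γ : Fin m → ℤ} (hγ : γ ≠ 0) :
    ∑ i, (γ i : RatFun m) * ratVar i ≠ 0 := by
  obtain ⟨i, hi⟩ := Function.ne_iff.1 hγ
  have e : ∑ i, (γ i : RatFun m) * ratVar i = algebraMap (MvPolynomial (Fin m) ℂ) (RatFun m)
      (∑ i, MvPolynomial.C (γ i : ℂ) * MvPolynomial.X i) := by
    rw [map_sum]
    refine Finset.sum_congr rfl fun j _ => ?_
    rw [map_mul, ratVar]
    simp
  rw [e]
  intro h
  have h2 := IsFractionRing.injective (MvPolynomial (Fin m) ℂ) (RatFun m)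
    (h.trans (map_zero _).symm)
  have h3 := congrArg (MvPolynomial.coeff (Finsupp.single i 1)) h2
  rw [MvPolynomial.coeff_sum, Finset.sum_eq_single i, MvPolynomial.coeff_C_mul,
    MvPolynomial.coeff_X, if_pos rfl, mul_one, MvPolynomial.coeff_zero] at h3
  · exact hi (by exact_mod_cast h3)
  · intro j _ hj
    rw [MvPolynomial.coeff_C_mul, MvPolynomial.coeff_X, if_neg, mul_zero]
    intro h
    exact hj (Finsupp.single_left_injective one_ne_zero h)
  · simp

/-- In the difference of the two Casimir values the terms quadratic in `λ` cancel, as do the linear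
terms that do not involve `γ`. -/
theorem lowEigenvalue_eq (γ : Fin m → ℤ) : ∃ c : ℂ, lowEigenvalue (ratVar (m := m)) γ =
    -(∑ i, (γ i : RatFun m) * ratVar i) + algebraMap ℂ (RatFun m) c := by
  refine ⟨-(∑ i, (γ i : ℂ) * γ i + ∑ i, ∑ j, if i < j then (γ i : ℂ) - γ j else 0) / 2, ?_⟩
  have h1 : ∀ i j : Fin m, (if i < j then ratVar i + (γ i : RatFun m) - (ratVar j + (γ j : RatFun m))
      else 0) = (if i < j then ratVar i - ratVar j else 0) +
        (if i < j then (γ i : RatFun m) - γ j else 0) := by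
    intro i j
    split_ifs
    · ring
    · rw [add_zero]
  have h2 : algebraMap ℂ (RatFun m)
      (∑ i, (γ i : ℂ) * γ i + ∑ i, ∑ j, if i < j then (γ i : ℂ) - γ j else 0) =
      ∑ i, (γ i : RatFun m) * γ i + ∑ i, ∑ j, if i < j then (γ i : RatFun m) - γ j else 0 := by
    simp only [map_add, map_sum, apply_ite (algebraMap ℂ (RatFun m)), map_sub, map_mul,
      map_intCast, map_zero]
  have h3 : ∀ i : Fin m, (ratVar i + (γ i : RatFun m)) * (ratVar i + (γ i : RatFun m)) =
      ratVar i * ratVar i + (γ i : RatFun m) * γ i + 2 * ((γ i : RatFun m) * ratVar i) := by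
    intro i; ring
  rw [map_div₀, map_neg, h2, map_ofNat, lowEigenvalue, casimirValue, casimirValue]
  simp only [h1, h3, Finset.sum_add_distrib, ← Finset.mul_sum]
  ring

theorem rDeg_linearForm (γ : Fin m → ℤ) (c : ℂ) :
    RDeg 1 (∑ i, (γ i : RatFun m) * ratVar i + algebraMap ℂ (RatFun m) c) := by
  refine RDeg.add ?_ ((rDeg_const c).mono (by lia))
  refine Finset.sum_induction _ _ (fun _ _ => RDeg.add) (RDeg.zero _) fun i _ => ?_
  have := (rDeg_const (m := m) (γ i : ℂ)).mul (rDeg_ratVar i)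
  rwa [zero_add, map_intCast] at this

theorem rCoeff_linearForm (γ : Fin m → ℤ) (c : ℂ) :
    rCoeff 1 (∑ i, (γ i : RatFun m) * ratVar i + algebraMap ℂ (RatFun m) c) =
      ∑ i, (γ i : RatFun m) * ratVar i := by
  have h : rCoeff 1 (algebraMap ℂ (RatFun m) c) = 0 := rDeg_const c 1 zero_lt_one
  rw [map_add, h, add_zero, map_sum]
  refine Finset.sum_congr rfl fun i _ => ?_
  have h2 := (rDeg_const (m := m) (γ i : ℂ)).rCoeff_mul (rDeg_ratVar i)
  have h3 : algebraMap ℂ (RatFun m) (γ i : ℂ) = (γ i : RatFun m) := map_intCast _ _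
  rw [rCoeff_ratVar, rCoeff_const, h3, zero_add] at h2
  exact h2

theorem neg_linearForm (γ : Fin m → ℤ) :
    -(∑ i, (γ i : RatFun m) * ratVar i) = ∑ i, ((-γ) i : RatFun m) * ratVar i := by
  rw [← Finset.sum_neg_distrib]
  refine Finset.sum_congr rfl fun i _ => ?_
  rw [Pi.neg_apply, Int.cast_neg, neg_mul]

theorem rDeg_lowEigenvalue (γ : Fin m → ℤ) : RDeg 1 (lowEigenvalue (ratVar (m := m)) γ) := by
  obtain ⟨c, hc⟩ := lowEigenvalue_eq γ
  rw [hc, neg_linearForm]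
  exact rDeg_linearForm _ _

theorem rCoeff_lowEigenvalue_ne_zero {γ : Fin m → ℤ} (hγ : γ ≠ 0) :
    rCoeff 1 (lowEigenvalue (ratVar (m := m)) γ) ≠ 0 := by
  obtain ⟨c, hc⟩ := lowEigenvalue_eq γ
  rw [hc, neg_linearForm, rCoeff_linearForm]
  exact linearForm_ne_zero (neg_ne_zero.2 hγ)

theorem wordWeight_ne_zero {L : List (Fin m × Fin m)} (hL : IsLow L) (hL' : L ≠ []) :
    wordWeight L ≠ 0 := by
  intro h
  have h2 := height_wordWeight hL
  simp only [h, Pi.zero_apply, mul_zero, Finset.sum_const_zero] at h2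
  have : 0 < L.length := List.length_pos_of_ne_nil hL'
  lia

/-- The eigenvalues in question are affine in `λ`, and it suffices that their linear parts are
nonzero. -/
theorem isGeneric_ratVar : IsGeneric (ratVar (m := m)) := by
  constructor
  · intro L hL hL' h
    exact rCoeff_lowEigenvalue_ne_zero (wordWeight_ne_zero hL hL') (by rw [h, map_zero])
  · intro k l hkl L hL h
    obtain ⟨c, hc⟩ := lowEigenvalue_eq (wordWeight L)
    set γ : Fin m → ℤ := -wordWeight L + (Pi.single k 1 - Pi.single l 1) with hγ
    have e : lowEigenvalue ratVar (wordWeight L) + (ratVar k + (wordWeight L k : RatFun m)) -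
        (ratVar l + (wordWeight L l : RatFun m)) = ∑ i, (γ i : RatFun m) * ratVar i +
        algebraMap ℂ (RatFun m) (c + wordWeight L k - wordWeight L l) := by
      have e1 : ∑ i, (γ i : RatFun m) * ratVar i =
          -(∑ i, (wordWeight L i : RatFun m) * ratVar i) + (ratVar k - ratVar l) := by
        simp [hγ, add_mul, sub_mul, Finset.sum_add_distrib, Pi.single_apply]
      rw [hc, e1, map_sub, map_add, map_intCast, map_intCast]
      ring
    rw [e] at h
    have h2 := congrArg (rCoeff 1) h
    rw [rCoeff_linearForm, map_zero] at h2
    refine linearForm_ne_zero (fun h3 => ?_) h2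
    -- Such a weight would have height `k - l < 0`, whereas a word of lowering operators has
    -- nonnegative height.
    have h4 : wordWeight L = Pi.single k 1 - Pi.single l 1 := by
      rw [hγ, neg_add_eq_sub, sub_eq_zero] at h3
      exact h3.symm
    have h5 := height_wordWeight hL
    rw [h4] at h5
    simp only [Pi.sub_apply, mul_sub, Finset.sum_sub_distrib, Pi.single_apply, mul_ite, mul_one,
      mul_zero, Finset.sum_ite_eq', Finset.mem_univ, if_true] at h5
    have h6 : ((k : ℕ) : ℤ) < ((l : ℕ) : ℤ) := by exact_mod_cast hkl
    have h7 : (0 : ℤ) ≤ L.length := Int.natCast_nonneg _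
    linarith

end Degree

/-! ## Leading terms of operators on `S^(m)(a) ⊗ M` -/

/-- In coordinates with respect to a basis of `V`, the leading terms are taken separately, so every
coordinate has degree at most `d`. -/
theorem mem_degLE_of_gr {m : ℕ} {V : Type*} [AddCommGroup V] [Module ℂ V] {d : ℤ}
    {x : RatFun m ⊗[ℂ] V} (h : ∀ k, d < k → gr k x = 0) : x ∈ degLE m V d := by
  classical
  set B := Module.Basis.ofVectorSpace ℂ V with hB
  set e := TensorProduct.equivFinsuppOfBasisRight (M := RatFun m) B with he
  have h1 : ∀ k (y : RatFun m ⊗[ℂ] V) i, e (gr k y) i = rCoeff k (e y i) := by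
    intro k y i
    induction y with
    | zero => simp
    | add x y hx hy => rw [map_add, map_add, map_add, Finsupp.add_apply, Finsupp.add_apply, hx, hy,
        map_add]
    | tmul p v =>
      rw [gr, LinearMap.rTensor_tmul, he, TensorProduct.equivFinsuppOfBasisRight_apply_tmul_apply,
        TensorProduct.equivFinsuppOfBasisRight_apply_tmul_apply, map_smul]
  have h2 : ∀ i, RDeg d (e x i) := fun i k hk => by
    rw [← h1, h k hk, map_zero, Finsupp.zero_apply]
  have h3 : x = (e x).sum fun i p => p ⊗ₜ[ℂ] B i := by
    rw [← TensorProduct.equivFinsuppOfBasisRight_symm_apply, he, LinearEquiv.symm_apply_apply]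
  rw [h3]
  exact Submodule.sum_mem _ fun i _ => Submodule.subset_span ⟨e x i, B i, h2 i, rfl⟩

/-! ### The degree filtration on the Verma module and on the tensor product -/

section Lattice
variable {m n : ℕ}

/-- The vectors of degree at most `d` in the Verma module, where lowering operators have
degree `1`. -/
def vermaLattice (m : ℕ) (d : ℤ) : AddSubgroup (Verma (ratVar (m := m))) :=
  AddSubgroup.closure {v | ∃ (p : RatFun m) (L : List (Fin m × Fin m)), IsLow L ∧
    RDeg (d - L.length) p ∧ v = p • vermaWord ratVar L}

theorem smul_word_mem {d : ℤ} {p : RatFun m} {L : List (Fin m × Fin m)} (hL : IsLow L)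
    (hp : RDeg (d - L.length) p) : p • vermaWord ratVar L ∈ vermaLattice m d :=
  AddSubgroup.subset_closure ⟨p, L, hL, hp, rfl⟩

theorem map_vermaLattice_le {V : Type*} [AddCommGroup V] (f : Verma (ratVar (m := m)) →+ V)
    {d : ℤ} {S : AddSubgroup V}
    (h : ∀ (p : RatFun m) L, IsLow L → RDeg (d - L.length) p → f (p • vermaWord ratVar L) ∈ S)
    {v : Verma (ratVar (m := m))} (hv : v ∈ vermaLattice m d) : f v ∈ S := by
  have : vermaLattice m d ≤ S.comap f := by
    refine (AddSubgroup.closure_le _).2 ?_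
    rintro _ ⟨p, L, hL, hp, rfl⟩
    exact h p L hL hp
  exact this hv

theorem vermaLattice_mono {d e : ℤ} (h : d ≤ e) : vermaLattice m d ≤ vermaLattice m e :=
  fun _ hv => map_vermaLattice_le (AddMonoidHom.id _)
    (fun _ _ hL hp => smul_word_mem hL (hp.mono (by lia))) hv

theorem smul_mem_vermaLattice {d e : ℤ} {q : RatFun m} (hq : RDeg e q)
    {v : Verma (ratVar (m := m))} (hv : v ∈ vermaLattice m d) : q • v ∈ vermaLattice m (d + e) := by
  refine map_vermaLattice_le (DistribSMul.toAddMonoidHom _ q) (fun p L hL hp => ?_) hv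
  change q • p • vermaWord ratVar L ∈ _
  rw [smul_smul]
  refine smul_word_mem hL ?_
  rw [show d + e - (L.length : ℤ) = e + (d - L.length) by ring]
  exact hq.mul hp

theorem gen_low_mem_vermaLattice {d : ℤ} {k l : Fin m} (h : l < k) {v : Verma (ratVar (m := m))}
    (hv : v ∈ vermaLattice m d) : vermaGen ratVar k l v ∈ vermaLattice m (d + 1) := by
  refine map_vermaLattice_le (vermaGen ratVar k l).toAddMonoidHom (fun p L hL hp => ?_) hv
  change vermaGen ratVar k l (p • vermaWord ratVar L) ∈ _
  rw [map_smul]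
  refine smul_word_mem (L := (k, l) :: L) (fun q hq => ?_) ?_
  · rcases List.mem_cons.1 hq with rfl | hq
    · exact h
    · exact hL q hq
  · rw [List.length_cons, Nat.cast_add, Nat.cast_one, add_sub_add_right_eq_sub]
    exact hp

/-- A lowering generator lengthens the word by one, and a diagonal one yields some `λ` on the
highest weight vector. Commuting any other generator past a letter costs a commutator acting on a
shorter word. -/
theorem gen_word_mem {L : List (Fin m × Fin m)} (hL : IsLow L) (k l : Fin m) :
    vermaGen ratVar k l (vermaWord ratVar L) ∈ vermaLattice m (L.length + 1) := by
  have hone : RDeg 0 (1 : RatFun m) := by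
    have := rDeg_const (m := m) 1
    rwa [map_one] at this
  have hword : ∀ L : List (Fin m × Fin m), IsLow L →
      vermaWord ratVar L ∈ vermaLattice m L.length := fun L hL => by
    rw [← one_smul (RatFun m) (vermaWord ratVar L)]
    exact smul_word_mem hL (by rwa [sub_self])
  induction L generalizing k l with
  | nil =>
    rcases lt_trichotomy k l with h | rfl | h
    · rw [vermaWord, vermaGen_vermaVec_of_lt ratVar h]; exact zero_mem _
    · rw [vermaWord, vermaGen_vermaVec_diag]
      exact smul_word_mem (L := []) hL (by simpa using rDeg_ratVar k)
    · exact gen_low_mem_vermaLattice h (hword _ hL)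
  | cons p L ih =>
    have hL' := hL.cons
    rw [vermaWord, vermaGen_comm]
    have h1 : ∀ k l, vermaGen ratVar k l (vermaWord ratVar L) ∈
        vermaLattice m ((p :: L).length + 1) := fun k l =>
      vermaLattice_mono (by rw [List.length_cons]; push_cast; lia) (ih hL'.2 k l)
    refine add_mem (gen_low_mem_vermaLattice hL'.1 ?_) (sub_mem ?_ ?_)
    · have := ih hL'.2 k l
      rwa [List.length_cons, Nat.cast_add, Nat.cast_one]
    · split_ifs
      · exact h1 _ _
      · exact zero_mem _
    · split_ifs
      · exact h1 _ _
      · exact zero_mem _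

theorem gen_mem_vermaLattice {d : ℤ} (k l : Fin m) {v : Verma (ratVar (m := m))}
    (hv : v ∈ vermaLattice m d) : vermaGen ratVar k l v ∈ vermaLattice m (d + 1) := by
  refine map_vermaLattice_le (vermaGen ratVar k l).toAddMonoidHom (fun p L hL hp => ?_) hv
  change vermaGen ratVar k l (p • vermaWord ratVar L) ∈ _
  rw [map_smul]
  have := smul_mem_vermaLattice hp (gen_word_mem hL k l)
  rwa [show (L.length : ℤ) + 1 + (d - L.length) = d + 1 by ring] at this

/-- Rational functions of degree at most `d`. -/
def rDegSubgroup (m : ℕ) (d : ℤ) : AddSubgroup (RatFun m) where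
  carrier := {p | RDeg d p}
  add_mem' := RDeg.add
  zero_mem' := RDeg.zero d
  neg_mem' := RDeg.neg

variable {ε : Verma (ratVar (m := m)) →ₗ[RatFun m] RatFun m}

theorem IsVermaProj.rDeg (hε : IsVermaProj ε) {d : ℤ} {v : Verma (ratVar (m := m))}
    (hv : v ∈ vermaLattice m d) : RDeg d (ε v) := by
  refine map_vermaLattice_le (S := rDegSubgroup m d) ε.toAddMonoidHom (fun p L hL hp => ?_) hv
  change RDeg d (ε (p • vermaWord ratVar L))
  rw [map_smul]
  rcases L with _ | ⟨q, L⟩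
  · have h1 : ε (vermaWord ratVar []) = 1 := hε.1
    rw [h1, smul_eq_mul, mul_one]
    simpa using hp
  · rw [hε.2 _ hL (List.cons_ne_nil _ _), smul_zero]
    exact RDeg.zero d

/-- A raising operator gains nothing after projection: `ε` kills everything that begins with the
first lowering letter, so only the commutator with that letter survives. It acts on a word shorter
by one, which compensates the degree of a generator. -/
theorem IsVermaProj.rDeg_raising (hε : IsVermaProj ε) {d : ℤ} {k l : Fin m} (hkl : k < l)
    {v : Verma (ratVar (m := m))} (hv : v ∈ vermaLattice m d) :
    RDeg d (ε (vermaGen ratVar k l v)) := by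
  refine map_vermaLattice_le (S := rDegSubgroup m d) (ε ∘ₗ vermaGen ratVar k l).toAddMonoidHom
    (fun p L hL hp => ?_) hv
  change RDeg d (ε (vermaGen ratVar k l (p • vermaWord ratVar L)))
  rw [map_smul, map_smul]
  rcases L with _ | ⟨q, L⟩
  · rw [vermaWord, vermaGen_vermaVec_of_lt ratVar hkl, map_zero, smul_zero]
    exact RDeg.zero d
  · have hL' := hL.cons
    rw [vermaWord, vermaGen_comm, map_add, hε.gen_low hL'.1, zero_add]
    have h : (if l = q.1 then vermaGen ratVar k q.2 (vermaWord ratVar L) else 0) -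
        (if q.2 = k then vermaGen ratVar q.1 l (vermaWord ratVar L) else 0) ∈
        vermaLattice m ((q :: L).length) := by
      rw [List.length_cons, Nat.cast_add, Nat.cast_one]
      refine sub_mem ?_ ?_
      · split_ifs
        · exact gen_word_mem hL'.2 _ _
        · exact zero_mem _
      · split_ifs
        · exact gen_word_mem hL'.2 _ _
        · exact zero_mem _
    have h2 := hp.mul (hε.rDeg h)
    rwa [sub_add_cancel] at h2

/-- This is the classical limit of the Verma factor: `e_{kl}` degenerates to the diagonal matrix of
the `λ`. A lowering generator is invisible to `ε`, and a raising one has degree too small. -/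
theorem IsVermaProj.rCoeff_gen (hε : IsVermaProj ε) {d : ℤ} (k l : Fin m)
    {v : Verma (ratVar (m := m))} (hv : v ∈ vermaLattice m d) :
    rCoeff (d + 1) (ε (vermaGen ratVar k l v)) =
      if k = l then ratVar k * rCoeff d (ε v) else 0 := by
  rcases lt_trichotomy k l with h | rfl | h
  · rw [if_neg h.ne]
    exact hε.rDeg_raising h hv _ (by lia)
  · rw [if_pos rfl, hε.gen_diag, add_comm d, (rDeg_ratVar k).rCoeff_mul (hε.rDeg hv), rCoeff_ratVar]
  · rw [if_neg h.ne', hε.gen_low h, map_zero]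

/-- The letter applied by the lowering operator costs one degree, and `T` divides by an eigenvalue
of degree exactly one. -/
theorem inverse_gen_mem_vermaLattice {T : Module.End (RatFun m) (Verma (ratVar (m := m)))}
    (hT : ∀ L, IsLow L → L ≠ [] → T (vermaWord ratVar L) =
        (lowEigenvalue ratVar (wordWeight L))⁻¹ • vermaWord ratVar L) {i j : Fin m} (hij : i < j)
    {d : ℤ} {v : Verma (ratVar (m := m))} (hv : v ∈ vermaLattice m d) :
    T (vermaGen ratVar j i v) ∈ vermaLattice m d := by
  refine map_vermaLattice_le (T ∘ₗ vermaGen ratVar j i).toAddMonoidHom (fun p L hL hp => ?_) hv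
  change T (vermaGen ratVar j i (p • vermaWord ratVar L)) ∈ _
  have hL' : IsLow ((j, i) :: L) := fun q hq => by
    rcases List.mem_cons.1 hq with rfl | hq
    · exact hij
    · exact hL q hq
  have hne := List.cons_ne_nil (j, i) L
  have h := hT _ hL' hne
  rw [vermaWord] at h
  rw [map_smul, map_smul, h, smul_smul]
  refine smul_word_mem hL' ?_
  have h2 := hp.mul ((rDeg_lowEigenvalue (wordWeight ((j, i) :: L))).inv
    (rCoeff_lowEigenvalue_ne_zero (wordWeight_ne_zero hL' hne)))
  refine h2.mono ?_
  rw [List.length_cons]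
  push_cast
  lia

variable {a : Fin n → ℕ}

/-- An element of `S^(m)(a)`, with scalars extended to the field of rational functions. -/
def oneTmul (s : SymTensor m a) : SymTensorOver (RatFun m) m a :=
  ((1 : RatFun m) ⊗ₜ[ℂ] s : RatFun m ⊗[ℂ] SymTensor m a)

variable (a) in
/-- The elements of degree at most `d` of `S^(m)(a) ⊗ M`. -/
def fullLattice (d : ℤ) : AddSubgroup (FullTensor a (ratVar (m := m))) :=
  AddSubgroup.closure {x | ∃ (s : SymTensor m a) (v : Verma (ratVar (m := m))),
    v ∈ vermaLattice m d ∧ x = fullTmul (oneTmul s) v}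

theorem fullTmul_mem {d : ℤ} (s : SymTensor m a) {v : Verma (ratVar (m := m))}
    (hv : v ∈ vermaLattice m d) :
    fullTmul (oneTmul s) v ∈ fullLattice a d :=
  AddSubgroup.subset_closure ⟨s, v, hv, rfl⟩

theorem fullLattice_induction {d : ℤ} {P : FullTensor a (ratVar (m := m)) → Prop} (h0 : P 0)
    (hsub : ∀ x y, P x → P y → P (x - y))
    (h : ∀ (s : SymTensor m a) v, v ∈ vermaLattice m d →
      P (fullTmul (oneTmul s) v))
    {x : FullTensor a (ratVar (m := m))} (hx : x ∈ fullLattice a d) : P x := by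
  have hneg : ∀ x, P x → P (-x) := fun x hx => by rw [← zero_sub]; exact hsub _ _ h0 hx
  refine AddSubgroup.closure_induction (p := fun x _ => P x) ?_ h0 ?_ ?_ hx
  · rintro _ ⟨s, v, hv, rfl⟩
    exact h s v hv
  · intro x y _ _ hx hy
    rw [← sub_neg_eq_add]
    exact hsub _ _ hx (hneg _ hy)
  · intro x _ hx
    exact hneg x hx

theorem fullLattice_mono {d e : ℤ} (h : d ≤ e) :
    fullLattice (m := m) a d ≤ fullLattice a e := fun _ hx =>
  fullLattice_induction (zero_mem _) (fun _ _ => sub_mem)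
    (fun s _ hv => fullTmul_mem s (vermaLattice_mono h hv)) hx

variable (a) in
/-- The leading term of an element of `S^(m)(a)` over the field of rational functions. -/
def grOver (k : ℤ) : SymTensorOver (RatFun m) m a →+ SymTensorOver (RatFun m) m a :=
  (gr (V := SymTensor m a) k).toAddMonoidHom

theorem grOver_smul_tmul (k : ℤ) (p : RatFun m) (s : SymTensor m a) :
    grOver a k (p • oneTmul s) =
      rCoeff k p • oneTmul s := by
  change gr k (p • ((1 : RatFun m) ⊗ₜ[ℂ] s)) = rCoeff k p • ((1 : RatFun m) ⊗ₜ[ℂ] s)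
  rw [TensorProduct.smul_tmul', TensorProduct.smul_tmul', smul_eq_mul, smul_eq_mul, mul_one,
    mul_one, gr, LinearMap.rTensor_tmul]

theorem grOver_overHom (k : ℤ) (x : Module.End ℂ (SymTensor m a))
    (y : SymTensorOver (RatFun m) m a) :
    grOver a k (overHom (RatFun m) a x y) = overHom (RatFun m) a x (grOver a k y) := by
  have : ∀ y : RatFun m ⊗[ℂ] SymTensor m a,
      gr k (LinearMap.lTensor (RatFun m) x y) = LinearMap.lTensor (RatFun m) x (gr k y) := by
    intro y
    rw [gr, ← LinearMap.comp_apply, LinearMap.rTensor_comp_lTensor, ← LinearMap.comp_apply,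
      LinearMap.lTensor_comp_rTensor]
  exact this y

theorem IsVermaProj.grOver_topPart (hε : IsVermaProj ε) {d k : ℤ} (hk : d < k)
    {x : FullTensor a (ratVar (m := m))} (hx : x ∈ fullLattice a d) :
    grOver a k (topPart ratVar ε x) = 0 := by
  refine fullLattice_induction (P := fun x => grOver a k (topPart ratVar ε x) = 0) ?_ ?_ ?_ hx
  · rw [map_zero, map_zero]
  · intro x y hx hy
    rw [map_sub, map_sub, hx, hy, sub_zero]
  · intro s v hv
    rw [topPart_tmul, grOver_smul_tmul, hε.rDeg hv k hk, zero_smul]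

/-- The operator `X` on `S^(m)(a) ⊗ M` has degree `k`, and on highest weight components its leading
term is given by `x`. -/
def HasLead (ε : Verma (ratVar (m := m)) →ₗ[RatFun m] RatFun m) (k : ℤ)
    (X : Module.End (RatFun m) (FullTensor a (ratVar (m := m))))
    (x : Module.End (RatFun m) (SymTensorOver (RatFun m) m a)) : Prop :=
  ∀ d, ∀ v ∈ fullLattice a d, X v ∈ fullLattice a (d + k) ∧
    grOver a (d + k) (topPart ratVar ε (X v)) = x (grOver a d (topPart ratVar ε v))

namespace HasLead

variable {k k' : ℤ} {X Y : Module.End (RatFun m) (FullTensor a (ratVar (m := m)))}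
  {x y : Module.End (RatFun m) (SymTensorOver (RatFun m) m a)}

theorem zero : HasLead ε k (0 : Module.End (RatFun m) (FullTensor a (ratVar (m := m)))) 0 :=
  fun d v _ => ⟨zero_mem _, by rw [LinearMap.zero_apply, map_zero, map_zero, LinearMap.zero_apply]⟩

theorem one : HasLead ε 0 (1 : Module.End (RatFun m) (FullTensor a (ratVar (m := m)))) 1 :=
  fun d v hv => by
    rw [add_zero]
    exact ⟨hv, rfl⟩

theorem add (hX : HasLead ε k X x) (hY : HasLead ε k Y y) : HasLead ε k (X + Y) (x + y) :=
  fun d v hv => ⟨add_mem (hX d v hv).1 (hY d v hv).1, by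
    rw [LinearMap.add_apply, map_add, map_add, (hX d v hv).2, (hY d v hv).2]
    rfl⟩

theorem neg (hX : HasLead ε k X x) : HasLead ε k (-X) (-x) :=
  fun d v hv => ⟨neg_mem (hX d v hv).1, by
    rw [LinearMap.neg_apply, map_neg, map_neg, (hX d v hv).2]
    rfl⟩

theorem sum {ι : Type*} {s : Finset ι}
    {X : ι → Module.End (RatFun m) (FullTensor a (ratVar (m := m)))}
    {x : ι → Module.End (RatFun m) (SymTensorOver (RatFun m) m a)}
    (h : ∀ i ∈ s, HasLead ε k (X i) (x i)) : HasLead ε k (∑ i ∈ s, X i) (∑ i ∈ s, x i) := by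
  classical
  induction s using Finset.induction_on with
  | empty => exact zero
  | insert i s hi ih =>
    rw [Finset.sum_insert hi, Finset.sum_insert hi]
    exact (h i (Finset.mem_insert_self _ _)).add
      (ih fun j hj => h j (Finset.mem_insert_of_mem hj))

theorem mul (hX : HasLead ε k X x) (hY : HasLead ε k' Y y) :
    HasLead ε (k + k') (X * Y) (x * y) := fun d v hv => by
  have h1 := hY d v hv
  have h2 := hX _ _ h1.1
  rw [add_assoc, add_comm k'] at h2
  exact ⟨h2.1, by rw [Module.End.mul_apply, h2.2, h1.2]; rfl⟩

theorem zsmul (c : ℤ) (hX : HasLead ε k X x) : HasLead ε k (c • X) (c • x) :=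
  fun d v hv => ⟨zsmul_mem (hX d v hv).1 c, by
    rw [LinearMap.smul_apply, map_zsmul, map_zsmul, (hX d v hv).2]
    rfl⟩

/-- An operator of smaller degree has no coefficient in the larger degree, so its leading term there
is zero. -/
theorem of_lt (hε : IsVermaProj ε) (h : k < k') (hX : HasLead ε k X x) : HasLead ε k' X 0 :=
  fun d v hv => ⟨fullLattice_mono (by lia) (hX d v hv).1,
    hε.grOver_topPart (by lia) (hX d v hv).1⟩

theorem siteHom (x : Module.End ℂ (SymTensor m a)) :
    HasLead ε 0 (siteHom a ratVar (overHom (RatFun m) a x)) (overHom (RatFun m) a x) :=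
  fun d v hv => by
    rw [add_zero, topPart_siteHom, grOver_overHom]
    refine ⟨fullLattice_induction
      (P := fun v => BetheDuality.siteHom a ratVar (overHom (RatFun m) a x) v ∈ fullLattice a d)
      ?_ ?_ ?_ hv, rfl⟩
    · rw [map_zero]; exact zero_mem _
    · intro x y hx hy
      rw [map_sub]; exact sub_mem hx hy
    · intro s v hv
      exact fullTmul_mem _ hv

theorem fullVermaGen (hε : IsVermaProj ε) (i j : Fin m) :
    HasLead ε 1 (fullVermaGen a ratVar i j)
      (if i = j then algebraMap (RatFun m) _ (ratVar i) else 0) := fun d v hv => by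
  refine ⟨fullLattice_induction
      (P := fun v => BetheDuality.fullVermaGen a ratVar i j v ∈ fullLattice a (d + 1))
      ?_ ?_ ?_ hv, fullLattice_induction (P := fun v => grOver a (d + 1)
      (topPart ratVar ε (BetheDuality.fullVermaGen a ratVar i j v)) = (if i = j then
        algebraMap (RatFun m) (Module.End (RatFun m) (SymTensorOver (RatFun m) m a)) (ratVar i)
        else 0) (grOver a d (topPart ratVar ε v))) ?_ ?_ ?_ hv⟩
  · rw [map_zero]; exact zero_mem _
  · intro x y hx hy
    rw [map_sub]; exact sub_mem hx hy
  · intro s v hv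
    exact fullTmul_mem _ (gen_mem_vermaLattice i j hv)
  · simp only [map_zero]
  · intro x y hx hy
    simp only [map_sub, hx, hy]
  · intro s v hv
    rw [fullVermaGen_eq, vermaHom_tmul, topPart_tmul, grOver_smul_tmul, hε.rCoeff_gen _ _ hv,
      topPart_tmul, grOver_smul_tmul]
    split_ifs
    · rw [Module.algebraMap_end_apply, mul_smul]
    · rw [zero_smul]; rfl

end HasLead

end Lattice

/-! ### Leading terms of series, quantum minors and Bethe operators -/

section SeriesLead
variable {m n : ℕ} {a : Fin n → ℕ} {ε : Verma (ratVar (m := m)) →ₗ[RatFun m] RatFun m}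

/-- Each step of the geometric series preserves degree zero by `inverse_gen_mem_vermaLattice`; hence
`θ⁻¹` of a constant vector has degree zero. -/
theorem thetaInv_mem_fullLattice {b : Fin m → ℕ}
    {T : Module.End (RatFun m) (Verma (ratVar (m := m)))}
    (hT : ∀ L, IsLow L → L ≠ [] → T (vermaWord ratVar L) =
        (lowEigenvalue ratVar (wordWeight L))⁻¹ • vermaWord ratVar L) (w : weightSpace a b) :
    thetaInv a b ratVar T ((1 : RatFun m) ⊗ₜ[ℂ] w) ∈ fullLattice a 0 := by
  set X := -(vermaHom a ratVar T * mixedCasimir a ratVar) with hX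
  have hstep : ∀ x ∈ fullLattice a 0, X x ∈ fullLattice a 0 := by
    intro x hx
    refine fullLattice_induction (P := fun x => X x ∈ fullLattice a 0) ?_ ?_ ?_ hx
    · rw [map_zero]; exact zero_mem _
    · intro x y hx hy
      rw [map_sub]; exact sub_mem hx hy
    · intro s v hv
      rw [hX, vermaHom_mul_mixedCasimir, LinearMap.neg_apply, LinearMap.sum_apply]
      refine neg_mem (sum_mem fun i _ => ?_)
      rw [LinearMap.sum_apply]
      refine sum_mem fun j _ => ?_
      split_ifs with hij
      · exact fullTmul_mem (siteSum a i j s) (inverse_gen_mem_vermaLattice hT hij hv)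
      · exact zero_mem _
  have h0 : tensorVermaVec a ratVar (weightIncl (RatFun m) a b (1 ⊗ₜ[ℂ] w)) ∈ fullLattice a 0 := by
    have hv : vermaVec (ratVar (m := m)) ∈ vermaLattice m 0 := by
      have h1 : RDeg (0 - (([] : List (Fin m × Fin m)).length : ℤ)) (1 : RatFun m) := by
        have := rDeg_const (m := m) 1
        rwa [map_one] at this
      have := smul_word_mem (fun _ h => absurd h List.not_mem_nil) h1
      rwa [one_smul] at this
    exact fullTmul_mem w.1 hv
  have hp : ∀ p : ℕ, (X ^ p) (tensorVermaVec a ratVar (weightIncl (RatFun m) a b (1 ⊗ₜ[ℂ] w))) ∈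
      fullLattice a 0 := by
    intro p
    induction p with
    | zero => exact h0
    | succ p ih => rw [pow_succ', Module.End.mul_apply]; exact hstep _ ih
  rw [thetaInv, LinearMap.comp_apply, LinearMap.sum_apply]
  exact sum_mem fun p _ => hp p

/-- Coefficientwise version of `HasLead`. -/
def SeriesLead (ε : Verma (ratVar (m := m)) →ₗ[RatFun m] RatFun m) (k : ℤ)
    (f : LaurentSeries (Module.End (RatFun m) (FullTensor a (ratVar (m := m)))))
    (g : LaurentSeries (Module.End (RatFun m) (SymTensorOver (RatFun m) m a))) : Prop :=
  ∀ l, HasLead ε k (f.coeff l) (g.coeff l)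

namespace HasLead

theorem algebraMap (c : ℂ) : HasLead (a := a) ε 0
    (algebraMap (RatFun m) _ (algebraMap ℂ (RatFun m) c))
    (algebraMap (RatFun m) _ (algebraMap ℂ (RatFun m) c)) := by
  have h : overHom (RatFun m) a (Algebra.algebraMap ℂ _ c) =
      Algebra.algebraMap (RatFun m) (Module.End (RatFun m) (SymTensorOver (RatFun m) m a))
        (Algebra.algebraMap ℂ (RatFun m) c) := by
    refine LinearMap.ext fun y => ?_
    change LinearMap.lTensor (RatFun m) (Algebra.algebraMap ℂ (Module.End ℂ (SymTensor m a)) c)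
      (show RatFun m ⊗[ℂ] SymTensor m a from y) =
      Algebra.algebraMap ℂ (RatFun m) c • (show RatFun m ⊗[ℂ] SymTensor m a from y)
    induction (show RatFun m ⊗[ℂ] SymTensor m a from y) with
    | zero => rw [map_zero, smul_zero]
    | add x y hx hy => rw [map_add, smul_add, hx, hy]
    | tmul p s =>
      rw [LinearMap.lTensor_tmul, Module.algebraMap_end_apply, TensorProduct.tmul_smul,
        algebraMap_smul]
  have h2 := HasLead.siteHom (a := a) (ε := ε) (Algebra.algebraMap ℂ _ c)
  rwa [h, AlgHom.commutes] at h2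

end HasLead

namespace SeriesLead

variable {k k' : ℤ} {f f' : LaurentSeries (Module.End (RatFun m) (FullTensor a (ratVar (m := m))))}
  {g g' : LaurentSeries (Module.End (RatFun m) (SymTensorOver (RatFun m) m a))}

theorem zero : SeriesLead (a := a) ε k 0 0 := fun _ => HasLead.zero

theorem C {X : Module.End (RatFun m) (FullTensor a (ratVar (m := m)))}
    {x : Module.End (RatFun m) (SymTensorOver (RatFun m) m a)} (h : HasLead ε k X x) :
    SeriesLead ε k (HahnSeries.C X) (HahnSeries.C x) := fun l => by
  rw [HahnSeries.C_apply, HahnSeries.C_apply, HahnSeries.coeff_single, HahnSeries.coeff_single]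
  split_ifs
  · exact h
  · exact HasLead.zero

theorem one : SeriesLead (a := a) ε 0 1 1 := C HasLead.one

theorem add (h : SeriesLead ε k f g) (h' : SeriesLead ε k f' g') :
    SeriesLead ε k (f + f') (g + g') := fun l => by
  rw [HahnSeries.coeff_add, HahnSeries.coeff_add]; exact (h l).add (h' l)

theorem neg (h : SeriesLead ε k f g) : SeriesLead ε k (-f) (-g) := fun l => by
  rw [HahnSeries.coeff_neg, HahnSeries.coeff_neg]; exact (h l).neg

theorem zsmul (c : ℤ) (h : SeriesLead ε k f g) : SeriesLead ε k (c • f) (c • g) := fun l => by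
  rw [HahnSeries.coeff_smul, HahnSeries.coeff_smul]; exact (h l).zsmul c

theorem intCast (c : ℤ) : SeriesLead (a := a) ε 0 c c := by
  rw [← zsmul_one c, ← zsmul_one c]; exact one.zsmul c

theorem of_lt (hε : IsVermaProj ε) (hk : k < k') (h : SeriesLead ε k f g) :
    SeriesLead ε k' f 0 := fun l => (h l).of_lt hε hk

theorem sum {ι : Type*} {s : Finset ι}
    {f : ι → LaurentSeries (Module.End (RatFun m) (FullTensor a (ratVar (m := m))))}
    {g : ι → LaurentSeries (Module.End (RatFun m) (SymTensorOver (RatFun m) m a))}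
    (h : ∀ i ∈ s, SeriesLead ε k (f i) (g i)) : SeriesLead ε k (∑ i ∈ s, f i) (∑ i ∈ s, g i) := by
  classical
  induction s using Finset.induction_on with
  | empty => exact zero
  | insert i s hi ih =>
    rw [Finset.sum_insert hi, Finset.sum_insert hi]
    exact (h i (Finset.mem_insert_self _ _)).add
      (ih fun j hj => h j (Finset.mem_insert_of_mem hj))

theorem exists_bound (f : LaurentSeries (Module.End (RatFun m) (FullTensor a (ratVar (m := m)))))
    (g : LaurentSeries (Module.End (RatFun m) (SymTensorOver (RatFun m) m a))) :
    ∃ B : ℤ, (∀ l < B, f.coeff l = 0) ∧ ∀ l < B, g.coeff l = 0 := by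
  obtain ⟨B, hB⟩ := exists_coeff_eq_zero f
  obtain ⟨B', hB'⟩ := exists_coeff_eq_zero g
  exact ⟨min B B', fun l hl => hB l (hl.trans_le (min_le_left _ _)),
    fun l hl => hB' l (hl.trans_le (min_le_right _ _))⟩

theorem mul (h : SeriesLead ε k f g) (h' : SeriesLead ε k' f' g') :
    SeriesLead ε (k + k') (f * f') (g * g') := fun l => by
  obtain ⟨B, hf, hg⟩ := exists_bound f g
  obtain ⟨B', hf', hg'⟩ := exists_bound f' g'
  by_cases hl : l < B + B'
  · rw [coeff_mul_lt hf hf' l hl, coeff_mul_lt hg hg' l hl]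
    exact HasLead.zero
  · obtain ⟨s, rfl⟩ : ∃ s : ℕ, l = B + B' + s := ⟨(l - (B + B')).toNat, by lia⟩
    rw [coeff_mul_add _ _ B B' hf hf', coeff_mul_add _ _ B B' hg hg']
    exact HasLead.sum fun x _ => (h _).mul (h' _)

theorem shiftHom (c : ℤ) (h : SeriesLead ε k f g) :
    SeriesLead ε k (shiftHom c f) (shiftHom c g) := fun l => by
  obtain ⟨B, hf, hg⟩ := exists_bound f g
  change HasLead ε k ((shiftSeries c f).coeff l) ((shiftSeries c g).coeff l)
  by_cases hl : l < B
  · rw [shiftSeries_coeff_lt c f B hf l hl, shiftSeries_coeff_lt c g B hg l hl]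
    exact HasLead.zero
  · obtain ⟨s, rfl⟩ : ∃ s : ℕ, l = B + s := ⟨(l - B).toNat, by lia⟩
    rw [shiftSeries_coeff_add c f B hf, shiftSeries_coeff_add c g B hg]
    exact HasLead.sum fun x _ => (h _).zsmul _

theorem oprod {r : ℕ}
    {f : Fin r → LaurentSeries (Module.End (RatFun m) (FullTensor a (ratVar (m := m))))}
    {g : Fin r → LaurentSeries (Module.End (RatFun m) (SymTensorOver (RatFun m) m a))}
    (h : ∀ s, SeriesLead ε k (f s) (g s)) :
    SeriesLead ε (r * k) (oprod f) (oprod g) := by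
  induction r with
  | zero => rw [oprod_zero, oprod_zero, Nat.cast_zero, zero_mul]; exact one
  | succ r ih =>
    rw [oprod_succ, oprod_succ, show ((r + 1 : ℕ) : ℤ) * k = k + r * k by push_cast; ring]
    exact (h 0).mul (ih fun s => h s.succ)

theorem ite (p : Prop) [Decidable p] (h : SeriesLead ε k f g) :
    SeriesLead ε k (if p then f else 0) (if p then g else 0) := by
  split_ifs
  · exact h
  · exact zero

theorem linearSeries (c : ℂ) : SeriesLead (a := a) ε 0
    (linearSeries (RatFun m) _ (algebraMap ℂ (RatFun m) c))
    (linearSeries (RatFun m) _ (algebraMap ℂ (RatFun m) c)) := by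
  rw [linearSeries_eq, linearSeries_eq, sub_eq_add_neg, sub_eq_add_neg]
  refine add (fun l => ?_) (C (HasLead.algebraMap c)).neg
  rw [scSeries_coeff, scSeries_coeff, uSeries, HahnSeries.coeff_single]
  split_ifs
  · rw [map_one, map_one]; exact HasLead.one
  · rw [map_zero, map_zero]; exact HasLead.zero

theorem evalMatrix_site (c : ℂ) (i : Fin n) (p q : Fin m) :
    SeriesLead ε 0 (evalMatrix (algebraMap ℂ (RatFun m) c) (fullSiteGen a ratVar i) p q)
      (evalMatrix (algebraMap ℂ (RatFun m) c) (siteGenOver (RatFun m) a i) p q) := by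
  have hpow : ∀ r : ℕ, HasLead ε 0
      ((algebraMap ℂ (RatFun m) c) ^ r • fullSiteGen a (ratVar (m := m)) i p q)
      ((algebraMap ℂ (RatFun m) c) ^ r • siteGenOver (RatFun m) a i p q) := by
    intro r
    have h := (HasLead.algebraMap (a := a) (ε := ε) (c ^ r)).mul (HasLead.siteHom (siteGen a i p q))
    rw [← Algebra.smul_def, ← Algebra.smul_def, map_pow, add_zero] at h
    exact h
  rw [evalMatrix, evalMatrix]
  refine add ?_ fun l => ?_
  · split_ifs
    · simpa using one
    · simpa using zero
  by_cases hl : l < 0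
  · have h0 : ∀ {A : Type _} [Ring A] (x : PowerSeries A),
        (HahnSeries.ofPowerSeries ℤ A x).coeff l = 0 := by
      intro A _ x
      rw [HahnSeries.ofPowerSeries_apply]
      refine HahnSeries.embDomain_of_notMem_range ?_
      rintro ⟨y, hy⟩
      simp at hy
      lia
    rw [h0, h0]
    exact HasLead.zero
  · obtain ⟨s, rfl⟩ : ∃ s : ℕ, l = s := ⟨l.toNat, by lia⟩
    rw [HahnSeries.ofPowerSeries_apply_coeff, HahnSeries.ofPowerSeries_apply_coeff,
      PowerSeries.coeff_mk, PowerSeries.coeff_mk]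
    rcases s with _ | r
    · exact HasLead.zero
    · exact hpow r

theorem sitesMatrix (z : Fin n → ℂ) (L : List (Fin n)) (p q : Fin m) :
    SeriesLead ε 0
      (sitesMatrix (L.map fun i => (algebraMap ℂ (RatFun m) (z i), fullSiteGen a ratVar i)) p q)
      (sitesMatrix (L.map fun i =>
        (algebraMap ℂ (RatFun m) (z i), siteGenOver (RatFun m) a i)) p q) := by
  induction L generalizing p q with
  | nil =>
    change SeriesLead ε 0 ((1 : Matrix (Fin m) (Fin m) _) p q) ((1 : Matrix (Fin m) (Fin m) _) p q)
    rw [Matrix.one_apply, Matrix.one_apply]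
    exact ite _ one
  | cons i L ih =>
    rw [List.map_cons, List.map_cons, sitesMatrix_cons, sitesMatrix_cons, Matrix.mul_apply,
      Matrix.mul_apply]
    refine sum fun r _ => ?_
    have := (evalMatrix_site (ε := ε) (z i) i p r).mul (ih r q)
    rwa [add_zero] at this

theorem altDelta {r : ℕ} {ι : Type*} [DecidableEq ι] (x y : Fin r → ι) :
    SeriesLead (a := a) ε 0 (altDelta x y) (altDelta x y) := by
  rw [BetheDuality.altDelta, BetheDuality.altDelta]
  exact sum fun σ _ => ite _ (intCast _)

theorem minorCoeff
    {t : Matrix (Fin m) (Fin m) (LaurentSeries (Module.End (RatFun m)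
      (FullTensor a (ratVar (m := m)))))}
    {t' : Matrix (Fin m) (Fin m) (LaurentSeries (Module.End (RatFun m)
      (SymTensorOver (RatFun m) m a)))}
    (h : ∀ p q, SeriesLead ε 0 (t p q) (t' p q)) (I : Finset (Fin m)) (x : Fin I.card → Fin m) :
    SeriesLead ε 0 (minorCoeff t I x) (minorCoeff t' I x) := by
  rw [BetheDuality.minorCoeff, BetheDuality.minorCoeff, colDet, colDet]
  refine sum fun y _ => ?_
  have h2 := (altDelta (a := a) (ε := ε) (id : Fin m → Fin m)
    (Function.extend (I.orderEmbOfFin rfl) y id)).mul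
    (oprod fun s : Fin I.card => (h (y s) (x s)).shiftHom (-(s : ℤ)))
  rwa [mul_zero, add_zero] at h2

/-- The series `u - s` has degree zero in `λ` and is negligible, so the leading term does not depend
on `u`. -/
theorem polyEntry (hε : IsVermaProj ε) (s : ℕ) (p q : Fin m) :
    SeriesLead (a := a) ε 1 (polyEntry (RatFun m) (fullVermaGen a ratVar) s p q)
      (HahnSeries.C (if p = q then algebraMap (RatFun m) _ (ratVar p) else 0)) := by
  have h1 := ((linearSeries (a := a) (ε := ε) (s : ℂ)).of_lt hε zero_lt_one).ite (p = q)
  have h2 := h1.add (C (HasLead.fullVermaGen (a := a) hε p q))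
  rwa [ite_self, zero_add, map_natCast] at h2

/-- The leading terms of the entries of the last factor are diagonal, so in the sum over index
functions only the increasing enumeration of `I` survives. It contributes the product of the
corresponding variables. -/
theorem fallingSeries_mul_principalMinor (hε : IsVermaProj ε)
    {t : Matrix (Fin m) (Fin m) (LaurentSeries (Module.End (RatFun m)
      (FullTensor a (ratVar (m := m)))))}
    {t' : Matrix (Fin m) (Fin m) (LaurentSeries (Module.End (RatFun m)
      (SymTensorOver (RatFun m) m a)))}
    (h : ∀ p q, SeriesLead ε 0 (t p q) (t' p q))
    (hc : ∀ p q r s, Commute (t p q) (HahnSeries.C (fullVermaGen a ratVar r s)))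
    (I : Finset (Fin m)) : SeriesLead ε I.card
      (BetheDuality.fallingSeries (RatFun m) _ I.card *
        principalMinor (t * evalMatrix (0 : RatFun m) (fullVermaGen a ratVar)) I)
      (HahnSeries.C (algebraMap (RatFun m) _ (∏ s ∈ I, ratVar s)) * principalMinor t' I) := by
  rw [BetheDuality.fallingSeries_mul_principalMinor t _ hc I]
  have h1 : ∀ x : Fin I.card → Fin m, SeriesLead ε I.card
      (BetheDuality.minorCoeff t I x * BetheDuality.oprod fun s : Fin I.card =>
        BetheDuality.polyEntry (RatFun m) (fullVermaGen a ratVar) s (x s) (I.orderEmbOfFin rfl s))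
      (BetheDuality.minorCoeff t' I x * BetheDuality.oprod fun s : Fin I.card => HahnSeries.C
        (if x s = I.orderEmbOfFin rfl s then algebraMap (RatFun m) _ (ratVar (x s)) else 0)) := by
    intro x
    have := (minorCoeff h I x).mul (oprod fun s : Fin I.card =>
      polyEntry (a := a) hε s (x s) (I.orderEmbOfFin rfl s))
    rwa [zero_add, mul_one] at this
  have h2 := sum (s := Finset.univ) fun x _ => h1 x
  rw [Finset.sum_eq_single (I.orderEmbOfFin rfl : Fin I.card → Fin m)
    (f := fun x => BetheDuality.minorCoeff t' I x * _)] at h2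
  · refine (congrArg (SeriesLead ε _ _) ?_).mp h2
    have h3 : (BetheDuality.oprod fun s : Fin I.card => HahnSeries.C (Γ := ℤ)
        (if I.orderEmbOfFin rfl s = I.orderEmbOfFin rfl s then
          algebraMap (RatFun m) (Module.End (RatFun m) (SymTensorOver (RatFun m) m a))
            (ratVar (I.orderEmbOfFin rfl s)) else 0)) =
        HahnSeries.C (algebraMap (RatFun m) _ (∏ s ∈ I, ratVar s)) := by
      simp only [if_true]
      refine (map_oprod ((HahnSeries.C (Γ := ℤ)).comp (algebraMap (RatFun m)
        (Module.End (RatFun m) (SymTensorOver (RatFun m) m a)))) fun s : Fin I.card =>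
          ratVar (I.orderEmbOfFin rfl s)).symm.trans ?_
      rw [RingHom.comp_apply, BetheDuality.oprod, List.prod_ofFn]
      congr 2
      have := Finset.prod_map Finset.univ (I.orderEmbOfFin rfl).toEmbedding (ratVar (m := m))
      rw [Finset.map_orderEmbOfFin_univ] at this
      exact this.symm
    rw [h3, ← principalMinor_eq_minorCoeff, ← scSeries_C]
    exact (scSeries_commute _ _).eq.symm
  · intro x _ hx
    obtain ⟨s, hs⟩ := Function.ne_iff.1 hx
    rw [oprod_eq_zero _ s, mul_zero]
    rw [if_neg hs, map_zero]
  · simp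

end SeriesLead

theorem coeff_betheOperator {F A : Type*} [Field F] [Ring A] [Algebra F A] (C : Fin m → F)
    (t : Matrix (Fin m) (Fin m) (LaurentSeries A)) (k : ℕ) : (betheOperator C t).coeff k =
      ∑ I : Finset (Fin m), if m - I.card = k then
        HahnSeries.C (algebraMap F A ((-1) ^ I.card * ∏ s, if s ∈ I then 1 else C s)) *
          principalMinor t I else 0 := by
  rw [betheOperator_expand]
  refine (map_sum (coeffHom k) _ _).trans (Finset.sum_congr rfl fun I _ => ?_)
  exact coeff_ofSeries_mul_tau_pow _ _ _

theorem C_sign_mul {F A : Type*} [Field F] [Ring A] [Algebra F A] (r : ℕ) (x : F)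
    (f : LaurentSeries A) : HahnSeries.C (algebraMap F A ((-1) ^ r * x)) * f =
      ((-1 : ℤ) ^ r) • (HahnSeries.C (algebraMap F A x) * f) := by
  rw [map_mul, map_mul, map_pow, map_pow, map_neg, map_neg, map_one, map_one, mul_assoc,
    zsmul_eq_mul, Int.cast_pow, Int.cast_neg, Int.cast_one]

/-- The binomial expansion of `τ^(m-|I|) = (1 + d)^(m-|I|)`. -/
theorem binomCoeff_betheOperator_one {F A : Type*} [Field F] [Ring A] [Algebra F A]
    (t : Matrix (Fin m) (Fin m) (LaurentSeries A)) (i : ℕ) :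
    binomCoeff m i (betheOperator (fun _ => (1 : F)) t) =
      ∑ I : Finset (Fin m), ((-1 : ℤ) ^ I.card * ((m - I.card).choose i : ℤ)) •
        principalMinor t I := by
  simp only [binomCoeff, coeff_betheOperator, Finset.smul_sum]
  rw [Finset.sum_comm]
  refine Finset.sum_congr rfl fun I _ => ?_
  rw [Finset.sum_eq_single (m - I.card)]
  · rw [if_pos rfl, C_sign_mul]
    simp only [ite_self, Finset.prod_const_one, map_one, one_mul]
    rw [mul_comm, mul_smul, natCast_zsmul]
  · intro k _ hk
    rw [if_neg hk.symm, smul_zero]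
  · intro h
    exact absurd (Finset.mem_range.2 (by lia)) h

/-- The leading terms of the coefficients of the Bethe operator with trivial twist form a Bethe
operator for the first factor. -/
theorem seriesLead_binomCoeff (hε : IsVermaProj ε)
    {t : Matrix (Fin m) (Fin m) (LaurentSeries (Module.End (RatFun m)
      (FullTensor a (ratVar (m := m)))))}
    {t' : Matrix (Fin m) (Fin m) (LaurentSeries (Module.End (RatFun m)
      (SymTensorOver (RatFun m) m a)))}
    (h : ∀ p q, SeriesLead ε 0 (t p q) (t' p q))
    (hc : ∀ p q r s, Commute (t p q) (HahnSeries.C (fullVermaGen a ratVar r s)))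
    (i : ℕ) (hi : i ≤ m) : SeriesLead ε (m - i : ℕ) (fallingSeries (RatFun m) _ (m - i) *
        binomCoeff m i (betheOperator (fun _ => (1 : RatFun m))
          (t * evalMatrix (0 : RatFun m) (fullVermaGen a ratVar))))
      ((ofConst (algebraMap (RatFun m) _ (∏ i, ratVar i)) *
          betheOperator (fun i : Fin m => (ratVar i)⁻¹) t').coeff i) := by
  have hL := binomCoeff_betheOperator_one (F := RatFun m)
    (t * evalMatrix (0 : RatFun m) (fullVermaGen a ratVar)) i
  have hR : (ofConst (algebraMap (RatFun m) _ (∏ i, ratVar i)) *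
      betheOperator (fun i : Fin m => (ratVar i)⁻¹) t').coeff i =
      ∑ I : Finset (Fin m), if I.card = m - i then ((-1 : ℤ) ^ I.card) •
        (HahnSeries.C (algebraMap (RatFun m) _ (∏ s ∈ I, ratVar s)) * principalMinor t' I)
        else 0 := by
    change (ofSeries _ * _ : DiffOp _).coeff i = _
    rw [coeff_ofSeries_mul, coeff_betheOperator, Finset.mul_sum]
    refine Finset.sum_congr rfl fun I _ => ?_
    have hI : I.card ≤ m := by simpa using Finset.card_le_univ I
    have hiff : m - I.card = i ↔ I.card = m - i := by lia
    simp only [hiff]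
    split_ifs
    · rw [C_sign_mul, mul_smul_comm, ← mul_assoc, ← map_mul, ← map_mul, ← Finset.prod_mul_distrib]
      congr 4
      -- The product of all variables times the inverses of those outside `I` leaves those in `I`.
      rw [← Finset.prod_filter_mul_prod_filter_not Finset.univ (· ∈ I)]
      rw [Finset.prod_congr (g := ratVar) (s₂ := I) (by ext; simp) fun s hs => by rw [if_pos hs,
        mul_one]]
      nth_rewrite 2 [← mul_one (∏ s ∈ I, ratVar s)]
      refine congrArg _ (Finset.prod_eq_one ?_)
      intro s hs
      rw [if_neg (Finset.mem_filter.1 hs).2, mul_inv_cancel₀]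
      exact (map_ne_zero_iff _ (IsFractionRing.injective _ _)).2 (MvPolynomial.X_ne_zero s)
    · rw [mul_zero]
  rw [hL, hR, Finset.mul_sum]
  refine SeriesLead.sum fun I _ => ?_
  rw [mul_smul_comm]
  have h1 := SeriesLead.fallingSeries_mul_principalMinor hε h hc I
  have hI : I.card ≤ m := by simpa using Finset.card_le_univ I
  -- Small subsets have too low a degree, large ones a vanishing binomial coefficient; subsets with
  -- exactly `m - i` elements give the twisted operator, with binomial coefficient `1`.
  rcases lt_trichotomy I.card (m - i) with hlt | heq | hgt
  · rw [if_neg hlt.ne]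
    obtain ⟨r, hr⟩ : ∃ r, m - i = I.card + r := ⟨m - i - I.card, by lia⟩
    -- The surplus factors `u - |I| - s` of the falling product have degree zero, so the total
    -- degree remains `|I| < m - i`.
    have h2 : ∀ r : ℕ, SeriesLead ε I.card (fallingSeries (RatFun m) _ (I.card + r) *
        principalMinor (t * evalMatrix (0 : RatFun m) (fullVermaGen a ratVar)) I)
        ((oprod fun s : Fin r => linearSeries (RatFun m) _ ((I.card + s : ℕ) : RatFun m)) *
        (HahnSeries.C (algebraMap (RatFun m) _ (∏ s ∈ I, ratVar s)) * principalMinor t' I)) := by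
      intro r
      induction r with
      | zero => simpa using h1
      | succ r ih =>
        rw [← add_assoc, fallingSeries_succ, oprod_castSucc]
        have h3 := (SeriesLead.linearSeries (a := a) (ε := ε) ((I.card + r : ℕ) : ℂ)).mul ih
        rw [zero_add, map_natCast, ← mul_assoc, (linearSeries_commute _ _).eq, ← mul_assoc,
          (linearSeries_commute _ _).eq] at h3
        exact h3
    have h4 := ((h2 r).of_lt hε (k' := (m - i : ℕ)) (by lia)).zsmul
      ((-1 : ℤ) ^ I.card * ((m - I.card).choose i : ℤ))
    rw [smul_zero] at h4
    rwa [hr] at h4 ⊢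
  · rw [if_pos heq, ← heq, show m - I.card = i by lia, Nat.choose_self, Nat.cast_one, mul_one]
    exact h1.zsmul _
  · rw [if_neg hgt.ne', Nat.choose_eq_zero_of_lt (by lia), Nat.cast_zero, mul_zero, zero_smul]
    exact SeriesLead.zero

end SeriesLead

/-! ## Expansions in powers of `(u - m + 1) d` -/

section Expansion
variable {F A : Type*} [Field F] [Ring A] [Algebra F A]

theorem diffOp_eq_zero {P : DiffOp A} (h : ∀ k, P.coeff k = 0) : P = 0 := by
  rw [← SkewPolynomial.sum_monomial P, SkewPolynomial.sum_def']
  refine Finset.sum_eq_zero fun k _ => ?_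
  change SkewPolynomial.monomial k.toAdd (P.coeff k.toAdd) = 0
  rw [h, map_zero]

theorem diffOp_ext {P Q : DiffOp A} (h : ∀ k, P.coeff k = Q.coeff k) : P = Q :=
  sub_eq_zero.1 (diffOp_eq_zero fun k => by rw [SkewPolynomial.coeff_sub, h, sub_self])

theorem coeff_sum_ofSeries_mul_tau_pow (N : ℕ) (f : ℕ → LaurentSeries A) (k : ℕ) :
    (∑ i ∈ Finset.range (N + 1), ofSeries (f i) * tau ^ i).coeff k = if k ≤ N then f k else 0 := by
  refine (map_sum (coeffHom k) _ _).trans ((Finset.sum_congr rfl fun i _ =>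
    coeff_ofSeries_mul_tau_pow (f i) i k).trans ?_)
  rw [Finset.sum_ite_eq' (Finset.range (N + 1)) k f]
  simp only [Finset.mem_range, Nat.lt_succ_iff]

theorem eq_sum_coeff {N : ℕ} {P : DiffOp A} (hP : ∀ k, N < k → P.coeff k = 0) :
    P = ∑ k ∈ Finset.range (N + 1), ofSeries (P.coeff k) * tau ^ k := by
  refine diffOp_ext fun k => ?_
  rw [coeff_sum_ofSeries_mul_tau_pow N P.coeff]
  split_ifs with h
  · rfl
  · exact hP k (not_le.1 h)

/-- The binomial theorem for `τ = 1 + (τ - 1)`. -/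
theorem eq_sum_binomCoeff {N : ℕ} {P : DiffOp A} (hP : ∀ k, N < k → P.coeff k = 0) :
    P = ∑ i ∈ Finset.range (N + 1), ofSeries (binomCoeff N i P) * (tau - 1) ^ i := by
  have h : ∀ k ∈ Finset.range (N + 1), ofSeries (P.coeff k) * tau ^ k =
      ∑ i ∈ Finset.range (N + 1), ofSeries (k.choose i • P.coeff k) * (tau - 1) ^ i := by
    intro k hk
    have hk' : k + 1 ≤ N + 1 := Finset.mem_range.1 hk
    have h1 : (tau : DiffOp A) ^ k = ∑ i ∈ Finset.range (k + 1),
        (tau - 1 : DiffOp A) ^ i * ((k.choose i : ℕ) : DiffOp A) := by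
      have := (Commute.one_right (tau - 1 : DiffOp A)).add_pow k
      simpa using this
    rw [h1, Finset.mul_sum, ← Finset.sum_subset (Finset.range_mono hk')]
    · refine Finset.sum_congr rfl fun i _ => ?_
      rw [map_nsmul, ← mul_assoc, (Nat.cast_commute _ _).eq.symm, nsmul_eq_mul, mul_assoc]
    · intro i _ hi
      rw [Nat.choose_eq_zero_of_lt (by simpa using hi), zero_smul, map_zero, zero_mul]
  conv_lhs => rw [eq_sum_coeff hP]
  rw [Finset.sum_congr rfl h, Finset.sum_comm]
  refine Finset.sum_congr rfl fun i _ => ?_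
  rw [binomCoeff, map_sum, Finset.sum_mul]

/-- The series `(u - c)(u - c + 1) ⋯ (u - c + i - 1)`. -/
def risingSeries (F A : Type*) [Field F] [Ring A] [Algebra F A] (c : F) : ℕ → LaurentSeries A
  | 0 => 1
  | i + 1 => risingSeries F A c i * linearSeries F A (c - i)

theorem shiftHom_one_linearSeries (c : F) :
    shiftHom 1 (linearSeries F A c) = linearSeries F A (c - 1) := by
  rw [linearSeries_eq, linearSeries_eq, map_sub, shiftHom_scSeries, shiftHom_uSeries, shiftHom_C,
    map_add, scSeries_C, map_sub, map_sub, Int.cast_one]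
  abel

theorem linearSeries_mul_shift_rising (c : F) (i : ℕ) :
    linearSeries F A c * shiftHom 1 (risingSeries F A c i) = risingSeries F A c (i + 1) := by
  induction i with
  | zero => simp [risingSeries]
  | succ i ih =>
    have h : risingSeries F A c (i + 1) = risingSeries F A c i * linearSeries F A (c - i) := rfl
    rw [h, map_mul, ← mul_assoc, ih, shiftHom_one_linearSeries]
    have h2 : risingSeries F A c (i + 1 + 1) =
      risingSeries F A c (i + 1) * linearSeries F A (c - (i + 1 : ℕ)) := rfl
    rw [h2]
    congr 2
    push_cast
    ring

/-- Splits off the last `i` factors, `(u-m+1)⋯(u-m+i)`, which are the ones absorbed by the Euler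
operator. -/
theorem fallingSeries_eq_mul_rising {m i : ℕ} (hi : i ≤ m) : fallingSeries F A m =
    fallingSeries F A (m - i) * risingSeries F A ((m : F) - 1) i := by
  induction i with
  | zero => simp [risingSeries]
  | succ i ih =>
    obtain ⟨r, hr⟩ : ∃ r, m = r + i + 1 := ⟨m - i - 1, by lia⟩
    have h1 : m - i = r + 1 := by lia
    have h2 : m - (i + 1) = r := by lia
    have h : risingSeries F A ((m : F) - 1) (i + 1) =
      risingSeries F A ((m : F) - 1) i * linearSeries F A ((m : F) - 1 - i) := rfl
    rw [ih (by lia), h1, h2, fallingSeries_succ, h, mul_assoc, (linearSeries_commute _ _).eq]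
    congr 3
    rw [hr]
    push_cast
    ring

theorem risingSeries_commute (c : F) (i : ℕ) (f : LaurentSeries A) :
    Commute (risingSeries F A c i) f := by
  induction i with
  | zero => exact Commute.one_left f
  | succ i ih => exact ih.mul_left (linearSeries_commute _ _)

variable (F A) in
/-- The operator `(u - c) d`. -/
def eulerOp (c : F) : DiffOp A := ofSeries (linearSeries F A c) * (tau - 1)

/-- The difference analogue of `(x∂) x^i ∂^i = x^(i+1) ∂^(i+1) + i x^i ∂^i`: the rising product
satisfies `(u-c)(R(u+1) - R(u)) = i R(u)`. -/
theorem eulerOp_mul (c : F) (i : ℕ) :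
    eulerOp F A c * (ofSeries (risingSeries F A c i) * (tau - 1) ^ i) =
      ofSeries (risingSeries F A c (i + 1)) * (tau - 1) ^ (i + 1) +
        (i : DiffOp A) * (ofSeries (risingSeries F A c i) * (tau - 1) ^ i) := by
  set R := risingSeries F A c i with hR
  have h1 : (tau - 1 : DiffOp A) * ofSeries R =
      ofSeries (shiftHom 1 R) * (tau - 1) + ofSeries (shiftHom 1 R - R) := by
    rw [sub_mul, tau_mul_ofSeries, one_mul, map_sub, mul_sub, mul_one]
    abel
  have h2 : linearSeries F A c * (shiftHom 1 R - R) = (i : LaurentSeries A) * R := by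
    have e : risingSeries F A c (i + 1) = R * linearSeries F A (c - i) := rfl
    rw [mul_sub, hR, linearSeries_mul_shift_rising, e, (linearSeries_commute c _).eq, ← hR,
      ← mul_sub, linearSeries_eq, linearSeries_eq, map_sub, map_sub, map_natCast, map_natCast,
      (Nat.cast_commute i R).eq]
    congr 1
    abel
  rw [eulerOp, mul_assoc, ← mul_assoc (tau - 1 : DiffOp A), h1, add_mul, mul_add, mul_assoc,
    ← mul_assoc (ofSeries _) (ofSeries _), ← map_mul, linearSeries_mul_shift_rising, ← pow_succ',
    ← mul_assoc (ofSeries _) (ofSeries _), ← map_mul, h2, map_mul, map_natCast, mul_assoc]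

/-- Hence `x(x-1)⋯(x-i+1)`, evaluated at the Euler operator, is the analogue of `x^i ∂^i`. -/
theorem aeval_descPochhammer (c : F) (i : ℕ) :
    Polynomial.aeval (eulerOp F A c) (descPochhammer ℤ i) =
      ofSeries (risingSeries F A c i) * (tau - 1) ^ i := by
  induction i with
  | zero => simp [risingSeries]
  | succ i ih =>
    rw [descPochhammer_succ_right, mul_comm, map_mul, ih, map_sub, Polynomial.aeval_X, sub_mul,
      eulerOp_mul, map_natCast, add_sub_cancel_right]

/-- The coefficient of `x^j` in `x(x - 1) ⋯ (x - i + 1)`. -/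
def stirling (i j : ℕ) : ℤ := (descPochhammer ℤ i).coeff j

theorem stirling_self (i : ℕ) : stirling i i = 1 := by
  have h := monic_descPochhammer ℤ i
  rwa [Polynomial.Monic, Polynomial.leadingCoeff, descPochhammer_natDegree] at h

theorem stirling_of_lt {i j : ℕ} (h : i < j) : stirling i j = 0 :=
  Polynomial.coeff_eq_zero_of_natDegree_lt (by rwa [descPochhammer_natDegree])

theorem rising_mul_pow (c : F) {i N : ℕ} (hi : i ≤ N) :
    ofSeries (risingSeries F A c i) * (tau - 1) ^ i =
      ∑ j ∈ Finset.range (N + 1), stirling i j • eulerOp F A c ^ j := by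
  rw [← aeval_descPochhammer, Polynomial.aeval_eq_sum_range' (n := N + 1)]
  · refine Finset.sum_congr rfl fun j _ => ?_
    rw [Algebra.smul_def, eq_intCast, ← zsmul_eq_mul]
    rfl
  · rw [descPochhammer_natDegree]; lia

/-- The expansion of `u(u-1) ⋯ (u-m+1) P` in powers of `(u - m + 1) d`. -/
theorem fallingSeries_mul_eq_sum {m : ℕ} {P : DiffOp A} (hP : ∀ k, m < k → P.coeff k = 0)
    (ρ : LaurentSeries F) : ofSeries (scSeries F A ρ * fallingSeries F A m) * P =
      ∑ j ∈ Finset.range (m + 1), ofSeries (∑ i ∈ Finset.range (m + 1), stirling i j •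
        (scSeries F A ρ * (fallingSeries F A (m - i) * binomCoeff m i P))) *
          eulerOp F A ((m : F) - 1) ^ j := by
  conv_lhs => rw [eq_sum_binomCoeff hP]
  simp only [map_sum, Finset.sum_mul]
  rw [Finset.sum_comm, Finset.mul_sum]
  refine Finset.sum_congr rfl fun i hi => ?_
  have hi' : i ≤ m := Nat.lt_succ_iff.1 (Finset.mem_range.1 hi)
  have h : scSeries F A ρ * fallingSeries F A m * binomCoeff m i P =
      scSeries F A ρ * (fallingSeries F A (m - i) * binomCoeff m i P) *
        risingSeries F A ((m : F) - 1) i := by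
    rw [fallingSeries_eq_mul_rising hi']
    simp only [mul_assoc]
    rw [(risingSeries_commute _ _ _).eq]
  rw [← mul_assoc, ← map_mul, h, map_mul, mul_assoc, rising_mul_pow _ hi', Finset.mul_sum]
  refine Finset.sum_congr rfl fun j _ => ?_
  rw [map_zsmul, mul_smul_comm, smul_mul_assoc]

theorem shiftHom_injective (c : ℤ) : Function.Injective (shiftHom (A := A) c) := fun f g h => by
  rw [← shiftHom_zero f, ← shiftHom_zero g, ← neg_add_cancel c, ← shiftHom_shiftHom, h,
    shiftHom_shiftHom]

theorem linearSeries_eq_scSeries (c : F) : ∃ x : LaurentSeries F, x ≠ 0 ∧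
    linearSeries F A c = scSeries F A x :=
  ⟨_, polySeries_ne_zero (Polynomial.X_sub_C_ne_zero c), rfl⟩

/-- The top coefficient in `τ` is a nonzero, hence invertible, scalar series; this yields uniqueness
of expansions from the top down. -/
theorem eulerOp_pow_coeff (c : F) (i : ℕ) : (∀ k, i < k → (eulerOp F A c ^ i).coeff k = 0) ∧
    ∃ x : LaurentSeries F, x ≠ 0 ∧ (eulerOp F A c ^ i).coeff i = scSeries F A x := by
  induction i with
  | zero =>
    refine ⟨fun k hk => ?_, 1, one_ne_zero, ?_⟩
    · rw [pow_zero, SkewPolynomial.coeff_one, if_neg hk.ne]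
    · rw [pow_zero, SkewPolynomial.coeff_one_zero, map_one]
  | succ i ih =>
    have hc : ∀ k, (eulerOp F A c ^ (i + 1)).coeff (k + 1) = linearSeries F A c *
        (shiftHom 1 ((eulerOp F A c ^ i).coeff k) - (eulerOp F A c ^ i).coeff (k + 1)) := by
      intro k
      rw [pow_succ', eulerOp, mul_assoc, coeff_ofSeries_mul, sub_mul, one_mul,
        SkewPolynomial.coeff_sub, coeff_tau_mul_succ]
    refine ⟨fun k hk => ?_, ?_⟩
    · obtain ⟨k, rfl⟩ : ∃ j, k = j + 1 := ⟨k - 1, by lia⟩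
      rw [hc, ih.1 k (by lia), ih.1 (k + 1) (by lia), map_zero, sub_zero, mul_zero]
    · obtain ⟨x, hx, hx'⟩ := ih.2
      obtain ⟨y, hy, hy'⟩ := linearSeries_eq_scSeries (A := A) c
      refine ⟨y * shiftHom 1 x, mul_ne_zero hy ?_, ?_⟩
      · intro h
        exact hx (shiftHom_injective 1 (h.trans (map_zero _).symm))
      · rw [hc, ih.1 (i + 1) (by lia), sub_zero, hx', hy', shiftHom_scSeries, map_mul]

/-- The highest power alone contributes to the highest power of `τ`, so the coefficients vanish
successively. -/
theorem eq_zero_of_sum_eulerOp (c : F) (N : ℕ) (e : ℕ → LaurentSeries A)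
    (h : ∑ i ∈ Finset.range N, ofSeries (e i) * eulerOp F A c ^ i = 0) : ∀ i < N, e i = 0 := by
  induction N with
  | zero => intro i hi; exact absurd hi (Nat.not_lt_zero _)
  | succ N ih =>
    have hN : e N = 0 := by
      have h1 := congrArg (coeffHom N) h
      rw [map_sum, map_zero, Finset.sum_range_succ, Finset.sum_eq_zero, zero_add] at h1
      · obtain ⟨x, hx, hx'⟩ := (eulerOp_pow_coeff (A := A) c N).2
        change (ofSeries (e N) * _).coeff N = 0 at h1
        rw [coeff_ofSeries_mul, hx'] at h1
        have h2 := congrArg (· * scSeries F A x⁻¹) h1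
        simpa only [mul_assoc, ← map_mul, mul_inv_cancel₀ hx, map_one, mul_one, zero_mul] using h2
      · intro i hi
        change (ofSeries (e i) * _).coeff N = 0
        rw [coeff_ofSeries_mul, (eulerOp_pow_coeff c i).1 N (Finset.mem_range.1 hi), mul_zero]
    rw [Finset.sum_range_succ, hN, map_zero, zero_mul, add_zero] at h
    intro i hi
    rcases Nat.lt_succ_iff_lt_or_eq.1 hi with hi | rfl
    · exact ih h i hi
    · exact hN

theorem fallingPoly_monic (c : F) (j : ℕ) : (fallingPoly c j).Monic ∧
    (fallingPoly c j).natDegree = j := by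
  induction j with
  | zero => simp [fallingPoly]
  | succ j ih =>
    rw [fallingPoly_succ]
    refine ⟨ih.1.mul (Polynomial.monic_X_add_C _), ?_⟩
    rw [ih.1.natDegree_mul (Polynomial.monic_X_add_C _), ih.2, Polynomial.natDegree_X_add_C]

/-- The polynomials are monic of distinct degrees, so the coefficients vanish from the highest
degree down, also with noncommutative coefficients. -/
theorem eq_zero_of_sum_fallingPoly (c : F) (N : ℕ) (x : ℕ → A)
    (h : ∑ j ∈ Finset.range N, HahnSeries.C (x j) * scSeries F A (polySeries (fallingPoly c j)) =
      (0 : LaurentSeries A)) : ∀ j < N, x j = 0 := by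
  have hc : ∀ j k : ℕ, (HahnSeries.C (x j) * scSeries F A (polySeries (fallingPoly c j)) :
      LaurentSeries A).coeff (-(k : ℤ)) = x j * algebraMap F A ((fallingPoly c j).coeff k) := by
    intro j k
    rw [coeff_C_mul, scSeries_coeff, polySeries_coeff]
  induction N with
  | zero => intro i hi; exact absurd hi (Nat.not_lt_zero _)
  | succ N ih =>
    have hN : x N = 0 := by
      have h1 := congrArg (HahnSeries.coeff · (-(N : ℤ))) h
      simp only [HahnSeries.coeff_sum, hc, HahnSeries.coeff_zero] at h1
      rw [Finset.sum_range_succ, Finset.sum_eq_zero, zero_add] at h1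
      · have h2 := (fallingPoly_monic c N).1
        rw [Polynomial.Monic, Polynomial.leadingCoeff, (fallingPoly_monic c N).2] at h2
        rwa [h2, map_one, mul_one] at h1
      · intro j hj
        rw [Polynomial.coeff_eq_zero_of_natDegree_lt, map_zero, mul_zero]
        rw [(fallingPoly_monic c j).2]
        exact Finset.mem_range.1 hj
    rw [Finset.sum_range_succ, hN, map_zero, zero_mul, add_zero] at h
    intro i hi
    rcases Nat.lt_succ_iff_lt_or_eq.1 hi with hi | rfl
    · exact ih h i hi
    · exact hN

/-- The monomials are combinations of the polynomials `(x + c)(x + c - 1) ⋯ (x + c - j + 1)`. -/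
theorem exists_fallingPoly_coeff (c : F) : ∃ γ : ℕ → ℕ → F, ∀ k N, k ≤ N →
    (Polynomial.X : Polynomial F) ^ k =
      ∑ j ∈ Finset.range (N + 1), Polynomial.C (γ k j) * fallingPoly c j := by
  have h : ∀ k, ∃ γ : ℕ → F, (∀ j, k < j → γ j = 0) ∧ (Polynomial.X : Polynomial F) ^ k =
      ∑ j ∈ Finset.range (k + 1), Polynomial.C (γ j) * fallingPoly c j := by
    intro k
    induction k with
    | zero =>
      refine ⟨fun j => if j = 0 then 1 else 0, fun j hj => if_neg hj.ne', ?_⟩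
      simp [fallingPoly]
    | succ k ih =>
      obtain ⟨γ, h0, h⟩ := ih
      -- The recursion comes from `X · p_j = p_{j+1} + (j - c) p_j` for the `j`-th falling
      -- polynomial `p_j`.
      refine ⟨fun j => (if j = 0 then 0 else γ (j - 1)) + (j - c) * γ j, fun j hj => ?_, ?_⟩
      · change (if j = 0 then 0 else γ (j - 1)) + (j - c) * γ j = 0
        rw [if_neg (by lia), h0 _ (by lia), h0 _ (by lia), mul_zero, add_zero]
      · have hX : ∀ j : ℕ, Polynomial.X * fallingPoly c j =
            fallingPoly c (j + 1) + Polynomial.C ((j : F) - c) * fallingPoly c j := by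
          intro j
          rw [fallingPoly_succ, map_sub, map_sub]
          ring
        rw [pow_succ', h, Finset.mul_sum]
        have h1 : ∀ j ∈ Finset.range (k + 1), Polynomial.X * (Polynomial.C (γ j) * fallingPoly c j) =
            Polynomial.C (γ j) * fallingPoly c (j + 1) +
              Polynomial.C ((j - c) * γ j) * fallingPoly c j := by
          intro j _
          rw [mul_left_comm, hX, map_mul]
          ring
        rw [Finset.sum_congr rfl h1, Finset.sum_add_distrib]
        simp only [map_add, add_mul, Finset.sum_add_distrib]
        congr 1
        · rw [Finset.sum_range_succ' _ (k + 1)]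
          simp
        · rw [Finset.sum_range_succ _ (k + 1), h0 (k + 1) (by lia), mul_zero, map_zero, zero_mul,
            add_zero]
  choose γ h0 hγ using h
  refine ⟨γ, fun k N hk => ?_⟩
  rw [hγ k]
  refine Finset.sum_subset (Finset.range_mono (by lia)) fun j _ hj => ?_
  rw [h0 k j (by simpa using hj), map_zero, zero_mul]

/-- The coefficients of a polynomial of degree at most `n` with respect to the basis of
polynomials `(x + c)(x + c - 1) ⋯ (x + c - j + 1)`. -/
theorem exists_falling_expansion (c : F) (n : ℕ) : ∃ γ : ℕ → ℕ → F, ∀ f : LaurentSeries A,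
    f ∈ polySubring A → (∀ l < -(n : ℤ), f.coeff l = 0) →
    f = ∑ j ∈ Finset.range (n + 1), HahnSeries.C (∑ k ∈ Finset.range (n + 1),
      γ k j • f.coeff (-(k : ℤ))) * scSeries F A (polySeries (fallingPoly c j)) := by
  obtain ⟨γ, hγ⟩ := exists_fallingPoly_coeff c
  refine ⟨γ, fun f hf hn => ?_⟩
  have h1 : f = ∑ k ∈ Finset.range (n + 1), HahnSeries.C (f.coeff (-(k : ℤ))) *
      scSeries F A (polySeries (Polynomial.X ^ k)) := by
    ext l
    have hX : ∀ k : ℕ, scSeries F A (polySeries ((Polynomial.X : Polynomial F) ^ k)) =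
        HahnSeries.single (-(k : ℤ)) 1 := by
      intro k
      rw [← Polynomial.monomial_one_right_eq_X_pow, polySeries_monomial, scSeries_single, map_one]
    rw [HahnSeries.coeff_sum]
    simp only [coeff_C_mul, hX, HahnSeries.coeff_single]
    by_cases hl : 0 < l
    · rw [hf l hl, Finset.sum_eq_zero]
      intro k _
      rw [if_neg (by lia), mul_zero]
    · by_cases hl' : l < -(n : ℤ)
      · rw [hn l hl', Finset.sum_eq_zero]
        intro k hk
        have := Finset.mem_range.1 hk
        rw [if_neg (by lia), mul_zero]
      · obtain ⟨k, rfl⟩ : ∃ k : ℕ, l = -(k : ℤ) := ⟨(-l).toNat, by lia⟩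
        rw [Finset.sum_eq_single k]
        · rw [if_pos rfl, mul_one]
        · intro j _ hj
          rw [if_neg (by lia), mul_zero]
        · intro h
          exact absurd (Finset.mem_range.2 (by lia)) h
  conv_lhs => rw [h1]
  have h2 : ∀ k ∈ Finset.range (n + 1), HahnSeries.C (f.coeff (-(k : ℤ))) *
      scSeries F A (polySeries (Polynomial.X ^ k)) = ∑ j ∈ Finset.range (n + 1),
        HahnSeries.C (γ k j • f.coeff (-(k : ℤ))) * scSeries F A (polySeries (fallingPoly c j)) := by
    intro k hk
    have hsum : polySeries (Polynomial.X ^ k) = ∑ j ∈ Finset.range (n + 1),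
        polySeries (Polynomial.C (γ k j) * fallingPoly c j) := by
      rw [hγ k n (Nat.lt_succ_iff.1 (Finset.mem_range.1 hk))]
      exact map_sum (Polynomial.eval₂RingHom HahnSeries.C (uSeries F)) _ _
    rw [hsum, map_sum, Finset.mul_sum]
    refine Finset.sum_congr rfl fun j _ => ?_
    rw [polySeries_mul, polySeries_C, map_mul, scSeries_C, ← mul_assoc, ← map_mul,
      ← Algebra.commutes, ← Algebra.smul_def]
  rw [Finset.sum_congr rfl h2, Finset.sum_comm]
  refine Finset.sum_congr rfl fun j _ => ?_
  rw [map_sum, Finset.sum_mul]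

end Expansion

/-! ### Replacing the field of rational functions by the complex numbers as scalars -/

section ScalarChange
variable {F A : Type*} [Field F] [Algebra ℂ F] [Ring A] [Algebra F A] [Algebra ℂ A]
  [IsScalarTower ℂ F A]

theorem scSeries_polySeries_map (p : Polynomial ℂ) :
    scSeries F A (polySeries (p.map (algebraMap ℂ F))) = scSeries ℂ A (polySeries p) := by
  ext l
  rw [scSeries_coeff, scSeries_coeff]
  by_cases hl : 0 < l
  · rw [polySeries_coeff_pos _ _ hl, polySeries_coeff_pos _ _ hl, map_zero, map_zero]
  · obtain ⟨k, rfl⟩ : ∃ k : ℕ, l = -(k : ℤ) := ⟨(-l).toNat, by lia⟩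
    rw [polySeries_coeff, polySeries_coeff, Polynomial.coeff_map,
      ← IsScalarTower.algebraMap_apply ℂ F A]

theorem ofPoly_map (p : Polynomial ℂ) :
    (ofPoly (p.map (algebraMap ℂ F)) : DiffOp A) = ofPoly p := by
  rw [ofPoly_eq, ofPoly_eq, scSeries_polySeries_map]

theorem fallingPoly_map (c : ℂ) (j : ℕ) :
    (fallingPoly c j).map (algebraMap ℂ F) = fallingPoly (algebraMap ℂ F c) j := by
  rw [fallingPoly, fallingPoly, Polynomial.map_comp, descPochhammer_map, Polynomial.map_add,
    Polynomial.map_X, Polynomial.map_C]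

theorem rootsPoly_map {n : ℕ} (z : Fin n → ℂ) :
    (rootsPoly ℂ z).map (algebraMap ℂ F) = rootsPoly F z := by
  rw [rootsPoly, rootsPoly, Polynomial.map_prod]
  simp

theorem fallingSeries_scalar (k : ℕ) : fallingSeries F A k = fallingSeries ℂ A k := by
  rw [fallingSeries, fallingSeries, ← scSeries_polySeries_map (F := F), fallingPoly_map, map_zero]

/-- The polynomials in the expansion have complex coefficients. Descending to `ℂ` matters because
the coefficient algebra and the leading term maps are only `ℂ`-linear. -/
theorem isExpansion_scalar {n m : ℕ} (z : Fin n → ℂ) (P : DiffOp A)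
    (D : Fin (m + 1) → Fin (n + 1) → A) :
    IsExpansion (F := F) z P D ↔ IsExpansion (F := ℂ) z P D := by
  have h1 : (ofPoly (fallingPoly (0 : F) m * rootsPoly F z) : DiffOp A) =
      ofPoly (fallingPoly (0 : ℂ) m * rootsPoly ℂ z) := by
    rw [← ofPoly_map (F := F), Polynomial.map_mul, fallingPoly_map, rootsPoly_map, map_zero]
  have h2 : ∀ j, (ofPoly (fallingPoly (n : F) j) : DiffOp A) = ofPoly (fallingPoly (n : ℂ) j) := by
    intro j
    rw [← ofPoly_map (F := F), fallingPoly_map, map_natCast]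
  have h3 : (ofPoly (Polynomial.X - Polynomial.C ((m : F) - 1)) : DiffOp A) =
      ofPoly (Polynomial.X - Polynomial.C ((m : ℂ) - 1)) := by
    rw [← ofPoly_map (F := F)]
    simp
  rw [IsExpansion, IsExpansion, h1, h3]
  simp only [h2]

end ScalarChange

/-! ### Uniqueness of the expansion and its coefficients in the Bethe algebra -/

section Coefficients
variable {A : Type*} [Ring A] [Algebra ℂ A] {n m : ℕ}

theorem isExpansion_iff (z : Fin n → ℂ) (P : DiffOp A) (D : Fin (m + 1) → Fin (n + 1) → A) :
    IsExpansion (F := ℂ) z P D ↔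
      ofSeries (scSeries ℂ A (polySeries (rootsPoly ℂ z)) * fallingSeries ℂ A m) * P =
      ∑ i : Fin (m + 1), ofSeries (∑ j : Fin (n + 1), HahnSeries.C (D i j) *
        scSeries ℂ A (polySeries (fallingPoly (n : ℂ) j))) *
          eulerOp ℂ A ((m : ℂ) - 1) ^ (i : ℕ) := by
  rw [IsExpansion, ofPoly_eq, polySeries_mul, mul_comm (polySeries _), map_mul, ofPoly_eq]
  simp only [map_sum, Finset.sum_mul, map_mul, ofPoly_eq]
  rfl

theorem IsExpansion.unique {z : Fin n → ℂ} {P : DiffOp A} {D D' : Fin (m + 1) → Fin (n + 1) → A}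
    (h : IsExpansion (F := ℂ) z P D) (h' : IsExpansion (F := ℂ) z P D') : D = D' := by
  rw [isExpansion_iff] at h h'
  have h1 := h.symm.trans h'
  -- The differences are extended by zero to natural indices, to match the range form of the
  -- independence lemmas.
  set x : ℕ → ℕ → A := fun i j => if hi : i < m + 1 then if hj : j < n + 1 then
    D ⟨i, hi⟩ ⟨j, hj⟩ - D' ⟨i, hi⟩ ⟨j, hj⟩ else 0 else 0 with hx
  have hx' : ∀ (i : Fin (m + 1)) (j : Fin (n + 1)), x i j = D i j - D' i j := by
    intro i j
    rw [hx]
    simp only [i.2, j.2, dif_pos]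
  have h2 : ∑ i ∈ Finset.range (m + 1), ofSeries (∑ j ∈ Finset.range (n + 1),
      HahnSeries.C (x i j) * scSeries ℂ A (polySeries (fallingPoly (n : ℂ) j))) *
        eulerOp ℂ A ((m : ℂ) - 1) ^ i = 0 := by
    rw [← sub_eq_zero, ← Finset.sum_sub_distrib] at h1
    rw [Finset.sum_range, ← h1]
    refine Finset.sum_congr rfl fun i _ => ?_
    rw [← sub_mul, ← map_sub, ← Finset.sum_sub_distrib, Finset.sum_range]
    simp only [hx', map_sub, sub_mul]
  funext i j
  have h3 := eq_zero_of_sum_eulerOp _ _ _ h2 i i.2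
  have h4 := eq_zero_of_sum_fallingPoly _ _ _ h3 j j.2
  rw [hx'] at h4
  exact sub_eq_zero.1 h4

/-- The coefficients with respect to falling factorials of the Euler operator are recombined into
powers; this change of basis is given by the numbers `stirling`. -/
theorem isExpansion_of_series {z : Fin n → ℂ} {P : DiffOp A} (hP : ∀ k, m < k → P.coeff k = 0)
    {c : ℕ → ℕ → A} (hc : ∀ i ≤ m, scSeries ℂ A (polySeries (rootsPoly ℂ z)) *
      (fallingSeries ℂ A (m - i) * binomCoeff m i P) = ∑ j ∈ Finset.range (n + 1),
        HahnSeries.C (c i j) * scSeries ℂ A (polySeries (fallingPoly (n : ℂ) j))) :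
    IsExpansion (F := ℂ) (m := m) z P
      (fun i j => ∑ i' ∈ Finset.range (m + 1), stirling i' i • c i' j) := by
  rw [isExpansion_iff, fallingSeries_mul_eq_sum hP, Finset.sum_range]
  refine Finset.sum_congr rfl fun i _ => ?_
  congr 2
  rw [Finset.sum_congr rfl fun i' hi' => congrArg (stirling i' i • ·)
    (hc i' (Nat.lt_succ_iff.1 (Finset.mem_range.1 hi')))]
  simp only [Finset.smul_sum]
  rw [Finset.sum_comm, Finset.sum_range]
  refine Finset.sum_congr rfl fun j _ => ?_
  rw [map_sum, Finset.sum_mul]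
  refine Finset.sum_congr rfl fun i' _ => ?_
  rw [map_zsmul, smul_mul_assoc]

/-- Series with all coefficients in a given subalgebra. -/
def seriesSubring (S : Subalgebra ℂ A) : Subring (LaurentSeries A) where
  carrier := {f | ∀ l, f.coeff l ∈ S}
  mul_mem' := by
    intro f g hf hg l
    rw [HahnSeries.coeff_mul]
    exact sum_mem fun x _ => mul_mem (hf _) (hg _)
  one_mem' := fun l => by
    rw [HahnSeries.coeff_one]
    split_ifs
    · exact one_mem S
    · exact zero_mem S
  add_mem' := fun hf hg l => by
    rw [HahnSeries.coeff_add]; exact add_mem (hf l) (hg l)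
  zero_mem' := fun _ => zero_mem S
  neg_mem' := fun hf l => by
    rw [HahnSeries.coeff_neg]; exact neg_mem (hf l)

theorem scSeries_mem_seriesSubring (S : Subalgebra ℂ A) (x : LaurentSeries ℂ) :
    scSeries ℂ A x ∈ seriesSubring S := fun l => by
  rw [scSeries_coeff]; exact S.algebraMap_mem _

/-- The multipliers are scalar series over `ℂ`, and the binomial coefficients are integers. -/
theorem coeff_mem_coeffAlgebra (z : Fin n → ℂ) (P : DiffOp A) (i : ℕ) (l : ℤ) :
    (scSeries ℂ A (polySeries (rootsPoly ℂ z)) *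
      (fallingSeries ℂ A (m - i) * binomCoeff m i P)).coeff l ∈ coeffAlgebra (F := ℂ) P := by
  have h : binomCoeff m i P ∈ seriesSubring (coeffAlgebra (F := ℂ) P) :=
    sum_mem fun k _ => nsmul_mem (show P.coeff k ∈ seriesSubring (coeffAlgebra (F := ℂ) P) from
      fun l => Algebra.subset_adjoin ⟨k, l, rfl⟩) _
  exact mul_mem (scSeries_mem_seriesSubring _ _)
    (mul_mem (scSeries_mem_seriesSubring _ _) h) l

end Coefficients

/-! ### Coefficientwise additive maps of difference operators -/

section MapOp
variable {A B : Type*} [Ring A] [Ring B]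

/-- The application of an additive map to the coefficients of a difference operator of degree at
most `N` in `τ`. -/
def mapOp (φ : A →+ B) (N : ℕ) (Q : DiffOp A) : DiffOp B :=
  ∑ k ∈ Finset.range (N + 1), ofSeries (mapSeries φ (Q.coeff k)) * tau ^ k

theorem coeff_mapOp (φ : A →+ B) {N : ℕ} {Q : DiffOp A} (hQ : ∀ k, N < k → Q.coeff k = 0) (k : ℕ) :
    (mapOp φ N Q).coeff k = mapSeries φ (Q.coeff k) := by
  rw [mapOp, coeff_sum_ofSeries_mul_tau_pow N (fun k => mapSeries φ (Q.coeff k))]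
  split_ifs with h
  · rfl
  · rw [hQ k (not_le.1 h), map_zero]

theorem binomCoeff_mapOp (φ : A →+ B) {N : ℕ} {Q : DiffOp A} (hQ : ∀ k, N < k → Q.coeff k = 0)
    (i : ℕ) : binomCoeff N i (mapOp φ N Q) = mapSeries φ (binomCoeff N i Q) := by
  rw [binomCoeff, binomCoeff, map_sum]
  refine Finset.sum_congr rfl fun k _ => ?_
  rw [coeff_mapOp φ hQ, map_nsmul]

end MapOp

/-! ### Operators on an extension of scalars and induced operators -/

section EndTensor
variable {F W : Type*} [Field F] [Algebra ℂ F] [AddCommGroup W] [Module ℂ W]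

theorem tensorProductEnd_tmul (p q : F) (f : Module.End ℂ W) (w : W) :
    LinearMap.tensorProductEnd ℂ F W (p ⊗ₜ[ℂ] f) (q ⊗ₜ[ℂ] w) = (p * q) ⊗ₜ[ℂ] f w := by
  change p • (LinearMap.baseChange F f (q ⊗ₜ[ℂ] w)) = _
  rw [LinearMap.baseChange_tmul, TensorProduct.smul_tmul', smul_eq_mul]

theorem end_tensor_ext {f g : Module.End F (F ⊗[ℂ] W)}
    (h : ∀ w : W, f (1 ⊗ₜ[ℂ] w) = g (1 ⊗ₜ[ℂ] w)) : f = g := by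
  refine TensorProduct.AlgebraTensorModule.curry_injective (LinearMap.ext fun p => ?_)
  refine LinearMap.ext fun w => ?_
  change f (p ⊗ₜ[ℂ] w) = g (p ⊗ₜ[ℂ] w)
  have e : (p ⊗ₜ[ℂ] w : F ⊗[ℂ] W) = p • ((1 : F) ⊗ₜ[ℂ] w) := by
    rw [TensorProduct.smul_tmul', smul_eq_mul, mul_one]
  rw [e, map_smul, map_smul, h]

/-- Finite-dimensionality gives an explicit inverse through a basis and its dual. -/
theorem bijective_tensorProductEnd [Module.Finite ℂ W] :
    Function.Bijective (LinearMap.tensorProductEnd ℂ F W) := by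
  set B := Module.finBasis ℂ W with hB
  set s : Fin (Module.finrank ℂ W) → W →ₗ[ℂ] Module.End ℂ W :=
    fun j => LinearMap.smulRightₗ (B.coord j) with hs
  have hs' : ∀ j w x, s j w x = B.coord j x • w := fun j w x => rfl
  -- An operator is rebuilt from its values on the basis vectors: `s j w` is the rank one operator
  -- that sends the `j`-th basis vector to `w` and the others to zero.
  set Ψ : Module.End F (F ⊗[ℂ] W) → F ⊗[ℂ] Module.End ℂ W :=
    fun X => ∑ j, LinearMap.lTensor F (s j) (X (1 ⊗ₜ[ℂ] B j)) with hΨ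
  have hleft : Function.LeftInverse Ψ (LinearMap.tensorProductEnd ℂ F W) := by
    intro D
    induction D with
    | zero => simp [hΨ]
    | add x y hx hy =>
      have : Ψ (LinearMap.tensorProductEnd ℂ F W (x + y)) =
          Ψ (LinearMap.tensorProductEnd ℂ F W x) + Ψ (LinearMap.tensorProductEnd ℂ F W y) := by
        simp only [hΨ, map_add, LinearMap.add_apply, Finset.sum_add_distrib]
      rw [this, hx, hy]
    | tmul p φ =>
      simp only [hΨ, tensorProductEnd_tmul, mul_one, LinearMap.lTensor_tmul]
      rw [← TensorProduct.tmul_sum]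
      congr 1
      refine LinearMap.ext fun x => ?_
      rw [LinearMap.sum_apply]
      simp only [hs', Module.Basis.coord_apply]
      conv_rhs => rw [← B.sum_repr x, map_sum]
      simp only [map_smul]
  have hright : Function.RightInverse Ψ (LinearMap.tensorProductEnd ℂ F W) := by
    intro X
    have h1 : ∀ (j : Fin (Module.finrank ℂ W)) (y : F ⊗[ℂ] W) (w : W),
        LinearMap.tensorProductEnd ℂ F W (LinearMap.lTensor F (s j) y) (1 ⊗ₜ[ℂ] w) =
          B.coord j w • y := by
      intro j y w
      induction y with
      | zero => simp
      | add x y hx hy => rw [map_add, map_add, LinearMap.add_apply, hx, hy, smul_add]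
      | tmul p v =>
        rw [LinearMap.lTensor_tmul, tensorProductEnd_tmul, mul_one, hs', TensorProduct.tmul_smul]
    refine end_tensor_ext fun w => ?_
    simp only [hΨ, map_sum, LinearMap.sum_apply, h1]
    conv_rhs => rw [← B.sum_repr w, TensorProduct.tmul_sum, map_sum]
    refine Finset.sum_congr rfl fun j _ => ?_
    rw [TensorProduct.tmul_smul, Module.Basis.coord_apply]
    exact ((X.restrictScalars ℂ).map_smul _ _).symm
  exact ⟨hleft.injective, hright.surjective⟩

variable (F W) in
/-- The identification of `F ⊗ End W` with `End (F ⊗ W)`. -/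
def tensorEndEquiv [Module.Finite ℂ W] : F ⊗[ℂ] Module.End ℂ W ≃ₗ[F] Module.End F (F ⊗[ℂ] W) :=
  LinearEquiv.ofBijective (LinearMap.tensorProductEnd ℂ F W).toLinearMap bijective_tensorProductEnd

theorem tensorProductEnd_symm [Module.Finite ℂ W] (X : Module.End F (F ⊗[ℂ] W)) :
    LinearMap.tensorProductEnd ℂ F W ((tensorEndEquiv F W).symm X) = X :=
  (tensorEndEquiv F W).apply_symm_apply X

/-- The operator induced through linear maps `f : F ⊗ W → V` and `g : V → F ⊗ W` by an operator
on `V`. -/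
def induce [Module.Finite ℂ W] {V : Type*} [AddCommGroup V] [Module F V] (f : F ⊗[ℂ] W →ₗ[F] V)
    (g : V →ₗ[F] F ⊗[ℂ] W) : Module.End F V →ₗ[F] F ⊗[ℂ] Module.End ℂ W :=
  (tensorEndEquiv F W).symm.toLinearMap ∘ₗ (LinearMap.compRight F g ∘ₗ LinearMap.lcomp F V f)

theorem tensorProductEnd_induce [Module.Finite ℂ W] {V : Type*} [AddCommGroup V] [Module F V]
    (f : F ⊗[ℂ] W →ₗ[F] V) (g : V →ₗ[F] F ⊗[ℂ] W) (X : Module.End F V) (w : F ⊗[ℂ] W) :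
    LinearMap.tensorProductEnd ℂ F W (induce f g X) w = g (X (f w)) := by
  rw [induce, LinearMap.comp_apply, LinearEquiv.coe_coe, tensorProductEnd_symm]
  rfl

variable (F W) in
/-- The operator induced through linear maps, as an additive map. -/
def induceHom [Module.Finite ℂ W] {V : Type*} [AddCommGroup V] [Module F V] (f : F ⊗[ℂ] W →ₗ[F] V)
    (g : V →ₗ[F] F ⊗[ℂ] W) : Module.End F V →+ F ⊗[ℂ] Module.End ℂ W :=
  (induce f g).toAddMonoidHom

/-- The difference operator induced by a difference operator of degree at most `N` in `τ`. -/
def induceOp [Module.Finite ℂ W] {V : Type*} [AddCommGroup V] [Module F V]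
    (f : F ⊗[ℂ] W →ₗ[F] V) (g : V →ₗ[F] F ⊗[ℂ] W) (N : ℕ) (Q : DiffOp (Module.End F V)) :
    DiffOp (F ⊗[ℂ] Module.End ℂ W) :=
  mapOp (induceHom F W f g) N Q

/-- Invariance of the image of `f` makes its left inverse `g` recover the restricted operator,
although `g` is defined on all of `V`. -/
theorem isInduced_induceOp [Module.Finite ℂ W] {V : Type*} [AddCommGroup V] [Module F V]
    (f : F ⊗[ℂ] W →ₗ[F] V) (g : V →ₗ[F] F ⊗[ℂ] W) {N : ℕ} {Q : DiffOp (Module.End F V)}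
    (hQ : ∀ k, N < k → Q.coeff k = 0) (hgf : ∀ w, g (f w) = w)
    (hpres : ∀ k l w, ((Q.coeff k).coeff l) (f w) ∈ LinearMap.range f) :
    IsInduced f (induceOp f g N Q) Q := by
  intro k l
  refine LinearMap.ext fun w => ?_
  rw [induceOp, coeff_mapOp _ hQ, mapSeries_coeff, LinearMap.comp_apply, LinearMap.comp_apply]
  obtain ⟨w', hw'⟩ := hpres k l w
  have := tensorProductEnd_induce f g ((Q.coeff k).coeff l) w
  change f (LinearMap.tensorProductEnd ℂ F W (induce f g ((Q.coeff k).coeff l)) w) = _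
  rw [this, ← hw', hgf]

end EndTensor

/-! ### Polynomiality and the degree bound in `u` -/

section Polynomiality
variable {F A : Type*} [Field F] [Ring A] [Algebra F A] {m : ℕ}

theorem exists_fallingSeries_eq_mul {r k : ℕ} (h : r ≤ k) :
    ∃ q ∈ polySubring A, fallingSeries F A k = q * fallingSeries F A r := by
  induction k, h using Nat.le_induction with
  | base => exact ⟨1, one_mem _, (one_mul _).symm⟩
  | succ k hk ih =>
    obtain ⟨q, hq, e⟩ := ih
    refine ⟨linearSeries F A (k : F) * q, mul_mem (linearSeries_mem _) hq, ?_⟩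
    rw [fallingSeries_succ, (fallingSeries_commute k _).eq, e, mul_assoc]

theorem sitesDenom_commute (L : List (F × (Fin m → Fin m → A))) (f : LaurentSeries A) :
    Commute (sitesDenom L) f := by
  rw [sitesDenom]
  refine Commute.list_prod_left _ _ fun x hx => ?_
  obtain ⟨p, -, rfl⟩ := List.mem_map.1 hx
  exact linearSeries_commute _ _

/-- Minors with `|I| > m - i` have binomial coefficient zero; for the others the falling product of
length `m - i` contains the one of length `|I|` that clears the minor. -/
theorem sitesDenom_mul_binomCoeff_mem [CharZero F] {L : List (F × (Fin m → Fin m → A))}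
    (hL : CommutingSites L) (hR : ∀ p ∈ L, RankOneRel p.2) (E : Fin m → Fin m → A)
    (h : ∀ p ∈ L, ∀ a b c d, Commute (p.2 a b) (E c d)) (i : ℕ) :
    sitesDenom L * (fallingSeries F A (m - i) *
      binomCoeff m i (betheOperator (fun _ => (1 : F)) (sitesMatrix L * evalMatrix (0 : F) E))) ∈
        polySubring A := by
  rw [binomCoeff_betheOperator_one, Finset.mul_sum, Finset.mul_sum]
  refine sum_mem fun I _ => ?_
  rw [mul_smul_comm, mul_smul_comm]
  by_cases hI : m - I.card < i
  · rw [Nat.choose_eq_zero_of_lt hI, Nat.cast_zero, mul_zero, zero_smul]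
    exact zero_mem _
  · have hc : I.card ≤ m := (Finset.card_le_univ I).trans (Fintype.card_fin m).le
    obtain ⟨q, hq, e⟩ := exists_fallingSeries_eq_mul (F := F) (A := A)
      (show I.card ≤ m - i by lia)
    refine zsmul_mem ?_ _
    rw [e, mul_assoc, ← mul_assoc, (sitesDenom_commute L q).eq, mul_assoc]
    exact mul_mem hq (sitesDenom_mul_principalMinor_mem (twoFree_of_algebra F A) hL hR E h I)

theorem polySeries_coeff_lt {p : Polynomial F} {N : ℕ} (hN : p.natDegree ≤ N) {l : ℤ}
    (hl : l < -(N : ℤ)) : (polySeries p).coeff l = 0 := by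
  obtain ⟨k, rfl⟩ : ∃ k : ℕ, l = -(k : ℤ) := ⟨(-l).toNat, by lia⟩
  rw [polySeries_coeff, Polynomial.coeff_eq_zero_of_natDegree_lt (by lia)]

theorem natDegree_fallingPoly_le (c : F) (k : ℕ) : (fallingPoly c k).natDegree ≤ k := by
  induction k with
  | zero => simp [fallingPoly]
  | succ k ih =>
    rw [fallingPoly_succ]
    refine Polynomial.natDegree_mul_le.trans ?_
    rw [Polynomial.natDegree_X_add_C]
    lia

theorem natDegree_rootsPoly_le [Algebra ℂ F] {n : ℕ} (z : Fin n → ℂ) :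
    (rootsPoly F z).natDegree ≤ n := by
  refine (Polynomial.natDegree_prod_le _ _).trans ?_
  simp

/-- The prefactors have degree at most `n + (m - i)`, and the coefficient of `d^i` has order `m - i`
at infinity. -/
theorem roots_mul_binomCoeff_coeff_lt [Algebra ℂ F] {n : ℕ} (z : Fin n → ℂ) {P : DiffOp A}
    (hP : HasOrder m P) {i : ℕ} (hi : i ≤ m) {l : ℤ} (hl : l < -(n : ℤ)) :
    (scSeries F A (polySeries (rootsPoly F z)) *
      (fallingSeries F A (m - i) * binomCoeff m i P)).coeff l = 0 := by
  have h1 : ∀ l < -((m - i : ℕ) : ℤ), (fallingSeries F A (m - i)).coeff l = 0 := fun l hl => by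
    rw [fallingSeries, scSeries_coeff, polySeries_coeff_lt (natDegree_fallingPoly_le _ _) hl,
      map_zero]
  have h2 : ∀ l < -(n : ℤ), (scSeries F A (polySeries (rootsPoly F z))).coeff l = 0 :=
    fun l hl => by
      rw [scSeries_coeff, polySeries_coeff_lt (natDegree_rootsPoly_le z) hl, map_zero]
  exact coeff_mul_lt h2 (coeff_mul_lt h1 (hP.2 i)) l (by lia)

/-- The sites of an inhomogeneous chain with evaluation points `z`. -/
def siteList [Algebra ℂ F] {n : ℕ} (z : Fin n → ℂ) (E : Fin n → Fin m → Fin m → A) :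
    List (F × (Fin m → Fin m → A)) :=
  (List.finRange n).map fun i => (algebraMap ℂ F (z i), E i)

theorem sitesMatrix_siteList [Algebra ℂ F] {n : ℕ} (z : Fin n → ℂ)
    (E : Fin n → Fin m → Fin m → A) : sitesMatrix (siteList (F := F) z E) =
      (List.ofFn fun i => evalMatrix (algebraMap ℂ F (z i)) (E i)).prod := by
  rw [sitesMatrix, siteList, List.map_map, List.ofFn_eq_map]
  rfl

theorem sitesDenom_siteList [Algebra ℂ F] {n : ℕ} (z : Fin n → ℂ)
    (E : Fin n → Fin m → Fin m → A) : sitesDenom (siteList (F := F) z E) =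
      scSeries F A (polySeries (rootsPoly F z)) := by
  have h : polySeries (rootsPoly F z) = (List.ofFn fun i =>
      polySeries (Polynomial.X - Polynomial.C (algebraMap ℂ F (z i)))).prod := by
    rw [rootsPoly, List.prod_ofFn]
    exact map_prod (Polynomial.eval₂RingHom (HahnSeries.C (R := F) (Γ := ℤ)) (uSeries F)) _ _
  rw [h, map_list_prod, List.ofFn_eq_map, sitesDenom, siteList, List.map_map, List.map_map]
  rfl

theorem mem_siteList [Algebra ℂ F] {n : ℕ} {z : Fin n → ℂ} {E : Fin n → Fin m → Fin m → A}
    {p : F × (Fin m → Fin m → A)} (hp : p ∈ siteList z E) : ∃ i, p = (algebraMap ℂ F (z i), E i) := by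
  obtain ⟨i, -, rfl⟩ := List.mem_map.1 hp
  exact ⟨i, rfl⟩

theorem commutingSites_siteList [Algebra ℂ F] {n : ℕ} (z : Fin n → ℂ)
    {E : Fin n → Fin m → Fin m → A} (hE : ∀ i, GlRel (E i))
    (hc : ∀ i j, i ≠ j → ∀ a b c d, Commute (E i a b) (E j c d)) :
    CommutingSites (siteList (F := F) z E) := by
  refine ⟨fun p hp => ?_, ?_⟩
  · obtain ⟨i, rfl⟩ := mem_siteList hp
    exact hE i
  · rw [siteList, List.pairwise_map]
    exact (List.nodup_finRange n).imp fun {i j} hij => hc i j hij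

theorem sum_siteList [Algebra ℂ F] {n : ℕ} (z : Fin n → ℂ) (E : Fin n → Fin m → Fin m → A)
    (i j : Fin m) : ((siteList (F := F) z E).map fun p => p.2 i j).sum = ∑ r, E r i j := by
  rw [siteList, List.map_map, ← List.ofFn_eq_map, List.sum_ofFn]
  rfl

end Polynomiality

/-! ### Leading terms of the coefficients of the expansion -/

section LeadingTerms
variable {m n : ℕ} {V : Type*} [AddCommGroup V] [Module ℂ V]

theorem ofSeries_C {A : Type*} [Ring A] (x : A) :
    (ofSeries (HahnSeries.C x) : DiffOp A) = ofConst x := rfl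

/-- A difference operator has an expansion in falling factorials with controlled leading terms, as
soon as its suitably normalized coefficients are polynomials with controlled leading terms. -/
theorem exists_expansion_of_lead {E : Type*} [Ring E] [Algebra ℂ E] (z : Fin n → ℂ)
    {P Q : DiffOp (RatFun m ⊗[ℂ] E)} (hP : ∀ k, m < k → P.coeff k = 0)
    (hQ : ∀ k, m < k → Q.coeff k = 0)
    (hpoly : ∀ i ≤ m, scSeries ℂ _ (polySeries (rootsPoly ℂ z)) *
      (fallingSeries ℂ _ (m - i) * binomCoeff m i P) ∈ polySubring (RatFun m ⊗[ℂ] E))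
    (hord : ∀ i ≤ m, ∀ l < -(n : ℤ), (scSeries ℂ _ (polySeries (rootsPoly ℂ z)) *
      (fallingSeries ℂ _ (m - i) * binomCoeff m i P)).coeff l = 0)
    (hgr : ∀ i ≤ m, ∀ l, gr ((m : ℤ) - i)
      ((fallingSeries ℂ _ (m - i) * binomCoeff m i P).coeff l) = (Q.coeff i).coeff l)
    (hlt : ∀ i ≤ m, ∀ k : ℤ, (m : ℤ) - i < k → ∀ l,
      gr k ((fallingSeries ℂ _ (m - i) * binomCoeff m i P).coeff l) = 0) :
    ∃ D : Fin (m + 1) → Fin (n + 1) → RatFun m ⊗[ℂ] E,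
      (IsExpansion (F := RatFun m) z P D ∧
        ∀ D', IsExpansion (F := RatFun m) z P D' → D' = D) ∧
      (∀ i j, D i j ∈ coeffAlgebra (F := ℂ) P) ∧
      (∀ (i : Fin (m + 1)) (j : Fin (n + 1)), D i j ∈ degLE m E ((m : ℤ) - (i : ℕ))) ∧
      ∑ i : Fin (m + 1), ∑ j : Fin (n + 1), ofConst (gr ((m : ℤ) - (i : ℕ)) (D i j)) *
          ofPoly (fallingPoly (n : RatFun m) j) * tau ^ (i : ℕ) =
        ofPoly (rootsPoly (RatFun m) z) * Q := by
  -- The coefficients `γ` are complex and do not depend on the series. Hence the same combinations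
  -- serve for `P` and for its leading terms, and they stay within the coefficient algebra.
  obtain ⟨γ, hγ⟩ := exists_falling_expansion (A := RatFun m ⊗[ℂ] E) (n : ℂ) n
  set R := scSeries ℂ (RatFun m ⊗[ℂ] E) (polySeries (rootsPoly ℂ z)) with hR
  set f : ℕ → LaurentSeries (RatFun m ⊗[ℂ] E) := fun i =>
    R * (fallingSeries ℂ _ (m - i) * binomCoeff m i P) with hf
  set c : ℕ → ℕ → RatFun m ⊗[ℂ] E := fun i j =>
    ∑ k ∈ Finset.range (n + 1), γ k j • (f i).coeff (-(k : ℤ)) with hc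
  -- The factor `R` has complex coefficients, so taking leading terms commutes with multiplication
  -- by it.
  have hgrmul : ∀ (k : ℤ) (h : LaurentSeries (RatFun m ⊗[ℂ] E)),
      mapSeries (gr (m := m) (V := E) k).toAddMonoidHom (R * h) =
        R * mapSeries (gr (m := m) (V := E) k).toAddMonoidHom h :=
    fun k h => mapSeries_scSeries_mul (gr (m := m) (V := E) k) _ h
  have hlt' : ∀ i ≤ m, ∀ k : ℤ, (m : ℤ) - i < k → ∀ l, gr k ((f i).coeff l) = 0 := by
    intro i hi k hk l
    have h0 : mapSeries (gr (m := m) (V := E) k).toAddMonoidHom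
        (fallingSeries ℂ _ (m - i) * binomCoeff m i P) = 0 := by
      ext l'
      exact hlt i hi k hk l'
    have := hgrmul k (fallingSeries ℂ _ (m - i) * binomCoeff m i P)
    rw [h0, mul_zero] at this
    exact congrArg (fun h => h.coeff l) this
  have hgr' : ∀ i ≤ m, ∀ l, gr ((m : ℤ) - i) ((f i).coeff l) = (R * Q.coeff i).coeff l := by
    intro i hi l
    have h0 : mapSeries (gr (m := m) (V := E) ((m : ℤ) - i)).toAddMonoidHom
        (fallingSeries ℂ _ (m - i) * binomCoeff m i P) = Q.coeff i := by
      ext l'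
      exact hgr i hi l'
    have := hgrmul ((m : ℤ) - i) (fallingSeries ℂ _ (m - i) * binomCoeff m i P)
    rw [h0] at this
    exact congrArg (fun h => h.coeff l) this
  have hcgr : ∀ (k : ℤ) (i j : ℕ), gr k (c i j) =
      ∑ k' ∈ Finset.range (n + 1), γ k' j • gr k ((f i).coeff (-(k' : ℤ))) := by
    intro k i j
    rw [hc]
    simp only [map_sum, map_smul]
  have hclt : ∀ i ≤ m, ∀ k : ℤ, (m : ℤ) - i < k → ∀ j, gr k (c i j) = 0 := by
    intro i hi k hk j
    rw [hcgr]
    exact Finset.sum_eq_zero fun k' _ => by rw [hlt' i hi k hk, smul_zero]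
  -- The series on the left inherits polynomiality and the degree bound, because its coefficients
  -- are leading terms of those of `f i`.
  have hQexp : ∀ i ≤ m, R * Q.coeff i = ∑ j ∈ Finset.range (n + 1),
      HahnSeries.C (gr ((m : ℤ) - i) (c i j)) *
        scSeries ℂ _ (polySeries (fallingPoly (n : ℂ) j)) := by
    intro i hi
    have h1 := hγ (R * Q.coeff i) (fun l hl => by
        rw [← hgr' i hi, hpoly i hi l hl, map_zero]) (fun l hl => by
        rw [← hgr' i hi, hord i hi l hl, map_zero])
    rw [h1]
    refine Finset.sum_congr rfl fun j _ => ?_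
    rw [hcgr]
    simp only [hgr' i hi]
  set D : Fin (m + 1) → Fin (n + 1) → RatFun m ⊗[ℂ] E :=
    fun i j => ∑ i' ∈ Finset.range (m + 1), stirling i' i • c i' j with hD
  have hexp : IsExpansion (F := ℂ) (m := m) z P D :=
    isExpansion_of_series hP fun i hi => hγ _ (hpoly i hi) (hord i hi)
  -- Unitriangularity: the terms with `i' < i` have coefficient zero, those with `i' > i` have
  -- degree at most `m - i' < m - i`, and the coefficient at `i' = i` is `1`.
  have hDgr : ∀ (i : Fin (m + 1)) (j : Fin (n + 1)),
      gr ((m : ℤ) - (i : ℕ)) (D i j) = gr ((m : ℤ) - (i : ℕ)) (c i j) := by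
    intro i j
    rw [hD]
    simp only [map_sum, map_zsmul]
    rw [Finset.sum_eq_single (i : ℕ)]
    · rw [stirling_self, one_smul]
    · intro i' hi' hne
      rcases lt_or_gt_of_ne hne with h | h
      · rw [stirling_of_lt h, zero_smul]
      · rw [hclt i' (by simpa [Nat.lt_succ_iff] using hi') _ (by lia), smul_zero]
    · intro h
      exact absurd (Finset.mem_range.2 i.2) h
  refine ⟨D, ⟨(isExpansion_scalar z P D).2 hexp, fun D' h' =>
    ((isExpansion_scalar z P D').1 h').unique hexp⟩, fun i j => ?_, fun i j => ?_, ?_⟩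
  · refine sum_mem fun i' _ => zsmul_mem (sum_mem fun k _ => Subalgebra.smul_mem _ ?_ _) _
    exact coeff_mem_coeffAlgebra z P i' _
  · refine mem_degLE_of_gr fun k hk => ?_
    rw [hD]
    simp only [map_sum, map_zsmul]
    refine Finset.sum_eq_zero fun i' hi' => ?_
    rcases lt_or_ge i' (i : ℕ) with h | h
    · rw [stirling_of_lt h, zero_smul]
    · rw [hclt i' (by simpa [Nat.lt_succ_iff] using hi') k (by omega), smul_zero]
  · simp only [hDgr]
    rw [← rootsPoly_map (F := RatFun m), ofPoly_map, ofPoly_eq, eq_sum_coeff hQ, Finset.mul_sum,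
      Finset.sum_range]
    refine Finset.sum_congr rfl fun i _ => ?_
    rw [← mul_assoc, ← map_mul, ← hR, hQexp i (Nat.lt_succ_iff.1 i.2), Finset.sum_range, map_sum,
      Finset.sum_mul]
    refine Finset.sum_congr rfl fun j _ => ?_
    rw [map_mul, ofSeries_C, ← ofPoly_eq, ← ofPoly_map (F := RatFun m), fallingPoly_map,
      map_natCast]

end LeadingTerms

/-! ### Symmetries of the monodromy matrices and invariance of the subspaces -/

section Monodromy
variable {F : Type*} [Field F] [Algebra ℂ F] {m n : ℕ} (a : Fin n → ℕ) (μ : Fin m → F)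
  (z : Fin n → ℂ)

theorem fullSiteGen_eq_map (i : Fin n) (k l : Fin m) : fullSiteGen a μ i k l =
    ((siteHom a μ : _ →+* Module.End F (FullTensor a μ)).comp (overHom F a)) (siteGen a i k l) := by
  rw [fullSiteGen_eq, siteGenOver_eq]
  rfl

theorem glRel_fullSiteGen (i : Fin n) : GlRel (fullSiteGen a μ i) := by
  have h := (glRel_siteGen (m := m) a i).map
    ((siteHom a μ : _ →+* Module.End F (FullTensor a μ)).comp (overHom F a))
  simp only [← fullSiteGen_eq_map] at h
  exact h

theorem rankOneRel_fullSiteGen (i : Fin n) : RankOneRel (fullSiteGen a μ i) := by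
  have h := (rankOneRel_siteGen (m := m) a i).map
    ((siteHom a μ : _ →+* Module.End F (FullTensor a μ)).comp (overHom F a))
  simp only [← fullSiteGen_eq_map] at h
  exact h

theorem commute_fullSiteGen {i j : Fin n} (hij : i ≠ j) (k l k' l' : Fin m) :
    Commute (fullSiteGen a μ i k l) (fullSiteGen a μ j k' l') := by
  rw [fullSiteGen_eq_map, fullSiteGen_eq_map]
  exact (siteGen_commute a hij k l k' l').map _

theorem commute_fullSiteGen_fullVermaGen (i : Fin n) (k l k' l' : Fin m) :
    Commute (fullSiteGen a μ i k l) (fullVermaGen a μ k' l') := by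
  rw [fullSiteGen_eq, fullVermaGen_eq]
  exact siteHom_commute _ _

theorem commutingSites_fullSiteGen :
    CommutingSites (siteList (F := F) z (fullSiteGen a μ)) :=
  commutingSites_siteList z (glRel_fullSiteGen a μ)
    fun _ _ hij k l k' l' => commute_fullSiteGen a μ hij k l k' l'

theorem commute_siteList_fullVermaGen {p : F × (Fin m → Fin m → Module.End F (FullTensor a μ))}
    (hp : p ∈ siteList z (fullSiteGen a μ)) (k l k' l' : Fin m) :
    Commute (p.2 k l) (fullVermaGen a μ k' l') := by
  obtain ⟨i, rfl⟩ := mem_siteList hp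
  exact commute_fullSiteGen_fullVermaGen a μ i k l k' l'

theorem monodromyFull_eq : monodromyFull a μ z =
    sitesMatrix (siteList (F := F) z (fullSiteGen a μ)) * evalMatrix (0 : F) (fullVermaGen a μ) := by
  rw [sitesMatrix_siteList]
  rfl

theorem commute_sitesMatrix_fullVermaGen (k l k' l' : Fin m) :
    Commute (sitesMatrix (siteList (F := F) z (fullSiteGen a μ)) k l)
      (HahnSeries.C (fullVermaGen a μ k' l')) :=
  (commute_sitesMatrix (fun p hp k l => by
    exact ((commute_siteList_fullVermaGen a μ z hp k l k' l').map
      (HahnSeries.C (Γ := ℤ) (R := Module.End F (FullTensor a μ)))).symm) k l).symm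

theorem adjAlt_monodromyFull [CharZero F] :
    AdjAlt (monodromyFull a μ z) ((monodromyFull a μ z).map (shiftHom (-1))) := by
  rw [monodromyFull_eq, matrix_map_mul_shift]
  have h2 := twoFree_of_algebra F (Module.End F (FullTensor a μ))
  refine adjAlt_mul h2.series (adjAlt_sitesMatrix h2 (commutingSites_fullSiteGen a μ z))
    (adjAlt_evalMatrix glRel_fullVermaGen 0) fun k l k' l' => ?_
  refine commute_evalMatrix _ _ _ _ ?_
  exact (shiftHom_commute_of_C (commute_sitesMatrix_fullVermaGen a μ z k l k' l').symm (-1)).symm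

theorem glAct_monodromyFull : GlAct (fullGen a μ) (monodromyFull a μ z) := by
  have h := glAct_mul (glAct_sitesMatrix (commutingSites_fullSiteGen a μ z))
    (glAct_evalMatrix (F := F) (glRel_fullVermaGen (a := a) (μ := μ)) 0)
    (fun i j k l => commute_evalMatrix _ _ _ _ (by
      rw [sum_siteList, map_sum]
      refine Commute.sum_left _ _ _ fun r _ => ?_
      exact (commute_fullSiteGen_fullVermaGen a μ r i j k l).map _))
    (fun i j k l => (commute_sitesMatrix_fullVermaGen a μ z k l i j).symm)
  simp only [sum_siteList] at h
  rw [monodromyFull_eq]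
  exact h

theorem hasOrder_monodromyFull :
    HasOrder m (betheOperator (fun _ : Fin m => (1 : F)) (monodromyFull a μ z)) := by
  refine hasOrder_betheOperator_one _ fun k l i hi => ?_
  rw [monodromyFull_eq]
  exact mul_sub_delta_coeff (fun k l i hi => sitesMatrix_sub_coeff _ k l i hi)
    (fun k l i hi => evalMatrix_sub_coeff _ _ k l i hi) k l i hi

/-- The singular vectors of given weight are defined by equations in the generators of `gl_m`, so
any operator commuting with `gl_m` preserves them. -/
theorem mem_singularSpace_of_commute {b : Fin m → ℕ} {X : Module.End F (FullTensor a μ)}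
    (hX : ∀ i j, Commute (fullGen a μ i j) X) {v : FullTensor a μ}
    (hv : v ∈ singularSpace a b μ) : X v ∈ singularSpace a b μ := by
  have e : ∀ i j, fullGen a μ i j (X v) = X (fullGen a μ i j v) := fun i j =>
    LinearMap.congr_fun (hX i j).eq v
  rw [mem_singularSpace] at hv ⊢
  refine ⟨fun k l hkl => ?_, fun j => ?_⟩
  · rw [e, hv.1 k l hkl, map_zero]
  · rw [e, hv.2 j, map_smul]

theorem betheOperator_mem_singularSpace [CharZero F] {b : Fin m → ℕ} (k : ℕ) (l : ℤ)
    {v : FullTensor a μ} (hv : v ∈ singularSpace a b μ) :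
    ((betheOperator (fun _ : Fin m => (1 : F)) (monodromyFull a μ z)).coeff k).coeff l v ∈
      singularSpace a b μ :=
  mem_singularSpace_of_commute a μ (fun i j => commute_betheOperator_one _
    (adjAlt_monodromyFull a μ z) (glAct_monodromyFull a μ z) i j k l) hv

theorem roots_mul_binomCoeff_mem [CharZero F] (i : ℕ) :
    scSeries F _ (polySeries (rootsPoly F z)) * (fallingSeries F _ (m - i) *
      binomCoeff m i (betheOperator (fun _ : Fin m => (1 : F)) (monodromyFull a μ z))) ∈
        polySubring (Module.End F (FullTensor a μ)) := by
  rw [monodromyFull_eq, ← sitesDenom_siteList z (fullSiteGen a μ)]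
  refine sitesDenom_mul_binomCoeff_mem (commutingSites_fullSiteGen a μ z) (fun p hp => ?_) _
    (fun p hp => commute_siteList_fullVermaGen a μ z hp) i
  obtain ⟨i, rfl⟩ := mem_siteList hp
  exact rankOneRel_fullSiteGen a μ i

theorem monodromy_eq : monodromy F m a z = sitesMatrix (siteList (F := F) z (siteGenOver F a)) := by
  rw [sitesMatrix_siteList]
  rfl

theorem glAct_monodromy :
    GlAct (fun i j => overHom F a (siteSum a i j)) (monodromy F m a z) := by
  have hL : CommutingSites (siteList (F := F) z (siteGenOver (m := m) F a)) := by
    refine commutingSites_siteList z (fun i => ?_) fun i j hij k l k' l' => ?_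
    · have h := (glRel_siteGen (m := m) a i).map (overHom F a)
      simp only [← siteGenOver_eq] at h
      exact h
    · rw [siteGenOver_eq, siteGenOver_eq]
      exact (siteGen_commute a hij k l k' l').map _
  have h := glAct_sitesMatrix hL
  simp only [sum_siteList, siteGenOver_eq, ← map_sum] at h
  rw [monodromy_eq]
  exact h

variable (C : Fin m → F) (c : F)

theorem coeff_twisted_eq_zero {k : ℕ} (hk : m < k) :
    (ofConst (algebraMap F _ c) * betheOperator C (monodromy F m a z)).coeff k = 0 := by
  rw [ofConst, RingHom.comp_apply, coeff_ofSeries_mul, coeff_betheOperator,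
    Finset.sum_eq_zero, mul_zero]
  intro I _
  rw [if_neg (by lia)]

/-- The twist breaks the symmetry to the diagonal generators, which still suffice to preserve weight
spaces. -/
theorem coeff_twisted_mem_range (b : Fin m → ℕ) (k : ℕ) (l : ℤ) (w : F ⊗[ℂ] weightSpace a b) :
    ((ofConst (algebraMap F _ c) * betheOperator C (monodromy F m a z)).coeff k).coeff l
      (weightIncl F a b w) ∈ LinearMap.range (weightIncl F a b) := by
  refine mem_range_weightIncl a b _ fun j => ?_
  have h := commute_betheOperator_diag C _ (glAct_monodromy (F := F) a z) j k l
  have e : ((ofConst (algebraMap F _ c) * betheOperator C (monodromy F m a z)).coeff k).coeff l =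
      algebraMap F _ c * ((betheOperator C (monodromy F m a z)).coeff k).coeff l := by
    rw [ofConst, RingHom.comp_apply, coeff_ofSeries_mul, HahnSeries.C_apply,
      HahnSeries.coeff_single_zero_mul]
  have h' := (Algebra.commutes c (overHom F a (siteSum a j j))).symm
  rw [e]
  have h2 : Commute (overHom F a (siteSum a j j))
      (algebraMap F _ c * ((betheOperator C (monodromy F m a z)).coeff k).coeff l) :=
    Commute.mul_right h' h
  refine (LinearMap.congr_fun h2.eq (weightIncl F a b w)).trans ?_
  rw [Module.End.mul_apply, weightIncl_weight, map_smul]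

end Monodromy

/-! ### Projection to the weight space and leading terms of induced operators -/

section WeightProjection
variable {F : Type*} [Field F] [Algebra ℂ F] {m n : ℕ} {a : Fin n → ℕ} {b : Fin m → ℕ}

/-- The extension of scalars of a projection to the weight subspace. -/
def weightProj (F : Type*) [Field F] [Algebra ℂ F] (p : SymTensor m a →ₗ[ℂ] weightSpace a b) :
    SymTensorOver F m a →ₗ[F] F ⊗[ℂ] weightSpace a b :=
  LinearMap.baseChange (M := SymTensor m a) F p

theorem weightProj_weightIncl {p : SymTensor m a →ₗ[ℂ] weightSpace a b}
    (hp : p ∘ₗ (weightSpace a b).subtype = LinearMap.id) (w : F ⊗[ℂ] weightSpace a b) :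
    weightProj F p (weightIncl F a b w) = w := by
  have h := LinearMap.baseChange_comp (A := F) (weightSpace a b).subtype p
  rw [hp, LinearMap.baseChange_id] at h
  exact (LinearMap.congr_fun h w).symm

theorem gr_baseChange {V W : Type*} [AddCommGroup V] [Module ℂ V] [AddCommGroup W] [Module ℂ W]
    (p : V →ₗ[ℂ] W) (k : ℤ) (y : RatFun m ⊗[ℂ] V) :
    gr k (LinearMap.baseChange (RatFun m) p y) = LinearMap.baseChange (RatFun m) p (gr k y) := by
  induction y with
  | zero => simp only [map_zero]
  | add x y hx hy => simp only [map_add, hx, hy]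
  | tmul q s => rfl

theorem gr_weightProj (p : SymTensor m a →ₗ[ℂ] weightSpace a b) (k : ℤ)
    (y : SymTensorOver (RatFun m) m a) :
    gr k (weightProj (RatFun m) p y) = weightProj (RatFun m) p (grOver a k y) :=
  gr_baseChange p k y

theorem tensorProductEnd_gr {W : Type*} [AddCommGroup W] [Module ℂ W] (k : ℤ)
    (D : RatFun m ⊗[ℂ] Module.End ℂ W) (w : W) :
    LinearMap.tensorProductEnd ℂ (RatFun m) W (gr k D) (1 ⊗ₜ[ℂ] w) =
      gr k (LinearMap.tensorProductEnd ℂ (RatFun m) W D (1 ⊗ₜ[ℂ] w)) := by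
  induction D with
  | zero => simp
  | add x y hx hy => simp only [map_add, LinearMap.add_apply, hx, hy]
  | tmul q s =>
    rw [tensorProductEnd_tmul, mul_one, gr, gr, LinearMap.rTensor_tmul, LinearMap.rTensor_tmul,
      tensorProductEnd_tmul, mul_one]

/-- On a constant vector `w`, the singular vector `θ⁻¹ w` has degree zero and top component `w`,
which is its own leading term. Thus the leading term of the conjugated operator is the one recorded
by `HasLead`, restricted to the weight space. -/
theorem HasLead.gr_induce {ε : Verma (ratVar (m := m)) →ₗ[RatFun m] RatFun m}
    {T : Module.End (RatFun m) (Verma (ratVar (m := m)))} (hε : IsVermaProj ε)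
    (hT : IsCasimirInverse ε T) (hword : ∀ L : List (Fin m × Fin m), IsLow L → L ≠ [] →
      T (vermaWord ratVar L) = (lowEigenvalue ratVar (wordWeight L))⁻¹ • vermaWord ratVar L)
    (p : SymTensor m a →ₗ[ℂ] weightSpace a b) {k : ℤ}
    {X : Module.End (RatFun m) (FullTensor a (ratVar (m := m)))}
    {x : Module.End (RatFun m) (SymTensorOver (RatFun m) m a)} (h : HasLead ε k X x) :
    gr k (induce (thetaInv a b ratVar T) (weightProj (RatFun m) p ∘ₗ topPart ratVar ε) X) =
      induce (weightIncl (RatFun m) a b) (weightProj (RatFun m) p) x := by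
  refine bijective_tensorProductEnd.1 (end_tensor_ext fun w => ?_)
  rw [tensorProductEnd_gr, tensorProductEnd_induce, tensorProductEnd_induce,
    LinearMap.comp_apply, gr_weightProj]
  have h1 := (h 0 _ (thetaInv_mem_fullLattice hword w)).2
  rw [zero_add, hT.topPart_thetaInv hε] at h1
  rw [h1]
  congr 2
  have h2 : weightIncl (RatFun m) a b (1 ⊗ₜ[ℂ] w) = (1 : RatFun m) • oneTmul (w : SymTensor m a) :=
    (one_smul (RatFun m) _).symm
  have h3 : rCoeff 0 (1 : RatFun m) = 1 := by
    have := rCoeff_const (m := m) 1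
    rwa [map_one] at this
  rw [h2, grOver_smul_tmul, h3]

end WeightProjection

/-! ### Scalar multipliers and induced difference operators -/

section InducedSeries
variable {F W : Type*} [Field F] [Algebra ℂ F] [AddCommGroup W] [Module ℂ W] [Module.Finite ℂ W]
  {V : Type*} [AddCommGroup V] [Module F V]

theorem mapSeries_scSeries_mul_of_map_smul {F A B : Type*} [Field F] [Ring A] [Algebra F A] [Ring B]
    [Algebra F B] (φ : A →+ B) (hφ : ∀ (c : F) x, φ (c • x) = c • φ x)
    (x : LaurentSeries F) (h : LaurentSeries A) :
    mapSeries φ (scSeries F A x * h) = scSeries F B x * mapSeries φ h :=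
  let g : A →ₗ[F] B :=
    { toFun := φ
      map_add' := map_add φ
      map_smul' := hφ }
  mapSeries_scSeries_mul g x h

theorem mapSeries_induceHom_mul (f : F ⊗[ℂ] W →ₗ[F] V) (g : V →ₗ[F] F ⊗[ℂ] W) (x : LaurentSeries F)
    (h : LaurentSeries (Module.End F V)) :
    mapSeries (induceHom F W f g) (scSeries F (Module.End F V) x * h) =
      scSeries F (F ⊗[ℂ] Module.End ℂ W) x * mapSeries (induceHom F W f g) h :=
  mapSeries_scSeries_mul_of_map_smul (F := F) (A := Module.End F V)
    (B := F ⊗[ℂ] Module.End ℂ W) (induceHom F W f g) (induce f g).map_smul x h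

theorem fallingSeries_mul_binomCoeff_induceOp (f : F ⊗[ℂ] W →ₗ[F] V) (g : V →ₗ[F] F ⊗[ℂ] W) {N : ℕ}
    {Q : DiffOp (Module.End F V)} (hQ : ∀ k, N < k → Q.coeff k = 0) (k i : ℕ) :
    fallingSeries ℂ _ k * binomCoeff N i (induceOp f g N Q) =
      mapSeries (induceHom F W f g) (fallingSeries F _ k * binomCoeff N i Q) := by
  rw [← fallingSeries_scalar (F := F), induceOp, binomCoeff_mapOp _ hQ, fallingSeries,
    fallingSeries, mapSeries_induceHom_mul]

theorem roots_mul_binomCoeff_induceOp (f : F ⊗[ℂ] W →ₗ[F] V) (g : V →ₗ[F] F ⊗[ℂ] W) {N n : ℕ}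
    {Q : DiffOp (Module.End F V)} (hQ : ∀ k, N < k → Q.coeff k = 0) (z : Fin n → ℂ) (k i : ℕ) :
    scSeries ℂ _ (polySeries (rootsPoly ℂ z)) *
        (fallingSeries ℂ _ k * binomCoeff N i (induceOp f g N Q)) =
      mapSeries (induceHom F W f g) (scSeries F _ (polySeries (rootsPoly F z)) *
        (fallingSeries F _ k * binomCoeff N i Q)) := by
  rw [fallingSeries_mul_binomCoeff_induceOp f g hQ, mapSeries_induceHom_mul,
    ← scSeries_polySeries_map (F := F), rootsPoly_map]

end InducedSeries

end

end BetheDuality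

open BetheDuality

theorem proposition5p4 (n m : ℕ) (a : Fin n → ℕ) (b : Fin m → ℕ) (hab : ∑ j, b j = ∑ i, a i)
    (lam : Fin n → ℂ) :
    ∃ (θ : singularSpace a b (ratVar (m := m)) ≃ₗ[RatFun m] RatFun m ⊗[ℂ] weightSpace a b)
      (Dm DXXX : DiffOp (RatFun m ⊗[ℂ] Module.End ℂ (weightSpace a b))),
      -- `θ` is the isomorphism from singular vectors to the weight subspace
      (IsTheta a b ratVar θ.toLinearMap ∧
        ∀ θ' : singularSpace a b (ratVar (m := m)) →ₗ[RatFun m] RatFun m ⊗[ℂ] weightSpace a b,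
          IsTheta a b ratVar θ' → θ' = θ.toLinearMap) ∧
      -- `Dm` is the Bethe operator on singular vectors, conjugated by `θ`
      IsInduced ((singularSpace a b ratVar).subtype ∘ₗ θ.symm.toLinearMap) Dm
        (betheOperator (fun _ : Fin m => (1 : RatFun m))
          (monodromyFull a ratVar (evalPoint a lam))) ∧
      -- `DXXX` is the generating difference operator of the quasi-periodic XXX spin chain
      IsInduced (weightIncl (RatFun m) a b) DXXX
        (ofConst (algebraMap (RatFun m) _ (∏ i, ratVar i)) *
          betheOperator (fun i : Fin m => (ratVar i)⁻¹)
            (monodromy (RatFun m) m a (evalPoint a lam))) ∧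
      ∃ D : Fin (m + 1) → Fin (n + 1) → RatFun m ⊗[ℂ] Module.End ℂ (weightSpace a b),
        (IsExpansion (F := RatFun m) (evalPoint a lam) Dm D ∧
          ∀ D', IsExpansion (F := RatFun m) (evalPoint a lam) Dm D' → D' = D) ∧
        (∀ i j, D i j ∈ coeffAlgebra (F := ℂ) Dm) ∧
        (∀ (i : Fin (m + 1)) (j : Fin (n + 1)),
          D i j ∈ degLE m (Module.End ℂ (weightSpace a b)) ((m : ℤ) - (i : ℕ))) ∧
        ∑ i : Fin (m + 1), ∑ j : Fin (n + 1), ofConst (gr ((m : ℤ) - (i : ℕ)) (D i j)) *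
            ofPoly (fallingPoly (n : RatFun m) j) * tau ^ (i : ℕ) =
          ofPoly (rootsPoly (RatFun m) (evalPoint a lam)) * DXXX := by
  set z := evalPoint a lam with hz
  set B := betheOperator (fun _ : Fin m => (1 : RatFun m)) (monodromyFull a ratVar z) with hB
  set B' := ofConst (algebraMap (RatFun m) _ (∏ i, ratVar i)) *
    betheOperator (fun i : Fin m => (ratVar i)⁻¹) (monodromy (RatFun m) m a z) with hB'
  obtain ⟨ε, hε⟩ := exists_vermaProj (isGeneric_ratVar (m := m))
  replace hε : IsVermaProj ε := hε
  obtain ⟨T, h1, h2, h3, h4, hword⟩ := exists_lowCasimir_inverse (isGeneric_ratVar (m := m)) hε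
  have hT : IsCasimirInverse ε T := ⟨h1, h2, h3, h4⟩
  obtain ⟨θ, hθ, hθ', hinv⟩ := hT.exists_theta (a := a) (b := b) isGeneric_ratVar hε
  -- A complement of the weight space is chosen over `ℂ`, so that the projection commutes with
  -- taking leading terms.
  obtain ⟨p, hp⟩ := LinearMap.exists_leftInverse_of_injective (weightSpace a b).subtype
    (Submodule.ker_subtype _)
  set f := thetaInv a b ratVar T with hf
  -- On singular vectors `g` is `θ`, but it is defined on the whole tensor product. Thus `X ↦ g X f`
  -- is linear in all operators `X`, including coefficients of minors that need not preserve
  -- singular vectors individually.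
  set g := weightProj (RatFun m) p ∘ₗ topPart ratVar ε with hg
  have hBord : HasOrder m B := hasOrder_monodromyFull a ratVar z
  have hB'deg : ∀ k, m < k → B'.coeff k = 0 := fun k hk => coeff_twisted_eq_zero a z _ _ hk
  have hgf : ∀ w, g (f w) = w := fun w => by
    rw [hg, LinearMap.comp_apply, hT.topPart_thetaInv hε, weightProj_weightIncl hp]
  have hlead : ∀ i ≤ m, SeriesLead ε (m - i : ℕ) (fallingSeries (RatFun m) _ (m - i) *
      binomCoeff m i B) (B'.coeff i) := by
    rw [hB, hB', monodromyFull_eq, monodromy_eq]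
    exact fun i hi => seriesLead_binomCoeff hε
      (fun q r => SeriesLead.sitesMatrix z (List.finRange n) q r)
      (commute_sitesMatrix_fullVermaGen a ratVar z) i hi
  have hcoeff : ∀ i l, (fallingSeries ℂ _ (m - i) * binomCoeff m i (induceOp f g m B)).coeff l =
      induce f g ((fallingSeries (RatFun m) _ (m - i) * binomCoeff m i B).coeff l) := fun i l => by
    rw [fallingSeries_mul_binomCoeff_induceOp f g hBord.1]
    rfl
  refine ⟨θ, induceOp f g m B, induceOp (weightIncl (RatFun m) a b) (weightProj (RatFun m) p) m B',
    ⟨hθ, hθ'⟩, ?_, isInduced_induceOp _ _ hB'deg (weightProj_weightIncl hp)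
      (coeff_twisted_mem_range a z _ _ b), exists_expansion_of_lead z (fun k hk => ?_)
      (fun k hk => ?_) (fun i hi l hl => ?_) (fun i hi l hl => ?_) (fun i hi l => ?_)
      (fun i hi k hk l => ?_)⟩
  · rw [hinv]
    refine isInduced_induceOp f g hBord.1 hgf fun k l w => ?_
    have hv := betheOperator_mem_singularSpace a ratVar z k l (hT.thetaInv_mem (b := b)
      isGeneric_ratVar hε w)
    -- Any singular vector is the image under `f = θ⁻¹` of its own top component.
    refine ⟨θ ⟨_, hv⟩, ?_⟩
    refine (LinearMap.congr_fun hinv (θ ⟨_, hv⟩)).symm.trans ?_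
    rw [LinearMap.comp_apply, LinearEquiv.coe_coe, θ.symm_apply_apply]
    rfl
  · rw [induceOp, coeff_mapOp _ hBord.1, hBord.1 k hk, map_zero]
  · rw [induceOp, coeff_mapOp _ hB'deg, hB'deg k hk, map_zero]
  -- Multiplication by scalar series commutes with inducing, so polynomiality, and likewise the
  -- degree bound in the next case, may be checked on the full tensor product.
  · rw [roots_mul_binomCoeff_induceOp f g hBord.1, mapSeries_coeff,
      roots_mul_binomCoeff_mem a ratVar z i l hl, map_zero]
  · rw [roots_mul_binomCoeff_induceOp f g hBord.1, mapSeries_coeff,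
      roots_mul_binomCoeff_coeff_lt z hBord hi hl, map_zero]
  · rw [hcoeff, induceOp, coeff_mapOp _ hB'deg, mapSeries_coeff, ← Nat.cast_sub hi]
    exact (hlead i hi l).gr_induce hε hT hword p
  -- The same operator, regarded as having the larger degree `k`, has leading term zero.
  · rw [hcoeff, ((hlead i hi l).of_lt hε (by lia)).gr_induce hε hT hword p, map_zero]
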